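/- Summation over repeated indices $1\le i,j,\dots\le 3$ is understood, and $\epsilon_{ijk}=\epsilon^{ijk}$ is totally skew with $\epsilon_{123}=1$. Let $M$ be a smooth $6$-manifold and let $D\subset TM$ be a smooth $3$-plane field with $D+[D,D]=TM$, i.e. every point has a neighbourhood on which $D$ has a frame $X_1,X_2,X_3$ such that $X_1,X_2,X_3,[X_2,X_3],[X_3,X_1],[X_1,X_2]$ are everywhere linearly independent. Let $B_2\to M$ be the bundle of $2$-adapted coframes $(\theta_i,\omega^i)$, that is, the values of local coframings of $M$ for which the $\theta_i$ annihilate $D$ and for which there are $1$-forms $\alpha^i_j,\beta_i$ with $$d\theta_i=-\alpha^k_k\wedge\theta_i+\alpha^j_i\wedge\theta_j+\epsilon_{ijk}\,\omega^j\wedge\omega^k,\qquad d\omega^i=-\epsilon^{ikj}\beta_k\wedge\theta_j-\alpha^i_j\wedge\omega^j,\tag{1}$$ and let $B_3\to B_2$ be the bundle of pointwise pseudo-connections $(\alpha,\beta)$ satisfying (1). On the $21$-manifold $B_3$ the tautological forms $\theta_i,\omega^i,\alpha^i_j,\beta_i$ satisfy (1), and there are unique $1$-forms $\tau^i$ and functions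 $S^{ik}_{jl},S^i_{jk},S_{ij}$ with $$d\alpha^i_j=-\alpha^i_k\wedge\alpha^k_j-2\,\omega^i\wedge\beta_j+\delta^i_j\,\tau^k\wedge\theta_k-\tau^i\wedge\theta_j+S^i_{jk}\epsilon^{klm}\theta_l\wedge\theta_m+S^{ik}_{jl}\,\theta_k\wedge\omega^l,$$ $$d\beta_i=\alpha^j_i\wedge\beta_j+\epsilon_{ijk}\tau^j\wedge\omega^k-2S^j_{ik}\,\theta_j\wedge\omega^k+\epsilon^{jkl}S_{ij}\,\theta_k\wedge\theta_l,$$ $S^i_{jk}=S^i_{kj}$, $S^i_{ik}=0$, $S^{ik}_{ij}=0$. The forms $\theta_i,\omega^i,\alpha^i_j,\beta_i,\tau^i$ are the canonical coframing of $B_3$. The fundamental tensor $\mathcal S$ of $D$ is the section of $(S^2D\otimes S^2D^*)_0\otimes\Lambda^3D^*$ (a bundle of rank $27$; the subscript $0$ denotes the kernel of the contraction to $D\otimes D^*$) given in any $2$-adapted coframing by $\mathcal S=S^{ik}_{jl}\,X_i\circ X_k\otimes\omega^j\circ\omega^l\otimes(\omega^1\wedge\omega^2\wedge\omega^3)$,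 where $X_i$ is the basis of $D$ dual to the $\omega^i$. **Proposition.** Suppose that $\mathcal S$ vanishes identically. Then: 1. The functions $S^i_{jk}$ and $S_{ij}$ vanish identically. 2. The canonical coframing satisfies (1) together with $$d\alpha^i_j=-\alpha^i_k\wedge\alpha^k_j-2\,\omega^i\wedge\beta_j+\delta^i_j\,\tau^k\wedge\theta_k-\tau^i\wedge\theta_j,\quad d\beta_i=\alpha^j_i\wedge\beta_j+\epsilon_{ijk}\,\tau^j\wedge\omega^k,\quad d\tau^i=\alpha^k_k\wedge\tau^i-\alpha^i_j\wedge\tau^j-\epsilon^{ijk}\beta_j\wedge\beta_k .$$ These are the Maurer–Cartan equations of $\mathfrak{so}(4,3)$: the matrix of $1$-forms, in blocks of sizes $3,1,3$, $$\gamma=\begin{pmatrix}-{}^t\alpha&2\beta&[\tau]\\ {}^t\omega&0&-{}^t\beta\\ -[\theta]&-2\omega&\alpha\end{pmatrix},\qquad [v]=\begin{pmatrix}0&-v_3&v_2\\ v_3&0&-v_1\\ -v_2&v_1&0\end{pmatrix},$$ takes values in $\{a\in\mathfrak{gl}(7,\mathbb R): Qa+{}^taQ=0\}\cong\mathfrak{so}(4,3)$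 with $Q=\begin{pmatrix}0&0&I_3\\0&2&0\\I_3&0&0\end{pmatrix}$, and satisfies $d\gamma=-\gamma\wedge\gamma$. 3. For every $1$-connected (i.e. connected and simply connected) open $U\subset M$, the smooth vector fields on $U$ whose (local) flows preserve $D$ form a Lie algebra isomorphic to $\mathfrak{so}(4,3)$. 4. Every point of $M$ is the center of a smooth coordinate system $(U,(x^j,y_i))$ in which $D$ is the common kernel of the three $1$-forms $dy_i+\epsilon_{ijk}\,x^j\,dx^k$. -/

import Mathlib

open scoped Manifold ContDiff TensorProduct

noncomputable section

namespace Bryant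

/-! ### One-forms on Euclidean space, wedge products and exterior derivatives -/

/-- The Euclidean space `ℝⁿ`. -/
abbrev Euc (n : ℕ) : Type := EuclideanSpace ℝ (Fin n)

/-- (Not necessarily smooth) `1`-forms on `ℝⁿ`. -/
abbrev OneForm (n : ℕ) : Type := Euc n → (Euc n →L[ℝ] ℝ)

/-- The wedge product of two `1`-forms, `(a ∧ b)(v₁, v₂) = a(v₁) b(v₂) - a(v₂) b(v₁)`. -/
def wedge {n : ℕ} (a b : OneForm n) (w v₁ v₂ : Euc n) : ℝ :=
  a w v₁ * b w v₂ - a w v₂ * b w v₁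

/-- The exterior derivative of a `1`-form, as a function of a point and two vectors. -/
def extD {n : ℕ} (a : OneForm n) (w v₁ v₂ : Euc n) : ℝ :=
  extDeriv (fun y => ContinuousAlternatingMap.ofSubsingleton ℝ (Euc n) ℝ (0 : Fin 1) (a y)) w
    ![v₁, v₂]

/-- The familiar formula for the exterior derivative of a `1`-form. -/
theorem extD_eq {n : ℕ} (a : OneForm n) (w v₁ v₂ : Euc n) (ha : DifferentiableAt ℝ a w) :
    extD a w v₁ v₂ = fderiv ℝ a w v₁ v₂ - fderiv ℝ a w v₂ v₁ := by
  have h : DifferentiableAt ℝ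
      (fun y => ContinuousAlternatingMap.ofSubsingleton ℝ (Euc n) ℝ (0 : Fin 1) (a y)) w :=
    (ContinuousAlternatingMap.ofSubsingletonLIE (𝕜 := ℝ) (E := Euc n) (F := ℝ)
      (0 : Fin 1)).differentiable.differentiableAt.comp w ha
  have key : ∀ u, fderiv ℝ (fun y => a y u) w = (fderiv ℝ a w).flip u := fun u =>
    ((ContinuousLinearMap.apply ℝ ℝ u).hasFDerivAt.comp w ha.hasFDerivAt).fderiv
  rw [extD, extDeriv_apply h]
  simp [Fin.sum_univ_two, key, Fin.removeNth]
  ring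

/-- The totally skew-symmetric symbol `ε_{ijk}` with `ε_{123} = 1` (indices are `0, 1, 2` here). -/
def eps (i j k : Fin 3) : ℝ :=
  ((i : ℝ) - (j : ℝ)) * ((j : ℝ) - (k : ℝ)) * ((k : ℝ) - (i : ℝ)) / 2

/-- The Kronecker symbol. -/
def delta (i j : Fin 3) : ℝ := if i = j then 1 else 0

/-! ### Maximally nonintegrable 3-plane fields on 6-manifolds -/

variable {M : Type*} [TopologicalSpace M] [ChartedSpace (Euc 6) M] [IsManifold (𝓡 6) ∞ M]

/-- The vector field `X` on `M` is smooth on the set `U`. -/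
def SmoothVectorFieldOn (X : (x : M) → TangentSpace (𝓡 6) x) (U : Set M) : Prop :=
  ContMDiffOn (𝓡 6) (𝓡 6).tangent ∞ (fun x => (⟨x, X x⟩ : TangentBundle (𝓡 6) M)) U

/-- `D` is a smooth `3`-plane field with `D + [D, D] = TM`: near every point it has a smooth frame
`X₁, X₂, X₃` such that `X₁, X₂, X₃, [X₂, X₃], [X₃, X₁], [X₁, X₂]` are everywhere linearly
independent. -/
def IsNondegenerate
    (D : (x : M) → Submodule ℝ (TangentSpace (𝓡 6) x)) : Prop :=
  ∀ x : M, ∃ U : Set M, IsOpen U ∧ x ∈ U ∧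
    ∃ X : Fin 3 → (y : M) → TangentSpace (𝓡 6) y,
      (∀ i, SmoothVectorFieldOn (X i) U) ∧
      ∀ y ∈ U, Submodule.span ℝ (Set.range fun i => X i y) = D y ∧
        LinearIndependent ℝ ![X 0 y, X 1 y, X 2 y,
          VectorField.mlieBracket (𝓡 6) (X 1) (X 2) y,
          VectorField.mlieBracket (𝓡 6) (X 2) (X 0) y,
          VectorField.mlieBracket (𝓡 6) (X 0) (X 1) y]

/-! ### The third-order bundle `B₃` and its canonical forms

`B₂ → M` is the bundle of `2`-adapted coframes `(θ_i, ω^i)` and `B₃ → B₂` is the bundle of pointwise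
pseudo-connections `(α, β)` satisfying the first two structure equations. By the tautological
property of `θ, ω, α, β`, a smooth map from a manifold `W` to `B₃` whose projection `f : W → M` is a
submersion is the same thing as `1`-forms `θ, ω, α, β` on `W` (the pull-backs of the tautological
ones) such that `(θ, ω)` is semibasic for `f` and induces at each point `w` a coframe of
`T_{f(w)}M` whose `θ_i` annihilate `D`, and such that the first two structure equations hold (modulo
`θ`, the first one says that the coframe is `1`-adapted, and then the second one that it is
`2`-adapted). Taking `W` open in `ℝ²¹` with `θ, ω, α, β` and the `τ` below a coframing gives the
local parametrizations of `B₃`; taking `f` a local diffeomorphism (`n = 6`) gives the local sections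
of `B₃ → M`. -/

/-- A smooth map from an open set `W ⊆ ℝⁿ` to `B₃` that covers a submersion `f : W → M`. -/
structure Lift (D : (x : M) → Submodule ℝ (TangentSpace (𝓡 6) x)) (n : ℕ) where
  /-- the domain -/
  W : Set (Euc n)
  /-- the projection to `M` -/
  f : Euc n → M
  /-- `θ i` is `θ_i` -/
  θ : Fin 3 → OneForm n
  /-- `om i` is `ω^i` -/
  om : Fin 3 → OneForm n
  /-- `α i j` is `α^i_j` -/
  α : Fin 3 → Fin 3 → OneForm n
  /-- `β i` is `β_i` -/
  β : Fin 3 → OneForm n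
  isOpen : IsOpen W
  smooth_f : ContMDiffOn (𝓡 n) (𝓡 6) ∞ f W
  submersion : ∀ w ∈ W, Function.Surjective (mfderiv (𝓡 n) (𝓡 6) f w)
  smooth_θ : ∀ i, ContDiffOn ℝ ∞ (θ i) W
  smooth_om : ∀ i, ContDiffOn ℝ ∞ (om i) W
  smooth_α : ∀ i j, ContDiffOn ℝ ∞ (α i j) W
  smooth_β : ∀ i, ContDiffOn ℝ ∞ (β i) W
  /-- the common kernel of the `θ_i` and `ω^i` is the vertical space, so that they induce a coframe
  at the image point -/
  coframe : ∀ w ∈ W, ∀ v : TangentSpace (𝓡 n) w,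
    ((∀ i, θ i w v = 0) ∧ ∀ i, om i w v = 0) ↔ mfderiv (𝓡 n) (𝓡 6) f w v = 0
  /-- the `θ_i` annihilate `D` -/
  annihilates : ∀ w ∈ W, ∀ v : TangentSpace (𝓡 n) w,
    mfderiv (𝓡 n) (𝓡 6) f w v ∈ D (f w) → ∀ i, θ i w v = 0
  /-- `dθ_i = -α^k_k ∧ θ_i + α^j_i ∧ θ_j + ε_{ijk} ω^j ∧ ω^k` -/
  dθ_eq : ∀ w ∈ W, ∀ v₁ v₂ i, extD (θ i) w v₁ v₂ =
    - ∑ k, wedge (α k k) (θ i) w v₁ v₂ + ∑ j, wedge (α j i) (θ j) w v₁ v₂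
      + ∑ j, ∑ k, eps i j k * wedge (om j) (om k) w v₁ v₂
  /-- `dω^i = -ε^{ikj} β_k ∧ θ_j - α^i_j ∧ ω^j` -/
  dω_eq : ∀ w ∈ W, ∀ v₁ v₂ i, extD (om i) w v₁ v₂ =
    - ∑ k, ∑ j, eps i k j * wedge (β k) (θ j) w v₁ v₂ - ∑ j, wedge (α i j) (om j) w v₁ v₂

variable {D : (x : M) → Submodule ℝ (TangentSpace (𝓡 6) x)} {n : ℕ}

/-- The curvature forms `A^i_j = dα^i_j + α^i_k ∧ α^k_j + 2 ω^i ∧ β_j`. -/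
def Lift.A (L : Lift D n) (i j : Fin 3) (w v₁ v₂ : Euc n) : ℝ :=
  extD (L.α i j) w v₁ v₂ + ∑ k, wedge (L.α i k) (L.α k j) w v₁ v₂
    + 2 * wedge (L.om i) (L.β j) w v₁ v₂

/-- The curvature forms `B_i = dβ_i - α^j_i ∧ β_j`. -/
def Lift.B (L : Lift D n) (i : Fin 3) (w v₁ v₂ : Euc n) : ℝ :=
  extD (L.β i) w v₁ v₂ - ∑ j, wedge (L.α j i) (L.β j) w v₁ v₂

/-- The `1`-forms `τ i = τ^i` and the functions `S4 i k j l = S^{ik}_{jl}`, `S3 i j k = S^i_{jk}`,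
`S2 i j = S_{ij}` are (the pull-backs of) the canonical ones on `B₃`: the `τ^i` and the
coefficients `S^i_{jk}`, `S^{ik}_{jl}` are the unique ones for which the formula `A_eq` for `A^i_j`
holds with the normalizations `S^i_{jk} = S^i_{kj}`, `S^i_{ik} = 0`, `S^{ik}_{ij} = 0`; and the
`S_{ij}` are then the remaining coefficients of `B_i`. -/
structure Lift.IsCanonical (L : Lift D n) (τ : Fin 3 → OneForm n)
    (S4 : Fin 3 → Fin 3 → Fin 3 → Fin 3 → Euc n → ℝ)
    (S3 : Fin 3 → Fin 3 → Fin 3 → Euc n → ℝ) (S2 : Fin 3 → Fin 3 → Euc n → ℝ) : Prop where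
  smooth_τ : ∀ i, ContDiffOn ℝ ∞ (τ i) L.W
  /-- `A^i_j = δ^i_j τ^k ∧ θ_k - τ^i ∧ θ_j + S^i_{jk} ε^{klm} θ_l ∧ θ_m + S^{ik}_{jl} θ_k ∧ ω^l` -/
  A_eq : ∀ w ∈ L.W, ∀ v₁ v₂ i j, L.A i j w v₁ v₂ =
    delta i j * ∑ k, wedge (τ k) (L.θ k) w v₁ v₂ - wedge (τ i) (L.θ j) w v₁ v₂
      + ∑ k, ∑ l, ∑ m, S3 i j k w * eps k l m * wedge (L.θ l) (L.θ m) w v₁ v₂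
      + ∑ k, ∑ l, S4 i k j l w * wedge (L.θ k) (L.om l) w v₁ v₂
  S3_symm : ∀ w ∈ L.W, ∀ i j k, S3 i j k w = S3 i k j w
  S3_trace : ∀ w ∈ L.W, ∀ k, ∑ i, S3 i i k w = 0
  S4_trace : ∀ w ∈ L.W, ∀ k j, ∑ i, S4 i k i j w = 0
  /-- `B_i = ε_{ijk} τ^j ∧ ω^k - 2 S^j_{ik} θ_j ∧ ω^k + ε^{jkl} S_{ij} θ_k ∧ θ_l` -/
  B_eq : ∀ w ∈ L.W, ∀ v₁ v₂ i, L.B i w v₁ v₂ =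
    ∑ j, ∑ k, eps i j k * wedge (τ j) (L.om k) w v₁ v₂
      - 2 * ∑ j, ∑ k, S3 j i k w * wedge (L.θ j) (L.om k) w v₁ v₂
      + ∑ j, ∑ k, ∑ l, eps j k l * S2 i j w * wedge (L.θ k) (L.θ l) w v₁ v₂

/-! ### The fundamental tensor -/

/-- The space `(P ⊗ P) ⊗ (P* ⊗ P*) ⊗ Λ³P*`, where the fundamental tensor takes its values for
`P = D x` (in the subspace `(S²P ⊗ S²P*)₀ ⊗ Λ³P*`). -/
abbrev TensorSpace (P : Type*) [AddCommGroup P] [Module ℝ P] : Type _ :=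
  ((P ⊗[ℝ] P) ⊗[ℝ] (Module.Dual ℝ P ⊗[ℝ] Module.Dual ℝ P)) ⊗[ℝ] (P [⋀^Fin 3]→ₗ[ℝ] ℝ)

/-- The tensor `S^{ik}_{jl} X_i ⊗ X_k ⊗ ω^j ⊗ ω^l ⊗ (ω^1 ∧ ω^2 ∧ ω^3)` for a basis `X = b` of `P`
with dual basis `ω`. -/
def tensorOf {P : Type*} [AddCommGroup P] [Module ℝ P] (b : Module.Basis (Fin 3) ℝ P)
    (S : Fin 3 → Fin 3 → Fin 3 → Fin 3 → ℝ) : TensorSpace P :=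
  ∑ i, ∑ k, ∑ j, ∑ l, S i k j l • (((b i ⊗ₜ[ℝ] b k) ⊗ₜ[ℝ] (b.coord j ⊗ₜ[ℝ] b.coord l)) ⊗ₜ[ℝ] b.det)

/-- `T` is the fundamental tensor of `D`: in every `2`-adapted coframing it has the components
`S^{ik}_{jl}`. Here `b` is the basis `X_i` of `D` at `f w` that is dual to the `ω^j`. -/
def IsFundamentalTensor (D : (x : M) → Submodule ℝ (TangentSpace (𝓡 6) x))
    (T : (x : M) → TensorSpace (D x)) : Prop :=
  ∀ (n : ℕ) (L : Lift D n) (τ : Fin 3 → OneForm n)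
    (S4 : Fin 3 → Fin 3 → Fin 3 → Fin 3 → Euc n → ℝ)
    (S3 : Fin 3 → Fin 3 → Fin 3 → Euc n → ℝ) (S2 : Fin 3 → Fin 3 → Euc n → ℝ),
    L.IsCanonical τ S4 S3 S2 →
    ∀ w ∈ L.W, ∀ b : Module.Basis (Fin 3) ℝ (D (L.f w)),
      (∀ i j, ∀ v : TangentSpace (𝓡 n) w,
        mfderiv (𝓡 n) (𝓡 6) L.f w v = (b i : TangentSpace (𝓡 6) (L.f w)) →
          L.om j w v = delta i j) →
      T (L.f w) = tensorOf b (fun i k j l => S4 i k j l w)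

open Classical in
/-- The fundamental tensor `𝒮` of `D`, the section of `D ⊗ D ⊗ D* ⊗ D* ⊗ Λ³D*` that is determined by
`IsFundamentalTensor`. -/
def fundamentalTensor (D : (x : M) → Submodule ℝ (TangentSpace (𝓡 6) x)) :
    (x : M) → TensorSpace (D x) :=
  if h : ∃ T, IsFundamentalTensor D T then h.choose else fun _ => 0

/-! ### The flat structure equations -/

/-- The flat structure equations for `dθ, dω, dα, dβ, dτ`. -/
structure Lift.FlatStructureEquations (L : Lift D n) (τ : Fin 3 → OneForm n) : Prop where
  /-- `dθ_i = -α^k_k ∧ θ_i + α^j_i ∧ θ_j + ε_{ijk} ω^j ∧ ω^k` -/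
  dθ_eq : ∀ w ∈ L.W, ∀ v₁ v₂ i, extD (L.θ i) w v₁ v₂ =
    - ∑ k, wedge (L.α k k) (L.θ i) w v₁ v₂ + ∑ j, wedge (L.α j i) (L.θ j) w v₁ v₂
      + ∑ j, ∑ k, eps i j k * wedge (L.om j) (L.om k) w v₁ v₂
  /-- `dω^i = -ε^{ikj} β_k ∧ θ_j - α^i_j ∧ ω^j` -/
  dω_eq : ∀ w ∈ L.W, ∀ v₁ v₂ i, extD (L.om i) w v₁ v₂ =
    - ∑ k, ∑ j, eps i k j * wedge (L.β k) (L.θ j) w v₁ v₂ - ∑ j, wedge (L.α i j) (L.om j) w v₁ v₂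
  /-- `dα^i_j = -α^i_k ∧ α^k_j - 2 ω^i ∧ β_j + δ^i_j τ^k ∧ θ_k - τ^i ∧ θ_j` -/
  dα_eq : ∀ w ∈ L.W, ∀ v₁ v₂ i j, extD (L.α i j) w v₁ v₂ =
    - ∑ k, wedge (L.α i k) (L.α k j) w v₁ v₂ - 2 * wedge (L.om i) (L.β j) w v₁ v₂
      + delta i j * ∑ k, wedge (τ k) (L.θ k) w v₁ v₂ - wedge (τ i) (L.θ j) w v₁ v₂
  /-- `dβ_i = α^j_i ∧ β_j + ε_{ijk} τ^j ∧ ω^k` -/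
  dβ_eq : ∀ w ∈ L.W, ∀ v₁ v₂ i, extD (L.β i) w v₁ v₂ =
    ∑ j, wedge (L.α j i) (L.β j) w v₁ v₂ + ∑ j, ∑ k, eps i j k * wedge (τ j) (L.om k) w v₁ v₂
  /-- `dτ^i = α^k_k ∧ τ^i - α^i_j ∧ τ^j - ε^{ijk} β_j ∧ β_k` -/
  dτ_eq : ∀ w ∈ L.W, ∀ v₁ v₂ i, extD (τ i) w v₁ v₂ =
    ∑ k, wedge (L.α k k) (τ i) w v₁ v₂ - ∑ j, wedge (L.α i j) (τ j) w v₁ v₂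
      - ∑ j, ∑ k, eps i j k * wedge (L.β j) (L.β k) w v₁ v₂

/-- The symmetric matrix `Q` of type `(4, 3)` with blocks `(0, 0, I₃; 0, 2, 0; I₃, 0, 0)`. -/
def Q : Matrix (Fin 7) (Fin 7) ℝ :=
  !![0, 0, 0, 0, 1, 0, 0;
     0, 0, 0, 0, 0, 1, 0;
     0, 0, 0, 0, 0, 0, 1;
     0, 0, 0, 2, 0, 0, 0;
     1, 0, 0, 0, 0, 0, 0;
     0, 1, 0, 0, 0, 0, 0;
     0, 0, 1, 0, 0, 0, 0]

/-- The matrix `γ` of `1`-forms assembled from `θ, ω, α, β, τ`. -/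
def Lift.γ (L : Lift D n) (τ : Fin 3 → OneForm n) : Matrix (Fin 7) (Fin 7) (OneForm n) :=
  !![-L.α 0 0, -L.α 1 0, -L.α 2 0, (2 : ℝ) • L.β 0, 0, -τ 2, τ 1;
     -L.α 0 1, -L.α 1 1, -L.α 2 1, (2 : ℝ) • L.β 1, τ 2, 0, -τ 0;
     -L.α 0 2, -L.α 1 2, -L.α 2 2, (2 : ℝ) • L.β 2, -τ 1, τ 0, 0;
     L.om 0, L.om 1, L.om 2, 0, -L.β 0, -L.β 1, -L.β 2;
     0, L.θ 2, -L.θ 1, (-2 : ℝ) • L.om 0, L.α 0 0, L.α 0 1, L.α 0 2;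
     -L.θ 2, 0, L.θ 0, (-2 : ℝ) • L.om 1, L.α 1 0, L.α 1 1, L.α 1 2;
     L.θ 1, -L.θ 0, 0, (-2 : ℝ) • L.om 2, L.α 2 0, L.α 2 1, L.α 2 2]

/-- `γ` takes values in `so(4, 3)`, realized as the matrices that are skew-adjoint for `Q`, and
satisfies the Maurer-Cartan equation `dγ = -γ ∧ γ`. -/
def Lift.MaurerCartan (L : Lift D n) (τ : Fin 3 → OneForm n) : Prop :=
  (∀ w ∈ L.W, ∀ v, Matrix.of (fun a b => L.γ τ a b w v) ∈ skewAdjointMatricesLieSubalgebra Q) ∧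
  ∀ w ∈ L.W, ∀ v₁ v₂ a b, extD (L.γ τ a b) w v₁ v₂ =
    - ∑ c, wedge (L.γ τ a c) (L.γ τ c b) w v₁ v₂

/-! ### Infinitesimal symmetries -/

/-- `φ` is a smooth local flow of `X` in `U`, defined for initial points in the open set `V` and
times in `(-r, r)`. -/
structure IsLocalFlow (X : (x : M) → TangentSpace (𝓡 6) x) (U V : Set M) (r : ℝ)
    (φ : ℝ → M → M) : Prop where
  isOpen : IsOpen V
  pos : 0 < r
  mapsTo : ∀ t ∈ Set.Ioo (-r) r, ∀ x ∈ V, φ t x ∈ U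
  zero : ∀ x ∈ V, φ 0 x = x
  smooth : ContMDiffOn (𝓘(ℝ, ℝ).prod (𝓡 6)) (𝓡 6) ∞ (fun p : ℝ × M => φ p.1 p.2)
    (Set.Ioo (-r) r ×ˢ V)
  integralCurve : ∀ x ∈ V, IsMIntegralCurveOn (I := 𝓡 6) (fun t => φ t x) X (Set.Ioo (-r) r)

/-- `X` is a smooth vector field on the open set `U` whose local flows preserve `D`: around every
point of `U`, its local flow maps `D` to `D`. (Values of `X` outside `U` are irrelevant.) -/
def IsInfinitesimalSymmetry (D : (x : M) → Submodule ℝ (TangentSpace (𝓡 6) x)) (U : Set M)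
    (X : (x : M) → TangentSpace (𝓡 6) x) : Prop :=
  SmoothVectorFieldOn X U ∧
  ∀ p ∈ U, ∃ (V : Set M) (r : ℝ) (φ : ℝ → M → M), p ∈ V ∧ IsLocalFlow X U V r φ ∧
    ∀ t ∈ Set.Ioo (-r) r, ∀ x ∈ V,
      (D x).map (mfderiv (𝓡 6) (𝓡 6) (φ t) x).toLinearMap = D (φ t x)

/-- The vector fields on `U` whose local flows preserve `D` form a Lie algebra (under the Lie
bracket of vector fields) that is isomorphic to `𝔤`: there is a linear map `Φ` from `𝔤` to vector
fields on `U` that is injective, has exactly these vector fields as its values, and maps brackets to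
brackets. Vector fields on `U` are functions on `M` here that count only through their values on
`U`. -/
def SymmetryAlgebraIsomorphicTo
    (D : (x : M) → Submodule ℝ (TangentSpace (𝓡 6) x))
    (U : Set M) (𝔤 : Type*) [LieRing 𝔤] [LieAlgebra ℝ 𝔤] : Prop :=
  ∃ Φ : 𝔤 →ₗ[ℝ] ((x : M) → TangentSpace (𝓡 6) x),
    (∀ a, IsInfinitesimalSymmetry D U (Φ a)) ∧
    (∀ a, (∀ x ∈ U, Φ a x = 0) → a = 0) ∧
    (∀ X, IsInfinitesimalSymmetry D U X → ∃ a, ∀ x ∈ U, Φ a x = X x) ∧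
    ∀ a b, ∀ x ∈ U, Φ ⁅a, b⁆ x = VectorField.mlieBracket (𝓡 6) (Φ a) (Φ b) x

/-! ### Flat coordinates -/

/-- The differential at `q` of the coordinate function number `a` of the chart `e`. -/
def coordDiff (e : OpenPartialHomeomorph M (Euc 6)) (a : Fin 6) (q : M)
    (v : TangentSpace (𝓡 6) q) : ℝ :=
  mfderiv (𝓡 6) 𝓘(ℝ, ℝ) (fun x => e x a) q v

/-- In the coordinates `(x^1, x^2, x^3, y_1, y_2, y_3)` given by `e`, the plane field `D` is the
common kernel of the `1`-forms `dy_i + ε_{ijk} x^j dx^k`. -/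
def IsFlatChart (D : (x : M) → Submodule ℝ (TangentSpace (𝓡 6) x))
    (e : OpenPartialHomeomorph M (Euc 6)) : Prop :=
  ∀ q ∈ e.source, ∀ v : TangentSpace (𝓡 6) q, v ∈ D q ↔
    ∀ i : Fin 3, coordDiff e (Fin.natAdd 3 i) q v
      + ∑ j : Fin 3, ∑ k : Fin 3, eps i j k * e q (Fin.castAdd 3 j)
          * coordDiff e (Fin.castAdd 3 k) q v = 0

end Bryant

end

noncomputable section

set_option linter.unusedSimpArgs false
set_option linter.unusedVariables false
set_option linter.unusedSectionVars false

namespace Bryant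

open Fin (sum_univ_three castAdd natAdd sum_univ_seven)
open Finset (sum_const_zero sum_congr sum_sub_distrib sum_neg_distrib sum_comm sum_add_distrib)
open Matrix (of of_apply cons_val mulVec nonsing_inv_mul mul_nonsing_inv transpose_mul
  transpose_apply mulVec_mulVec vecMul linftyOpNormedRing linftyOpNormedAlgebra
  mulVec_zero vecMulVec_apply det_fin_three)
open Module (finrank Basis)
open Function (Surjective Injective)
open VectorField (mlieBracket lieBracket)
open Set (Ioo MapsTo)
open Metric (ball)

variable {M : Type*} [TopologicalSpace M] [ChartedSpace (Euc 6) M]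
  {D : (x : M) → Submodule ℝ (TangentSpace (𝓡 6) x)} {n : ℕ} (L : Lift D n) {w : Euc n}
  {τ : Fin 3 → OneForm n} {S4 : Fin 3 → Fin 3 → Fin 3 → Fin 3 → Euc n → ℝ}
  {S3 : Fin 3 → Fin 3 → Fin 3 → Euc n → ℝ} {S2 : Fin 3 → Fin 3 → Euc n → ℝ}

/-- The space `ℝ³`. -/
abbrev V3 : Type := Fin 3 → ℝ

/-- (Not necessarily alternating) `2`-forms on `ℝⁿ`. -/
abbrev TwoForm (n : ℕ) : Type := Euc n → Euc n → Euc n → ℝ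

lemma _root_.ContDiffAt.diffAt {E F : Type*} [NormedAddCommGroup E] [NormedSpace ℝ E]
    [NormedAddCommGroup F] [NormedSpace ℝ F] {f : E → F} {x : E} {m : WithTop ℕ∞}
    (h : ContDiffAt ℝ m f x) (hm : m ≠ 0 := by simp) : DifferentiableAt ℝ f x :=
  h.differentiableAt hm

lemma _root_.ContDiffOn.diffAt {E F : Type*} [NormedAddCommGroup E] [NormedSpace ℝ E]
    [NormedAddCommGroup F] [NormedSpace ℝ F] {f : E → F} {x : E} {s : Set E}
    (h : ContDiffOn ℝ ∞ f s) (hs : IsOpen s) (hx : x ∈ s) : DifferentiableAt ℝ f x :=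
  (h.contDiffAt (hs.mem_nhds hx)).diffAt

/-- Square matrices of size `3`. -/
abbrev Mat3 : Type := Matrix (Fin 3) (Fin 3) ℝ

/-- Square matrices of size `7`. -/
abbrev Mat7 : Type := Matrix (Fin 7) (Fin 7) ℝ

/-- The Lie algebra of skew-adjoint matrices for `Q`. -/
abbrev skewQ := skewAdjointMatricesLieSubalgebra Q

/-- The maximal smooth atlas of a `6`-manifold. -/
abbrev maxAtlas (M : Type*) [TopologicalSpace M] [ChartedSpace (Euc 6) M] :
    Set (OpenPartialHomeomorph M (Euc 6)) := IsManifold.maximalAtlas (𝓡 6) ∞ M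

/-! ### Calculus of differential forms -/

section Forms

variable {m : ℕ}

lemma fderiv_oneForm_apply {a : OneForm n} (ha : DifferentiableAt ℝ a w)
    (u v : Euc n) : fderiv ℝ (fun y => a y u) w v = fderiv ℝ a w v u := by
  have := ((ContinuousLinearMap.apply ℝ ℝ u).hasFDerivAt.comp w ha.hasFDerivAt).fderiv
  exact congrArg (fun L => L v) this

lemma differentiableAt_oneForm_apply {a : OneForm n} (ha : DifferentiableAt ℝ a w)
    (u : Euc n) : DifferentiableAt ℝ (fun y => a y u) w :=
  ha.clm_apply (differentiableAt_const u)

lemma extD_swap {a : OneForm n} (ha : DifferentiableAt ℝ a w) (v₁ v₂ : Euc n) :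
    extD a w v₂ v₁ = -extD a w v₁ v₂ := by
  rw [extD_eq _ _ _ _ ha, extD_eq _ _ _ _ ha]; ring

lemma extD_congr {a b : OneForm n} (h : a =ᶠ[nhds w] b) (v₁ v₂ : Euc n) :
    extD a w v₁ v₂ = extD b w v₁ v₂ := by
  unfold extD
  have h' : (fun y => ContinuousAlternatingMap.ofSubsingleton ℝ (Euc n) ℝ (0 : Fin 1) (a y)) =ᶠ[nhds w]
      fun y => ContinuousAlternatingMap.ofSubsingleton ℝ (Euc n) ℝ (0 : Fin 1) (b y) :=
    h.mono fun y hy => by simp only [hy]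
  rw [h'.extDeriv_eq]

lemma extD_congr_on {a b : OneForm n} {s : Set (Euc n)} (hs : IsOpen s)
    (h : ∀ y ∈ s, ∀ v, a y v = b y v) (hw : w ∈ s) (v₁ v₂ : Euc n) :
    extD a w v₁ v₂ = extD b w v₁ v₂ :=
  extD_congr (by
    filter_upwards [hs.mem_nhds hw] with y hy
    ext v
    exact h y hy v) v₁ v₂

lemma extD_add {a b : OneForm n} (ha : DifferentiableAt ℝ a w)
    (hb : DifferentiableAt ℝ b w) (v₁ v₂ : Euc n) :
    extD (a + b) w v₁ v₂ = extD a w v₁ v₂ + extD b w v₁ v₂ := by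
  rw [extD_eq _ _ _ _ (ha.add hb), extD_eq _ _ _ _ ha, extD_eq _ _ _ _ hb, fderiv_add ha hb]
  simp only [add_apply]; ring

lemma extD_smul {a : OneForm n} (ha : DifferentiableAt ℝ a w) (c : ℝ)
    (v₁ v₂ : Euc n) : extD (c • a) w v₁ v₂ = c * extD a w v₁ v₂ := by
  rw [extD_eq _ _ _ _ (ha.const_smul c), extD_eq _ _ _ _ ha, fderiv_const_smul ha]
  simp only [smul_apply, smul_eq_mul]; ring

lemma extD_neg {a : OneForm n} (ha : DifferentiableAt ℝ a w)
    (v₁ v₂ : Euc n) : extD (-a) w v₁ v₂ = -extD a w v₁ v₂ := by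
  have := extD_smul ha (-1) v₁ v₂
  have e : (-1 : ℝ) • a = -a := by funext y; ext v; simp
  rwa [e, neg_one_mul] at this

lemma extD_zero (w v₁ v₂ : Euc n) : extD (0 : OneForm n) w v₁ v₂ = 0 := by
  have := extD_smul (a := (0 : OneForm n)) (w := w) (differentiableAt_const 0) 0 v₁ v₂
  rwa [zero_smul, zero_mul] at this

lemma extD_fun_smul {a : OneForm n} {f : Euc n → ℝ} (hf : DifferentiableAt ℝ f w)
    (ha : DifferentiableAt ℝ a w) (v₁ v₂ : Euc n) :
    extD (fun y => f y • a y) w v₁ v₂ = fderiv ℝ f w v₁ * a w v₂ - fderiv ℝ f w v₂ * a w v₁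
      + f w * extD a w v₁ v₂ := by
  rw [extD_eq _ _ _ _ (hf.fun_smul ha), extD_eq _ _ _ _ ha, fderiv_fun_smul hf ha]
  simp only [add_apply, smul_apply, smul_eq_mul, ContinuousLinearMap.smulRight_apply]; ring

lemma extD_fun_sum {ι : Type*} (s : Finset ι) {a : ι → OneForm n}
    (ha : ∀ i ∈ s, DifferentiableAt ℝ (a i) w) (v₁ v₂ : Euc n) :
    extD (fun y => ∑ i ∈ s, a i y) w v₁ v₂ = ∑ i ∈ s, extD (a i) w v₁ v₂ := by
  rw [extD_eq _ _ _ _ (DifferentiableAt.fun_sum ha), fderiv_fun_sum ha]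
  simp only [sum_apply, ← sum_sub_distrib]
  exact sum_congr rfl fun i hi => (extD_eq _ _ _ _ (ha i hi)).symm

/-- The exterior derivative of a `2`-form, given as a function of a point and two vectors. -/
def d2 (F : TwoForm n) (w v₀ v₁ v₂ : Euc n) : ℝ :=
  fderiv ℝ (fun y => F y v₁ v₂) w v₀ + fderiv ℝ (fun y => F y v₂ v₀) w v₁
    + fderiv ℝ (fun y => F y v₀ v₁) w v₂

lemma d2_congr {F G : TwoForm n}
    (h : ∀ᶠ y in nhds w, ∀ u v, F y u v = G y u v) (v₀ v₁ v₂ : Euc n) :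
    d2 F w v₀ v₁ v₂ = d2 G w v₀ v₁ v₂ := by
  have key : ∀ u v, fderiv ℝ (fun y => F y u v) w = fderiv ℝ (fun y => G y u v) w := fun u v =>
    Filter.EventuallyEq.fderiv_eq (h.mono fun y hy => hy u v)
  simp only [d2, key]

lemma d2_zero {F : TwoForm n}
    (h : ∀ᶠ y in nhds w, ∀ u v, F y u v = 0) (v₀ v₁ v₂ : Euc n) : d2 F w v₀ v₁ v₂ = 0 := by
  rw [d2_congr (G := fun _ _ _ => 0) h]; simp [d2]

lemma d2_add {F G : TwoForm n} (hF : ∀ u v, DifferentiableAt ℝ (fun y => F y u v) w)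
    (hG : ∀ u v, DifferentiableAt ℝ (fun y => G y u v) w) (v₀ v₁ v₂ : Euc n) :
    d2 (fun y u v => F y u v + G y u v) w v₀ v₁ v₂ = d2 F w v₀ v₁ v₂ + d2 G w v₀ v₁ v₂ := by
  simp only [d2, fderiv_fun_add (hF _ _) (hG _ _), add_apply]; ring

lemma d2_sum {ι : Type*} (s : Finset ι) {F : ι → TwoForm n}
    (hF : ∀ i ∈ s, ∀ u v, DifferentiableAt ℝ (fun y => F i y u v) w) (v₀ v₁ v₂ : Euc n) :
    d2 (fun y u v => ∑ i ∈ s, F i y u v) w v₀ v₁ v₂ = ∑ i ∈ s, d2 (F i) w v₀ v₁ v₂ := by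
  simp only [d2, fun u v => fderiv_fun_sum (fun i hi => hF i hi u v),
    sum_apply, sum_add_distrib]

lemma d2_mul {F : TwoForm n} {f : Euc n → ℝ} (hf : DifferentiableAt ℝ f w)
    (hF : ∀ u v, DifferentiableAt ℝ (fun y => F y u v) w) (v₀ v₁ v₂ : Euc n) :
    d2 (fun y u v => f y * F y u v) w v₀ v₁ v₂ = fderiv ℝ f w v₀ * F w v₁ v₂
      + fderiv ℝ f w v₁ * F w v₂ v₀ + fderiv ℝ f w v₂ * F w v₀ v₁ + f w * d2 F w v₀ v₁ v₂ := by
  simp only [d2, fderiv_fun_mul hf (hF _ _), add_apply, smul_apply, smul_eq_mul]; ring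

lemma differentiableAt_wedge {a b : OneForm n} (ha : DifferentiableAt ℝ a w)
    (hb : DifferentiableAt ℝ b w) (u v : Euc n) : DifferentiableAt ℝ (fun y => wedge a b y u v) w :=
  ((differentiableAt_oneForm_apply ha u).mul (differentiableAt_oneForm_apply hb v)).sub
    ((differentiableAt_oneForm_apply ha v).mul (differentiableAt_oneForm_apply hb u))

lemma d2_wedge {a b : OneForm n} (ha : DifferentiableAt ℝ a w)
    (hb : DifferentiableAt ℝ b w) (v₀ v₁ v₂ : Euc n) : d2 (wedge a b) w v₀ v₁ v₂ =
      (extD a w v₁ v₂ * b w v₀ + extD a w v₂ v₀ * b w v₁ + extD a w v₀ v₁ * b w v₂)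
      - (a w v₀ * extD b w v₁ v₂ + a w v₁ * extD b w v₂ v₀ + a w v₂ * extD b w v₀ v₁) := by
  have key : ∀ u v z, fderiv ℝ (fun y => wedge a b y u v) w z =
      fderiv ℝ a w z u * b w v + a w u * fderiv ℝ b w z v
        - (fderiv ℝ a w z v * b w u + a w v * fderiv ℝ b w z u) := by
    intro u v z
    have h1 := differentiableAt_oneForm_apply ha
    have h2 := differentiableAt_oneForm_apply hb
    unfold wedge
    rw [fderiv_fun_sub ((h1 u).fun_mul (h2 v)) ((h1 v).fun_mul (h2 u)), fderiv_fun_mul (h1 u) (h2 v),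
      fderiv_fun_mul (h1 v) (h2 u)]
    simp only [sub_apply, add_apply, smul_apply, smul_eq_mul, fderiv_oneForm_apply ha,
      fderiv_oneForm_apply hb]
    ring
  simp only [d2, key, extD_eq _ _ _ _ ha, extD_eq _ _ _ _ hb]
  ring

lemma eventually_extD_eq {a : OneForm n} (ha : ContDiffAt ℝ 2 a w) :
    ∀ᶠ y in nhds w, ∀ u v, extD a y u v = fderiv ℝ a y u v - fderiv ℝ a y v u := by
  filter_upwards [ha.eventually (by simp)] with y hy u v
  exact extD_eq _ _ _ _ hy.diffAt

lemma hasFDerivAt_fderiv_apply {a : OneForm n} (ha : ContDiffAt ℝ 2 a w)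
    (u v : Euc n) : HasFDerivAt (fun y => fderiv ℝ a y u v) ((ContinuousLinearMap.apply ℝ ℝ v).comp
        ((ContinuousLinearMap.apply ℝ _ u).comp (fderiv ℝ (fderiv ℝ a) w))) w := by
  have h := ((ha.fderiv_right (m := 1) (by norm_num)).differentiableAt (by simp)).hasFDerivAt
  have h1 := (ContinuousLinearMap.apply ℝ (Euc n →L[ℝ] ℝ) u).hasFDerivAt.comp w h
  exact (ContinuousLinearMap.apply ℝ ℝ v).hasFDerivAt.comp w h1

lemma differentiableAt_extD {a : OneForm n} (ha : ContDiffAt ℝ 2 a w) (u v : Euc n) :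
    DifferentiableAt ℝ (fun y => extD a y u v) w :=
  ((hasFDerivAt_fderiv_apply ha u v).differentiableAt.sub
    (hasFDerivAt_fderiv_apply ha v u).differentiableAt).congr_of_eventuallyEq
      ((eventually_extD_eq ha).mono fun _ hy => hy u v)

lemma d2_extD {a : OneForm n} (ha : ContDiffAt ℝ 2 a w) (v₀ v₁ v₂ : Euc n) :
    d2 (extD a) w v₀ v₁ v₂ = 0 := by
  have hs : IsSymmSndFDerivAt ℝ a w := ha.isSymmSndFDerivAt (by simp)
  have key : ∀ u v z, fderiv ℝ (fun y => fderiv ℝ a y u v - fderiv ℝ a y v u) w z =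
      fderiv ℝ (fderiv ℝ a) w z u v - fderiv ℝ (fderiv ℝ a) w z v u := by
    intro u v z
    rw [((hasFDerivAt_fderiv_apply ha u v).fun_sub (hasFDerivAt_fderiv_apply ha v u)).fderiv]
    rfl
  rw [d2_congr (eventually_extD_eq ha)]
  simp only [d2, key, hs.eq v₁ v₀, hs.eq v₂ v₀, hs.eq v₂ v₁]
  ring

/-- The value of a matrix of `1`-forms on a vector. -/
def mat (γ : Fin m → Fin m → OneForm n) (w v : Euc n) : Matrix (Fin m) (Fin m) ℝ :=
  of fun a b => γ a b w v

/-- The curvature `dγ + γ ∧ γ` of a matrix of `1`-forms. -/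
def curv (γ : Fin m → Fin m → OneForm n) (w v₁ v₂ : Euc n) : Matrix (Fin m) (Fin m) ℝ :=
  of (fun a b => extD (γ a b) w v₁ v₂) + mat γ w v₁ * mat γ w v₂ - mat γ w v₂ * mat γ w v₁

lemma curv_apply (γ : Fin m → Fin m → OneForm n) (w v₁ v₂ : Euc n) (a b : Fin m) :
    curv γ w v₁ v₂ a b = extD (γ a b) w v₁ v₂ + ∑ c, wedge (γ a c) (γ c b) w v₁ v₂ := by
  simp only [curv, mat, wedge, Matrix.sub_apply, Matrix.add_apply, of_apply,
    Matrix.mul_apply, sum_sub_distrib, add_sub_assoc]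

lemma bianchi {γ : Fin m → Fin m → OneForm n}
    (hγ : ∀ a b, ContDiffAt ℝ 2 (γ a b) w) (v₀ v₁ v₂ : Euc n) :
    of (fun a b => d2 (fun y u v => curv γ y u v a b) w v₀ v₁ v₂) =
      curv γ w v₁ v₂ * mat γ w v₀ + curv γ w v₂ v₀ * mat γ w v₁ + curv γ w v₀ v₁ * mat γ w v₂
      - (mat γ w v₀ * curv γ w v₁ v₂ + mat γ w v₁ * curv γ w v₂ v₀
        + mat γ w v₂ * curv γ w v₀ v₁) := by
  have hd : ∀ a b, DifferentiableAt ℝ (γ a b) w := fun a b => (hγ a b).diffAt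
  set dG : Euc n → Euc n → Matrix (Fin m) (Fin m) ℝ :=
    fun u v => of (fun a b => extD (γ a b) w u v) with hdG
  have key : of (fun a b => d2 (fun y u v => curv γ y u v a b) w v₀ v₁ v₂) =
      dG v₁ v₂ * mat γ w v₀ + dG v₂ v₀ * mat γ w v₁ + dG v₀ v₁ * mat γ w v₂
      - (mat γ w v₀ * dG v₁ v₂ + mat γ w v₁ * dG v₂ v₀ + mat γ w v₂ * dG v₀ v₁) := by
    ext a b
    simp only [of_apply, curv_apply]
    rw [d2_add (fun u v => differentiableAt_extD (hγ a b) u v)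
      (fun u v => DifferentiableAt.fun_sum fun c _ => differentiableAt_wedge (hd a c) (hd c b) u v),
      d2_extD (hγ a b), d2_sum _ (fun c _ u v => differentiableAt_wedge (hd a c) (hd c b) u v)]
    simp only [d2_wedge (hd _ _) (hd _ _), hdG, mat, Matrix.sub_apply, Matrix.add_apply,
      Matrix.mul_apply, of_apply, sum_add_distrib, sum_sub_distrib, zero_add]
  have hc : ∀ u v, curv γ w u v = dG u v + mat γ w u * mat γ w v - mat γ w v * mat γ w u :=
    fun u v => rfl
  rw [key, hc, hc, hc]
  noncomm_ring

lemma gauge_curv {γ γ' : Fin m → Fin m → OneForm n} {h : Fin m → Fin m → Euc n → ℝ}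
    (hγ : ∀ a b, DifferentiableAt ℝ (γ a b) w) (hγ' : ∀ a b, DifferentiableAt ℝ (γ' a b) w)
    (hh : ∀ a b, ContDiffAt ℝ 2 (h a b) w)
    (hg : ∀ᶠ y in nhds w, ∀ v a b, ∑ c, h a c y * γ' c b y v =
      ∑ c, γ a c y v * h c b y + fderiv ℝ (h a b) y v) (v₁ v₂ : Euc n) :
    (of fun a b => h a b w) * curv γ' w v₁ v₂ = curv γ w v₁ v₂ * (of fun a b => h a b w) := by
  have hd : ∀ a b, DifferentiableAt ℝ (h a b) w := fun a b => (hh a b).diffAt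
  set H : Matrix (Fin m) (Fin m) ℝ := of fun a b => h a b w with hH
  set dH : Euc n → Matrix (Fin m) (Fin m) ℝ := fun v => of fun a b => fderiv ℝ (h a b) w v
    with hdH
  have h0 : ∀ v, dH v = H * mat γ' w v - mat γ w v * H := by
    intro v; ext a b
    have := hg.self_of_nhds v a b
    simp only [hdH, hH, mat, Matrix.sub_apply, Matrix.mul_apply, of_apply]
    linarith
  have h1 : dH v₁ * mat γ' w v₂ - dH v₂ * mat γ' w v₁
      + H * of (fun a b => extD (γ' a b) w v₁ v₂) =
      of (fun a b => extD (γ a b) w v₁ v₂) * H + mat γ w v₂ * dH v₁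
        - mat γ w v₁ * dH v₂ := by
    ext a b
    have key : ∀ u v, ∑ c, (fderiv ℝ (h a c) w u * γ' c b w v + h a c w * fderiv ℝ (γ' c b) w u v) =
        ∑ c, (fderiv ℝ (γ a c) w u v * h c b w + γ a c w v * fderiv ℝ (h c b) w u)
          + fderiv ℝ (fderiv ℝ (h a b)) w u v := by
      intro u v
      have e := Filter.EventuallyEq.fderiv_eq (𝕜 := ℝ) (hg.mono fun y hy => hy v a b)
      have e' := congrArg (fun L => L u) e
      have hf := ((hh a b).fderiv_right (m := 1) (by norm_num)).differentiableAt (by simp)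
      rw [fderiv_fun_add (DifferentiableAt.fun_sum fun c _ =>
          (differentiableAt_oneForm_apply (hγ a c) v).fun_mul (hd c b)) (hf.clm_apply
            (differentiableAt_const v)),
        fderiv_fun_sum (fun c _ => (hd a c).fun_mul (differentiableAt_oneForm_apply (hγ' c b) v)),
        fderiv_fun_sum (fun c _ => (differentiableAt_oneForm_apply (hγ a c) v).fun_mul (hd c b))] at e'
      simp only [fun c => fderiv_fun_mul (hd a c) (differentiableAt_oneForm_apply (hγ' c b) v),
        fun c => fderiv_fun_mul (differentiableAt_oneForm_apply (hγ a c) v) (hd c b),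
        add_apply, sum_apply,
        smul_apply, smul_eq_mul, fderiv_oneForm_apply (hγ _ _),
        fderiv_oneForm_apply (hγ' _ _)] at e'
      have e3 : fderiv ℝ (fun y => fderiv ℝ (h a b) y v) w u = fderiv ℝ (fderiv ℝ (h a b)) w u v :=
        fderiv_oneForm_apply hf v u
      rw [e3] at e'
      refine Eq.trans (sum_congr rfl fun c _ => by ring) (e'.trans ?_)
      congr 1
      exact sum_congr rfl fun c _ => by ring
    have hs : IsSymmSndFDerivAt ℝ (h a b) w := (hh a b).isSymmSndFDerivAt (by simp)
    have k1 := key v₁ v₂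
    have k2 := key v₂ v₁
    rw [hs.eq v₂ v₁] at k2
    simp only [hdH, hH, mat, Matrix.sub_apply, Matrix.add_apply, Matrix.mul_apply, of_apply,
      extD_eq _ _ _ _ (hγ _ _), extD_eq _ _ _ _ (hγ' _ _), mul_sub, sub_mul,
      sum_sub_distrib, sum_add_distrib] at k1 k2 ⊢
    linarith
  simp only [h0] at h1
  simp only [curv, Matrix.mul_sub, Matrix.mul_add, Matrix.sub_mul, Matrix.add_mul]
  have h2 : H * of (fun a b => extD (γ' a b) w v₁ v₂) =
      of (fun a b => extD (γ a b) w v₁ v₂) * H + mat γ w v₂ * (H * mat γ' w v₁ - mat γ w v₁ * H)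
        - mat γ w v₁ * (H * mat γ' w v₂ - mat γ w v₂ * H)
      - ((H * mat γ' w v₁ - mat γ w v₁ * H) * mat γ' w v₂
        - (H * mat γ' w v₂ - mat γ w v₂ * H) * mat γ' w v₁) := by
    rw [← h1]; abel
  rw [h2]
  noncomm_ring

end Forms

/-! ### The Lie algebra `so(4, 3)` in components -/

@[simp] lemma eps_same_left (i j : Fin 3) : eps i i j = 0 := by simp [eps]
@[simp] lemma eps_same_right (i j : Fin 3) : eps i j j = 0 := by simp [eps]
@[simp] lemma eps_same_outer (i j : Fin 3) : eps i j i = 0 := by simp [eps]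
@[simp] lemma eps_012 : eps 0 1 2 = 1 := by norm_num [eps]
@[simp] lemma eps_120 : eps 1 2 0 = 1 := by norm_num [eps]
@[simp] lemma eps_201 : eps 2 0 1 = 1 := by norm_num [eps]
@[simp] lemma eps_021 : eps 0 2 1 = -1 := by norm_num [eps]
@[simp] lemma eps_210 : eps 2 1 0 = -1 := by norm_num [eps]
@[simp] lemma delta_same (i : Fin 3) : delta i i = 1 := by simp [delta]
@[simp] lemma delta_01 : delta 0 1 = 0 := by simp [delta]
@[simp] lemma delta_02 : delta 0 2 = 0 := by simp [delta]
@[simp] lemma delta_10 : delta 1 0 = 0 := by simp [delta]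
@[simp] lemma delta_12 : delta 1 2 = 0 := by simp [delta]
@[simp] lemma delta_20 : delta 2 0 = 0 := by simp [delta]
@[simp] lemma delta_21 : delta 2 1 = 0 := by simp [delta]
@[simp] lemma eps_102 : eps 1 0 2 = -1 := by norm_num [eps]

lemma eps_vals : eps 0 0 0 = 0 ∧ eps 0 0 1 = 0 ∧ eps 0 0 2 = 0 ∧ eps 0 1 0 = 0 ∧ eps 0 1 1 = 0 ∧
    eps 0 1 2 = 1 ∧ eps 0 2 0 = 0 ∧ eps 0 2 1 = -1 ∧ eps 0 2 2 = 0 ∧ eps 1 0 0 = 0 ∧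
    eps 1 0 1 = 0 ∧ eps 1 0 2 = -1 ∧ eps 1 1 0 = 0 ∧ eps 1 1 1 = 0 ∧ eps 1 1 2 = 0 ∧
    eps 1 2 0 = 1 ∧ eps 1 2 1 = 0 ∧ eps 1 2 2 = 0 ∧ eps 2 0 0 = 0 ∧ eps 2 0 1 = 1 ∧
    eps 2 0 2 = 0 ∧ eps 2 1 0 = -1 ∧ eps 2 1 1 = 0 ∧ eps 2 1 2 = 0 ∧ eps 2 2 0 = 0 ∧
    eps 2 2 1 = 0 ∧ eps 2 2 2 = 0 := by
  simp

lemma delta_vals : delta 0 0 = 1 ∧ delta 0 1 = 0 ∧ delta 0 2 = 0 ∧ delta 1 0 = 0 ∧ delta 1 1 = 1 ∧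
    delta 1 2 = 0 ∧ delta 2 0 = 0 ∧ delta 2 1 = 0 ∧ delta 2 2 = 1 := by
  simp

lemma forall_fin3 {P : Fin 3 → Prop} (h₀ : P 0) (h₁ : P 1) (h₂ : P 2) : ∀ i, P i := by
  intro i
  fin_cases i <;> assumption

/-- The element of `so(4, 3)` with the given components. -/
def so43 (θ om : V3) (α : Fin 3 → V3) (β τ : V3) : Mat7 :=
  !![-α 0 0, -α 1 0, -α 2 0, 2 * β 0, 0, -τ 2, τ 1;
     -α 0 1, -α 1 1, -α 2 1, 2 * β 1, τ 2, 0, -τ 0;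
     -α 0 2, -α 1 2, -α 2 2, 2 * β 2, -τ 1, τ 0, 0;
     om 0, om 1, om 2, 0, -β 0, -β 1, -β 2;
     0, θ 2, -θ 1, (-2) * om 0, α 0 0, α 0 1, α 0 2;
     -θ 2, 0, θ 0, (-2) * om 1, α 1 0, α 1 1, α 1 2;
     θ 1, -θ 0, 0, (-2) * om 2, α 2 0, α 2 1, α 2 2]

lemma ext_seven {A B : Mat7}
    (h00 : A 0 0 = B 0 0) (h01 : A 0 1 = B 0 1) (h02 : A 0 2 = B 0 2) (h03 : A 0 3 = B 0 3)
    (h04 : A 0 4 = B 0 4) (h05 : A 0 5 = B 0 5) (h06 : A 0 6 = B 0 6) (h10 : A 1 0 = B 1 0)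
    (h11 : A 1 1 = B 1 1) (h12 : A 1 2 = B 1 2) (h13 : A 1 3 = B 1 3) (h14 : A 1 4 = B 1 4)
    (h15 : A 1 5 = B 1 5) (h16 : A 1 6 = B 1 6) (h20 : A 2 0 = B 2 0) (h21 : A 2 1 = B 2 1)
    (h22 : A 2 2 = B 2 2) (h23 : A 2 3 = B 2 3) (h24 : A 2 4 = B 2 4) (h25 : A 2 5 = B 2 5)
    (h26 : A 2 6 = B 2 6) (h30 : A 3 0 = B 3 0) (h31 : A 3 1 = B 3 1) (h32 : A 3 2 = B 3 2)
    (h33 : A 3 3 = B 3 3) (h34 : A 3 4 = B 3 4) (h35 : A 3 5 = B 3 5) (h36 : A 3 6 = B 3 6)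
    (h40 : A 4 0 = B 4 0) (h41 : A 4 1 = B 4 1) (h42 : A 4 2 = B 4 2) (h43 : A 4 3 = B 4 3)
    (h44 : A 4 4 = B 4 4) (h45 : A 4 5 = B 4 5) (h46 : A 4 6 = B 4 6) (h50 : A 5 0 = B 5 0)
    (h51 : A 5 1 = B 5 1) (h52 : A 5 2 = B 5 2) (h53 : A 5 3 = B 5 3) (h54 : A 5 4 = B 5 4)
    (h55 : A 5 5 = B 5 5) (h56 : A 5 6 = B 5 6) (h60 : A 6 0 = B 6 0) (h61 : A 6 1 = B 6 1)
    (h62 : A 6 2 = B 6 2) (h63 : A 6 3 = B 6 3) (h64 : A 6 4 = B 6 4) (h65 : A 6 5 = B 6 5)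
    (h66 : A 6 6 = B 6 6) : A = B := by
  ext a b
  fin_cases a <;> fin_cases b <;> assumption

lemma so43_commutator (θ om : V3) (α : Fin 3 → V3) (β τ : V3)
    (θ' om' : V3) (α' : Fin 3 → V3) (β' τ' : V3) :
    so43 θ om α β τ * so43 θ' om' α' β' τ' - so43 θ' om' α' β' τ' * so43 θ om α β τ =
    so43 (fun i => ∑ k, (α k k * θ' i - α' k k * θ i) - ∑ j, (α j i * θ' j - α' j i * θ j)
        - ∑ j, ∑ k, eps i j k * (om j * om' k - om' j * om k))
      (fun i => ∑ k, ∑ j, eps i k j * (β k * θ' j - β' k * θ j)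
        + ∑ j, (α i j * om' j - α' i j * om j))
      (fun i j => ∑ k, (α i k * α' k j - α' i k * α k j) + 2 * (om i * β' j - om' i * β j)
        - delta i j * ∑ k, (τ k * θ' k - τ' k * θ k) + (τ i * θ' j - τ' i * θ j))
      (fun i => -∑ j, (α j i * β' j - α' j i * β j)
        - ∑ j, ∑ k, eps i j k * (τ j * om' k - τ' j * om k))
      (fun i => -∑ k, (α k k * τ' i - α' k k * τ i) + ∑ j, (α i j * τ' j - α' i j * τ j)
        + ∑ j, ∑ k, eps i j k * (β j * β' k - β' j * β k)) := by
  apply ext_seven <;>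
  · simp only [Matrix.sub_apply, Matrix.mul_apply, sum_univ_seven, so43, of_apply, cons_val]
    simp [sum_univ_three]
    try ring

lemma so43_add (θ om : V3) (α : Fin 3 → V3) (β τ : V3)
    (θ' om' : V3) (α' : Fin 3 → V3) (β' τ' : V3) : so43 θ om α β τ + so43 θ' om' α' β' τ' =
      so43 (θ + θ') (om + om') (α + α') (β + β') (τ + τ') := by
  apply ext_seven <;>
  · simp only [Matrix.add_apply, so43, of_apply, cons_val, Pi.add_apply]
    try ring

lemma Q_apply :
    Q 0 0 = 0 ∧ Q 0 1 = 0 ∧ Q 0 2 = 0 ∧ Q 0 3 = 0 ∧ Q 0 4 = 1 ∧ Q 0 5 = 0 ∧ Q 0 6 = 0 ∧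
    Q 1 0 = 0 ∧ Q 1 1 = 0 ∧ Q 1 2 = 0 ∧ Q 1 3 = 0 ∧ Q 1 4 = 0 ∧ Q 1 5 = 1 ∧ Q 1 6 = 0 ∧
    Q 2 0 = 0 ∧ Q 2 1 = 0 ∧ Q 2 2 = 0 ∧ Q 2 3 = 0 ∧ Q 2 4 = 0 ∧ Q 2 5 = 0 ∧ Q 2 6 = 1 ∧
    Q 3 0 = 0 ∧ Q 3 1 = 0 ∧ Q 3 2 = 0 ∧ Q 3 3 = 2 ∧ Q 3 4 = 0 ∧ Q 3 5 = 0 ∧ Q 3 6 = 0 ∧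
    Q 4 0 = 1 ∧ Q 4 1 = 0 ∧ Q 4 2 = 0 ∧ Q 4 3 = 0 ∧ Q 4 4 = 0 ∧ Q 4 5 = 0 ∧ Q 4 6 = 0 ∧
    Q 5 0 = 0 ∧ Q 5 1 = 1 ∧ Q 5 2 = 0 ∧ Q 5 3 = 0 ∧ Q 5 4 = 0 ∧ Q 5 5 = 0 ∧ Q 5 6 = 0 ∧
    Q 6 0 = 0 ∧ Q 6 1 = 0 ∧ Q 6 2 = 1 ∧ Q 6 3 = 0 ∧ Q 6 4 = 0 ∧ Q 6 5 = 0 ∧ Q 6 6 = 0  := by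
  and_intros <;> rfl

lemma so43_mem (θ om : V3) (α : Fin 3 → V3) (β τ : V3) : so43 θ om α β τ ∈ skewQ := by
  rw [mem_skewAdjointMatricesLieSubalgebra, mem_skewAdjointMatricesSubmodule,
    Matrix.IsSkewAdjoint, Matrix.IsAdjointPair]
  apply ext_seven <;>
  · simp only [Matrix.mul_apply, sum_univ_seven, transpose_apply, Matrix.neg_apply,
      so43, of_apply, cons_val, Q_apply]
    ring

section Forms

/-- The matrix of `1`-forms with the given components. -/
def so43Form (θ om : Fin 3 → OneForm n) (α : Fin 3 → Fin 3 → OneForm n) (β τ : Fin 3 → OneForm n) :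
    Matrix (Fin 7) (Fin 7) (OneForm n) :=
  !![-α 0 0, -α 1 0, -α 2 0, (2 : ℝ) • β 0, 0, -τ 2, τ 1;
     -α 0 1, -α 1 1, -α 2 1, (2 : ℝ) • β 1, τ 2, 0, -τ 0;
     -α 0 2, -α 1 2, -α 2 2, (2 : ℝ) • β 2, -τ 1, τ 0, 0;
     om 0, om 1, om 2, 0, -β 0, -β 1, -β 2;
     0, θ 2, -θ 1, (-2 : ℝ) • om 0, α 0 0, α 0 1, α 0 2;
     -θ 2, 0, θ 0, (-2 : ℝ) • om 1, α 1 0, α 1 1, α 1 2;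
     θ 1, -θ 0, 0, (-2 : ℝ) • om 2, α 2 0, α 2 1, α 2 2]

variable {θ om : Fin 3 → OneForm n} {α : Fin 3 → Fin 3 → OneForm n} {β τ : Fin 3 → OneForm n}

lemma mat_so43Form (w v : Euc n) :
    mat (so43Form θ om α β τ) w v = so43 (fun i => θ i w v) (fun i => om i w v)
      (fun i j => α i j w v) (fun i => β i w v) (fun i => τ i w v) := by
  apply ext_seven <;> rfl

lemma contDiffAt_so43Form (h1 : ∀ i, ContDiffAt ℝ ∞ (θ i) w)
    (h2 : ∀ i, ContDiffAt ℝ ∞ (om i) w) (h3 : ∀ i j, ContDiffAt ℝ ∞ (α i j) w)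
    (h4 : ∀ i, ContDiffAt ℝ ∞ (β i) w) (hτ : ∀ i, ContDiffAt ℝ ∞ (τ i) w) (a b : Fin 7) :
    ContDiffAt ℝ ∞ (so43Form θ om α β τ a b) w := by
  have hneg : ∀ {a : OneForm n}, ContDiffAt ℝ ∞ a w → ContDiffAt ℝ ∞ (-a) w := fun h => h.neg
  have hsmul : ∀ {a : OneForm n} (c : ℝ), ContDiffAt ℝ ∞ a w → ContDiffAt ℝ ∞ (c • a) w :=
    fun c h => h.const_smul c
  have h0 : ContDiffAt ℝ ∞ (0 : OneForm n) w := contDiffAt_const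
  unfold so43Form
  fin_cases a <;> fin_cases b
  all_goals first
    | exact h0
    | exact h1 _
    | exact h2 _
    | exact h3 _ _
    | exact hτ _
    | exact hneg (h1 _)
    | exact hneg (h3 _ _)
    | exact hneg (h4 _)
    | exact hneg (hτ _)
    | exact hsmul _ (h2 _)
    | exact hsmul _ (h4 _)

lemma extD_so43Form (h1 : ∀ i, DifferentiableAt ℝ (θ i) w)
    (h2 : ∀ i, DifferentiableAt ℝ (om i) w) (h3 : ∀ i j, DifferentiableAt ℝ (α i j) w)
    (h4 : ∀ i, DifferentiableAt ℝ (β i) w) (h5 : ∀ i, DifferentiableAt ℝ (τ i) w) (v₁ v₂ : Euc n) :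
    of (fun a b => extD (so43Form θ om α β τ a b) w v₁ v₂) =
      so43 (fun i => extD (θ i) w v₁ v₂) (fun i => extD (om i) w v₁ v₂)
      (fun i j => extD (α i j) w v₁ v₂) (fun i => extD (β i) w v₁ v₂)
      (fun i => extD (τ i) w v₁ v₂) := by
  apply ext_seven <;>
  simp only [so43, so43Form, of_apply, cons_val, extD_zero, extD_neg (h1 _),
    extD_neg (h3 _ _), extD_neg (h4 _), extD_neg (h5 _), extD_smul (h2 _), extD_smul (h4 _)]

end Forms

lemma Lift.diffAt (hw : w ∈ L.W) {F : Type*} [NormedAddCommGroup F]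
    [NormedSpace ℝ F] {a : Euc n → F} (ha : ContDiffOn ℝ ∞ a L.W) : DifferentiableAt ℝ a w :=
  (ha.diffAt L.isOpen hw)

lemma Lift.contDiffAt_θ (hw : w ∈ L.W) (i : Fin 3) :
    ContDiffAt ℝ ∞ (L.θ i) w := (L.smooth_θ i).contDiffAt (L.isOpen.mem_nhds hw)

lemma Lift.contDiffAt_om (hw : w ∈ L.W) (i : Fin 3) :
    ContDiffAt ℝ ∞ (L.om i) w := (L.smooth_om i).contDiffAt (L.isOpen.mem_nhds hw)

lemma Lift.contDiffAt_α (hw : w ∈ L.W) (i j : Fin 3) :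
    ContDiffAt ℝ ∞ (L.α i j) w := (L.smooth_α i j).contDiffAt (L.isOpen.mem_nhds hw)

lemma Lift.contDiffAt_β (hw : w ∈ L.W) (i : Fin 3) :
    ContDiffAt ℝ ∞ (L.β i) w := (L.smooth_β i).contDiffAt (L.isOpen.mem_nhds hw)

lemma mat_γ (τ : Fin 3 → OneForm n) (w v : Euc n) :
    mat (L.γ τ) w v = so43 (fun i => L.θ i w v) (fun i => L.om i w v) (fun i j => L.α i j w v)
      (fun i => L.β i w v) (fun i => τ i w v) :=
  mat_so43Form (θ := L.θ) w v

lemma contDiffAt_γ (hw : w ∈ L.W)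
    (hτ : ∀ i, ContDiffAt ℝ ∞ (τ i) w) (a b : Fin 7) : ContDiffAt ℝ ∞ (L.γ τ a b) w :=
  contDiffAt_so43Form (L.contDiffAt_θ hw) (L.contDiffAt_om hw) (L.contDiffAt_α hw)
    (L.contDiffAt_β hw) hτ a b

lemma extD_γ (hw : w ∈ L.W) (hτ : ∀ i, ContDiffAt ℝ ∞ (τ i) w) (v₁ v₂ : Euc n) :
    of (fun a b => extD (L.γ τ a b) w v₁ v₂) =
      so43 (fun i => extD (L.θ i) w v₁ v₂) (fun i => extD (L.om i) w v₁ v₂)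
      (fun i j => extD (L.α i j) w v₁ v₂) (fun i => extD (L.β i) w v₁ v₂)
      (fun i => extD (τ i) w v₁ v₂) :=
  extD_so43Form (fun i => L.diffAt hw (L.smooth_θ i))
    (fun i => L.diffAt hw (L.smooth_om i))
    (fun i j => L.diffAt hw (L.smooth_α i j))
    (fun i => L.diffAt hw (L.smooth_β i))
    (fun i => (hτ i).diffAt) v₁ v₂

/-- The curvature forms `A` corrected by the terms with `τ`. -/
def Lift.At (τ : Fin 3 → OneForm n) (i j : Fin 3) (w v₁ v₂ : Euc n) : ℝ :=
  L.A i j w v₁ v₂ - delta i j * ∑ k, wedge (τ k) (L.θ k) w v₁ v₂ + wedge (τ i) (L.θ j) w v₁ v₂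

/-- The curvature forms `B` corrected by the terms with `τ`. -/
def Lift.Bt (τ : Fin 3 → OneForm n) (i : Fin 3) (w v₁ v₂ : Euc n) : ℝ :=
  L.B i w v₁ v₂ - ∑ j, ∑ k, eps i j k * wedge (τ j) (L.om k) w v₁ v₂

/-- The curvature forms that belong to `τ`. -/
def Lift.T (τ : Fin 3 → OneForm n) (i : Fin 3) (w v₁ v₂ : Euc n) : ℝ :=
  extD (τ i) w v₁ v₂ - ∑ k, wedge (L.α k k) (τ i) w v₁ v₂ + ∑ j, wedge (L.α i j) (τ j) w v₁ v₂
    + ∑ j, ∑ k, eps i j k * wedge (L.β j) (L.β k) w v₁ v₂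

lemma curv_γ (hw : w ∈ L.W) (hτ : ∀ i, ContDiffAt ℝ ∞ (τ i) w) (v₁ v₂ : Euc n) :
    curv (L.γ τ) w v₁ v₂ = so43 0 0 (fun i j => L.At τ i j w v₁ v₂)
      (fun i => L.Bt τ i w v₁ v₂) (fun i => L.T τ i w v₁ v₂) := by
  unfold curv
  rw [add_sub_assoc, mat_γ, mat_γ, so43_commutator, extD_γ L hw hτ, so43_add]
  congr 1
  · funext i
    simp only [Pi.add_apply, L.dθ_eq w hw, wedge, Pi.zero_apply]
    ring
  · funext i
    simp only [Pi.add_apply, L.dω_eq w hw, wedge, Pi.zero_apply]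
    ring
  · funext i j
    simp only [Pi.add_apply, Lift.At, Lift.A, wedge]
    ring
  · funext i
    simp only [Pi.add_apply, Lift.Bt, Lift.B, wedge]
    ring
  · funext i
    simp only [Pi.add_apply, Lift.T, wedge]
    ring

lemma two_le_infty : (2 : WithTop ℕ∞) ≤ ∞ := WithTop.coe_le_coe.2 le_top

lemma Lift.bianchi (hw : w ∈ L.W) (hτ : ∀ i, ContDiffOn ℝ ∞ (τ i) L.W) (v₀ v₁ v₂ : Euc n) :
    (∀ i, (∑ k, L.At τ k k w v₁ v₂) * L.θ i w v₀ - ∑ j, L.At τ j i w v₁ v₂ * L.θ j w v₀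
      + ((∑ k, L.At τ k k w v₂ v₀) * L.θ i w v₁ - ∑ j, L.At τ j i w v₂ v₀ * L.θ j w v₁)
      + ((∑ k, L.At τ k k w v₀ v₁) * L.θ i w v₂ - ∑ j, L.At τ j i w v₀ v₁ * L.θ j w v₂) = 0) ∧
    (∀ i, ∑ k, ∑ j, eps i k j * (L.Bt τ k w v₁ v₂ * L.θ j w v₀)
        + ∑ j, L.At τ i j w v₁ v₂ * L.om j w v₀
      + (∑ k, ∑ j, eps i k j * (L.Bt τ k w v₂ v₀ * L.θ j w v₁)
        + ∑ j, L.At τ i j w v₂ v₀ * L.om j w v₁)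
      + (∑ k, ∑ j, eps i k j * (L.Bt τ k w v₀ v₁ * L.θ j w v₂)
        + ∑ j, L.At τ i j w v₀ v₁ * L.om j w v₂) = 0) ∧ (∀ i j, d2 (L.At τ i j) w v₀ v₁ v₂ =
      ∑ k, (L.At τ i k w v₁ v₂ * L.α k j w v₀ - L.α i k w v₀ * L.At τ k j w v₁ v₂)
        - 2 * (L.om i w v₀ * L.Bt τ j w v₁ v₂)
        - delta i j * ∑ k, L.T τ k w v₁ v₂ * L.θ k w v₀ + L.T τ i w v₁ v₂ * L.θ j w v₀
      + (∑ k, (L.At τ i k w v₂ v₀ * L.α k j w v₁ - L.α i k w v₁ * L.At τ k j w v₂ v₀)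
        - 2 * (L.om i w v₁ * L.Bt τ j w v₂ v₀)
        - delta i j * ∑ k, L.T τ k w v₂ v₀ * L.θ k w v₁ + L.T τ i w v₂ v₀ * L.θ j w v₁)
      + (∑ k, (L.At τ i k w v₀ v₁ * L.α k j w v₂ - L.α i k w v₂ * L.At τ k j w v₀ v₁)
        - 2 * (L.om i w v₂ * L.Bt τ j w v₀ v₁)
        - delta i j * ∑ k, L.T τ k w v₀ v₁ * L.θ k w v₂ + L.T τ i w v₀ v₁ * L.θ j w v₂)) := by
  have hτ' : ∀ y ∈ L.W, ∀ i, ContDiffAt ℝ ∞ (τ i) y := fun y hy i =>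
    (hτ i).contDiffAt (L.isOpen.mem_nhds hy)
  have hb := Bryant.bianchi (γ := L.γ τ) (w := w)
    (fun a b => (contDiffAt_γ L hw (hτ' w hw) a b).of_le two_le_infty) v₀ v₁ v₂
  have hev : ∀ a b, d2 (fun y u v => curv (L.γ τ) y u v a b) w v₀ v₁ v₂ =
      d2 (fun y u v => so43 0 0 (fun i j => L.At τ i j y u v)
      (fun i => L.Bt τ i y u v) (fun i => L.T τ i y u v) a b) w v₀ v₁ v₂ := by
    intro a b
    apply d2_congr
    filter_upwards [L.isOpen.mem_nhds hw] with y hy u v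
    rw [curv_γ L hy (hτ' y hy)]
  rw [curv_γ L hw (hτ' w hw), curv_γ L hw (hτ' w hw), curv_γ L hw (hτ' w hw), mat_γ, mat_γ,
    mat_γ] at hb
  have hr : ∀ a b c a' b' c' : Mat7,
    a * a' + b * b' + c * c' - (a' * a + b' * b + c' * c) =
      (a * a' - a' * a) + (b * b' - b' * b) + (c * c' - c' * c) := by intros; abel
  rw [hr, so43_commutator, so43_commutator, so43_commutator, so43_add, so43_add] at hb
  have e : ∀ a b, d2 (fun y u v => so43 0 0 (fun i j => L.At τ i j y u v)
      (fun i => L.Bt τ i y u v) (fun i => L.T τ i y u v) a b) w v₀ v₁ v₂ = _ := fun a b =>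
    (hev a b).symm.trans (congrFun (congrFun hb a) b)
  have z : ∀ w v₀ v₁ v₂ : Euc n, d2 (fun _ _ _ => (0 : ℝ)) w v₀ v₁ v₂ = 0 := fun w v₀ v₁ v₂ =>
    d2_zero (Filter.Eventually.of_forall fun _ _ _ => rfl) v₀ v₁ v₂
  have z' : ∀ w v₀ v₁ v₂ : Euc n, d2 (fun _ _ _ => -(0 : ℝ)) w v₀ v₁ v₂ = 0 := fun w v₀ v₁ v₂ =>
    d2_zero (Filter.Eventually.of_forall fun _ _ _ => neg_zero) v₀ v₁ v₂
  refine ⟨fun i => ?_, fun i => ?_, fun i j => ?_⟩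
  · have h3 := e 5 2
    have h4 := e 6 0
    have h5 := e 4 1
    simp only [so43, of_apply, cons_val, Pi.zero_apply, z, Pi.add_apply, zero_mul, mul_zero, sub_zero,
      sum_const_zero, ← Finset.sum_mul] at h3 h4 h5
    fin_cases i
    · exact h3.symm
    · exact h4.symm
    · exact h5.symm
  · have h3 := e 3 0
    have h4 := e 3 1
    have h5 := e 3 2
    simp only [so43, of_apply, cons_val, Pi.zero_apply, z, Pi.add_apply, zero_mul, mul_zero, sub_zero] at h3 h4 h5
    fin_cases i
    · exact h3.symm
    · exact h4.symm
    · exact h5.symm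
  · have h3 := e (natAdd 4 i) (natAdd 4 j)
    have h4 : ∀ (A : Fin 3 → V3) θ om B T, so43 θ om A B T (natAdd 4 i) (natAdd 4 j) =
        A i j := by
      intro A θ om B T
      fin_cases i <;> fin_cases j <;> rfl
    simp only [h4] at h3
    refine h3.trans ?_
    simp only [Pi.add_apply, Pi.zero_apply, mul_zero, zero_mul, sub_zero, zero_sub, mul_neg]
    ring

/-! ### Solving the algebraic Bianchi identities -/

lemma normal_form_aux (c : Fin 3 → Fin 3 → Fin 3 → V3) (t : Fin 3 → V3)
    (hc : ∀ i j l m, c i j l m = -c i j m l)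
    (b1 : ∀ i, (∑ k, c k k 1 2) * delta i 0 - c 0 i 1 2 + ((∑ k, c k k 2 0) * delta i 1 - c 1 i 2 0)
      + ((∑ k, c k k 0 1) * delta i 2 - c 2 i 0 1) = 0)
    (ht : ∀ i l, t i l = 1 / 4 * ∑ k, c k k l i - 1 / 2 * ∑ j, c i j l j) (S3 : Fin 3 → Fin 3 → V3)
    (hS3 : ∀ i j k, S3 i j k = 1 / 4 * ∑ l, ∑ m, eps k l m * (c i j l m
      - delta i j * (t m l - t l m) + t i l * delta j m - t i m * delta j l)) :
    (∀ i j k, S3 i j k = S3 i k j) ∧ (∀ k, ∑ i, S3 i i k = 0) ∧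
    (∀ i j l m, c i j l m = delta i j * (t m l - t l m)
      - (t i l * delta j m - t i m * delta j l) + 2 * ∑ k, S3 i j k * eps k l m) := by
  have h0 : ∀ i j l, c i j l l = 0 := fun i j l => by have := hc i j l l; linarith
  have h10 : ∀ i j, c i j 1 0 = -c i j 0 1 := fun i j => hc _ _ _ _
  have h21 : ∀ i j, c i j 2 1 = -c i j 1 2 := fun i j => hc _ _ _ _
  have h20 : ∀ i j, c i j 2 0 = -c i j 0 2 := fun i j => hc _ _ _ _
  have b10 := b1 0
  have b11 := b1 1
  have b12 := b1 2
  simp only [sum_univ_three, delta_vals, h20] at b10 b11 b12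
  have v : ∀ i j, S3 i j 0 = 1 / 2 * (c i j 1 2 - delta i j * (t 2 1 - t 1 2) + t i 1 * delta j 2
        - t i 2 * delta j 1) ∧
      S3 i j 1 = 1 / 2 * (-c i j 0 2 - delta i j * (t 0 2 - t 2 0) + t i 2 * delta j 0
        - t i 0 * delta j 2) ∧
      S3 i j 2 = 1 / 2 * (c i j 0 1 - delta i j * (t 1 0 - t 0 1) + t i 0 * delta j 1
        - t i 1 * delta j 0) := by
    intro i j
    simp only [hS3, sum_univ_three, eps_vals, h0, h10, h20, h21]
    refine ⟨?_, ?_, ?_⟩ <;> ring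
  refine ⟨?_, ?_, ?_⟩
  · have e : ∀ i, S3 i 0 1 = S3 i 1 0 ∧ S3 i 0 2 = S3 i 2 0 ∧ S3 i 1 2 = S3 i 2 1 := by
      refine forall_fin3 ?_ ?_ ?_ <;>
      · simp only [v, ht, sum_univ_three, delta_vals, h0, h10, h20, h21]
        refine ⟨?_, ?_, ?_⟩ <;> linarith
    intro i
    obtain ⟨e1, e2, e3⟩ := e i
    exact forall_fin3 (forall_fin3 rfl e1 e2) (forall_fin3 e1.symm rfl e3)
      (forall_fin3 e2.symm e3.symm rfl)
  · refine forall_fin3 ?_ ?_ ?_ <;>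
    · simp only [v, ht, sum_univ_three, delta_vals, h0, h10, h20, h21]
      linarith
  · intro i j
    (repeat' refine forall_fin3 ?_ ?_ ?_) <;>
    · simp only [v, sum_univ_three, eps_vals, h0, h10, h20, h21]
      ring

lemma normal_form_aux' (S3 : Fin 3 → Fin 3 → V3) (t : Fin 3 → V3) (x : V3)
    (b : Fin 3 → V3) (hs : ∀ i j k, S3 i j k = S3 i k j) (htr : ∀ k, ∑ i, S3 i i k = 0)
    (h : ∀ a k l, ∑ j, eps a j l * b j k - ∑ j, eps a j k * b j l
      + ∑ j, (delta a j * (t l k - t k l) - (t a k * delta j l - t a l * delta j k)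
        + 2 * ∑ m, S3 a j m * eps m k l) * x j = 0) :
    ∀ i m, b i m = -∑ j, ∑ k, eps i j k * (t j m * x k) + 2 * ∑ k, S3 m i k * x k := by
  have s01 := fun i => hs i 1 0
  have s02 := fun i => hs i 2 0
  have s12 := fun i => hs i 2 1
  have t00 := h 0 0 1
  have t01 := h 0 0 2
  have t02 := h 0 1 2
  have t10 := h 1 0 1
  have t11 := h 1 0 2
  have t12 := h 1 1 2
  have t20 := h 2 0 1
  have t21 := h 2 0 2
  have t22 := h 2 1 2
  have r0 : S3 2 0 2 = -S3 0 0 0 - S3 1 0 1 := by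
    have := htr 0; simp only [sum_univ_three, s01, s02] at this; linarith
  have r1 : S3 2 1 2 = -S3 0 0 1 - S3 1 1 1 := by
    have := htr 1; simp only [sum_univ_three, s12] at this; linarith
  have r2 : S3 2 2 2 = -S3 0 0 2 - S3 1 1 2 := by
    have := htr 2; simp only [sum_univ_three] at this; linarith
  simp only [sum_univ_three, s01, s02, s12, eps_vals, delta_vals] at t00 t01 t02
  simp only [sum_univ_three, s01, s02, s12, eps_vals, delta_vals] at t10 t11 t12
  simp only [sum_univ_three, s01, s02, s12, eps_vals, delta_vals, r0, r1, r2] at t20 t21 t22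
  ring_nf at t00 t01 t02 t10 t11 t12 t20 t21 t22
  (repeat' refine forall_fin3 ?_ ?_ ?_) <;>
  · simp only [sum_univ_three, eps_vals, s01, s02, s12, r0, r1, r2]
    ring_nf
    linarith

lemma alternating_expand {V : Type*} [AddCommGroup V] [Module ℝ V] {F : V →ₗ[ℝ] V →ₗ[ℝ] ℝ}
    (hF : ∀ u v, F u v = -F v u) (u₁ u₂ x y z : V) (a b c a' b' c' : ℝ) :
    F (u₁ + (a • x + b • y + c • z)) (u₂ + (a' • x + b' • y + c' • z)) =
      F u₁ u₂ + (a' * F u₁ x + b' * F u₁ y + c' * F u₁ z) - (a * F u₂ x + b * F u₂ y + c * F u₂ z)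
      + (a * (a' * F x x + b' * F x y + c' * F x z) + b * (a' * F y x + b' * F y y + c' * F y z)
        + c * (a' * F z x + b' * F z y + c' * F z z)) := by
  simp only [map_add, map_smul, LinearMap.add_apply, LinearMap.smul_apply, smul_eq_mul,
    hF x u₂, hF y u₂, hF z u₂]
  ring

set_option maxHeartbeats 1000000 in
lemma normal_form {V : Type*} [AddCommGroup V] [Module ℝ V] (θ om τ : Fin 3 → V →ₗ[ℝ] ℝ)
    (E X : Fin 3 → V) (hθE : ∀ i j, θ i (E j) = delta i j) (hθX : ∀ i j, θ i (X j) = 0)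
    (homE : ∀ i j, om i (E j) = 0) (homX : ∀ i j, om i (X j) = delta i j)
    (A : Fin 3 → Fin 3 → V →ₗ[ℝ] V →ₗ[ℝ] ℝ) (B : Fin 3 → V →ₗ[ℝ] V →ₗ[ℝ] ℝ)
    (hA : ∀ i j u v, A i j u v = -A i j v u) (hB : ∀ i u v, B i u v = -B i v u)
    (b1 : ∀ v₀ v₁ v₂ i, (∑ k, A k k v₁ v₂) * θ i v₀ - ∑ j, A j i v₁ v₂ * θ j v₀
      + ((∑ k, A k k v₂ v₀) * θ i v₁ - ∑ j, A j i v₂ v₀ * θ j v₁)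
      + ((∑ k, A k k v₀ v₁) * θ i v₂ - ∑ j, A j i v₀ v₁ * θ j v₂) = 0)
    (b2 : ∀ v₀ v₁ v₂ i, ∑ k, ∑ j, eps i k j * (B k v₁ v₂ * θ j v₀) + ∑ j, A i j v₁ v₂ * om j v₀
      + (∑ k, ∑ j, eps i k j * (B k v₂ v₀ * θ j v₁) + ∑ j, A i j v₂ v₀ * om j v₁)
      + (∑ k, ∑ j, eps i k j * (B k v₀ v₁ * θ j v₂) + ∑ j, A i j v₀ v₁ * om j v₂) = 0)
    (hτ : ∀ i v, τ i v = 1 / 2 * ∑ k, A k k v (E i)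
      + ∑ l, θ l v * (-(1 / 2) * ∑ j, A i j (E l) (E j) - 1 / 4 * ∑ k, A k k (E l) (E i)))
    (S4 : Fin 3 → Fin 3 → Fin 3 → V3) (S3 : Fin 3 → Fin 3 → V3) (S2 : Fin 3 → V3)
    (hS4 : ∀ i m j l, S4 i m j l = -A i j (X l) (E m) + delta i j * τ m (X l)
      - delta m j * τ i (X l))
    (hS3 : ∀ i j k, S3 i j k = 1 / 4 * ∑ l, ∑ m, eps k l m * (A i j (E l) (E m)
      - delta i j * (τ m (E l) - τ l (E m)) + τ i (E l) * delta j m - τ i (E m) * delta j l))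
    (hS2 : ∀ i j, S2 i j = 1 / 4 * ∑ k, ∑ l, eps j k l * B i (E k) (E l)) :
    (∀ v₁ v₂ i j, A i j v₁ v₂ = delta i j * ∑ k, (τ k v₁ * θ k v₂ - τ k v₂ * θ k v₁)
      - (τ i v₁ * θ j v₂ - τ i v₂ * θ j v₁)
      + ∑ k, ∑ l, ∑ m, S3 i j k * eps k l m * (θ l v₁ * θ m v₂ - θ l v₂ * θ m v₁)
      + ∑ k, ∑ l, S4 i k j l * (θ k v₁ * om l v₂ - θ k v₂ * om l v₁)) ∧
    (∀ i j k, S3 i j k = S3 i k j) ∧ (∀ k, ∑ i, S3 i i k = 0) ∧ (∀ k j, ∑ i, S4 i k i j = 0) ∧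
    (∀ v₁ v₂ i, B i v₁ v₂ = ∑ j, ∑ k, eps i j k * (τ j v₁ * om k v₂ - τ j v₂ * om k v₁)
      - 2 * ∑ j, ∑ k, S3 j i k * (θ j v₁ * om k v₂ - θ j v₂ * om k v₁)
      + ∑ j, ∑ k, ∑ l, eps j k l * S2 i j * (θ k v₁ * θ l v₂ - θ k v₂ * θ l v₁)) := by
  -- values on the annihilator of the `θ`
  have c1 : ∀ u v, (∀ i, θ i u = 0) → (∀ i, θ i v = 0) → ∀ i j, A i j u v = 0 := by
    intro u v hu hv
    have h : ∀ m i, (∑ k, A k k u v) * delta i m - A m i u v = 0 := by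
      intro m i
      have := b1 (E m) u v i
      simp only [hu, hv, hθE, mul_zero, sum_const_zero, sub_zero, add_zero] at this
      rw [← this]
      congr 1
      fin_cases m <;> simp [sum_univ_three]
    have ht : ∑ k, A k k u v = 0 := by
      have h0 := h 0 0
      have h1 := h 1 1
      have h2 := h 2 2
      simp only [sum_univ_three, delta_same] at *
      linarith
    intro i j
    have := h i j
    rw [ht] at this
    linarith
  have hτu : ∀ u, (∀ i, θ i u = 0) → ∀ i, τ i u = 1 / 2 * ∑ k, A k k u (E i) := by
    intro u hu i
    rw [hτ]; simp [hu]
  have anti : ∀ u, (∀ i, θ i u = 0) → ∀ i k l, A l i u (E k) - A k i u (E l) =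
      delta l i * (2 * τ k u) - delta k i * (2 * τ l u) := by
    intro u hu i k l
    have := b1 u (E k) (E l) i
    simp only [hu, hθE, mul_zero, sum_const_zero, sub_zero] at this
    rw [hτu u hu, hτu u hu]
    have e1 : ∑ j, A j i (E l) u * delta j k = A k i (E l) u := by
      fin_cases k <;> simp [sum_univ_three]
    have e2 : ∑ j, A j i u (E k) * delta j l = A l i u (E k) := by
      fin_cases l <;> simp [sum_univ_three]
    have e3 : ∑ k, A k k (E l) u = -∑ k, A k k u (E l) := by
      rw [← sum_neg_distrib]; exact sum_congr rfl fun j _ => hA _ _ _ _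
    have d1 : delta i l = delta l i := by simp [delta, eq_comm]
    have d2 : delta i k = delta k i := by simp [delta, eq_comm]
    rw [e1, e2, e3, hA k i (E l) u, d1, d2] at this
    linarith
  -- the symmetric part of `-A i j u (E m)`
  set P : V → Fin 3 → Fin 3 → V3 := fun u i m j => -A i j u (E m) + delta i j * τ m u
    - delta m j * τ i u with hP
  have Psymm : ∀ u, (∀ i, θ i u = 0) → ∀ i m j, P u i m j = P u m i j := by
    intro u hu i m j
    have := anti u hu j m i
    simp only [hP]
    linarith
  have key : ∀ u v, (∀ i, θ i u = 0) → (∀ i, θ i v = 0) → ∀ i m,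
      ∑ k, eps i k m * B k u v + ∑ j, A i j v (E m) * om j u - ∑ j, A i j u (E m) * om j v = 0 := by
    intro u v hu hv i m
    have := b2 u v (E m) i
    simp only [hu, hv, hθE, homE, mul_zero, sum_const_zero, zero_add, add_zero] at this
    rw [← this]
    have e1 : ∀ k, ∑ j, eps i k j * (B k u v * delta j m) = eps i k m * B k u v := by
      intro k
      fin_cases m <;> simp [sum_univ_three]
    simp only [e1]
    have e2 : ∑ j, A i j (E m) u * om j v = -∑ j, A i j u (E m) * om j v := by
      rw [← sum_neg_distrib]
      exact sum_congr rfl fun j _ => by rw [hA, neg_mul]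
    rw [e2]; ring
  have Pcomm : ∀ u v, (∀ i, θ i u = 0) → (∀ i, θ i v = 0) → ∀ i m,
      ∑ j, P v i m j * om j u = ∑ j, P u i m j * om j v := by
    intro u v hu hv i m
    have k1 := key u v hu hv i m
    have k2 := key u v hu hv m i
    have s : ∀ k, eps m k i = -eps i k m := by intro k; simp only [eps]; ring
    have e := fun u j => (hP ▸ rfl : P u i m j = -A i j u (E m) + delta i j * τ m u
      - delta m j * τ i u)
    have e' := fun u j => (hP ▸ rfl : P u m i j = -A m j u (E i) + delta m j * τ i u
      - delta i j * τ m u)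
    have q : ∀ u, (∀ i, θ i u = 0) → ∀ j, 2 * P u i m j = -A i j u (E m) - A m j u (E i) := by
      intro u hu j
      have := Psymm u hu i m j
      rw [e'] at this
      have := e u j
      linarith
    simp only [s, neg_mul, sum_neg_distrib] at k2
    have q1 : ∑ j, 2 * P v i m j * om j u = ∑ j, 2 * P u i m j * om j v := by
      simp only [q v hv, q u hu, sub_mul, neg_mul, sum_sub_distrib, sum_neg_distrib]
      linarith
    simp only [mul_assoc, ← Finset.mul_sum] at q1
    linarith
  have hS4' : ∀ i m j l, S4 i m j l = P (X l) i m j := by intro i m j l; rw [hS4]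
  have c2 : ∀ u, (∀ i, θ i u = 0) → ∀ i j m, A i j u (E m) =
      delta i j * τ m u - delta m j * τ i u - ∑ l, S4 i m j l * om l u := by
    intro u hu i j m
    have e1 : ∑ l, S4 i m j l * om l u = P u i m j := by
      have := Pcomm u (X j) hu (fun i => hθX i j) i m
      have h2 : ∀ l, P (X l) i m j = P (X j) i m l := by
        intro l
        have := Pcomm (X l) (X j) (fun i => hθX i l) (fun i => hθX i j) i m
        simp only [homX] at this
        have f1 : ∀ (f : V3) l, ∑ j, f j * delta j l = f l := by
          intro f l
          fin_cases l <;> simp [sum_univ_three]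
        rw [f1, f1] at this
        exact this.symm
      simp only [hS4', h2]
      rw [this]
      simp only [homX]
      fin_cases j <;> simp [sum_univ_three]
    rw [e1]; simp only [hP]; ring
  have tr : ∀ k j, ∑ i, S4 i k i j = 0 := by
    intro k j
    have := hτu (X j) (fun i => hθX i j) k
    simp only [hS4, delta_same, one_mul]
    fin_cases k <;> simp [sum_univ_three] at this ⊢ <;> linarith
  obtain ⟨symm3, tr3, c3⟩ := normal_form_aux (fun i j l m => A i j (E l) (E m))
    (fun i l => τ i (E l)) (fun i j l m => hA _ _ _ _) (by
      intro i
      have := b1 (E 0) (E 1) (E 2) i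
      simp only [hθE] at this
      rw [← this]
      simp only [sum_univ_three, delta_vals]
      ring) (by
      intro i l
      rw [hτ]
      have f1 : ∀ (f : V3), ∑ j, delta j l * f j = f l := by
        intro f
        fin_cases l <;> simp [sum_univ_three]
      simp only [hθE]
      rw [f1]; ring) S3 hS3
  have d1 : ∀ u v, (∀ i, θ i u = 0) → (∀ i, θ i v = 0) → ∀ i,
      B i u v = ∑ j, ∑ k, eps i j k * (τ j u * om k v - τ j v * om k u) := by
    intro u v hu hv i
    have k1 : ∀ a b, ∑ k, eps a k b * B k u v = τ b u * om a v - τ a u * om b v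
        - (τ b v * om a u - τ a v * om b u) := by
      intro a b
      have h1 := key u v hu hv a b
      simp only [c2 u hu, c2 v hv] at h1
      have h2 : ∑ j, (∑ l, S4 a b j l * om l v) * om j u = ∑ j, (∑ l, S4 a b j l * om l u) * om j v := by
        have := Pcomm u v hu hv a b
        have f : ∀ u, (∀ i, θ i u = 0) → ∀ j, ∑ l, S4 a b j l * om l u = P u a b j := by
          intro u hu j
          have := c2 u hu a j b
          simp only [hP]
          linarith
        simp only [f u hu, f v hv]
        exact this
      have f1 : ∀ (c : ℝ) (f : V3) l, ∑ j, delta l j * c * f j = c * f l := by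
        intro c f l
        fin_cases l <;> simp [sum_univ_three]
      simp only [sub_mul, sum_sub_distrib, f1] at h1
      linarith
    have h01 := k1 0 1
    have h12 := k1 1 2
    have h20 := k1 2 0
    simp [sum_univ_three] at h01 h12 h20
    fin_cases i <;> simp [sum_univ_three] <;> linarith
  have d2 : ∀ u, (∀ i, θ i u = 0) → ∀ i m, B i u (E m) =
      -∑ j, ∑ k, eps i j k * (τ j (E m) * om k u) + 2 * ∑ k, S3 m i k * om k u := by
    intro u hu
    have k1 : ∀ a k l, ∑ j, eps a j l * B j u (E k) - ∑ j, eps a j k * B j u (E l)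
        + ∑ j, A a j (E k) (E l) * om j u = 0 := by
      intro a k l
      have := b2 u (E k) (E l) a
      simp only [hu, hθE, homE, mul_zero, sum_const_zero, zero_add, add_zero] at this
      rw [← this]
      have e1 : ∀ (c : ℝ) j m, ∑ i, eps a j i * (c * delta i m) = eps a j m * c := by
        intro c j m
        fin_cases m <;> simp [sum_univ_three]
      simp only [e1, fun j => hB j (E l) u, mul_neg, sum_neg_distrib]
      ring
    exact normal_form_aux' S3 (fun i l => τ i (E l)) (fun j => om j u) (fun j k => B j u (E k))
      symm3 tr3 (fun a k l => by
        rw [← k1 a k l]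
        simp only [c3])
  have d3 : ∀ i k l, B i (E k) (E l) = 2 * ∑ j, eps j k l * S2 i j := by
    intro i
    have h0 : ∀ l, B i (E l) (E l) = 0 := fun l => by have := hB i (E l) (E l); linarith
    have h10 := hB i (E 1) (E 0)
    have h21 := hB i (E 2) (E 1)
    have h20 := hB i (E 2) (E 0)
    (repeat' refine forall_fin3 ?_ ?_ ?_) <;>
    · simp only [hS2, sum_univ_three, eps_vals, h0, h10, h20, h21]
      ring
  have dec : ∀ v, ∃ u, (∀ i, θ i u = 0) ∧ v = u + (θ 0 v • E 0 + θ 1 v • E 1 + θ 2 v • E 2) ∧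
      (∀ l, om l v = om l u) ∧
      ∀ l, τ l v = τ l u + (θ 0 v * τ l (E 0) + θ 1 v * τ l (E 1) + θ 2 v * τ l (E 2)) := by
    refine fun v => ⟨v - (θ 0 v • E 0 + θ 1 v • E 1 + θ 2 v • E 2), ?_, by abel, ?_, ?_⟩
    · refine forall_fin3 ?_ ?_ ?_ <;> simp [hθE]
    · simp [homE]
    · simp
  refine ⟨fun v₁ v₂ i j => ?_, symm3, tr3, tr, fun v₁ v₂ i => ?_⟩
  all_goals
    obtain ⟨u₁, h₁, e₁, o₁, s₁⟩ := dec v₁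
    obtain ⟨u₂, h₂, e₂, o₂, s₂⟩ := dec v₂
  · refine (congrArg₂ (A i j · ·) e₁ e₂).trans ((alternating_expand (hA i j) ..).trans ?_)
    rw [c1 u₁ u₂ h₁ h₂]
    simp only [c2 u₁ h₁, c2 u₂ h₂, c3, s₁, s₂, o₁, o₂, sum_univ_three, eps_vals]
    revert i j
    (repeat' refine forall_fin3 ?_ ?_ ?_) <;>
    · simp only [delta_vals]
      ring
  · refine (congrArg₂ (B i · ·) e₁ e₂).trans ((alternating_expand (hB i) ..).trans ?_)
    rw [d1 u₁ u₂ h₁ h₂]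
    simp only [d2 u₁ h₁, d2 u₂ h₂, d3, s₁, s₂, o₁, o₂, sum_univ_three, eps_vals]
    ring

/-! ### Dual frames -/

section DualFrame

variable {ι : Type*} [Fintype ι] [DecidableEq ι]

lemma contDiffAt_det {F : Type*} [NormedAddCommGroup F] [NormedSpace ℝ F] {k : WithTop ℕ∞}
    {A : F → Matrix ι ι ℝ} {x : F} (hA : ∀ i j, ContDiffAt ℝ k (fun y => A y i j) x) :
    ContDiffAt ℝ k (fun y => (A y).det) x := by
  simp only [Matrix.det_apply']
  exact ContDiffAt.sum fun σ _ => contDiffAt_const.mul (contDiffAt_prod fun i _ => hA _ _)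

lemma contDiffAt_matrix_inv {F : Type*} [NormedAddCommGroup F] [NormedSpace ℝ F]
    {k : WithTop ℕ∞} {A : F → Matrix ι ι ℝ} {x : F}
    (hA : ∀ i j, ContDiffAt ℝ k (fun y => A y i j) x) (hx : (A x).det ≠ 0) (i j : ι) :
    ContDiffAt ℝ k (fun y => (A y)⁻¹ i j) x := by
  simp only [Matrix.inv_def, Matrix.smul_apply, Ring.inverse_eq_inv', smul_eq_mul,
    Matrix.adjugate_apply]
  refine ((contDiffAt_det hA).inv hx).mul (contDiffAt_det fun a b => ?_)
  by_cases h : a = j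
  · subst h
    simp only [Matrix.updateRow_self]
    exact contDiffAt_const
  · simp only [Matrix.updateRow_ne h]
    exact hA _ _

lemma exists_dual_vectors {n : ℕ} {W : Set (Euc n)} (hW : IsOpen W) (c : ι → OneForm n)
    (hc : ∀ k, ContDiffOn ℝ ∞ (c k) W) (hs : ∀ w ∈ W, ∀ x : ι → ℝ, ∃ v, ∀ k, c k w v = x k) :
    ∃ e : ι → Euc n → Euc n, (∀ k, ContDiffOn ℝ ∞ (e k) W) ∧
      ∀ w ∈ W, ∀ k l, c k w (e l w) = if k = l then 1 else 0 := by
  set b : Fin n → Euc n := fun i => EuclideanSpace.single i 1 with hb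
  set G : Euc n → Matrix ι ι ℝ := fun w => of fun k l => ∑ i, c k w (b i) * c l w (b i)
    with hG
  have hdet : ∀ w ∈ W, (G w).det ≠ 0 := by
    intro w hw h0
    obtain ⟨x, hx, hGx⟩ := Matrix.exists_mulVec_eq_zero_iff.2 h0
    have h1 : ∑ i, (∑ k, x k * c k w (b i)) ^ 2 = 0 := by
      have : x ⬝ᵥ (G w).mulVec x = 0 := by rw [hGx]; simp
      rw [← this]
      simp only [dotProduct, mulVec, hG, of_apply, sq, Finset.mul_sum, Finset.sum_mul]
      rw [sum_comm]
      refine sum_congr rfl fun k _ => ?_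
      rw [sum_comm]
      refine sum_congr rfl fun l _ => sum_congr rfl fun i _ => by ring
    have h2 : ∀ i, ∑ k, x k * c k w (b i) = 0 := by
      intro i
      have := (Finset.sum_eq_zero_iff_of_nonneg (fun i _ => sq_nonneg _)).1 h1 i (Finset.mem_univ i)
      exact pow_eq_zero_iff (two_ne_zero) |>.1 this
    obtain ⟨v, hv⟩ := hs w hw x
    have h3 : v = ∑ i, v i • b i := by ext j; simp [hb, Pi.single_apply]
    have h4 : ∑ k, x k * x k = 0 := by
      have : ∀ k, x k = ∑ i, v i * c k w (b i) := by
        intro k; rw [← hv k]; conv_lhs => rw [h3]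
        simp
      have e : ∀ k, x k * x k = ∑ i, v i * (x k * c k w (b i)) := by
        intro k; conv_lhs => rw [this k, ← this k]
        conv_lhs => rhs; rw [this k]
        rw [Finset.mul_sum]
        exact sum_congr rfl fun i _ => by ring
      simp only [e]
      rw [sum_comm]
      simp only [← Finset.mul_sum, h2, mul_zero, sum_const_zero]
    apply hx
    funext k
    have := (Finset.sum_eq_zero_iff_of_nonneg (fun i _ => mul_self_nonneg _)).1 h4 k
      (Finset.mem_univ k)
    simpa using this
  refine ⟨fun l w => ∑ k, (G w)⁻¹ k l • ∑ i, c k w (b i) • b i, fun l => ?_, fun w hw k l => ?_⟩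
  · intro w hw
    have hcw : ∀ k i, ContDiffAt ℝ ∞ (fun y => c k y (b i)) w := fun k i =>
      ((hc k).contDiffAt (hW.mem_nhds hw)).clm_apply contDiffAt_const
    refine ContDiffAt.contDiffWithinAt (ContDiffAt.sum fun k _ => ?_)
    refine (contDiffAt_matrix_inv (fun a b => ?_) (hdet w hw) k l).smul
      (ContDiffAt.sum fun i _ => (hcw k i).smul contDiffAt_const)
    simp only [hG, of_apply]
    exact ContDiffAt.sum fun i _ => (hcw _ i).mul (hcw _ i)
  · have h1 : G w * (G w)⁻¹ = 1 := mul_nonsing_inv _ (isUnit_iff_ne_zero.2 (hdet w hw))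
    have h2 := congrFun (congrFun h1 k) l
    rw [Matrix.one_apply] at h2
    rw [← h2, Matrix.mul_apply]
    simp only [map_sum, map_smul, smul_eq_mul, hG, of_apply]
    refine sum_congr rfl fun m _ => ?_
    rw [mul_comm]
    congr 1
    exact sum_congr rfl fun i _ => by ring

lemma Lift.coframe_surjective (hw : w ∈ L.W)
    (x y : V3) : ∃ v, (∀ i, L.θ i w v = x i) ∧ ∀ i, L.om i w v = y i := by
  let d : Euc n →ₗ[ℝ] Euc 6 := (mfderiv (𝓡 n) (𝓡 6) L.f w).toLinearMap
  let c : Euc n →ₗ[ℝ] V3 × V3 :=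
    (LinearMap.pi fun i => (L.θ i w).toLinearMap).prod (LinearMap.pi fun i => (L.om i w).toLinearMap)
  have hker : LinearMap.ker c = LinearMap.ker d := by
    ext v
    rw [LinearMap.mem_ker, LinearMap.mem_ker]
    refine Iff.trans ?_ (L.coframe w hw v)
    constructor
    · intro h
      exact ⟨fun i => congrFun (congrArg Prod.fst h) i, fun i => congrFun (congrArg Prod.snd h) i⟩
    · intro h
      exact Prod.ext (funext h.1) (funext h.2)
  have hd : LinearMap.range d = ⊤ := LinearMap.range_eq_top.2 (L.submersion w hw)
  have h1 := LinearMap.finrank_range_add_finrank_ker c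
  have h2 := LinearMap.finrank_range_add_finrank_ker d
  rw [hd, finrank_top] at h2
  rw [hker] at h1
  have h3 : finrank ℝ (LinearMap.range c) =
      finrank ℝ (V3 × V3) := by
    have e1 : finrank ℝ (Euc 6) = 6 := by simp
    have e2 : finrank ℝ (V3 × V3) = 6 := by simp
    rw [e1] at h2
    rw [e2]
    omega
  have h4 : LinearMap.range c = ⊤ := Submodule.eq_top_of_finrank_eq h3
  obtain ⟨v, hv⟩ := LinearMap.range_eq_top.1 h4 (x, y)
  exact ⟨v, fun i => congrFun (congrArg Prod.fst hv) i, fun i => congrFun (congrArg Prod.snd hv) i⟩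

lemma Lift.exists_dual_frame : ∃ E X : Fin 3 → Euc n → Euc n,
    (∀ i, ContDiffOn ℝ ∞ (E i) L.W) ∧ (∀ i, ContDiffOn ℝ ∞ (X i) L.W) ∧
    ∀ w ∈ L.W, (∀ i j, L.θ i w (E j w) = delta i j) ∧ (∀ i j, L.θ i w (X j w) = 0) ∧
      (∀ i j, L.om i w (E j w) = 0) ∧ ∀ i j, L.om i w (X j w) = delta i j := by
  obtain ⟨e, he, hd⟩ := exists_dual_vectors L.isOpen (Sum.elim L.θ L.om)
    (by rintro (k | k); exacts [L.smooth_θ k, L.smooth_om k])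
    (fun w hw x => by
      obtain ⟨v, h1, h2⟩ := L.coframe_surjective hw (fun i => x (Sum.inl i)) (fun i => x (Sum.inr i))
      exact ⟨v, by rintro (k | k); exacts [h1 k, h2 k]⟩)
  refine ⟨fun i => e (Sum.inl i), fun i => e (Sum.inr i), fun i => he _, fun i => he _,
    fun w hw => ⟨fun i j => ?_, fun i j => ?_, fun i j => ?_, fun i j => ?_⟩⟩
  · simpa [delta] using hd w hw (Sum.inl i) (Sum.inl j)
  · simpa using hd w hw (Sum.inl i) (Sum.inr j)
  · simpa using hd w hw (Sum.inr i) (Sum.inl j)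
  · simpa [delta] using hd w hw (Sum.inr i) (Sum.inr j)

end DualFrame

/-! ### Smooth 2-forms -/

/-- `F` is a smooth `2`-form near `w`. -/
def IsSmoothTwoForm (F : TwoForm n) (w : Euc n) : Prop :=
  (∀ᶠ y in nhds w, (∃ G : Euc n →ₗ[ℝ] Euc n →ₗ[ℝ] ℝ, ∀ u v, F y u v = G u v) ∧
    ∀ u v, F y u v = -F y v u) ∧
  ∀ u v, ContDiffAt ℝ ∞ (fun y => F y u v) w

lemma isSmoothTwoForm_extD {a : OneForm n} (ha : ContDiffAt ℝ ∞ a w) :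
    IsSmoothTwoForm (extD a) w := by
  have h := ha.fderiv_right (m := ∞) (by simp)
  have he := eventually_extD_eq (ha.of_le two_le_infty)
  refine ⟨?_, fun u v => ?_⟩
  · filter_upwards [he, (ha.of_le two_le_infty).eventually (by simp)] with y hy hy'
    refine ⟨⟨LinearMap.mk₂ ℝ (fun u v => fderiv ℝ a y u v - fderiv ℝ a y v u) ?_ ?_ ?_ ?_,
      fun u v => hy u v⟩, fun u v => extD_swap (hy'.diffAt) _ _⟩ <;>
    · intros
      simp only [map_add, map_smul, add_apply, smul_apply, smul_eq_mul]
      ring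
  · refine ContDiffAt.congr_of_eventuallyEq ?_ (he.mono fun y hy => hy u v)
    exact ((h.clm_apply contDiffAt_const).clm_apply contDiffAt_const).sub
      ((h.clm_apply contDiffAt_const).clm_apply contDiffAt_const)

lemma isSmoothTwoForm_wedge {a b : OneForm n} (ha : ContDiffAt ℝ ∞ a w)
    (hb : ContDiffAt ℝ ∞ b w) : IsSmoothTwoForm (wedge a b) w := by
  refine ⟨Filter.Eventually.of_forall fun y => ⟨⟨LinearMap.mk₂ ℝ (fun u v => wedge a b y u v)
    ?_ ?_ ?_ ?_, fun u v => rfl⟩, fun u v => by simp [wedge]⟩, fun u v => ?_⟩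
  any_goals
    intros
    simp only [wedge, map_add, map_smul, smul_eq_mul]
    try ring1
  exact ((ha.clm_apply contDiffAt_const).mul (hb.clm_apply contDiffAt_const)).sub
    ((ha.clm_apply contDiffAt_const).mul (hb.clm_apply contDiffAt_const))

lemma IsSmoothTwoForm.add {F G : TwoForm n}
    (hF : IsSmoothTwoForm F w) (hG : IsSmoothTwoForm G w) :
    IsSmoothTwoForm (fun y u v => F y u v + G y u v) w := by
  refine ⟨?_, fun u v => (hF.2 u v).add (hG.2 u v)⟩
  filter_upwards [hF.1, hG.1] with y ⟨⟨F', h1⟩, h2⟩ ⟨⟨G', h3⟩, h4⟩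
  exact ⟨⟨F' + G', fun u v => by simp [h1, h3]⟩, fun u v => by rw [h2, h4]; ring⟩

lemma IsSmoothTwoForm.mul {F : TwoForm n}
    (hF : IsSmoothTwoForm F w) {f : Euc n → ℝ} (hf : ContDiffAt ℝ ∞ f w) :
    IsSmoothTwoForm (fun y u v => f y * F y u v) w := by
  refine ⟨?_, fun u v => hf.mul (hF.2 u v)⟩
  filter_upwards [hF.1] with y ⟨⟨F', h1⟩, h2⟩
  exact ⟨⟨f y • F', fun u v => by simp [h1]⟩, fun u v => by rw [h2]; ring⟩

lemma IsSmoothTwoForm.const_mul {F : TwoForm n}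
    (hF : IsSmoothTwoForm F w) (c : ℝ) : IsSmoothTwoForm (fun y u v => c * F y u v) w :=
  hF.mul contDiffAt_const

lemma IsSmoothTwoForm.neg {F : TwoForm n}
    (hF : IsSmoothTwoForm F w) : IsSmoothTwoForm (fun y u v => -F y u v) w := by
  simpa using hF.const_mul (-1)

lemma IsSmoothTwoForm.sub {F G : TwoForm n}
    (hF : IsSmoothTwoForm F w) (hG : IsSmoothTwoForm G w) :
    IsSmoothTwoForm (fun y u v => F y u v - G y u v) w := by
  simpa [sub_eq_add_neg] using hF.add hG.neg

lemma IsSmoothTwoForm.sum {ι : Type*} {s : Finset ι} {F : ι → TwoForm n} (hF : ∀ i ∈ s, IsSmoothTwoForm (F i) w) :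
    IsSmoothTwoForm (fun y u v => ∑ i ∈ s, F i y u v) w := by
  classical
  induction s using Finset.induction_on with
  | empty =>
    exact ⟨Filter.Eventually.of_forall fun y => ⟨⟨0, by simp⟩, by simp⟩,
      fun u v => by simpa using contDiffAt_const⟩
  | insert a s ha ih =>
    simp only [Finset.sum_insert ha]
    exact (hF a (Finset.mem_insert_self _ _)).add
      (ih fun i hi => hF i (Finset.mem_insert_of_mem hi))

lemma euc_eq_sum (v : Euc n) : v = ∑ i, v i • EuclideanSpace.single i (1 : ℝ) := by
  ext j; simp [Pi.single_apply]

lemma IsSmoothTwoForm.contDiffAt_apply {F : TwoForm n}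
    (hF : IsSmoothTwoForm F w) {X Y : Euc n → Euc n} (hX : ContDiffAt ℝ ∞ X w)
    (hY : ContDiffAt ℝ ∞ Y w) : ContDiffAt ℝ ∞ (fun y => F y (X y) (Y y)) w := by
  have h : ∀ᶠ y in nhds w, F y (X y) (Y y) = ∑ i, ∑ j, X y i * (Y y j *
      F y (EuclideanSpace.single i (1 : ℝ)) (EuclideanSpace.single j (1 : ℝ))) := by
    filter_upwards [hF.1] with y ⟨⟨G, hG⟩, h2⟩
    rw [hG]
    conv_lhs => rw [euc_eq_sum (X y), euc_eq_sum (Y y)]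
    simp only [map_sum, map_smul, LinearMap.sum_apply, LinearMap.smul_apply, smul_eq_mul, hG,
      Finset.mul_sum]
    rw [sum_comm]
    exact sum_congr rfl fun i _ => sum_congr rfl fun j _ => by ring
  refine ContDiffAt.congr_of_eventuallyEq ?_ h
  refine ContDiffAt.sum fun i _ => ContDiffAt.sum fun j _ => ContDiffAt.mul ?_ (ContDiffAt.mul ?_ ?_)
  · exact (EuclideanSpace.proj i : Euc n →L[ℝ] ℝ).contDiff.contDiffAt.comp w hX
  · exact (EuclideanSpace.proj j : Euc n →L[ℝ] ℝ).contDiff.contDiffAt.comp w hY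
  · exact hF.2 _ _

lemma IsSmoothTwoForm.differentiableAt {F : TwoForm n}
    (hF : IsSmoothTwoForm F w) (u v : Euc n) : DifferentiableAt ℝ (fun y => F y u v) w :=
  (hF.2 u v).diffAt

lemma IsSmoothTwoForm.swap {F : TwoForm n}
    (hF : IsSmoothTwoForm F w) (u v : Euc n) : F w u v = -F w v u :=
  hF.1.self_of_nhds.2 u v

lemma contDiffAt_oneForm {a : OneForm n}
    (ha : ∀ v, ContDiffAt ℝ ∞ (fun y => a y v) w) : ContDiffAt ℝ ∞ a w := by
  have h : a = fun y => ∑ i, a y (EuclideanSpace.single i (1 : ℝ)) •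
      (EuclideanSpace.proj i : Euc n →L[ℝ] ℝ) := by
    funext y; ext v
    conv_lhs => rw [euc_eq_sum v]
    simp [mul_comm]
  rw [h]
  exact ContDiffAt.sum fun i _ => (ha _).smul contDiffAt_const

lemma IsSmoothTwoForm.exists_insert {F : TwoForm n} {W : Set (Euc n)}
    (hW : IsOpen W) (hF : ∀ w ∈ W, IsSmoothTwoForm F w) {X : Euc n → Euc n}
    (hX : ContDiffOn ℝ ∞ X W) : ∃ a : OneForm n, ContDiffOn ℝ ∞ a W ∧
      ∀ w ∈ W, ∀ v, a w v = F w v (X w) := by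
  classical
  have key : ∀ w ∈ W, ∃ l : Euc n →L[ℝ] ℝ, ∀ v, l v = F w v (X w) := by
    intro w hw
    obtain ⟨G, hG⟩ := (hF w hw).1.self_of_nhds.1
    exact ⟨LinearMap.toContinuousLinearMap (G.flip (X w)), fun v => by simp [hG]⟩
  choose! a ha using key
  refine ⟨a, fun w hw => (contDiffAt_oneForm fun v => ?_).contDiffWithinAt, ha⟩
  refine ((hF w hw).contDiffAt_apply (X := fun _ => v) contDiffAt_const
    (hX.contDiffAt (hW.mem_nhds hw))).congr_of_eventuallyEq ?_
  filter_upwards [hW.mem_nhds hw] with y hy using ha y hy v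

lemma Lift.isSmoothTwoForm_A (hw : w ∈ L.W) (i j : Fin 3) : IsSmoothTwoForm (L.A i j) w :=
  ((isSmoothTwoForm_extD (L.contDiffAt_α hw i j)).add (IsSmoothTwoForm.sum fun k _ =>
    isSmoothTwoForm_wedge (L.contDiffAt_α hw i k) (L.contDiffAt_α hw k j))).add
    ((isSmoothTwoForm_wedge (L.contDiffAt_om hw i) (L.contDiffAt_β hw j)).const_mul 2)

lemma Lift.isSmoothTwoForm_B (hw : w ∈ L.W) (i : Fin 3) : IsSmoothTwoForm (L.B i) w :=
  (isSmoothTwoForm_extD (L.contDiffAt_β hw i)).sub (IsSmoothTwoForm.sum fun j _ =>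
    isSmoothTwoForm_wedge (L.contDiffAt_α hw j i) (L.contDiffAt_β hw j))

lemma Lift.At_zero (i j : Fin 3) : L.At 0 i j = L.A i j := by funext w u v; simp [Lift.At, wedge]

lemma Lift.Bt_zero (i : Fin 3) : L.Bt 0 i = L.B i := by funext w u v; simp [Lift.Bt, wedge]

lemma Lift.exists_isCanonical : ∃ τ S4 S3 S2, L.IsCanonical τ S4 S3 S2 := by
  obtain ⟨E, X, hE, hX, hd⟩ := L.exists_dual_frame
  have hE' : ∀ i, ∀ w ∈ L.W, ContDiffAt ℝ ∞ (E i) w := fun i w hw =>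
    (hE i).contDiffAt (L.isOpen.mem_nhds hw)
  have htr : ∀ w ∈ L.W, IsSmoothTwoForm (fun y u v => 1 / 2 * ∑ k, L.A k k y u v) w := fun w hw =>
    (IsSmoothTwoForm.sum fun k _ => L.isSmoothTwoForm_A hw k k).const_mul _
  choose a ha ha' using fun i => IsSmoothTwoForm.exists_insert L.isOpen htr (hE i)
  set τ : Fin 3 → OneForm n := fun i y => a i y + ∑ l, (-(1 / 2) * ∑ j, L.A i j y (E l y) (E j y)
    - 1 / 4 * ∑ k, L.A k k y (E l y) (E i y)) • L.θ l y with hτdef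
  have hτ : ∀ w ∈ L.W, ∀ i v, τ i w v = 1 / 2 * ∑ k, L.A k k w v (E i w)
      + ∑ l, L.θ l w v * (-(1 / 2) * ∑ j, L.A i j w (E l w) (E j w)
      - 1 / 4 * ∑ k, L.A k k w (E l w) (E i w)) := by
    intro w hw i v
    simp only [hτdef, add_apply, sum_apply, smul_apply, smul_eq_mul, ha' i w hw, mul_comm]
  have hτs : ∀ i, ContDiffOn ℝ ∞ (τ i) L.W := by
    intro i w hw
    have hA := fun i j l m => (L.isSmoothTwoForm_A hw i j).contDiffAt_apply (hE' l w hw) (hE' m w hw)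
    refine ContDiffAt.contDiffWithinAt ?_
    refine ((ha i).contDiffAt (L.isOpen.mem_nhds hw)).add (ContDiffAt.sum fun l _ => ?_)
    have hc : ContDiffAt ℝ ∞ (fun y => -(1 / 2) * ∑ j, L.A i j y (E l y) (E j y)
        - 1 / 4 * ∑ k, L.A k k y (E l y) (E i y)) w :=
      (contDiffAt_const.mul (ContDiffAt.sum fun j _ => hA i j l j)).sub
        (contDiffAt_const.mul (ContDiffAt.sum fun k _ => hA k k l i))
    exact hc.smul (L.contDiffAt_θ hw l)
  set S4 : Fin 3 → Fin 3 → Fin 3 → Fin 3 → Euc n → ℝ := fun i m j l w =>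
    -L.A i j w (X l w) (E m w) + delta i j * τ m w (X l w) - delta m j * τ i w (X l w) with hS4
  set S3 : Fin 3 → Fin 3 → Fin 3 → Euc n → ℝ := fun i j k w =>
    1 / 4 * ∑ l, ∑ m, eps k l m * (L.A i j w (E l w) (E m w)
      - delta i j * (τ m w (E l w) - τ l w (E m w)) + τ i w (E l w) * delta j m
      - τ i w (E m w) * delta j l) with hS3
  set S2 : Fin 3 → Fin 3 → Euc n → ℝ := fun i j w =>
    1 / 4 * ∑ k, ∑ l, eps j k l * L.B i w (E k w) (E l w) with hS2
  have main : ∀ w ∈ L.W,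
      (∀ v₁ v₂ i j, L.A i j w v₁ v₂ =
        delta i j * ∑ k, wedge (τ k) (L.θ k) w v₁ v₂ - wedge (τ i) (L.θ j) w v₁ v₂
        + ∑ k, ∑ l, ∑ m, S3 i j k w * eps k l m * wedge (L.θ l) (L.θ m) w v₁ v₂
        + ∑ k, ∑ l, S4 i k j l w * wedge (L.θ k) (L.om l) w v₁ v₂) ∧
      (∀ i j k, S3 i j k w = S3 i k j w) ∧ (∀ k, ∑ i, S3 i i k w = 0) ∧
      (∀ k j, ∑ i, S4 i k i j w = 0) ∧
      (∀ v₁ v₂ i, L.B i w v₁ v₂ = ∑ j, ∑ k, eps i j k * wedge (τ j) (L.om k) w v₁ v₂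
        - 2 * ∑ j, ∑ k, S3 j i k w * wedge (L.θ j) (L.om k) w v₁ v₂
        + ∑ j, ∑ k, ∑ l, eps j k l * S2 i j w * wedge (L.θ k) (L.θ l) w v₁ v₂) := by
    intro w hw
    choose A hA using fun i j => (L.isSmoothTwoForm_A hw i j).1.self_of_nhds.1
    choose B hB using fun i => (L.isSmoothTwoForm_B hw i).1.self_of_nhds.1
    have hb := fun v₀ v₁ v₂ => L.bianchi hw (τ := 0) (fun i => contDiffOn_const) v₀ v₁ v₂
    simp only [L.At_zero, L.Bt_zero] at hb
    obtain ⟨d1, d2, d3, d4⟩ := hd w hw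
    have key := normal_form (fun i => (L.θ i w).toLinearMap) (fun i => (L.om i w).toLinearMap)
      (fun i => (τ i w).toLinearMap) (fun i => E i w) (fun i => X i w) d1 d2 d3 d4
      A B (fun i j u v => by rw [← hA, ← hA]; exact (L.isSmoothTwoForm_A hw i j).swap u v)
      (fun i u v => by rw [← hB, ← hB]; exact (L.isSmoothTwoForm_B hw i).swap u v)
      (fun v₀ v₁ v₂ i => by simp only [← hA]; exact (hb v₀ v₁ v₂).1 i)
      (fun v₀ v₁ v₂ i => by simp only [← hA, ← hB]; exact (hb v₀ v₁ v₂).2.1 i)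
      (fun i v => by simp only [← hA]; exact hτ w hw i v)
      (fun i k j l => S4 i k j l w) (fun i j k => S3 i j k w) (fun i j => S2 i j w)
      (fun i m j l => by simp only [← hA]; rfl) (fun i j k => by simp only [← hA]; rfl)
      (fun i j => by simp only [← hB]; rfl)
    simp only [← hA, ← hB] at key
    exact key
  exact ⟨τ, S4, S3, S2, hτs, fun w hw => (main w hw).1, fun w hw => (main w hw).2.1,
    fun w hw => (main w hw).2.2.1, fun w hw => (main w hw).2.2.2.1,
    fun w hw => (main w hw).2.2.2.2⟩

section Flat

lemma curvature_eq_zero_of_bianchi {V : Type*} [AddCommGroup V] [Module ℝ V]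
    (θ om : Fin 3 → V →ₗ[ℝ] ℝ) (E X : Fin 3 → V)
    (hθE : ∀ i j, θ i (E j) = delta i j) (hθX : ∀ i j, θ i (X j) = 0)
    (homE : ∀ i j, om i (E j) = 0) (homX : ∀ i j, om i (X j) = delta i j)
    (T : Fin 3 → V →ₗ[ℝ] V →ₗ[ℝ] ℝ) (hT : ∀ i u v, T i u v = -T i v u)
    (S2 : Fin 3 → V3) (B : Fin 3 → V → V → ℝ) (hB : ∀ v₁ v₂ i, B i v₁ v₂ =
      ∑ j, ∑ k, ∑ l, eps j k l * S2 i j * (θ k v₁ * θ l v₂ - θ k v₂ * θ l v₁)) (hb : ∀ v₀ v₁ v₂ i j,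
      -2 * (om i v₀ * B j v₁ v₂) - delta i j * ∑ k, T k v₁ v₂ * θ k v₀ + T i v₁ v₂ * θ j v₀
      + (-2 * (om i v₁ * B j v₂ v₀) - delta i j * ∑ k, T k v₂ v₀ * θ k v₁ + T i v₂ v₀ * θ j v₁)
      + (-2 * (om i v₂ * B j v₀ v₁) - delta i j * ∑ k, T k v₀ v₁ * θ k v₂ + T i v₀ v₁ * θ j v₂)
      = 0) : (∀ i j, S2 i j = 0) ∧ ∀ i u v, T i u v = 0 := by
  have hBE : ∀ i r s, B i (E r) (E s) = ∑ j, 2 * eps j r s * S2 i j := by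
    intro i r s
    rw [hB]
    simp only [hθE]
    refine sum_congr rfl fun j hj => ?_
    clear hj
    revert j r s
    (repeat' refine forall_fin3 ?_ ?_ ?_) <;>
    simp only [sum_univ_three, eps_vals, delta_vals] <;> ring
  have hBu : ∀ i u v, (∀ k, θ k u = 0) → B i u v = 0 ∧ B i v u = 0 := by
    intro i u v hu
    rw [hB, hB]; simp [hu]
  have t0 : ∀ u u', (∀ k, θ k u = 0) → (∀ k, θ k u' = 0) → ∀ i, T i u u' = 0 := by
    intro u u' hu hu'
    have h : ∀ r i j, -(delta i j * ∑ k, T k u u' * delta k r) + T i u u' * delta j r = 0 := by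
      intro r i j
      have := hb (E r) u u' i j
      simp only [hu, hu', hθE, homE, (hBu _ _ _ hu).1, (hBu _ _ _ hu).2, (hBu _ _ _ hu').1] at this
      simp at this
      linarith
    have h1 := h 1 0 1
    have h2 := h 0 1 0
    have h3 := h 0 2 0
    simp only [delta_vals] at h1 h2 h3
    refine forall_fin3 ?_ ?_ ?_ <;> linarith
  -- one argument in the annihilator
  have key : ∀ u, (∀ k, θ k u = 0) → ∀ i j r s, -2 * (om i u * B j (E r) (E s))
      - delta i j * (-∑ k, T k u (E s) * delta k r) - T i u (E s) * delta j r
      - delta i j * (∑ k, T k u (E r) * delta k s) + T i u (E r) * delta j s = 0 := by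
    intro u hu i j r s
    have := hb u (E r) (E s) i j
    simp only [hu, hθE, homE, (hBu _ _ _ hu).1, (hBu _ _ _ hu).2] at this
    simp only [hT _ (E s) u] at this
    simp at this ⊢
    linarith
  have hS : ∀ i j, S2 i j = 0 := by
    have h := fun p => key (X p) (hθX · p)
    simp only [homX, hBE] at h
    have d0 := h 1 1 0 1 2
    have d1 := h 0 0 1 2 0
    have d2 := h 0 0 2 0 1
    have a01 := h 0 0 0 0 2
    have a02 := h 0 0 0 0 1
    have a10 := h 1 1 1 1 2
    have a12 := h 1 1 1 1 0
    have a20 := h 2 2 2 2 1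
    have a21 := h 2 2 2 2 0
    have b01 := h 0 2 1 1 0
    have b02 := h 0 1 2 2 0
    have b10 := h 1 2 0 0 1
    have b12 := h 1 0 2 2 1
    have b20 := h 2 1 0 0 2
    have b21 := h 2 0 1 1 2
    simp only [sum_univ_three, eps_vals, delta_vals] at d0 d1 d2 a01 a02 a10 a12 a20 a21 b01 b02 b10 b12 b20 b21
    (repeat' refine forall_fin3 ?_ ?_ ?_) <;> linarith
  have hB0 : ∀ i u v, B i u v = 0 := by intro i u v; rw [hB]; simp [hS]
  have t1 : ∀ u, (∀ k, θ k u = 0) → ∀ i s, T i u (E s) = 0 := by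
    intro u hu
    have h := key u hu
    simp only [hB0] at h
    have h00 := h 0 1 1 0
    have h01 := h 0 2 2 1
    have h02 := h 0 1 1 2
    have h10 := h 1 2 2 0
    have h11 := h 1 2 2 1
    have h12 := h 1 0 0 2
    have h20 := h 2 1 1 0
    have h21 := h 2 0 0 1
    have h22 := h 2 0 0 2
    simp only [sum_univ_three, delta_vals] at h00 h01 h02 h10 h11 h12 h20 h21 h22
    (repeat' refine forall_fin3 ?_ ?_ ?_) <;> linarith
  have t2 : ∀ i r s, T i (E r) (E s) = 0 := by
    have h := hb (E 0) (E 1) (E 2)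
    simp only [hB0, hθE] at h
    have z : ∀ i r, T i (E r) (E r) = 0 := fun i r => by linarith [hT i (E r) (E r)]
    have w : ∀ i, T i (E 0) (E 1) = 0 ∧ T i (E 1) (E 2) = 0 ∧ T i (E 2) (E 0) = 0 := by
      have h00 := h 0 0
      have h01 := h 0 1
      have h02 := h 0 2
      have h10 := h 1 0
      have h11 := h 1 1
      have h12 := h 1 2
      have h20 := h 2 0
      have h21 := h 2 1
      have h22 := h 2 2
      simp only [sum_univ_three, delta_vals] at h00 h01 h02 h10 h11 h12 h20 h21 h22
      refine forall_fin3 ?_ ?_ ?_ <;> refine ⟨?_, ?_, ?_⟩ <;> linarith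
    intro i
    have := w i
    (repeat' refine forall_fin3 ?_ ?_ ?_) <;>
      linarith [this.1, this.2.1, this.2.2, z i 0, z i 1, z i 2, hT i (E 0) (E 1),
        hT i (E 1) (E 2), hT i (E 2) (E 0)]
  refine ⟨hS, fun i u v => ?_⟩
  have hdec : ∀ v, ∃ u, (∀ k, θ k u = 0) ∧ v = u + ∑ a, θ a v • E a := by
    intro v
    refine ⟨v - ∑ a, θ a v • E a, fun k => ?_, by abel⟩
    simp only [map_sub, map_sum, map_smul, hθE, smul_eq_mul]
    revert k
    refine forall_fin3 ?_ ?_ ?_ <;> simp only [sum_univ_three, delta_vals] <;> ring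
  obtain ⟨u', hu', eu⟩ := hdec u
  obtain ⟨v', hv', ev⟩ := hdec v
  have e1 : ∀ s, T i u (E s) = 0 := by
    intro s
    rw [eu]; simp [t1 u' hu', t2]
  rw [ev, map_add, map_sum]
  simp only [map_smul, e1, smul_zero, sum_const_zero, add_zero]
  rw [hT, eu]
  simp only [map_add, map_sum, map_smul, t0 v' u' hv' hu', t1 v' hv', smul_zero,
    sum_const_zero, add_zero, neg_zero]

variable {L : Lift D n}

lemma Lift.isSmoothTwoForm_T (hw : w ∈ L.W)
    (hτ : ∀ i, ContDiffAt ℝ ∞ (τ i) w) (i : Fin 3) : IsSmoothTwoForm (L.T τ i) w :=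
  (((isSmoothTwoForm_extD (hτ i)).sub (IsSmoothTwoForm.sum fun k _ =>
    isSmoothTwoForm_wedge (L.contDiffAt_α hw k k) (hτ i))).add (IsSmoothTwoForm.sum fun j _ =>
    isSmoothTwoForm_wedge (L.contDiffAt_α hw i j) (hτ j))).add (IsSmoothTwoForm.sum fun j _ =>
    IsSmoothTwoForm.sum fun k _ =>
      (isSmoothTwoForm_wedge (L.contDiffAt_β hw j) (L.contDiffAt_β hw k)).const_mul _)

lemma Lift.isSmoothTwoForm_At (hw : w ∈ L.W)
    (hτ : ∀ i, ContDiffAt ℝ ∞ (τ i) w) (i j : Fin 3) : IsSmoothTwoForm (L.At τ i j) w :=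
  ((L.isSmoothTwoForm_A hw i j).sub ((IsSmoothTwoForm.sum fun k _ =>
    isSmoothTwoForm_wedge (hτ k) (L.contDiffAt_θ hw k)).const_mul _)).add
    (isSmoothTwoForm_wedge (hτ i) (L.contDiffAt_θ hw j))

lemma Lift.IsCanonical.At_eq (hc : L.IsCanonical τ S4 S3 S2) (hw : w ∈ L.W)
    (h4 : ∀ i k j l, S4 i k j l w = 0) (i j : Fin 3) (v₁ v₂ : Euc n) : L.At τ i j w v₁ v₂ =
      ∑ k, S3 i j k w * ∑ l, ∑ m, eps k l m * wedge (L.θ l) (L.θ m) w v₁ v₂ := by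
  rw [Lift.At, hc.A_eq w hw]
  simp only [h4, zero_mul, sum_const_zero, Finset.mul_sum, mul_assoc]
  ring

lemma Lift.IsCanonical.Bt_eq (hc : L.IsCanonical τ S4 S3 S2) (hw : w ∈ L.W)
    (i : Fin 3) (v₁ v₂ : Euc n) : L.Bt τ i w v₁ v₂ =
      - 2 * ∑ j, ∑ k, S3 j i k w * wedge (L.θ j) (L.om k) w v₁ v₂
      + ∑ j, ∑ k, ∑ l, eps j k l * S2 i j w * wedge (L.θ k) (L.θ l) w v₁ v₂ := by
  rw [Lift.Bt, hc.B_eq w hw]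
  ring

lemma Lift.IsCanonical.S3_differentiableAt (hc : L.IsCanonical τ S4 S3 S2)
    (h4 : ∀ w ∈ L.W, ∀ i k j l, S4 i k j l w = 0) (hw : w ∈ L.W) (i j k : Fin 3) :
    DifferentiableAt ℝ (S3 i j k) w := by
  obtain ⟨E, X, hE, hX, hd⟩ := L.exists_dual_frame
  have h : ∀ y ∈ L.W, S3 i j k y = 1 / 4 * ∑ l, ∑ m, eps k l m * L.At τ i j y (E l y) (E m y) := by
    intro y hy
    simp only [hc.At_eq hy (h4 y hy), wedge, (hd y hy).1]
    revert k
    refine forall_fin3 ?_ ?_ ?_ <;>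
    simp only [sum_univ_three, eps_vals, delta_vals] <;> ring
  have hs : ContDiffAt ℝ ∞
      (fun y => 1 / 4 * ∑ l, ∑ m, eps k l m * L.At τ i j y (E l y) (E m y)) w := by
    refine contDiffAt_const.mul (ContDiffAt.sum fun l _ => ContDiffAt.sum fun m _ =>
      contDiffAt_const.mul ?_)
    exact (L.isSmoothTwoForm_At hw (fun i => (hc.smooth_τ i).contDiffAt (L.isOpen.mem_nhds hw))
      i j).contDiffAt_apply ((hE l).contDiffAt (L.isOpen.mem_nhds hw))
      ((hE m).contDiffAt (L.isOpen.mem_nhds hw))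
  refine hs.diffAt.congr_of_eventuallyEq ?_
  filter_upwards [L.isOpen.mem_nhds hw] with y hy using h y hy

lemma Lift.IsCanonical.S3_eq_zero (hc : L.IsCanonical τ S4 S3 S2)
    (h4 : ∀ w ∈ L.W, ∀ i k j l, S4 i k j l w = 0) (hw : w ∈ L.W) (i j k : Fin 3) :
    S3 i j k w = 0 := by
  obtain ⟨E, X, hE, hX, hd⟩ := L.exists_dual_frame
  obtain ⟨d1, d2, d3, d4⟩ := hd w hw
  have hF : ∀ k : Fin 3, ∀ u v, DifferentiableAt ℝ
      (fun y => ∑ l, ∑ m, eps k l m * wedge (L.θ l) (L.θ m) y u v) w := fun k u v =>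
    (IsSmoothTwoForm.sum fun l _ => IsSmoothTwoForm.sum fun m _ =>
      (isSmoothTwoForm_wedge (L.contDiffAt_θ hw l)
        (L.contDiffAt_θ hw m)).const_mul _).differentiableAt u v
  have hdθ : ∀ i p q, extD (L.θ i) w (X p w) (X q w) = 2 * eps i p q := by
    intro i p q
    rw [L.dθ_eq w hw]
    simp only [wedge, d2, d4]
    revert i p q
    (repeat' refine forall_fin3 ?_ ?_ ?_) <;>
    simp only [sum_univ_three, eps_vals, delta_vals] <;> ring
  have hlhs : ∀ r p q i j, Bryant.d2 (L.At τ i j) w (E r w) (X p w) (X q w) =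
      ∑ k, S3 i j k w * ∑ l, ∑ m, eps k l m *
        (2 * eps l p q * delta m r - delta l r * (2 * eps m p q)) := by
    intro r p q i j
    rw [d2_congr (G := fun y u v => ∑ k, S3 i j k y *
      ∑ l, ∑ m, eps k l m * wedge (L.θ l) (L.θ m) y u v)]
    · rw [d2_sum]
      · refine sum_congr rfl fun k _ => ?_
        rw [d2_mul (hc.S3_differentiableAt h4 hw i j k) (hF k)]
        have : ∀ k u q, ∑ l, ∑ m, eps k l m * wedge (L.θ l) (L.θ m) w u (X q w) = 0 ∧
            ∑ l, ∑ m, eps k l m * wedge (L.θ l) (L.θ m) w (X q w) u = 0 := by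
          intro k u q
          simp [wedge, d2]
        rw [(this _ _ _).1, (this _ _ _).2, (this _ _ _).1]
        have hw' : ∀ l m, ∀ u v, DifferentiableAt ℝ (fun y => wedge (L.θ l) (L.θ m) y u v) w :=
          fun l m u v => (isSmoothTwoForm_wedge (L.contDiffAt_θ hw l)
            (L.contDiffAt_θ hw m)).differentiableAt u v
        rw [d2_sum _ fun l _ u v => DifferentiableAt.fun_sum fun m _ =>
          (hw' l m u v).const_mul _]
        simp only [mul_zero, zero_add]
        congr 1
        refine sum_congr rfl fun l _ => ?_
        rw [d2_sum _ fun m _ u v => (hw' l m u v).const_mul _]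
        refine sum_congr rfl fun m _ => ?_
        rw [d2_mul (f := fun _ => eps k l m) (differentiableAt_const _) (hw' l m)]
        rw [d2_wedge (L.diffAt hw (L.smooth_θ l))
          (L.diffAt hw (L.smooth_θ m))]
        simp [d1, d2, hdθ]
      · exact fun k _ u v => (hc.S3_differentiableAt h4 hw i j k).mul (hF k u v)
    · filter_upwards [L.isOpen.mem_nhds hw] with y hy u v
      exact hc.At_eq hy (h4 y hy) i j u v
  have hrhs := fun r p q => (L.bianchi hw hc.smooth_τ (E r w) (X p w) (X q w)).2.2
  have hA : ∀ i j u q, L.At τ i j w u (X q w) = 0 ∧ L.At τ i j w (X q w) u = 0 := by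
    intro i j u q
    rw [hc.At_eq hw (h4 w hw), hc.At_eq hw (h4 w hw)]
    simp [wedge, d2]
  have hB : ∀ j r p, L.Bt τ j w (E r w) (X p w) = -2 * S3 r j p w ∧
      L.Bt τ j w (X p w) (E r w) = 2 * S3 r j p w := by
    intro j r p
    rw [hc.Bt_eq hw, hc.Bt_eq hw]
    simp only [wedge, d1, d2, d3, d4]
    revert r p
    (repeat' refine forall_fin3 ?_ ?_ ?_) <;>
    simp only [sum_univ_three, eps_vals, delta_vals] <;> constructor <;> ring
  have key : ∀ p q j, p ≠ q → S3 p j q w = 0 := by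
    intro p q j hpq
    have h := hrhs p p q p j
    rw [hlhs] at h
    simp only [(hA _ _ _ _).1, (hA _ _ _ _).2, (hB _ _ _).1, (hB _ _ _).2, d1, d2, d3, d4] at h
    revert h hpq
    revert p q j
    (repeat' refine forall_fin3 ?_ ?_ ?_) <;> intro hpq h <;> first
      | exact absurd rfl hpq
      | (simp only [sum_univ_three, eps_vals, delta_vals] at h; linarith)
  by_cases hik : i = k
  · by_cases hij : i = j
    · subst hik hij
      have h := hc.S3_trace w hw i
      rw [Finset.sum_eq_single i (fun b _ hb => key b i b hb) (by simp)] at h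
      exact h
    · rw [hc.S3_symm w hw]
      exact key i j k hij
  · exact key i k j hik

lemma Lift.IsCanonical.S2_T_eq_zero (hc : L.IsCanonical τ S4 S3 S2)
    (h4 : ∀ w ∈ L.W, ∀ i k j l, S4 i k j l w = 0) (hw : w ∈ L.W) :
    (∀ i j, S2 i j w = 0) ∧ ∀ i u v, L.T τ i w u v = 0 := by
  obtain ⟨E, X, hE, hX, hd⟩ := L.exists_dual_frame
  obtain ⟨d1, d2, d3, d4⟩ := hd w hw
  have hτ := fun i => (hc.smooth_τ i).contDiffAt (L.isOpen.mem_nhds hw)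
  choose T hT using fun i => (L.isSmoothTwoForm_T hw hτ i).1.self_of_nhds.1
  have hA : ∀ y ∈ L.W, ∀ i j u v, L.At τ i j y u v = 0 := by
    intro y hy i j u v
    rw [hc.At_eq hy (h4 y hy)]
    simp [hc.S3_eq_zero h4 hy]
  have key := curvature_eq_zero_of_bianchi (fun i => (L.θ i w).toLinearMap)
    (fun i => (L.om i w).toLinearMap) (fun i => E i w) (fun i => X i w) d1 d2 d3 d4 T
    (fun i u v => by rw [← hT, ← hT]; exact (L.isSmoothTwoForm_T hw hτ i).swap u v)
    (fun i j => S2 i j w) (fun i => L.Bt τ i w)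
    (fun u v i => by
      rw [hc.Bt_eq hw]
      simp only [hc.S3_eq_zero h4 hw, zero_mul, sum_const_zero, mul_zero, zero_add]
      rfl)
    (fun v₀ v₁ v₂ i j => by
      have h := (L.bianchi hw hc.smooth_τ v₀ v₁ v₂).2.2 i j
      rw [d2_zero (by filter_upwards [L.isOpen.mem_nhds hw] with y hy using hA y hy i j)] at h
      simp only [hA w hw, zero_mul, mul_zero, sub_zero, sum_const_zero, zero_sub] at h
      simp only [← hT]
      rw [h]
      simp only [ContinuousLinearMap.coe_coe]
      ring)
  exact ⟨key.1, fun i u v => by rw [hT]; exact key.2 i u v⟩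

lemma Lift.IsCanonical.curv_eq_zero (hc : L.IsCanonical τ S4 S3 S2)
    (h4 : ∀ w ∈ L.W, ∀ i k j l, S4 i k j l w = 0) (hw : w ∈ L.W) (i j : Fin 3)
    (u v : Euc n) : L.At τ i j w u v = 0 ∧ L.Bt τ i w u v = 0 ∧ L.T τ i w u v = 0 := by
  refine ⟨?_, ?_, (hc.S2_T_eq_zero h4 hw).2 i u v⟩
  · rw [hc.At_eq hw (h4 w hw)]
    simp [hc.S3_eq_zero h4 hw]
  · rw [hc.Bt_eq hw]
    simp [hc.S3_eq_zero h4 hw, (hc.S2_T_eq_zero h4 hw).1]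

lemma Lift.IsCanonical.flatStructureEquations (hc : L.IsCanonical τ S4 S3 S2)
    (h4 : ∀ w ∈ L.W, ∀ i k j l, S4 i k j l w = 0) : L.FlatStructureEquations τ where
  dθ_eq := L.dθ_eq
  dω_eq := L.dω_eq
  dα_eq w hw v₁ v₂ i j := by
    have := (hc.curv_eq_zero h4 hw i j v₁ v₂).1
    rw [Lift.At, Lift.A] at this
    linarith
  dβ_eq w hw v₁ v₂ i := by
    have := (hc.curv_eq_zero h4 hw i 0 v₁ v₂).2.1
    rw [Lift.Bt, Lift.B] at this
    linarith
  dτ_eq w hw v₁ v₂ i := by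
    have := (hc.curv_eq_zero h4 hw i 0 v₁ v₂).2.2
    rw [Lift.T] at this
    linarith

lemma Lift.IsCanonical.maurerCartan (hc : L.IsCanonical τ S4 S3 S2)
    (h4 : ∀ w ∈ L.W, ∀ i k j l, S4 i k j l w = 0) : L.MaurerCartan τ := by
  refine ⟨fun w hw v => ?_, fun w hw v₁ v₂ a b => ?_⟩
  · change mat (L.γ τ) w v ∈ _
    rw [mat_γ]
    exact so43_mem _ _ _ _ _
  · have h := curv_γ L hw (fun i => (hc.smooth_τ i).contDiffAt (L.isOpen.mem_nhds hw)) v₁ v₂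
    have e := curv_apply (L.γ τ) w v₁ v₂ a b
    have z : so43 0 0 (fun i j => L.At τ i j w v₁ v₂) (fun i => L.Bt τ i w v₁ v₂)
        (fun i => L.T τ i w v₁ v₂) = 0 := by
      have e1 : (fun i j => L.At τ i j w v₁ v₂) = 0 := by
        funext i j; exact (hc.curv_eq_zero h4 hw i j v₁ v₂).1
      have e2 : (fun i => L.Bt τ i w v₁ v₂) = 0 := by
        funext i; exact (hc.curv_eq_zero h4 hw i 0 v₁ v₂).2.1
      have e3 : (fun i => L.T τ i w v₁ v₂) = 0 := by
        funext i; exact (hc.curv_eq_zero h4 hw i 0 v₁ v₂).2.2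
      rw [e1, e2, e3]
      apply ext_seven <;> simp [so43]
    rw [h, z] at e
    simp only [Matrix.zero_apply] at e
    linarith

end Flat

section Blocks

/-- The `7 × 7` matrix with the given blocks of sizes `3, 1, 3`. -/
def mk7 (P : Mat3) (u : V3) (S : Mat3)
    (p : V3) (c : ℝ) (q : V3) (T : Mat3) (z : V3)
    (R : Mat3) : Mat7 :=
  !![P 0 0, P 0 1, P 0 2, u 0, S 0 0, S 0 1, S 0 2;
     P 1 0, P 1 1, P 1 2, u 1, S 1 0, S 1 1, S 1 2;
     P 2 0, P 2 1, P 2 2, u 2, S 2 0, S 2 1, S 2 2;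
     p 0, p 1, p 2, c, q 0, q 1, q 2;
     T 0 0, T 0 1, T 0 2, z 0, R 0 0, R 0 1, R 0 2;
     T 1 0, T 1 1, T 1 2, z 1, R 1 0, R 1 1, R 1 2;
     T 2 0, T 2 1, T 2 2, z 2, R 2 0, R 2 1, R 2 2]

/-- The cross product matrix. -/
def cross (v : V3) : Mat3 := !![0, -v 2, v 1; v 2, 0, -v 0; -v 1, v 0, 0]

lemma so43_eq_mk7 (θ om : V3) (α : Fin 3 → V3) (β τ : V3) :
    so43 θ om α β τ = mk7 (-(of α).transpose) ((2 : ℝ) • β) (cross τ) om 0 (-β) (-cross θ)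
      ((-2 : ℝ) • om) (of α) := by
  apply ext_seven <;> simp [so43, mk7, cross]

variable {P S T R P' S' T' R' : Mat3} {u p q z u' p' q' z' : V3} {c c' : ℝ}

open Matrix in
lemma mk7_mul : mk7 P u S p c q T z R * mk7 P' u' S' p' c' q' T' z' R' =
      mk7 (P * P' + vecMulVec u p' + S * T') (P *ᵥ u' + c' • u + S *ᵥ z')
        (P * S' + vecMulVec u q' + S * R')
        (p ᵥ* P' + c • p' + q ᵥ* T') (p ⬝ᵥ u' + c * c' + q ⬝ᵥ z') (p ᵥ* S' + c • q' + q ᵥ* R')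
        (T * P' + vecMulVec z p' + R * T') (T *ᵥ u' + c' • z + R *ᵥ z')
        (T * S' + vecMulVec z q' + R * R') := by
  apply ext_seven <;>
  · simp only [Matrix.mul_apply, sum_univ_seven, mk7, of_apply, cons_val, Matrix.add_apply,
      vecMulVec_apply, sum_univ_three, Pi.add_apply, mulVec, vecMul,
      dotProduct, Pi.smul_apply, smul_eq_mul]
    try ring1

lemma mk7_add : mk7 P u S p c q T z R + mk7 P' u' S' p' c' q' T' z' R' =
      mk7 (P + P') (u + u') (S + S') (p + p') (c + c') (q + q') (T + T') (z + z') (R + R') := by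
  apply ext_seven <;> simp only [Matrix.add_apply, mk7, of_apply, cons_val, Pi.add_apply]

lemma mk7_injective (h : mk7 P u S p c q T z R = mk7 P' u' S' p' c' q' T' z' R') :
    P = P' ∧ u = u' ∧ S = S' ∧ p = p' ∧ c = c' ∧ q = q' ∧ T = T' ∧ z = z' ∧ R = R' := by
  have e : ∀ a b, mk7 P u S p c q T z R a b = mk7 P' u' S' p' c' q' T' z' R' a b :=
    fun a b => by rw [h]
  refine ⟨?_, ?_, ?_, ?_, e 3 3, ?_, ?_, ?_, ?_⟩
  · ext i j
    revert i j
    repeat' refine forall_fin3 ?_ ?_ ?_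
    exacts [e 0 0, e 0 1, e 0 2, e 1 0, e 1 1, e 1 2, e 2 0, e 2 1, e 2 2]
  · exact funext (forall_fin3 (e 0 3) (e 1 3) (e 2 3))
  · ext i j
    revert i j
    repeat' refine forall_fin3 ?_ ?_ ?_
    exacts [e 0 4, e 0 5, e 0 6, e 1 4, e 1 5, e 1 6, e 2 4, e 2 5, e 2 6]
  · exact funext (forall_fin3 (e 3 0) (e 3 1) (e 3 2))
  · exact funext (forall_fin3 (e 3 4) (e 3 5) (e 3 6))
  · ext i j
    revert i j
    repeat' refine forall_fin3 ?_ ?_ ?_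
    exacts [e 4 0, e 4 1, e 4 2, e 5 0, e 5 1, e 5 2, e 6 0, e 6 1, e 6 2]
  · exact funext (forall_fin3 (e 4 3) (e 5 3) (e 6 3))
  · ext i j
    revert i j
    repeat' refine forall_fin3 ?_ ?_ ?_
    exacts [e 4 4, e 4 5, e 4 6, e 5 4, e 5 5, e 5 6, e 6 4, e 6 5, e 6 6]

lemma mk7_one : mk7 1 0 0 0 1 0 0 0 1 = 1 := by apply ext_seven <;> simp [mk7]

lemma cross_injective {v w : V3} (h : cross v = cross w) : v = w := by
  have e : ∀ a b, cross v a b = cross w a b := fun a b => by rw [h]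
  have h0 := e 2 1
  have h1 := e 0 2
  have h2 := e 1 0
  simp only [cross, of_apply, cons_val] at h0 h1 h2
  exact funext (forall_fin3 h0 h1 h2)

end Blocks

section Gauge

variable {θ om : Fin 3 → OneForm n} {α : Fin 3 → Fin 3 → OneForm n} {β τ : Fin 3 → OneForm n}

lemma so43_congr {θ om : V3} {α : Fin 3 → V3} {θ' om' : V3}
    {α' : Fin 3 → V3} (β τ : V3) (h1 : θ = θ') (h2 : om = om') (h3 : α = α') :
    so43 θ om α β τ = so43 θ' om' α' β τ := by
  rw [h1, h2, h3]

lemma curv_so43Form (h1 : ∀ i, DifferentiableAt ℝ (θ i) w)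
    (h2 : ∀ i, DifferentiableAt ℝ (om i) w) (h3 : ∀ i j, DifferentiableAt ℝ (α i j) w)
    (h4 : ∀ i, DifferentiableAt ℝ (β i) w) (h5 : ∀ i, DifferentiableAt ℝ (τ i) w)
    (v₁ v₂ : Euc n) : ∃ B T : V3, curv (so43Form θ om α β τ) w v₁ v₂ = so43
      (fun i => extD (θ i) w v₁ v₂ - (- ∑ k, wedge (α k k) (θ i) w v₁ v₂
        + ∑ j, wedge (α j i) (θ j) w v₁ v₂ + ∑ j, ∑ k, eps i j k * wedge (om j) (om k) w v₁ v₂))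
      (fun i => extD (om i) w v₁ v₂ - (- ∑ k, ∑ j, eps i k j * wedge (β k) (θ j) w v₁ v₂
        - ∑ j, wedge (α i j) (om j) w v₁ v₂))
      (fun i j => extD (α i j) w v₁ v₂ + ∑ k, wedge (α i k) (α k j) w v₁ v₂
        + 2 * wedge (om i) (β j) w v₁ v₂ - delta i j * ∑ k, wedge (τ k) (θ k) w v₁ v₂
        + wedge (τ i) (θ j) w v₁ v₂) B T := by
  unfold curv
  rw [add_sub_assoc, mat_so43Form, mat_so43Form, so43_commutator, extD_so43Form h1 h2 h3 h4 h5,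
    so43_add]
  refine ⟨_, _, so43_congr _ _ (funext fun i => ?_) (funext fun i => ?_)
    (funext fun i => funext fun j => ?_)⟩ <;>
  · simp only [Pi.add_apply, wedge]
    ring

lemma Lift.exists_gauge (hτ : ∀ i, ContDiffOn ℝ ∞ (τ i) L.W)
    {θ' om' : Fin 3 → OneForm n} {α' : Fin 3 → Fin 3 → OneForm n} {β' τ' : Fin 3 → OneForm n}
    (h1 : ∀ i, ContDiffOn ℝ ∞ (θ' i) L.W) (h2 : ∀ i, ContDiffOn ℝ ∞ (om' i) L.W)
    (h3 : ∀ i j, ContDiffOn ℝ ∞ (α' i j) L.W) (h4 : ∀ i, ContDiffOn ℝ ∞ (β' i) L.W)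
    (h5 : ∀ i, ContDiffOn ℝ ∞ (τ' i) L.W)
    (hco : ∀ w ∈ L.W, ∀ v, ((∀ i, θ' i w v = 0) ∧ ∀ i, om' i w v = 0) ↔
      ((∀ i, L.θ i w v = 0) ∧ ∀ i, L.om i w v = 0))
    (hann : ∀ w ∈ L.W, ∀ v, (∀ i, L.θ i w v = 0) → ∀ i, θ' i w v = 0)
    {P S R r : Euc n → Mat3} {p q : Euc n → V3} (hP : ∀ i j, ContDiffOn ℝ ∞ (fun y => P y i j) L.W)
    (hS : ∀ i j, ContDiffOn ℝ ∞ (fun y => S y i j) L.W)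
    (hR : ∀ i j, ContDiffOn ℝ ∞ (fun y => R y i j) L.W)
    (hp : ∀ i, ContDiffOn ℝ ∞ (fun y => p y i) L.W) (hq : ∀ i, ContDiffOn ℝ ∞ (fun y => q y i) L.W)
    (hr : ∀ w ∈ L.W, r w * R w = 1)
    (hg : ∀ w ∈ L.W, ∀ v, mk7 (P w) (p w) (S w) 0 1 (q w) 0 0 (R w) *
        so43 (fun i => θ' i w v) (fun i => om' i w v) (fun i j => α' i j w v) (fun i => β' i w v)
          (fun i => τ' i w v) =
      so43 (fun i => L.θ i w v) (fun i => L.om i w v) (fun i j => L.α i j w v)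
          (fun i => L.β i w v) (fun i => τ i w v) * mk7 (P w) (p w) (S w) 0 1 (q w) 0 0 (R w) +
      mk7 (of fun i j => fderiv ℝ (fun y => P y i j) w v) (fun i => fderiv ℝ (fun y => p y i) w v)
        (of fun i j => fderiv ℝ (fun y => S y i j) w v) 0 0
        (fun i => fderiv ℝ (fun y => q y i) w v) 0 0
        (of fun i j => fderiv ℝ (fun y => R y i j) w v)) :
    ∃ L' : Lift D n, L'.W = L.W ∧ L'.f = L.f ∧ L'.θ = θ' ∧ L'.om = om' ∧ L'.α = α' ∧ L'.β = β' ∧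
      ∀ w ∈ L.W, ∀ v₁ v₂, R w * (of fun i j => L'.At τ' i j w v₁ v₂) =
        (of fun i j => L.At τ i j w v₁ v₂) * R w := by
  have hat : ∀ {w}, w ∈ L.W → ∀ {F : Type} [NormedAddCommGroup F] [NormedSpace ℝ F]
      {a : Euc n → F}, ContDiffOn ℝ ∞ a L.W → ContDiffAt ℝ ∞ a w := fun hw _ _ _ _ h =>
    h.contDiffAt (L.isOpen.mem_nhds hw)
  have hdat : ∀ {w}, w ∈ L.W → ∀ {a : OneForm n}, ContDiffOn ℝ ∞ a L.W →
      DifferentiableAt ℝ a w := fun hw _ h => (hat hw h).diffAt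
  have hentry : ∀ w ∈ L.W, ∀ a b, ContDiffAt ℝ ∞
        (fun y => mk7 (P y) (p y) (S y) 0 1 (q y) 0 0 (R y) a b) w ∧
      ∀ v, fderiv ℝ (fun y => mk7 (P y) (p y) (S y) 0 1 (q y) 0 0 (R y) a b) w v =
        mk7 (of fun i j => fderiv ℝ (fun y => P y i j) w v)
        (fun i => fderiv ℝ (fun y => p y i) w v)
        (of fun i j => fderiv ℝ (fun y => S y i j) w v) 0 0
        (fun i => fderiv ℝ (fun y => q y i) w v) 0 0
        (of fun i j => fderiv ℝ (fun y => R y i j) w v) a b := by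
    intro w hw a b
    have z : ∀ c v, fderiv ℝ (fun _ : Euc n => (c : ℝ)) w v = 0 := by intro c v; simp
    fin_cases a <;> fin_cases b
    all_goals first
      | exact ⟨contDiffAt_const, fun v => z _ v⟩
      | exact ⟨hat hw (hP _ _), fun v => rfl⟩
      | exact ⟨hat hw (hS _ _), fun v => rfl⟩
      | exact ⟨hat hw (hR _ _), fun v => rfl⟩
      | exact ⟨hat hw (hp _), fun v => rfl⟩
      | exact ⟨hat hw (hq _), fun v => rfl⟩
  have main : ∀ w ∈ L.W, ∀ v₁ v₂, _ := fun w hw v₁ v₂ => gauge_curv (w := w)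
    (γ := L.γ τ) (γ' := so43Form θ' om' α' β' τ')
    (h := fun a b y => mk7 (P y) (p y) (S y) 0 1 (q y) 0 0 (R y) a b)
    (fun a b => (contDiffAt_γ L hw (fun i => hat hw (hτ i)) a b).diffAt)
    (fun a b => (contDiffAt_so43Form (fun i => hat hw (h1 i)) (fun i => hat hw (h2 i))
      (fun i j => hat hw (h3 i j)) (fun i => hat hw (h4 i)) (fun i => hat hw (h5 i))
      a b).diffAt)
    (fun a b => (hentry w hw a b).1.of_le two_le_infty)
    (by
      filter_upwards [L.isOpen.mem_nhds hw] with y hy v a b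
      have h := congrFun (congrFun (hg y hy v) a) b
      rw [← mat_so43Form, ← mat_γ] at h
      rw [(hentry y hy a b).2 v]
      simp only [Matrix.mul_apply, Matrix.add_apply] at h
      exact h) v₁ v₂
  have cons : ∀ w ∈ L.W, ∀ v₁ v₂,
      ((fun i => extD (θ' i) w v₁ v₂ - (- ∑ k, wedge (α' k k) (θ' i) w v₁ v₂
        + ∑ j, wedge (α' j i) (θ' j) w v₁ v₂
        + ∑ j, ∑ k, eps i j k * wedge (om' j) (om' k) w v₁ v₂)) = 0) ∧
      ((fun i => extD (om' i) w v₁ v₂ - (- ∑ k, ∑ j, eps i k j * wedge (β' k) (θ' j) w v₁ v₂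
        - ∑ j, wedge (α' i j) (om' j) w v₁ v₂)) = 0) ∧
      R w * (of fun i j => extD (α' i j) w v₁ v₂ + ∑ k, wedge (α' i k) (α' k j) w v₁ v₂
        + 2 * wedge (om' i) (β' j) w v₁ v₂ - delta i j * ∑ k, wedge (τ' k) (θ' k) w v₁ v₂
        + wedge (τ' i) (θ' j) w v₁ v₂) =
        (of fun i j => L.At τ i j w v₁ v₂) * R w := by
    intro w hw v₁ v₂
    have h := main w hw v₁ v₂
    obtain ⟨B, T, e⟩ := curv_so43Form (fun i => hdat hw (h1 i)) (fun i => hdat hw (h2 i))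
      (fun i j => hdat hw (h3 i j)) (fun i => hdat hw (h4 i)) (fun i => hdat hw (h5 i)) v₁ v₂
    rw [e, curv_γ L hw (fun i => hat hw (hτ i)), so43_eq_mk7, so43_eq_mk7] at h
    obtain ⟨-, -, -, e21, -, -, e31, -, e33⟩ := mk7_injective
      ((mk7_mul.symm.trans h).trans
        mk7_mul)
    have c0 : cross 0 = 0 := by ext i j; fin_cases i <;> fin_cases j <;> simp [cross]
    simp only [c0, Matrix.zero_mul, Matrix.zero_vecMulVec, zero_add, add_zero, smul_zero,
      Matrix.vecMulVec_zero, neg_zero, Matrix.mul_zero] at e31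
    have e31' : cross (fun i => extD (θ' i) w v₁ v₂ - (- ∑ k, wedge (α' k k) (θ' i) w v₁ v₂
        + ∑ j, wedge (α' j i) (θ' j) w v₁ v₂
        + ∑ j, ∑ k, eps i j k * wedge (om' j) (om' k) w v₁ v₂)) = cross 0 := by
      have := congrArg (fun X => r w * X) e31
      simp only [← Matrix.mul_assoc, hr w hw, Matrix.one_mul, Matrix.mul_zero] at this
      rw [c0]
      exact neg_eq_zero.1 this
    have hΘ := cross_injective e31'
    rw [hΘ, c0] at e21
    refine ⟨hΘ, ?_, ?_⟩
    · simpa using e21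
    · simpa [c0] using e33
  refine ⟨{ W := L.W, f := L.f, θ := θ', om := om', α := α', β := β', isOpen := L.isOpen,
            smooth_f := L.smooth_f, submersion := L.submersion, smooth_θ := h1, smooth_om := h2,
            smooth_α := h3, smooth_β := h4,
            coframe := fun w hw v => (hco w hw v).trans (L.coframe w hw v),
            annihilates := fun w hw v hv => hann w hw v (L.annihilates w hw v hv),
            dθ_eq := fun w hw v₁ v₂ i => sub_eq_zero.1 (congrFun (cons w hw v₁ v₂).1 i),
            dω_eq := fun w hw v₁ v₂ i => sub_eq_zero.1 (congrFun (cons w hw v₁ v₂).2.1 i) },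
    rfl, rfl, rfl, rfl, rfl, rfl, fun w hw v₁ v₂ => (cons w hw v₁ v₂).2.2⟩

end Gauge

section GaugeAlgebra

open Matrix

lemma cross_conj (g : Mat3) (θ : V3) : g * cross θ * gᵀ = cross (g.adjugateᵀ *ᵥ θ) := by
  ext i j
  revert i j
  (repeat' refine forall_fin3 ?_ ?_ ?_) <;>
  · simp only [Matrix.adjugate_fin_three, cross, Matrix.mul_apply, sum_univ_three,
      transpose_apply, mulVec, dotProduct, of_apply, cons_val]
    try ring1

lemma gauge_linear (g r dg dr A : Mat3) (θ om β τ : V3)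
    (hrg : r * g = 1) (hd : dg * r + g * dr = 0) :
    mk7 gᵀ 0 0 0 1 0 0 0 r * so43 (g.adjugateᵀ *ᵥ θ) (g *ᵥ om)
      (fun i j => (g * A * r + g * dr) i j) (rᵀ *ᵥ β) (r.adjugate *ᵥ τ) =
    so43 θ om (fun i j => A i j) β τ * mk7 gᵀ 0 0 0 1 0 0 0 r + mk7 dgᵀ 0 0 0 0 0 0 0 dr := by
  have hgr : g * r = 1 := mul_eq_one_comm.1 hrg
  have hrt : gᵀ * rᵀ = 1 := by rw [← transpose_mul, hrg, Matrix.transpose_one]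
  have e1 : g * dr * g = -dg := by
    have := congrArg (· * g) (eq_neg_of_add_eq_zero_right hd)
    simpa [Matrix.mul_assoc, hrg] using this
  have e2 : cross (r.adjugate *ᵥ τ) = rᵀ * cross τ * r := by
    have := cross_conj rᵀ τ
    rw [Matrix.transpose_transpose, ← Matrix.adjugate_transpose, Matrix.transpose_transpose] at this
    exact this.symm
  have hof : ∀ B : Mat3, of (fun i j => B i j) = B := fun B => rfl
  rw [so43_eq_mk7, so43_eq_mk7, mk7_mul, mk7_mul, mk7_add]
  simp only [hof]
  congr 1
  · have : gᵀ * (g * A * r + g * dr)ᵀ = Aᵀ * gᵀ - dgᵀ := by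
      rw [← transpose_mul, add_mul, Matrix.mul_assoc (g * A), hrg, e1, Matrix.mul_one]
      simp [sub_eq_add_neg]
    rw [Matrix.mul_neg, this]
    simp [sub_eq_add_neg, add_comm]
  · simp [Matrix.mulVec_smul, mulVec_mulVec, hrt]
  · simp [e2, ← Matrix.mul_assoc, hrt]
  · simp [Matrix.vecMul_transpose]
  · simp
  · simp [Matrix.neg_vecMul, Matrix.mulVec_transpose]
  · have : r * cross (g.adjugateᵀ *ᵥ θ) = cross θ * gᵀ := by
      rw [← cross_conj, ← Matrix.mul_assoc, ← Matrix.mul_assoc, hrg, Matrix.one_mul]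
    simp [this]
  · simp [Matrix.mulVec_neg, Matrix.mulVec_smul, mulVec_mulVec, hrg]
  · have : r * (g * A * r + g * dr) = A * r + dr := by
      rw [mul_add, ← Matrix.mul_assoc, ← Matrix.mul_assoc, ← Matrix.mul_assoc, hrg]; simp
    simp [this]

lemma gauge_translation (p dp : V3) (A : Mat3) (θ om β τ : V3) :
    mk7 1 ((2 : ℝ) • p) (-vecMulVec p p) 0 1 (-p) 0 0 1 * so43 θ (om + cross θ *ᵥ p)
      (fun i j => (A + vecMulVec (cross θ *ᵥ p) p + (2 : ℝ) • vecMulVec om p) i j)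
      (β + dp - p ᵥ* A - (om ⬝ᵥ p) • p) (τ - cross p *ᵥ (dp + (2 : ℝ) • β - p ᵥ* A)) =
    so43 θ om (fun i j => A i j) β τ * mk7 1 ((2 : ℝ) • p) (-vecMulVec p p) 0 1 (-p) 0 0 1 +
      mk7 0 ((2 : ℝ) • dp) (-(vecMulVec dp p + vecMulVec p dp)) 0 0 (-dp) 0 0 0 := by
  rw [so43_eq_mk7, so43_eq_mk7]
  apply ext_seven <;>
  · simp only [Matrix.mul_apply, sum_univ_seven, mk7, Matrix.add_apply, cross,
      vecMulVec_apply, sum_univ_three, Pi.add_apply, mulVec, vecMul,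
      dotProduct, Pi.smul_apply, smul_eq_mul, Matrix.neg_apply, transpose_apply,
      of_apply, cons_val, Matrix.one_apply_eq, Pi.neg_apply, Pi.sub_apply,
      Matrix.smul_apply, Pi.zero_apply, Matrix.zero_apply]
    simp [-mul_eq_mul_left_iff, -mul_eq_mul_right_iff]
    try ring1

lemma gauge_unipotent (t dt : V3) (A : Mat3) (θ om β τ : V3) :
    mk7 1 0 (cross t) 0 1 0 0 0 1 * so43 θ om (fun i j => (A - cross θ * cross t) i j) (β + cross t *ᵥ om)
      (τ + dt - (A.trace • t - A *ᵥ t) - (t ⬝ᵥ θ) • t) =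
    so43 θ om (fun i j => A i j) β τ * mk7 1 0 (cross t) 0 1 0 0 0 1 +
      mk7 0 0 (cross dt) 0 0 0 0 0 0 := by
  rw [so43_eq_mk7, so43_eq_mk7]
  apply ext_seven <;>
  · simp only [Matrix.mul_apply, sum_univ_seven, mk7, Matrix.add_apply, cross,
      sum_univ_three, Pi.add_apply, mulVec,
      dotProduct, Pi.smul_apply, smul_eq_mul, Matrix.neg_apply, transpose_apply,
      of_apply, cons_val, Matrix.one_apply_eq, Pi.neg_apply, Pi.sub_apply,
      Pi.zero_apply, Matrix.zero_apply, Matrix.sub_apply, Matrix.trace,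
      Matrix.diag_apply]
    simp [-mul_eq_mul_left_iff, -mul_eq_mul_right_iff]
    try ring1

lemma skew_of_structure_eq (a : Fin 3 → Fin 3 → V3) (q : Fin 3 → V3)
    (h1 : ∀ i m p, -(∑ k, a k k p) * delta i m + a m i p - 2 * ∑ j, eps i j p * q j m = 0)
    (h2 : ∀ i p r, 2 * ∑ m, q i m * eps m p r = -a i r p + a i p r) (i j : Fin 3) :
    q i j = -q j i := by
  have htr : ∀ p, ∑ k, a k k p = -∑ i, ∑ j, eps i j p * q j i := by
    intro p
    have e0 := h1 0 0 p
    have e1 := h1 1 1 p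
    have e2 := h1 2 2 p
    simp only [sum_univ_three, delta_vals] at e0 e1 e2 ⊢
    linarith
  have ha : ∀ i m p, a m i p = 2 * ∑ j, eps i j p * q j m
      - (∑ i, ∑ j, eps i j p * q j i) * delta i m := by
    intro i m p
    have := h1 i m p
    rw [htr] at this
    linarith
  simp only [ha] at h2
  have k0 := h2 0 0 1
  have k1 := h2 0 1 2
  have k2 := h2 0 2 0
  have k3 := h2 1 0 1
  have k4 := h2 1 1 2
  have k5 := h2 1 2 0
  have k6 := h2 2 0 1
  have k7 := h2 2 1 2
  have k8 := h2 2 2 0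
  simp only [sum_univ_three, eps_vals, delta_vals] at k0 k1 k2 k3 k4 k5 k6 k7 k8
  revert i j
  (repeat' refine forall_fin3 ?_ ?_ ?_) <;> linarith

lemma connection_unique {V : Type*} [AddCommGroup V] [Module ℝ V] (θ om b : Fin 3 → V →ₗ[ℝ] ℝ)
    (a : Fin 3 → Fin 3 → V →ₗ[ℝ] ℝ)
    (E X : Fin 3 → V) (hθE : ∀ i j, θ i (E j) = delta i j) (hθX : ∀ i j, θ i (X j) = 0)
    (homE : ∀ i j, om i (E j) = 0) (homX : ∀ i j, om i (X j) = delta i j)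
    (h1 : ∀ u v i, -∑ k, (a k k u * θ i v - a k k v * θ i u)
      + ∑ j, (a j i u * θ j v - a j i v * θ j u) = 0)
    (h2 : ∀ u v i, ∑ k, ∑ j, eps i k j * (b k u * θ j v - b k v * θ j u)
      + ∑ j, (a i j u * om j v - a i j v * om j u) = 0) :
    (∀ v i j, a i j v = delta i j * (b 2 (X 1) * θ 0 v + b 0 (X 2) * θ 1 v + b 1 (X 0) * θ 2 v)
      - ![b 2 (X 1), b 0 (X 2), b 1 (X 0)] i * θ j v) ∧
    (∀ v i, b i v = ∑ j, ∑ k, eps i j k * (![b 2 (X 1), b 0 (X 2), b 1 (X 0)] j * om k v)) := by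
  have ha : ∀ u, (∀ i, θ i u = 0) → ∀ i j, a i j u = 0 := by
    intro u hu
    have h : ∀ m i, -(∑ k, a k k u) * delta i m + a m i u = 0 := by
      intro m i
      have := h1 u (E m) i
      simp only [hu, hθE, mul_zero, sub_zero] at this
      rw [← this]
      clear this
      revert m i
      (repeat' refine forall_fin3 ?_ ?_ ?_) <;>
      simp only [sum_univ_three, delta_vals] <;> ring
    have h0 := h 0 0
    have h1 := h 1 1
    have h2 := h 2 2
    have ht : ∑ k, a k k u = 0 := by
      simp only [sum_univ_three, delta_vals] at h0 h1 h2 ⊢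
      linarith
    intro i j
    have := h i j
    rw [ht] at this
    linarith
  have hc : ∀ i n m, a i n (E m) = ∑ k, eps i k m * b k (X n) := by
    intro i n m
    have := h2 (E m) (X n) i
    simp only [hθE, hθX, homE, homX, ha _ (hθX · n)] at this
    revert this
    revert i n m
    (repeat' refine forall_fin3 ?_ ?_ ?_) <;> intro this <;>
    simp only [sum_univ_three, eps_vals, delta_vals] at this ⊢ <;> linarith
  have hB : ∀ k n, b k (X n) = -b n (X k) := by
    have h := fun m n i => h1 (E m) (E n) i
    simp only [hθE, hc] at h
    have k0 := h 0 1 0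
    have k1 := h 0 1 1
    have k2 := h 0 1 2
    have k3 := h 1 2 0
    have k4 := h 1 2 1
    have k5 := h 1 2 2
    have k6 := h 2 0 0
    have k7 := h 2 0 1
    have k8 := h 2 0 2
    simp only [sum_univ_three, eps_vals, delta_vals] at k0 k1 k2 k3 k4 k5 k6 k7 k8
    (repeat' refine forall_fin3 ?_ ?_ ?_) <;> linarith
  have hbE : ∀ k m, b k (E m) = 0 := by
    have h := fun m n i => h2 (E m) (E n) i
    simp only [hθE, homE] at h
    have k0 := h 0 1 0
    have k1 := h 0 1 1
    have k2 := h 0 1 2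
    have k3 := h 1 2 0
    have k4 := h 1 2 1
    have k5 := h 1 2 2
    have k6 := h 2 0 0
    have k7 := h 2 0 1
    have k8 := h 2 0 2
    simp only [sum_univ_three, eps_vals, delta_vals] at k0 k1 k2 k3 k4 k5 k6 k7 k8
    (repeat' refine forall_fin3 ?_ ?_ ?_) <;> linarith
  have hbu : ∀ u, (∀ i, θ i u = 0) → (∀ i, om i u = 0) → ∀ k, b k u = 0 := by
    intro u hu hu'
    have h := fun m i => h2 (E m) u i
    simp only [hθE, homE, hu, hu', ha u hu] at h
    have k0 := h 0 1
    have k1 := h 1 2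
    have k2 := h 2 0
    simp only [sum_univ_three, eps_vals, delta_vals] at k0 k1 k2
    refine forall_fin3 ?_ ?_ ?_ <;> linarith
  have hdec : ∀ v, ∃ u, (∀ k, θ k u = 0) ∧ (∀ k, om k u = 0) ∧
      v = u + ∑ a, θ a v • E a + ∑ a, om a v • X a := by
    intro v
    refine ⟨v - ∑ a, θ a v • E a - ∑ a, om a v • X a, fun k => ?_, fun k => ?_, by abel⟩ <;>
    · simp only [map_sub, map_sum, map_smul, hθE, hθX, homE, homX, smul_eq_mul]
      revert k
      refine forall_fin3 ?_ ?_ ?_ <;> simp only [sum_univ_three, delta_vals] <;> ring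
  have z : ∀ k, b k (X k) = 0 := fun k => by linarith [hB k k]
  refine ⟨fun v i j => ?_, fun v i => ?_⟩
  · obtain ⟨u, h3, h4, e⟩ := hdec v
    have : a i j v = ∑ m, θ m v * a i j (E m) := by
      conv_lhs => rw [e]
      simp [ha u h3, ha _ (hθX · _)]
    rw [this]
    simp only [hc]
    clear this e
    revert i j
    (repeat' refine forall_fin3 ?_ ?_ ?_) <;>
    simp only [sum_univ_three, eps_vals, delta_vals, z, hB 1 2, hB 2 0, hB 0 1, cons_val] <;> ring
  · obtain ⟨u, h3, h4, e⟩ := hdec v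
    have : b i v = ∑ m, om m v * b i (X m) := by
      conv_lhs => rw [e]
      simp [hbu u h3 h4, hbE]
    rw [this]
    clear this e
    revert i
    refine forall_fin3 ?_ ?_ ?_ <;>
    simp only [sum_univ_three, eps_vals, z, hB 1 2, hB 2 0, hB 0 1, cons_val] <;> ring

end GaugeAlgebra

section GaugeLift

open Matrix

lemma adjugate_transpose_mulVec_eq_zero {g r : Mat3} (h : r * g = 1)
    {x : V3} : g.adjugateᵀ *ᵥ x = 0 ↔ x = 0 := by
  constructor
  · intro hx
    have h1 : gᵀ *ᵥ (g.adjugateᵀ *ᵥ x) = 0 := by rw [hx, mulVec_zero]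
    rw [mulVec_mulVec, ← transpose_mul, Matrix.adjugate_mul, Matrix.transpose_smul,
      Matrix.transpose_one, Matrix.smul_mulVec, Matrix.one_mulVec] at h1
    have hd : g.det ≠ 0 := by
      intro h0
      have := congrArg Matrix.det h
      rw [Matrix.det_mul, h0, mul_zero, Matrix.det_one] at this
      exact zero_ne_one this
    exact (smul_eq_zero.1 h1).resolve_left hd
  · rintro rfl
    exact mulVec_zero _

lemma contDiffOn_adjugate {W : Set (Euc n)} (hW : IsOpen W) {G : Euc n → Mat3}
    (hG : ∀ i j, ContDiffOn ℝ ∞ (fun y => G y i j) W) (i j : Fin 3) :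
    ContDiffOn ℝ ∞ (fun y => (G y).adjugate i j) W := by
  simp only [Matrix.adjugate_apply]
  refine fun w hw => (contDiffAt_det fun a b => ?_).contDiffWithinAt
  by_cases h : a = j
  · subst h
    simp only [Matrix.updateRow_self]
    exact contDiffAt_const
  · simp only [Matrix.updateRow_ne h]
    exact (hG _ _).contDiffAt (hW.mem_nhds hw)

lemma exists_crossForm {θ : Fin 3 → OneForm n} {W : Set (Euc n)}
    (hθ : ∀ i, ContDiffOn ℝ ∞ (θ i) W) : ∃ X : Fin 3 → Fin 3 → OneForm n,
      (∀ w v i k, X i k w v = cross (fun i => θ i w v) i k) ∧ ∀ i k, ContDiffOn ℝ ∞ (X i k) W := by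
  refine ⟨![![0, -θ 2, θ 1], ![θ 2, 0, -θ 0], ![-θ 1, θ 0, 0]], fun w v i k => ?_, fun i k => ?_⟩
  · fin_cases i <;> fin_cases k <;> simp [cross]
  · have h0 : ContDiffOn ℝ ∞ (0 : OneForm n) W := contDiffOn_const
    fin_cases i <;> fin_cases k
    exacts [h0, (hθ 2).neg, hθ 1, hθ 2, h0, (hθ 0).neg, (hθ 1).neg, hθ 0, h0]

lemma contDiffOn_cross {p : Euc n → V3} {W : Set (Euc n)}
    (hp : ∀ i, ContDiffOn ℝ ∞ (fun y => p y i) W) (i k : Fin 3) :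
    ContDiffOn ℝ ∞ (fun y => cross (p y) i k) W := by
  have h0 : ContDiffOn ℝ ∞ (fun _ : Euc n => (0 : ℝ)) W := contDiffOn_const
  fin_cases i <;> fin_cases k
  exacts [h0, (hp 2).neg, hp 1, hp 2, h0, (hp 0).neg, (hp 1).neg, hp 0, h0]

lemma Lift.exists_gauge_linear (hτ : ∀ i, ContDiffOn ℝ ∞ (τ i) L.W)
    {G : Euc n → Mat3} (hG : ∀ i j, ContDiffOn ℝ ∞ (fun y => G y i j) L.W)
    (hdet : ∀ w ∈ L.W, (G w).det ≠ 0) :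
    ∃ (L' : Lift D n) (τ' : Fin 3 → OneForm n), (∀ i, ContDiffOn ℝ ∞ (τ' i) L.W) ∧
      L'.W = L.W ∧ L'.f = L.f ∧
      (∀ w ∈ L.W, ∀ v i, L'.θ i w v = ∑ l, (G w).adjugate l i * L.θ l w v) ∧
      (∀ w ∈ L.W, ∀ v i, L'.om i w v = ∑ j, G w i j * L.om j w v) ∧
      ∀ w ∈ L.W, ∀ v₁ v₂, (G w)⁻¹ * (of fun i j => L'.At τ' i j w v₁ v₂) =
        (of fun i j => L.At τ i j w v₁ v₂) * (G w)⁻¹ := by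
  have hadj := fun i j => contDiffOn_adjugate L.isOpen hG i j
  have hr : ∀ i j, ContDiffOn ℝ ∞ (fun y => (G y)⁻¹ i j) L.W := fun i j w hw =>
    (contDiffAt_matrix_inv (fun a b => (hG a b).contDiffAt (L.isOpen.mem_nhds hw))
      (hdet w hw) i j).contDiffWithinAt
  have hradj := fun i j => contDiffOn_adjugate L.isOpen hr i j
  have hu : ∀ w ∈ L.W, IsUnit (G w).det := fun w hw => isUnit_iff_ne_zero.2 (hdet w hw)
  set θ' : Fin 3 → OneForm n := fun i y => ∑ l, (G y).adjugate l i • L.θ l y with hθ'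
  set om' : Fin 3 → OneForm n := fun i y => ∑ j, G y i j • L.om j y with hom'
  set α' : Fin 3 → Fin 3 → OneForm n := fun i j y => ∑ l, (G y)⁻¹ l j • ∑ k, G y i k • L.α k l y
    + ∑ k, G y i k • fderiv ℝ (fun y => (G y)⁻¹ k j) y with hα'
  set β' : Fin 3 → OneForm n := fun i y => ∑ k, (G y)⁻¹ k i • L.β k y with hβ'
  set τ' : Fin 3 → OneForm n := fun i y => ∑ k, ((G y)⁻¹).adjugate i k • τ k y with hτ'
  have e1 : ∀ w v, (fun i => θ' i w v) = (G w).adjugateᵀ *ᵥ (fun i => L.θ i w v) := by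
    intro w v; funext i
    simp [hθ', mulVec, dotProduct]
  have e2 : ∀ w v, (fun i => om' i w v) = G w *ᵥ (fun i => L.om i w v) := by
    intro w v; funext i
    simp [hom', mulVec, dotProduct]
  have e3 : ∀ w v, (fun i j => α' i j w v) = fun i j =>
      (G w * (of fun i j => L.α i j w v) * (G w)⁻¹
        + G w * of fun i j => fderiv ℝ (fun y => (G y)⁻¹ i j) w v) i j := by
    intro w v; funext i j
    simp [hα', Matrix.mul_apply, mul_comm]
  have e4 : ∀ w v, (fun i => β' i w v) = (G w)⁻¹ᵀ *ᵥ (fun i => L.β i w v) := by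
    intro w v; funext i
    simp [hβ', mulVec, dotProduct]
  have e5 : ∀ w v, (fun i => τ' i w v) = (G w)⁻¹.adjugate *ᵥ (fun i => τ i w v) := by
    intro w v; funext i
    simp [hτ', mulVec, dotProduct]
  have hτs : ∀ i, ContDiffOn ℝ ∞ (τ' i) L.W := fun i =>
    ContDiffOn.sum fun k _ => (hradj i k).smul (hτ k)
  obtain ⟨L', h1, h2, h3, h4, h5, h6, h7⟩ := L.exists_gauge hτ (θ' := θ') (om' := om') (α' := α')
    (β' := β') (τ' := τ') (fun i => ContDiffOn.sum fun l _ => (hadj l i).smul (L.smooth_θ l))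
    (fun i => ContDiffOn.sum fun j _ => (hG i j).smul (L.smooth_om j))
    (fun i j => (ContDiffOn.sum fun l _ => (hr l j).smul
      (ContDiffOn.sum fun k _ => (hG i k).smul (L.smooth_α k l))).add
      (ContDiffOn.sum fun k _ => (hG i k).smul ((hr k j).fderiv_of_isOpen L.isOpen (by simp))))
    (fun i => ContDiffOn.sum fun k _ => (hr k i).smul (L.smooth_β k)) hτs
    (fun w hw v => by
      have a1 : (∀ i, θ' i w v = 0) ↔ ∀ i, L.θ i w v = 0 := by
        rw [← funext_iff (f := fun i => θ' i w v) (g := fun _ => 0), e1]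
        exact (adjugate_transpose_mulVec_eq_zero (nonsing_inv_mul _ (hu w hw))).trans
          funext_iff
      have a2 : (∀ i, om' i w v = 0) ↔ ∀ i, L.om i w v = 0 := by
        rw [← funext_iff (f := fun i => om' i w v) (g := fun _ => 0), e2]
        refine Iff.trans ⟨fun h => ?_, fun h => ?_⟩ (funext_iff (f := fun i => L.om i w v)
          (g := fun _ => 0))
        · have := congrArg ((G w)⁻¹ *ᵥ ·) h
          simp only [mulVec_mulVec, nonsing_inv_mul _ (hu w hw), Matrix.one_mulVec] at this
          rw [this]
          exact mulVec_zero _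
        · rw [h]
          exact mulVec_zero _
      rw [a1, a2])
    (fun w hw v h i => by
      simp only [hθ', _root_.sum_apply, _root_.smul_apply, h, smul_zero, sum_const_zero])
    (P := fun y => (G y)ᵀ) (S := fun _ => 0) (R := fun y => (G y)⁻¹) (r := G) (p := fun _ => 0)
    (q := fun _ => 0) (fun i j => hG j i) (fun i j => contDiffOn_const) hr
    (fun i => contDiffOn_const) (fun i => contDiffOn_const)
    (fun w hw => mul_nonsing_inv _ (hu w hw))
    (fun w hw v => by
      have hd : (of fun i j => fderiv ℝ (fun y => G y i j) w v) * (G w)⁻¹ +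
          G w * (of fun i j => fderiv ℝ (fun y => (G y)⁻¹ i j) w v) = 0 := by
        ext i j
        have hev : (fun y => ∑ k, G y i k * (G y)⁻¹ k j) =ᶠ[nhds w]
            fun _ => (1 : Mat3) i j := by
          filter_upwards [L.isOpen.mem_nhds hw] with y hy
          rw [← Matrix.mul_apply, mul_nonsing_inv _ (hu y hy)]
        have hdG : ∀ i j, DifferentiableAt ℝ (fun y => G y i j) w := fun i j =>
          L.diffAt hw (hG i j)
        have hdr : ∀ i j, DifferentiableAt ℝ (fun y => (G y)⁻¹ i j) w := fun i j =>
          L.diffAt hw (hr i j)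
        have h := congrArg (fun l : Euc n →L[ℝ] ℝ => l v) (hev.fderiv_eq (𝕜 := ℝ))
        rw [fderiv_fun_sum fun k _ => (hdG i k).fun_mul (hdr k j)] at h
        simp only [fun k => fderiv_fun_mul (hdG i k) (hdr k j), _root_.sum_apply, _root_.add_apply, _root_.smul_apply,
          smul_eq_mul, fderiv_fun_const, Pi.zero_apply, _root_.zero_apply, sum_add_distrib] at h
        rw [Matrix.add_apply, Matrix.mul_apply, Matrix.mul_apply, Matrix.zero_apply, ← h, add_comm]
        congr 1
        exact sum_congr rfl fun k _ => mul_comm _ _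
      have key := gauge_linear (G w) (G w)⁻¹ (of fun i j => fderiv ℝ (fun y => G y i j) w v)
        (of fun i j => fderiv ℝ (fun y => (G y)⁻¹ i j) w v)
        (of fun i j => L.α i j w v) (fun i => L.θ i w v) (fun i => L.om i w v)
        (fun i => L.β i w v) (fun i => τ i w v) (nonsing_inv_mul _ (hu w hw)) hd
      rw [e1, e2, e3, e4, e5]
      have z1 : (fun i : Fin 3 => fderiv ℝ (fun _ : Euc n => (0 : V3) i) w v) = 0 := by
        funext i; simp
      have z2 : (of fun i j : Fin 3 =>
          fderiv ℝ (fun _ : Euc n => (0 : Mat3) i j) w v) = 0 := by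
        ext i j; simp
      rw [z1, z2]
      exact key)
  refine ⟨L', τ', hτs, h1, h2, fun w _ v i => ?_, fun w _ v i => ?_, h7⟩
  · rw [h3]; simp [hθ']
  · rw [h4]; simp [hom']

lemma Lift.exists_gauge_translation (hτ : ∀ i, ContDiffOn ℝ ∞ (τ i) L.W)
    {p : Euc n → V3} (hp : ∀ i, ContDiffOn ℝ ∞ (fun y => p y i) L.W) :
    ∃ (L' : Lift D n) (τ' : Fin 3 → OneForm n), (∀ i, ContDiffOn ℝ ∞ (τ' i) L.W) ∧
      L'.W = L.W ∧ L'.f = L.f ∧ L'.θ = L.θ ∧ (∀ w ∈ L.W, ∀ v i, L'.om i w v =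
        L.om i w v + ∑ k, cross (fun i => L.θ i w v) i k * p w k) ∧
      ∀ w ∈ L.W, ∀ v₁ v₂ i j, L'.At τ' i j w v₁ v₂ = L.At τ i j w v₁ v₂ := by
  obtain ⟨X, hXa, hXs⟩ := exists_crossForm L.smooth_θ
  have hdp : ∀ i, ContDiffOn ℝ ∞ (fun y => fderiv ℝ (fun y => p y i) y) L.W := fun i =>
    (hp i).fderiv_of_isOpen L.isOpen (by simp)
  have hcr := contDiffOn_cross hp
  set om' : Fin 3 → OneForm n := fun i y => L.om i y + ∑ k, p y k • X i k y with hom'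
  set α' : Fin 3 → Fin 3 → OneForm n := fun i j y => L.α i j y + p y j • ∑ k, p y k • X i k y
    + (2 * p y j) • L.om i y with hα'
  set β' : Fin 3 → OneForm n := fun i y => L.β i y + fderiv ℝ (fun y => p y i) y
    - ∑ k, p y k • L.α k i y - p y i • ∑ k, p y k • L.om k y with hβ'
  set τ' : Fin 3 → OneForm n := fun i y => τ i y - ∑ k, cross (p y) i k •
    (fderiv ℝ (fun y => p y k) y + (2 : ℝ) • L.β k y - ∑ l, p y l • L.α l k y) with hτ'
  have e2 : ∀ w v, (fun i => om' i w v) =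
      (fun i => L.om i w v) + cross (fun i => L.θ i w v) *ᵥ p w := by
    intro w v; funext i
    simp [hom', hXa, mulVec, dotProduct, mul_comm]
  have e3 : ∀ w v, (fun i j => α' i j w v) = fun i j => ((of fun i j => L.α i j w v)
      + vecMulVec (cross (fun i => L.θ i w v) *ᵥ p w) (p w)
      + (2 : ℝ) • vecMulVec (fun i => L.om i w v) (p w)) i j := by
    intro w v; funext i j
    simp [hα', hXa, mulVec, dotProduct, vecMulVec_apply, mul_comm]
    ring
  have e4 : ∀ w v, (fun i => β' i w v) = (fun i => L.β i w v)
      + (fun i => fderiv ℝ (fun y => p y i) w v) - p w ᵥ* (of fun i j => L.α i j w v)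
      - ((fun i => L.om i w v) ⬝ᵥ p w) • p w := by
    intro w v; funext i
    simp [hβ', vecMul, dotProduct, mul_comm]
  have e5 : ∀ w v, (fun i => τ' i w v) = (fun i => τ i w v) - cross (p w) *ᵥ
      ((fun i => fderiv ℝ (fun y => p y i) w v) + (2 : ℝ) • (fun i => L.β i w v)
        - p w ᵥ* (of fun i j => L.α i j w v)) := by
    intro w v; funext i
    simp [hτ', mulVec, vecMul, dotProduct]
  have hτs : ∀ i, ContDiffOn ℝ ∞ (τ' i) L.W := fun i =>
    (hτ i).sub (ContDiffOn.sum fun k _ => (hcr i k).smul (((hdp k).add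
      ((L.smooth_β k).const_smul (2 : ℝ))).sub (ContDiffOn.sum fun l _ =>
        (hp l).smul (L.smooth_α l k))))
  have hpX : ∀ i, ContDiffOn ℝ ∞ (fun y => ∑ k, p y k • X i k y) L.W := fun i =>
    ContDiffOn.sum fun k _ => (hp k).smul (hXs i k)
  obtain ⟨L', h1, h2, h3, h4, h5, h6, h7⟩ := L.exists_gauge hτ (θ' := L.θ) (om' := om') (α' := α')
    (β' := β') (τ' := τ') L.smooth_θ
    (fun i => (L.smooth_om i).add (hpX i))
    (fun i j => ((L.smooth_α i j).add ((hp j).smul (hpX i))).add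
      ((contDiffOn_const.mul (hp j)).smul (L.smooth_om i)))
    (fun i => (((L.smooth_β i).add (hdp i)).sub (ContDiffOn.sum fun k _ =>
      (hp k).smul (L.smooth_α k i))).sub ((hp i).smul (ContDiffOn.sum fun k _ =>
      (hp k).smul (L.smooth_om k)))) hτs
    (fun w hw v => by
      refine and_congr_right fun h => forall_congr' fun i => ?_
      have : om' i w v = L.om i w v := by
        have := congrFun (e2 w v) i
        have c0 : cross (fun i => L.θ i w v) = 0 := by
          ext i j; fin_cases i <;> fin_cases j <;> simp [cross, h]
        rw [c0, Matrix.zero_mulVec, add_zero] at this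
        exact this
      rw [this])
    (fun w hw v h i => h i)
    (P := fun y => 1) (S := fun y => -vecMulVec (p y) (p y)) (R := fun y => 1) (r := fun y => 1)
    (p := fun y => (2 : ℝ) • p y) (q := fun y => -p y) (fun i j => contDiffOn_const)
    (fun i j => ((hp i).mul (hp j)).neg) (fun i j => contDiffOn_const)
    (fun i => contDiffOn_const.smul (hp i)) (fun i => (hp i).neg)
    (fun w hw => Matrix.one_mul _)
    (fun w hw v => by
      have key := gauge_translation (p w) (fun i => fderiv ℝ (fun y => p y i) w v)
        (of fun i j => L.α i j w v) (fun i => L.θ i w v) (fun i => L.om i w v)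
        (fun i => L.β i w v) (fun i => τ i w v)
      rw [e2, e3, e4, e5]
      have hd : ∀ i, DifferentiableAt ℝ (fun y => p y i) w := fun i =>
        L.diffAt hw (hp i)
      have z1 : (of fun i j : Fin 3 =>
          fderiv ℝ (fun _ : Euc n => (1 : Mat3) i j) w v) = 0 := by
        ext i j; simp
      have z2 : (fun i : Fin 3 => fderiv ℝ (fun y : Euc n => ((2 : ℝ) • p y) i) w v) =
          (2 : ℝ) • (fun i => fderiv ℝ (fun y => p y i) w v) := by
        funext i
        simp only [Pi.smul_apply]
        rw [fderiv_fun_const_smul (hd i)]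
        rfl
      have z3 : (fun i : Fin 3 => fderiv ℝ (fun y : Euc n => (-p y) i) w v) =
          -(fun i => fderiv ℝ (fun y => p y i) w v) := by
        funext i
        simp only [Pi.neg_apply]
        rw [fderiv_fun_neg]
        rfl
      have z4 : (of fun i j : Fin 3 =>
          fderiv ℝ (fun y : Euc n => (-vecMulVec (p y) (p y)) i j) w v) =
          -(vecMulVec (fun i => fderiv ℝ (fun y => p y i) w v) (p w)
            + vecMulVec (p w) (fun i => fderiv ℝ (fun y => p y i) w v)) := by
        ext i j
        simp only [Matrix.neg_apply, vecMulVec_apply, of_apply, Matrix.add_apply]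
        rw [fderiv_fun_neg, fderiv_fun_mul (hd i) (hd j)]
        simp only [_root_.neg_apply, _root_.add_apply, _root_.smul_apply, smul_eq_mul]
        ring
      rw [z1, z2, z3, z4]
      exact key)
  refine ⟨L', τ', hτs, h1, h2, h3, fun w _ v i => ?_, fun w hw v₁ v₂ i j => ?_⟩
  · rw [h4]
    exact congrFun (e2 w v) i
  · have := h7 w hw v₁ v₂
    rw [Matrix.one_mul, Matrix.mul_one] at this
    exact congrFun (congrFun this i) j

lemma Lift.exists_gauge_unipotent (hτ : ∀ i, ContDiffOn ℝ ∞ (τ i) L.W)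
    {t : Euc n → V3} (ht : ∀ i, ContDiffOn ℝ ∞ (fun y => t y i) L.W) :
    ∃ (L' : Lift D n) (τ' : Fin 3 → OneForm n), (∀ i, ContDiffOn ℝ ∞ (τ' i) L.W) ∧
      L'.W = L.W ∧ L'.f = L.f ∧ L'.θ = L.θ ∧ L'.om = L.om ∧
      (∀ w ∈ L.W, ∀ v i j, L'.α i j w v = L.α i j w v
        - ∑ k, cross (fun i => L.θ i w v) i k * cross (t w) k j) ∧
      (∀ w ∈ L.W, ∀ v i, L'.β i w v = L.β i w v + ∑ k, cross (t w) i k * L.om k w v) ∧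
      ∀ w ∈ L.W, ∀ v₁ v₂ i j, L'.At τ' i j w v₁ v₂ = L.At τ i j w v₁ v₂ := by
  obtain ⟨X, hXa, hXs⟩ := exists_crossForm L.smooth_θ
  have hcr := contDiffOn_cross ht
  have hdt : ∀ i, ContDiffOn ℝ ∞ (fun y => fderiv ℝ (fun y => t y i) y) L.W := fun i =>
    (ht i).fderiv_of_isOpen L.isOpen (by simp)
  set α' : Fin 3 → Fin 3 → OneForm n := fun i j y => L.α i j y
    - ∑ k, cross (t y) k j • X i k y with hα'
  set β' : Fin 3 → OneForm n := fun i y => L.β i y + ∑ k, cross (t y) i k • L.om k y with hβ'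
  set τ' : Fin 3 → OneForm n := fun i y => τ i y + fderiv ℝ (fun y => t y i) y
    - (t y i • ∑ k, L.α k k y - ∑ k, t y k • L.α i k y) - t y i • ∑ k, t y k • L.θ k y with hτ'
  have e3 : ∀ w v, (fun i j => α' i j w v) = fun i j => ((of fun i j => L.α i j w v)
      - cross (fun i => L.θ i w v) * cross (t w)) i j := by
    intro w v; funext i j
    simp [hα', hXa, Matrix.mul_apply, mul_comm]
  have e4 : ∀ w v, (fun i => β' i w v) = (fun i => L.β i w v)
      + cross (t w) *ᵥ (fun i => L.om i w v) := by
    intro w v; funext i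
    simp [hβ', mulVec, dotProduct]
  have e5 : ∀ w v, (fun i => τ' i w v) = (fun i => τ i w v) +
      (fun i => fderiv ℝ (fun y => t y i) w v)
      - ((of fun i j => L.α i j w v).trace • t w - (of fun i j => L.α i j w v) *ᵥ t w)
      - (t w ⬝ᵥ (fun i => L.θ i w v)) • t w := by
    intro w v; funext i
    simp [hτ', mulVec, Matrix.trace, dotProduct, mul_comm]
  have hτs : ∀ i, ContDiffOn ℝ ∞ (τ' i) L.W := fun i =>
    (((hτ i).add (hdt i)).sub (((ht i).smul (ContDiffOn.sum fun k _ => L.smooth_α k k)).sub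
      (ContDiffOn.sum fun k _ => (ht k).smul (L.smooth_α i k)))).sub
      ((ht i).smul (ContDiffOn.sum fun k _ => (ht k).smul (L.smooth_θ k)))
  obtain ⟨L', h1, h2, h3, h4, h5, h6, h7⟩ := L.exists_gauge hτ (θ' := L.θ) (om' := L.om) (α' := α')
    (β' := β') (τ' := τ') L.smooth_θ L.smooth_om
    (fun i j => (L.smooth_α i j).sub (ContDiffOn.sum fun k _ => (hcr k j).smul (hXs i k)))
    (fun i => (L.smooth_β i).add (ContDiffOn.sum fun k _ => (hcr i k).smul (L.smooth_om k))) hτs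
    (fun w hw v => Iff.rfl)
    (fun w hw v h i => h i)
    (P := fun y => 1) (S := fun y => cross (t y)) (R := fun y => 1) (r := fun y => 1)
    (p := fun y => 0) (q := fun y => 0) (fun i j => contDiffOn_const)
    hcr (fun i j => contDiffOn_const)
    (fun i => contDiffOn_const) (fun i => contDiffOn_const)
    (fun w hw => Matrix.one_mul _)
    (fun w hw v => by
      have key := gauge_unipotent (t w) (fun i => fderiv ℝ (fun y => t y i) w v)
        (of fun i j => L.α i j w v) (fun i => L.θ i w v) (fun i => L.om i w v)
        (fun i => L.β i w v) (fun i => τ i w v)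
      rw [e3, e4, e5]
      have z1 : (of fun i j : Fin 3 =>
          fderiv ℝ (fun _ : Euc n => (1 : Mat3) i j) w v) = 0 := by
        ext i j; simp
      have z2 : (fun i : Fin 3 => fderiv ℝ (fun _ : Euc n => (0 : V3) i) w v) = 0 := by
        funext i; simp
      have z4 : (of fun i j : Fin 3 =>
          fderiv ℝ (fun y : Euc n => cross (t y) i j) w v) =
          cross (fun i => fderiv ℝ (fun y => t y i) w v) := by
        ext i j
        fin_cases i <;> fin_cases j <;> simp [cross]
      rw [z1, z2, z4]
      exact key)
  refine ⟨L', τ', hτs, h1, h2, h3, h4, fun w _ v i j => ?_, fun w _ v i => ?_,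
    fun w hw v₁ v₂ i j => ?_⟩
  · rw [h5]
    exact congrFun (congrFun (e3 w v) i) j
  · rw [h6]
    exact congrFun (e4 w v) i
  · have := h7 w hw v₁ v₂
    rw [Matrix.one_mul, Matrix.mul_one] at this
    exact congrFun (congrFun this i) j

end GaugeLift

lemma IsNondegenerate.finrank_eq_three [IsManifold (𝓡 6) ∞ M] (hD : IsNondegenerate D) (x : M) :
    finrank ℝ (D x) = 3 := by
  obtain ⟨U, -, hx, X, -, h⟩ := hD x
  obtain ⟨h1, h2⟩ := h x hx
  rw [← h1]
  have h3 : LinearIndependent ℝ (fun i => X i x) := by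
    have := h2.comp (Fin.castLE (show 3 ≤ 6 by norm_num)) (Fin.castLE_injective _)
    convert this using 1
    funext i
    fin_cases i <;> rfl
  rw [finrank_span_eq_card h3, Fintype.card_fin]

/-- The differential of the projection of a lift. -/
def Lift.df (w : Euc n) : Euc n →L[ℝ] Euc 6 := mfderiv (𝓡 n) (𝓡 6) L.f w

lemma Lift.df_eq_zero_iff (hw : w ∈ L.W) (v : Euc n) :
    L.df w v = 0 ↔ (∀ i, L.θ i w v = 0) ∧ ∀ i, L.om i w v = 0 :=
  (L.coframe w hw v).symm

lemma Lift.df_surjective (hw : w ∈ L.W) : Surjective (L.df w) := L.submersion w hw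

/-- The plane field along a lift. -/
def Lift.Df (w : Euc n) : Submodule ℝ (Euc 6) := D (L.f w)

lemma Lift.decompose (hw : w ∈ L.W) {E X : Fin 3 → Euc n}
    (d1 : ∀ i j, L.θ i w (E j) = delta i j) (d2 : ∀ i j, L.θ i w (X j) = 0)
    (d3 : ∀ i j, L.om i w (E j) = 0) (d4 : ∀ i j, L.om i w (X j) = delta i j) (v : Euc n) :
    ∃ u : Euc n, L.df w u = 0 ∧ v = u + ∑ a, L.θ a w v • E a + ∑ a, L.om a w v • X a := by
  refine ⟨v - ∑ a, L.θ a w v • E a - ∑ a, L.om a w v • X a,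
    (L.df_eq_zero_iff hw _).2 ⟨fun k => ?_, fun k => ?_⟩, by abel⟩ <;>
  · simp only [map_sub, map_sum, map_smul, d1, d2, d3, d4, smul_eq_mul]
    revert k
    refine forall_fin3 ?_ ?_ ?_ <;> simp only [sum_univ_three, delta_vals] <;> ring

lemma Lift.theta_eq_zero_iff (hw : w ∈ L.W) (hD : finrank ℝ (D (L.f w)) = 3) (v : Euc n) :
    (∀ i, L.θ i w v = 0) ↔ L.df w v ∈ L.Df w := by
  refine ⟨fun h => ?_, fun h => L.annihilates w hw v h⟩
  obtain ⟨E, X, -, -, hd⟩ := L.exists_dual_frame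
  obtain ⟨d1, d2, d3, d4⟩ := hd w hw
  have key : ∀ v, (∀ i, L.θ i w v = 0) →
      L.df w v ∈ Submodule.span ℝ (Set.range fun i => L.df w (X i w)) := by
    intro v hv
    obtain ⟨u, hu, e⟩ := L.decompose hw d1 d2 d3 d4 v
    rw [e]
    simp only [hv, zero_smul, sum_const_zero, add_zero, map_add, map_sum, map_smul]
    rw [hu, zero_add]
    exact Submodule.sum_mem _ fun i _ => Submodule.smul_mem _ _ (Submodule.subset_span ⟨i, rfl⟩)
  have hS : L.Df w ≤ Submodule.span ℝ (Set.range fun i => L.df w (X i w)) := by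
    intro d hd
    obtain ⟨v, rfl⟩ := L.df_surjective hw d
    exact key v (L.annihilates w hw v hd)
  have hS' := Submodule.eq_of_le_of_finrank_le hS (by
    refine le_trans ((finrank_range_le_card _).trans (by simp)) (le_of_eq hD.symm))
  rw [hS']
  exact key v h

lemma Lift.df_eq {L L' : Lift D n} (hf : ∀ w ∈ L.W, L'.f w = L.f w) (hw : w ∈ L.W) : L'.df w = L.df w := by
  have : L'.f =ᶠ[nhds w] L.f := by
    filter_upwards [L.isOpen.mem_nhds hw] with y hy using hf y hy
  exact this.mfderiv_eq

lemma Lift.At_congr {L L' : Lift D n}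
    (h1 : ∀ w ∈ L.W, ∀ v i, L'.θ i w v = L.θ i w v) (h2 : ∀ w ∈ L.W, ∀ v i, L'.om i w v = L.om i w v)
    (h3 : ∀ w ∈ L.W, ∀ v i j, L'.α i j w v = L.α i j w v)
    (h4 : ∀ w ∈ L.W, ∀ v i, L'.β i w v = L.β i w v) (hw : w ∈ L.W) (i j : Fin 3)
    (v₁ v₂ : Euc n) : L'.At τ i j w v₁ v₂ = L.At τ i j w v₁ v₂ := by
  have : extD (L'.α i j) w v₁ v₂ = extD (L.α i j) w v₁ v₂ :=
    extD_congr_on L.isOpen (fun y hy v => h3 y hy v i j) hw _ _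
  simp only [Lift.At, Lift.A, wedge, h1 w hw, h2 w hw, h3 w hw, h4 w hw, this]

lemma Lift.extD_θ_of_dual (hw : w ∈ L.W) {X : Fin 3 → Euc n}
    (d2 : ∀ i j, L.θ i w (X j) = 0) (d4 : ∀ i j, L.om i w (X j) = delta i j) (i p q : Fin 3) :
    extD (L.θ i) w (X p) (X q) = 2 * eps i p q := by
  rw [L.dθ_eq w hw]
  simp only [wedge, d2, d4]
  revert i p q
  (repeat' refine forall_fin3 ?_ ?_ ?_) <;>
  simp only [sum_univ_three, eps_vals, delta_vals] <;> ring

lemma Lift.skew_of_theta_eq {L L' : Lift D n} (hW : L'.W = L.W)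
    (h1 : ∀ w ∈ L.W, ∀ v i, L'.θ i w v = L.θ i w v) {q : Fin 3 → Fin 3 → Euc n → ℝ}
    (hq : ∀ i j, ContDiffOn ℝ ∞ (q i j) L.W)
    (h2 : ∀ w ∈ L.W, ∀ v i, L'.om i w v = L.om i w v + ∑ j, q i j w * L.θ j w v) (hw : w ∈ L.W) (i j : Fin 3) : q i j w = -q j i w := by
  have hw' : w ∈ L'.W := hW ▸ hw
  obtain ⟨E, X, hE, hX, hd⟩ := L.exists_dual_frame
  obtain ⟨d1, d2, d3, d4⟩ := hd w hw
  have hdθ := L.extD_θ_of_dual hw d2 d4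
  refine skew_of_structure_eq (fun i j p => L'.α i j w (X p w) - L.α i j w (X p w))
    (fun i j => q i j w) (fun i m p => ?_) (fun i p r => ?_) i j
  · have e : extD (L'.θ i) w (X p w) (E m w) = extD (L.θ i) w (X p w) (E m w) :=
      extD_congr_on L.isOpen (fun y hy v => h1 y hy v i) hw _ _
    rw [L.dθ_eq w hw, L'.dθ_eq w hw'] at e
    simp only [wedge, h1 w hw, h2 w hw, d1, d2, d3, d4, mul_zero, sum_const_zero,
      add_zero, sub_zero, zero_add, zero_mul] at e
    revert i m p
    (repeat' refine forall_fin3 ?_ ?_ ?_) <;> intro e <;>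
    simp only [sum_univ_three, eps_vals, delta_vals] at e ⊢ <;> linarith
  · have hqd : ∀ i j, DifferentiableAt ℝ (q i j) w := fun i j =>
      L.diffAt hw (hq i j)
    have hθd : ∀ i, DifferentiableAt ℝ (L.θ i) w := fun i =>
      L.diffAt hw (L.smooth_θ i)
    have e : extD (L'.om i) w (X p w) (X r w) =
        extD (L.om i + fun y => ∑ j, q i j y • L.θ j y) w (X p w) (X r w) :=
      extD_congr_on L.isOpen (fun y hy v => by
          simp only [Pi.add_apply, add_apply, sum_apply, smul_apply, smul_eq_mul]
          exact h2 y hy v i) hw _ _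
    rw [extD_add (L.diffAt hw (L.smooth_om i))
      (DifferentiableAt.fun_sum fun j _ => (hqd i j).fun_smul (hθd j)),
      extD_fun_sum _ (fun j _ => (hqd i j).fun_smul (hθd j)), L.dω_eq w hw, L'.dω_eq w hw'] at e
    simp only [fun j => extD_fun_smul (hqd i j) (hθd j), d2, hdθ, wedge, h1 w hw, h2 w hw, d4,
      mul_zero, sum_const_zero, add_zero, sub_zero, zero_sub, neg_zero, zero_add] at e
    revert p r
    (repeat' refine forall_fin3 ?_ ?_ ?_) <;>
    intro e <;>
    simp only [sum_univ_three, eps_vals, delta_vals] at e ⊢ <;> linarith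

lemma Lift.exists_unipotent {L L' : Lift D n} (hW : L'.W = L.W)
    (h1 : ∀ w ∈ L.W, ∀ v i, L'.θ i w v = L.θ i w v)
    (h2 : ∀ w ∈ L.W, ∀ v i, L'.om i w v = L.om i w v) (hτ : ∀ i, ContDiffOn ℝ ∞ (τ i) L.W) :
    ∃ τ' : Fin 3 → OneForm n, (∀ i, ContDiffOn ℝ ∞ (τ' i) L.W) ∧
      ∀ w ∈ L.W, ∀ v₁ v₂ i j, L'.At τ' i j w v₁ v₂ = L.At τ i j w v₁ v₂ := by
  obtain ⟨E, X, hE, hX, hd⟩ := L.exists_dual_frame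
  have hb : ∀ i j, ContDiffOn ℝ ∞ (fun y => L'.β i y (X j y) - L.β i y (X j y)) L.W := fun i j =>
    ((hW ▸ L'.smooth_β i).clm_apply (hX j)).sub ((L.smooth_β i).clm_apply (hX j))
  set t : Euc n → V3 := fun y => ![L'.β 2 y (X 1 y) - L.β 2 y (X 1 y),
    L'.β 0 y (X 2 y) - L.β 0 y (X 2 y), L'.β 1 y (X 0 y) - L.β 1 y (X 0 y)] with ht
  have hts : ∀ i, ContDiffOn ℝ ∞ (fun y => t y i) L.W := forall_fin3 (hb 2 1) (hb 0 2) (hb 1 0)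
  have key : ∀ w ∈ L.W,
      (∀ v i j, L'.α i j w v - L.α i j w v = delta i j *
        (t w 0 * L.θ 0 w v + t w 1 * L.θ 1 w v + t w 2 * L.θ 2 w v) - t w i * L.θ j w v) ∧
      (∀ v i, L'.β i w v - L.β i w v = ∑ j, ∑ k, eps i j k * (t w j * L.om k w v)) := by
    intro w hw
    have hw' : w ∈ L'.W := hW ▸ hw
    obtain ⟨d1, d2, d3, d4⟩ := hd w hw
    refine connection_unique (fun i => (L.θ i w).toLinearMap) (fun i => (L.om i w).toLinearMap)
      (fun i => (L'.β i w - L.β i w).toLinearMap) (fun i j => (L'.α i j w - L.α i j w).toLinearMap)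
      (fun i => E i w) (fun i => X i w) d1 d2 d3 d4 (fun u v i => ?_) (fun u v i => ?_)
    · have e : extD (L'.θ i) w u v = extD (L.θ i) w u v :=
        extD_congr_on L.isOpen (fun y hy v => h1 y hy v i) hw _ _
      rw [L.dθ_eq w hw, L'.dθ_eq w hw'] at e
      simp only [wedge, h1 w hw, h2 w hw] at e
      simp only [ContinuousLinearMap.coe_coe, sub_apply, sum_univ_three] at e ⊢
      linarith
    · have e : extD (L'.om i) w u v = extD (L.om i) w u v :=
        extD_congr_on L.isOpen (fun y hy v => h2 y hy v i) hw _ _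
      rw [L.dω_eq w hw, L'.dω_eq w hw'] at e
      simp only [wedge, h1 w hw, h2 w hw] at e
      simp only [ContinuousLinearMap.coe_coe, sub_apply, sum_univ_three] at e ⊢
      linarith
  obtain ⟨L₁, τ₁, hτ₁, g1, g2, g3, g4, g5, g6, g7⟩ := L.exists_gauge_unipotent hτ hts
  refine ⟨τ₁, hτ₁, fun w hw v₁ v₂ i j => ?_⟩
  rw [← g7 w hw]
  refine Lift.At_congr (L := L₁) (L' := L') ?_ ?_ ?_ ?_ (g1.symm ▸ hw) i j v₁ v₂
  · intro w hw v i
    rw [g1] at hw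
    rw [g3, h1 w hw]
  · intro w hw v i
    rw [g1] at hw
    rw [g4, h2 w hw]
  · intro w hw v i j
    rw [g1] at hw
    have := (key w hw).1 v i j
    rw [g5 w hw]
    revert i j
    (repeat' refine forall_fin3 ?_ ?_ ?_) <;> intro e <;>
    simp only [sum_univ_three, delta_vals, cross, of_apply, cons_val] at e ⊢ <;>
    linarith
  · intro w hw v i
    rw [g1] at hw
    have := (key w hw).2 v i
    rw [g6 w hw]
    revert i
    refine forall_fin3 ?_ ?_ ?_ <;> intro e <;>
    simp only [sum_univ_three, eps_vals, cross, of_apply, cons_val] at e ⊢ <;>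
    linarith

lemma Lift.exists_compare (hD : ∀ x, finrank ℝ (D x) = 3) {L L' : Lift D n}
    (hW : L'.W = L.W) (hf : ∀ w ∈ L.W, L'.f w = L.f w) (hτ : ∀ i, ContDiffOn ℝ ∞ (τ i) L.W) :
    ∃ (G : Euc n → Mat3) (τ' : Fin 3 → OneForm n),
      (∀ i, ContDiffOn ℝ ∞ (τ' i) L.W) ∧ (∀ w ∈ L.W, (G w).det ≠ 0) ∧
      (∀ w ∈ L.W, ∀ v i, L'.θ i w v = ∑ l, (G w).adjugate l i * L.θ l w v) ∧
      (∀ w ∈ L.W, ∀ v, (∀ i, L.θ i w v = 0) → ∀ i, L'.om i w v = ∑ j, G w i j * L.om j w v) ∧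
      ∀ w ∈ L.W, ∀ v₁ v₂, (G w)⁻¹ * (of fun i j => L'.At τ' i j w v₁ v₂) =
        (of fun i j => L.At τ i j w v₁ v₂) * (G w)⁻¹ := by
  obtain ⟨E, X, hE, hX, hd⟩ := L.exists_dual_frame
  have hθ0 : ∀ w ∈ L.W, ∀ v, (∀ i, L.θ i w v = 0) → ∀ i, L'.θ i w v = 0 := by
    intro w hw v h
    have h1 := (L.theta_eq_zero_iff hw (hD _) v).1 h
    have h2 := L'.annihilates w (hW ▸ hw) v
    refine h2 ?_
    have e : L'.Df w = L.Df w := by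
      unfold Lift.Df
      rw [hf w hw]
    change L'.df w v ∈ L'.Df w
    rw [e, Lift.df_eq hf hw]
    exact h1
  have hvert : ∀ w ∈ L.W, ∀ u, L.df w u = 0 →
      (∀ i, L'.θ i w u = 0) ∧ ∀ i, L'.om i w u = 0 := by
    intro w hw u hu
    rw [← Lift.df_eq hf hw] at hu
    exact (L'.df_eq_zero_iff (hW ▸ hw) u).1 hu
  have hvert' : ∀ w ∈ L.W, ∀ u, ((∀ i, L'.θ i w u = 0) ∧ ∀ i, L'.om i w u = 0) →
      L.df w u = 0 := by
    intro w hw u hu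
    rw [← Lift.df_eq hf hw]
    exact (L'.df_eq_zero_iff (hW ▸ hw) u).2 hu
  set G : Euc n → Mat3 := fun y => of fun i j => L'.om i y (X j y)
    with hG
  have hGs : ∀ i j, ContDiffOn ℝ ∞ (fun y => G y i j) L.W := fun i j =>
    (hW ▸ L'.smooth_om i).clm_apply (hX j)
  have hθ : ∀ w ∈ L.W, ∀ v i, L'.θ i w v = ∑ l, L'.θ i w (E l w) * L.θ l w v := by
    intro w hw v i
    obtain ⟨d1, d2, d3, d4⟩ := hd w hw
    obtain ⟨u, hu, e⟩ := L.decompose hw d1 d2 d3 d4 v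
    conv_lhs => rw [e]
    simp [(hvert w hw u hu).1, hθ0 w hw _ (fun i => d2 i _), mul_comm]
  have hom : ∀ w ∈ L.W, ∀ v i, L'.om i w v = ∑ j, G w i j * L.om j w v
      + ∑ l, L'.om i w (E l w) * L.θ l w v := by
    intro w hw v i
    obtain ⟨d1, d2, d3, d4⟩ := hd w hw
    obtain ⟨u, hu, e⟩ := L.decompose hw d1 d2 d3 d4 v
    conv_lhs => rw [e]
    simp [(hvert w hw u hu).2, hG, mul_comm]
    ring
  have hdet : ∀ w ∈ L.W, (G w).det ≠ 0 := by
    intro w hw h0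
    obtain ⟨d1, d2, d3, d4⟩ := hd w hw
    obtain ⟨c, hc, hGc⟩ := Matrix.exists_mulVec_eq_zero_iff.2 h0
    apply hc
    have h := hvert' w hw (∑ j, c j • X j w) ⟨hθ0 w hw _ fun i => by simp [d2], fun i => by
      have := congrFun hGc i
      simpa [mulVec, dotProduct, hG, mul_comm] using this⟩
    have h' := ((L.df_eq_zero_iff hw _).1 h).2
    funext i
    have := h' i
    simp only [map_sum, map_smul, d4, smul_eq_mul] at this
    revert i
    refine forall_fin3 ?_ ?_ ?_ <;> intro this <;>
    simpa only [sum_univ_three, delta_vals, mul_one, mul_zero, add_zero, zero_add,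
      Pi.zero_apply] using this
  have hadj : ∀ w ∈ L.W, ∀ i l, L'.θ i w (E l w) = (G w).adjugate l i := by
    intro w hw i l
    obtain ⟨d1, d2, d3, d4⟩ := hd w hw
    have hw' : w ∈ L'.W := hW ▸ hw
    have hdθ := L.extD_θ_of_dual hw d2 d4
    have hqd : ∀ i j, DifferentiableAt ℝ (fun y => L'.θ i y (E j y)) w := fun i j =>
      ((L'.contDiffAt_θ hw' i).clm_apply
        ((hE j).contDiffAt (L.isOpen.mem_nhds hw))).diffAt
    have hθd : ∀ i, DifferentiableAt ℝ (L.θ i) w := fun i =>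
      L.diffAt hw (L.smooth_θ i)
    have e : ∀ p q, extD (L'.θ i) w (X p w) (X q w) =
        extD (fun y => ∑ l, L'.θ i y (E l y) • L.θ l y) w (X p w) (X q w) := by
      intro p q
      apply extD_congr
      filter_upwards [L.isOpen.mem_nhds hw] with y hy
      ext v
      simp only [sum_apply, smul_apply, smul_eq_mul]
      exact hθ y hy v i
    simp only [extD_fun_sum _ (fun j _ => (hqd i j).fun_smul (hθd j)), L'.dθ_eq w hw',
      fun j => extD_fun_smul (hqd i j) (hθd j), d2, hdθ, wedge,
      hθ0 w hw _ (fun i => d2 i _), mul_zero, sum_const_zero, sub_zero, zero_add,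
      neg_zero] at e
    have hGa : ∀ i j, L'.om i w (X j w) = G w i j := fun i j => rfl
    simp only [hGa] at e
    have e0 := e 1 2
    have e1 := e 2 0
    have e2 := e 0 1
    simp only [Matrix.adjugate_fin_three, of_apply]
    clear hqd e
    revert i l
    refine forall_fin3 ?_ ?_ ?_ <;> intro l e0 e1 e2 <;>
    simp only [sum_univ_three, eps_vals] at e0 e1 e2 <;> revert l <;>
    refine forall_fin3 ?_ ?_ ?_ <;> simp only [cons_val] <;> linarith
  obtain ⟨L₁, τ₁, hτ₁, g1, g2, g3, g4, g5⟩ := L.exists_gauge_linear hτ hGs hdet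
  have hW₁ : L'.W = L₁.W := hW.trans g1.symm
  have hf₁ : ∀ w ∈ L₁.W, L'.f w = L₁.f w := fun w hw => by rw [g2, hf w (g1 ▸ hw)]
  have hθ₁ : ∀ w ∈ L₁.W, ∀ v i, L'.θ i w v = L₁.θ i w v := by
    intro w hw v i
    rw [g3 w (g1 ▸ hw), hθ w (g1 ▸ hw)]
    simp only [hadj w (g1 ▸ hw)]
  obtain ⟨E₁, X₁, hE₁, hX₁, hd₁⟩ := L₁.exists_dual_frame
  have hom₁ : ∀ w ∈ L₁.W, ∀ v i, L'.om i w v = L₁.om i w v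
      + ∑ j, L'.om i w (E₁ j w) * L₁.θ j w v := by
    intro w hw v i
    obtain ⟨d1, d2, d3, d4⟩ := hd₁ w hw
    obtain ⟨u, hu, e⟩ := L₁.decompose hw d1 d2 d3 d4 v
    have hX' : ∀ v, (∀ i, L₁.θ i w v = 0) → L'.om i w v = L₁.om i w v := by
      intro v hv
      have hL : ∀ l, L.θ l w v = 0 := by
        have := (adjugate_transpose_mulVec_eq_zero (x := fun l => L.θ l w v)
          (nonsing_inv_mul _ (isUnit_iff_ne_zero.2 (hdet w (g1 ▸ hw))))).1 (by
            funext i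
            have := hv i
            rw [g3 w (g1 ▸ hw)] at this
            simpa [mulVec, dotProduct] using this)
        exact fun l => congrFun this l
      rw [hom w (g1 ▸ hw), g4 w (g1 ▸ hw)]
      simp [hL]
    have e1 : v = (u + ∑ a, L₁.om a w v • X₁ a w) + ∑ a, L₁.θ a w v • E₁ a w := by
      conv_lhs => rw [e]
      abel
    have e2 : L'.om i w (u + ∑ a, L₁.om a w v • X₁ a w) =
        L₁.om i w (u + ∑ a, L₁.om a w v • X₁ a w) := by
      refine hX' _ fun i => ?_
      have := ((L₁.df_eq_zero_iff hw u).1 hu).1 i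
      simp [this, d2]
    conv_lhs => rw [e1, map_add, e2]
    have e3 : L₁.om i w v = L₁.om i w (u + ∑ a, L₁.om a w v • X₁ a w) := by
      conv_lhs => rw [e1]
      simp [d3]
    rw [← e3]
    simp [mul_comm]
  have hqs : ∀ i j, ContDiffOn ℝ ∞ (fun y => L'.om i y (E₁ j y)) L₁.W := fun i j =>
    (hW₁ ▸ L'.smooth_om i).clm_apply (hE₁ j)
  have hskew := fun w hw => Lift.skew_of_theta_eq (q := fun i j y => L'.om i y (E₁ j y)) hW₁ hθ₁
    hqs hom₁ (w := w) hw
  obtain ⟨L₂, τ₂, hτ₂, k1, k2, k3, k4, k5⟩ := L₁.exists_gauge_translation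
    (τ := τ₁) (fun i => g1.symm ▸ hτ₁ i)
    (p := fun y => ![L'.om 1 y (E₁ 2 y), L'.om 2 y (E₁ 0 y), L'.om 0 y (E₁ 1 y)])
    (forall_fin3 (hqs 1 2) (hqs 2 0) (hqs 0 1))
  have hW₂ : L'.W = L₂.W := hW₁.trans k1.symm
  obtain ⟨τ₃, hτ₃, m1⟩ := Lift.exists_unipotent (L := L₂) (L' := L') (τ := τ₂) hW₂
    (fun w hw v i => by rw [k3]; exact hθ₁ w (k1 ▸ hw) v i)
    (fun w hw v i => by
      have hw₁ : w ∈ L₁.W := k1 ▸ hw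
      rw [k4 w hw₁, hom₁ w hw₁ v]
      have s := hskew w hw₁
      have z : ∀ i, L'.om i w (E₁ i w) = 0 := fun i => by linarith [s i i]
      congr 1
      revert i
      refine forall_fin3 ?_ ?_ ?_ <;>
      simp only [sum_univ_three, cross, of_apply, cons_val, z, s 0 2, s 1 0, s 2 1] <;> ring)
    (fun i => k1.symm ▸ hτ₂ i)
  refine ⟨G, τ₃, fun i => ?_, hdet, fun w hw v i => ?_, fun w hw v h i => ?_,
    fun w hw v₁ v₂ => ?_⟩
  · have := hτ₃ i
    rwa [k1, g1] at this
  · rw [hθ w hw]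
    simp only [hadj w hw]
  · rw [hom w hw]
    simp [h]
  · rw [← g5 w hw]
    congr 1
    ext i j
    simp only [of_apply]
    rw [m1 w (by rw [k1, g1]; exact hw), k5 w (by rw [g1]; exact hw)]

section Pullback

variable {m : ℕ}

/-- The pull-back of a `1`-form. -/
def pull (s : Euc m → Euc n) (a : OneForm n) : OneForm m := fun y => (a (s y)).comp (fderiv ℝ s y)

lemma contDiffOn_pull {s : Euc m → Euc n} {a : OneForm n} {V : Set (Euc m)} {W : Set (Euc n)}
    (hV : IsOpen V) (hs : ContDiffOn ℝ ∞ s V) (h : MapsTo s V W) (ha : ContDiffOn ℝ ∞ a W) :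
    ContDiffOn ℝ ∞ (pull s a) V :=
  (ha.comp hs h).clm_comp (hs.fderiv_of_isOpen hV (by simp))

lemma extD_pull {s : Euc m → Euc n} {a : OneForm n} {y : Euc m} (hs : ContDiffAt ℝ ∞ s y)
    (ha : DifferentiableAt ℝ a (s y)) (v₁ v₂ : Euc m) :
    extD (pull s a) y v₁ v₂ = extD a (s y) (fderiv ℝ s y v₁) (fderiv ℝ s y v₂) := by
  have hd : DifferentiableAt ℝ s y := hs.diffAt
  have hds : DifferentiableAt ℝ (fderiv ℝ s) y :=
    ((hs.of_le two_le_infty).fderiv_right (m := 1) (by norm_num)).differentiableAt (by simp)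
  have hc : DifferentiableAt ℝ (fun z => a (s z)) y := ha.comp y hd
  have hp : DifferentiableAt ℝ (pull s a) y := hc.clm_comp hds
  have hsymm : IsSymmSndFDerivAt ℝ s y := hs.isSymmSndFDerivAt (by
    rw [minSmoothness_of_isRCLikeNormedField]; exact two_le_infty)
  have key : ∀ u v, fderiv ℝ (pull s a) y u v =
      fderiv ℝ a (s y) (fderiv ℝ s y u) (fderiv ℝ s y v)
        + a (s y) (fderiv ℝ (fderiv ℝ s) y u v) := by
    intro u v
    have h1 : HasFDerivAt (pull s a) _ y := hc.hasFDerivAt.clm_comp hds.hasFDerivAt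
    rw [h1.fderiv]
    have h2 : fderiv ℝ (fun z => a (s z)) y = (fderiv ℝ a (s y)).comp (fderiv ℝ s y) :=
      fderiv_comp y ha hd
    rw [h2]
    simp [add_comm]
  rw [extD_eq _ _ _ _ hp, extD_eq _ _ _ _ ha, key, key, hsymm.eq v₁ v₂]
  ring

lemma Lift.mdifferentiableAt (hw : w ∈ L.W) : MDifferentiableAt (𝓡 n) (𝓡 6) L.f w :=
  ((L.smooth_f w hw).contMDiffAt (L.isOpen.mem_nhds hw)).mdifferentiableAt (by simp)

lemma Lift.mfderiv_comp {s : Euc m → Euc n} {y : Euc m}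
    (hs : DifferentiableAt ℝ s y) (hy : s y ∈ L.W) :
    (mfderiv (𝓡 m) (𝓡 6) (L.f ∘ s) y : Euc m →L[ℝ] Euc 6) = (L.df (s y)).comp (fderiv ℝ s y) := by
  have h := _root_.mfderiv_comp y (L.mdifferentiableAt hy) hs.mdifferentiableAt
  rw [mfderiv_eq_fderiv] at h
  exact h

lemma Lift.mfderiv_comp_apply {s : Euc m → Euc n} {y : Euc m}
    (hs : DifferentiableAt ℝ s y) (h : s y ∈ L.W) (v : Euc m) :
    (mfderiv (𝓡 m) (𝓡 6) (L.f ∘ s) y v : Euc 6) = L.df (s y) (fderiv ℝ s y v) :=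
  congrArg (fun l : Euc m →L[ℝ] Euc 6 => l v) (L.mfderiv_comp hs h)

/-- The pull-back of a lift. -/
def Lift.pullback (s : Euc m → Euc n) (V : Set (Euc m)) (hV : IsOpen V)
    (hs : ContDiffOn ℝ ∞ s V) (h : MapsTo s V L.W)
    (hsub : ∀ y ∈ V, Surjective ((L.df (s y)).comp (fderiv ℝ s y))) : Lift D m where
  W := V
  f := L.f ∘ s
  θ i := pull s (L.θ i)
  om i := pull s (L.om i)
  α i j := pull s (L.α i j)
  β i := pull s (L.β i)
  isOpen := hV
  smooth_f := L.smooth_f.comp hs.contMDiffOn h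
  submersion y hy := by
    have e := L.mfderiv_comp (hs.diffAt hV hy) (h hy)
    intro d
    obtain ⟨v, hv⟩ := hsub y hy d
    exact ⟨v, (congrArg (fun l : Euc m →L[ℝ] Euc 6 => l v) e).trans hv⟩
  smooth_θ i := contDiffOn_pull hV hs h (L.smooth_θ i)
  smooth_om i := contDiffOn_pull hV hs h (L.smooth_om i)
  smooth_α i j := contDiffOn_pull hV hs h (L.smooth_α i j)
  smooth_β i := contDiffOn_pull hV hs h (L.smooth_β i)
  coframe y hy v := by
    have e' := L.mfderiv_comp_apply (hs.diffAt hV hy) (h hy) v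
    refine Iff.trans (L.df_eq_zero_iff (h hy) (fderiv ℝ s y v)).symm ?_
    rw [← e']
    rfl
  annihilates y hy v hv := by
    have e' := L.mfderiv_comp_apply (hs.diffAt hV hy) (h hy) v
    refine L.annihilates (s y) (h hy) (fderiv ℝ s y v) ?_
    change L.df (s y) (fderiv ℝ s y v) ∈ L.Df (s y)
    rw [← e']
    exact hv
  dθ_eq y hy v₁ v₂ i := by
    rw [extD_pull (hs.contDiffAt (hV.mem_nhds hy))
      (L.contDiffAt_θ (h hy) i).diffAt, L.dθ_eq _ (h hy)]
    rfl
  dω_eq y hy v₁ v₂ i := by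
    rw [extD_pull (hs.contDiffAt (hV.mem_nhds hy))
      (L.contDiffAt_om (h hy) i).diffAt, L.dω_eq _ (h hy)]
    rfl

lemma Lift.IsCanonical.pullback {L : Lift D n} (hc : L.IsCanonical τ S4 S3 S2) (s : Euc m → Euc n)
    (V : Set (Euc m)) (hV : IsOpen V) (hs : ContDiffOn ℝ ∞ s V) (h : MapsTo s V L.W)
    (hsub : ∀ y ∈ V, Surjective ((L.df (s y)).comp (fderiv ℝ s y))) :
    (L.pullback s V hV hs h hsub).IsCanonical (fun i => pull s (τ i))
      (fun i k j l y => S4 i k j l (s y)) (fun i j k y => S3 i j k (s y))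
      (fun i j y => S2 i j (s y)) where
  smooth_τ i := contDiffOn_pull hV hs h (hc.smooth_τ i)
  A_eq y hy v₁ v₂ i j := by
    have e : (L.pullback s V hV hs h hsub).A i j y v₁ v₂ =
        L.A i j (s y) (fderiv ℝ s y v₁) (fderiv ℝ s y v₂) := by
      change extD (pull s (L.α i j)) y v₁ v₂ + _ + _ = _
      rw [extD_pull (hs.contDiffAt (hV.mem_nhds hy))
        (L.contDiffAt_α (h hy) i j).diffAt]
      rfl
    rw [e, hc.A_eq _ (h hy)]
    rfl
  S3_symm y hy := hc.S3_symm _ (h hy)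
  S3_trace y hy := hc.S3_trace _ (h hy)
  S4_trace y hy := hc.S4_trace _ (h hy)
  B_eq y hy v₁ v₂ i := by
    have e : (L.pullback s V hV hs h hsub).B i y v₁ v₂ =
        L.B i (s y) (fderiv ℝ s y v₁) (fderiv ℝ s y v₂) := by
      change extD (pull s (L.β i)) y v₁ v₂ - _ = _
      rw [extD_pull (hs.contDiffAt (hV.mem_nhds hy))
        (L.contDiffAt_β (h hy) i).diffAt]
      rfl
    rw [e, hc.B_eq _ (h hy)]
    rfl

lemma Lift.exists_section [IsManifold (𝓡 6) ∞ M] (L : Lift D n) {w₀ : Euc n} (hw₀ : w₀ ∈ L.W) :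
    ∃ (V : Set (Euc 6)) (s : Euc 6 → Euc n), IsOpen V ∧
      chartAt (Euc 6) (L.f w₀) (L.f w₀) ∈ V ∧ V ⊆ (chartAt (Euc 6) (L.f w₀)).target ∧
      ContDiffOn ℝ ∞ s V ∧ MapsTo s V L.W ∧ s (chartAt (Euc 6) (L.f w₀) (L.f w₀)) = w₀ ∧
      (∀ y ∈ V, L.f (s y) = (chartAt (Euc 6) (L.f w₀)).symm y) ∧
      ∀ y ∈ V, Surjective ((L.df (s y)).comp (fderiv ℝ s y)) := by
  set e := chartAt (Euc 6) (L.f w₀) with he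
  have hesrc : L.f w₀ ∈ e.source := mem_chart_source _ _
  have heat : e ∈ maxAtlas M := IsManifold.chart_mem_maximalAtlas _
  set O : Set (Euc n) := L.W ∩ L.f ⁻¹' e.source with hO
  have hOo : IsOpen O := L.smooth_f.continuousOn.isOpen_inter_preimage L.isOpen e.open_source
  have hOw : w₀ ∈ O := ⟨hw₀, hesrc⟩
  have hemd : ∀ x ∈ e.source, MDifferentiableAt (𝓡 6) (𝓡 6) e x := fun x hx =>
    ((contMDiffOn_of_mem_maximalAtlas heat x hx).contMDiffAt (e.open_source.mem_nhds hx)).mdifferentiableAt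
      (by simp)
  set F : Euc n → Euc 6 := fun w => e (L.f w) with hF
  have hFs : ContDiffOn ℝ ∞ F O := by
    have := (contMDiffOn_of_mem_maximalAtlas heat).comp (L.smooth_f.mono Set.inter_subset_left)
      (fun w hw => hw.2)
    exact this.contDiffOn
  let K : Euc n → (Euc 6 →L[ℝ] Euc 6) := fun w => mfderiv (𝓡 6) (𝓡 6) e (L.f w)
  have hFd : ∀ w ∈ O, fderiv ℝ F w = (K w).comp (L.df w) := by
    intro w hw
    have h := _root_.mfderiv_comp w (hemd _ hw.2) (L.mdifferentiableAt hw.1)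
    rw [mfderiv_eq_fderiv] at h
    exact h
  have hsurj : Surjective (fderiv ℝ F w₀) := by
    rw [hFd w₀ hOw]
    have hinj : Surjective (mfderiv (𝓡 6) (𝓡 6) e (L.f w₀)) := by
      have hsy : MDifferentiableAt (𝓡 6) (𝓡 6) e.symm (e (L.f w₀)) :=
        ((contMDiffOn_symm_of_mem_maximalAtlas heat _ (e.map_source hesrc)).contMDiffAt
          (e.open_target.mem_nhds (e.map_source hesrc))).mdifferentiableAt (by simp)
      have hh : MDifferentiableAt (𝓡 6) (𝓡 6) e (e.symm (e (L.f w₀))) := by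
        rw [e.left_inv hesrc]; exact hemd _ hesrc
      have h1 := _root_.mfderiv_comp (e (L.f w₀)) hh hsy
      have h2 : (e ∘ e.symm) =ᶠ[nhds (e (L.f w₀))] id := by
        filter_upwards [e.open_target.mem_nhds (e.map_source hesrc)] with y hy
        exact e.right_inv hy
      rw [h2.mfderiv_eq, mfderiv_id] at h1
      rw [e.left_inv hesrc] at h1
      intro d
      refine ⟨mfderiv (𝓡 6) (𝓡 6) e.symm (e (L.f w₀)) d, ?_⟩
      exact (congrArg (fun l : Euc 6 →L[ℝ] Euc 6 => l d) h1).symm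
    exact hinj.comp (L.df_surjective hw₀)
  obtain ⟨j, hj⟩ := (fderiv ℝ F w₀).exists_rightInverse_of_surjective
    (LinearMap.range_eq_top.2 hsurj)
  set φ : Euc 6 → Euc n := fun u => w₀ + j u with hφ
  have hφ0 : φ 0 = w₀ := by simp [hφ]
  have hφs : ContDiff ℝ ∞ φ := contDiff_const.add j.contDiff
  have hφd : HasFDerivAt φ j 0 := by
    have := (j.hasFDerivAt (x := (0 : Euc 6))).const_add w₀
    exact this
  have hFφs : ContDiffAt ℝ ∞ (F ∘ φ) 0 := by
    refine ContDiffAt.comp (0 : Euc 6) ?_ hφs.contDiffAt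
    rw [hφ0]
    exact hFs.contDiffAt (hOo.mem_nhds hOw)
  have hFφd : HasFDerivAt (F ∘ φ) ((ContinuousLinearEquiv.refl ℝ (Euc 6)) : Euc 6 →L[ℝ] Euc 6) 0 := by
    have h1 : HasFDerivAt F (fderiv ℝ F w₀) (φ 0) := by
      rw [hφ0]
      exact (hFs.diffAt hOo hOw).hasFDerivAt
    have := h1.comp (0 : Euc 6) hφd
    rw [hj] at this
    exact this
  have h1n : (∞ : WithTop ℕ∞) ≠ 0 := by simp
  set ψ := hFφs.toOpenPartialHomeomorph (F ∘ φ) hFφd h1n with hψ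
  have hψc : (ψ : Euc 6 → Euc 6) = F ∘ φ := rfl
  have h0s : (0 : Euc 6) ∈ ψ.source := hFφs.mem_toOpenPartialHomeomorph_source hFφd h1n
  have hFφ0 : (F ∘ φ) 0 = e (L.f w₀) := by simp [hF, hφ0]
  have hψinv : ContDiffAt ℝ ∞ ψ.symm (e (L.f w₀)) := by
    have := hFφs.to_localInverse hFφd h1n
    rw [hFφ0] at this
    exact this
  have hψ0 : ψ.symm (e (L.f w₀)) = 0 := by
    rw [← hFφ0, ← hψc]
    exact ψ.left_inv h0s
  have hFφo : IsOpen (φ ⁻¹' O) := hOo.preimage hφs.continuous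
  have hFφS : ContDiffOn ℝ ∞ (F ∘ φ) (φ ⁻¹' O) := hFs.comp hφs.contDiffOn fun u hu => hu
  have hev : ∀ᶠ u in nhds (0 : Euc 6), u ∈ φ ⁻¹' O ∧
      ∃ l : Euc 6 ≃L[ℝ] Euc 6, (l : Euc 6 →L[ℝ] Euc 6) = fderiv ℝ (F ∘ φ) u := by
    have h0 : (0 : Euc 6) ∈ φ ⁻¹' O := by
      rw [Set.mem_preimage, hφ0]
      exact hOw
    refine Filter.Eventually.and (hFφo.mem_nhds h0) ?_
    have hc : ContinuousAt (fderiv ℝ (F ∘ φ)) 0 :=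
      ((hFφs.of_le two_le_infty).fderiv_right (m := 1) (by norm_num)).continuousAt
    refine hc.eventually (p := fun k => ∃ l : Euc 6 ≃L[ℝ] Euc 6, (l : Euc 6 →L[ℝ] Euc 6) = k) ?_
    rw [hFφd.fderiv]
    exact ContinuousLinearEquiv.nhds _
  have hψV : ∀ᶠ y in nhds (e (L.f w₀)), y ∈ ψ.target → ContDiffAt ℝ ∞ ψ.symm y := by
    have hc : Filter.Tendsto ψ.symm (nhds (e (L.f w₀))) (nhds 0) := hψ0 ▸ hψinv.continuousAt
    filter_upwards [hc.eventually hev] with y hy hyt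
    obtain ⟨h1, l, hl⟩ := hy
    have h2 := hFφS.contDiffAt (hFφo.mem_nhds h1)
    refine ψ.contDiffAt_symm (f₀' := l) hyt ?_ h2
    rw [hl]
    exact h2.diffAt.hasFDerivAt
  obtain ⟨V₁, hV₁, hψV⟩ := hψV.exists_mem
  have hcont : ContinuousAt (φ ∘ ψ.symm) (e (L.f w₀)) :=
    hφs.continuous.continuousAt.comp hψinv.continuousAt
  have hOpre : (φ ∘ ψ.symm) ⁻¹' O ∈ nhds (e (L.f w₀)) := by
    refine hcont.preimage_mem_nhds (hOo.mem_nhds ?_)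
    simp only [Function.comp, hψ0, hφ0]
    exact hOw
  have hψt : ψ.target ∈ nhds (e (L.f w₀)) := by
    refine ψ.open_target.mem_nhds ?_
    rw [← hFφ0, ← hψc]
    exact ψ.map_source h0s
  obtain ⟨V, hVsub, hVo, hVm⟩ := mem_nhds_iff.1 (Filter.inter_mem (Filter.inter_mem hV₁ hOpre)
    (Filter.inter_mem hψt (e.open_target.mem_nhds (e.map_source hesrc))))
  have hright : ∀ y ∈ V, F (φ (ψ.symm y)) = y := fun y hy => ψ.right_inv (hVsub hy).2.1
  have hs : ContDiffOn ℝ ∞ (φ ∘ ψ.symm) V := fun y hy =>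
    (hφs.contDiffAt.comp y (hψV y (hVsub hy).1.1 (hVsub hy).2.1)).contDiffWithinAt
  refine ⟨V, φ ∘ ψ.symm, hVo, hVm, fun y hy => (hVsub hy).2.2, hs,
    fun y hy => (hVsub hy).1.2.1, by simp [hψ0, hφ0], fun y hy => ?_, fun y hy => ?_⟩
  · have h1 := hright y hy
    have h2 : L.f ((φ ∘ ψ.symm) y) ∈ e.source := (hVsub hy).1.2.2
    rw [← e.left_inv h2]
    congr 1
  · have hyO : (φ ∘ ψ.symm) y ∈ O := (hVsub hy).1.2
    have hd : DifferentiableAt ℝ (φ ∘ ψ.symm) y :=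
      (hs.diffAt hVo hy)
    have h1 : (F ∘ (φ ∘ ψ.symm)) =ᶠ[nhds y] id := by
      filter_upwards [hVo.mem_nhds hy] with z hz using hright z hz
    have h2 := fderiv_comp y (hFs.diffAt hOo hyO) hd
    rw [h1.fderiv_eq, fderiv_id, hFd _ hyO] at h2
    have hinj : Injective ((L.df ((φ ∘ ψ.symm) y)).comp (fderiv ℝ (φ ∘ ψ.symm) y)) := by
      intro u v huv
      have e1 := congrArg (fun l : Euc 6 →L[ℝ] Euc 6 => l u) h2
      have e2 := congrArg (fun l : Euc 6 →L[ℝ] Euc 6 => l v) h2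
      simp only [ContinuousLinearMap.comp_apply] at e1 e2 huv
      rw [huv] at e1
      exact e1.trans e2.symm
    exact LinearMap.surjective_of_injective
      (f := ((L.df ((φ ∘ ψ.symm) y)).comp (fderiv ℝ (φ ∘ ψ.symm) y)).toLinearMap) hinj

end Pullback

section TensorOf

variable {P : Type*} [AddCommGroup P] [Module ℝ P]

lemma sum_prod_four {A : Type*} [AddCommMonoid A] (g : Fin 3 → Fin 3 → Fin 3 → Fin 3 → A) :
    ∑ i, ∑ j, ∑ k, ∑ l, g i j k l =
      ∑ x : Fin 3 × Fin 3 × Fin 3 × Fin 3, g x.1 x.2.1 x.2.2.1 x.2.2.2 := by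
  simp only [Fintype.sum_prod_type]

lemma tensorOf_change {b b' : Basis (Fin 3) ℝ P} {G : Mat3}
    (hG : G.det ≠ 0) (hb : ∀ i, b' i = ∑ a, G⁻¹ a i • b a)
    (S S' : Fin 3 → Fin 3 → Fin 3 → V3) (hS : ∀ i m j l, S' i m j l =
      ∑ a, ∑ k, ∑ c, ∑ d, G.det⁻¹ * (G i a * G m k * G⁻¹ c j * G⁻¹ d l) * S a k c d) :
    tensorOf b' S' = tensorOf b S := by
  have hu : IsUnit G.det := isUnit_iff_ne_zero.2 hG
  have h1 : G * G⁻¹ = 1 := mul_nonsing_inv G hu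
  have h2 : G⁻¹ * G = 1 := nonsing_inv_mul G hu
  have hba : ∀ a, b a = ∑ i, G i a • b' i := by
    intro a
    simp only [hb, Finset.smul_sum, smul_smul]
    rw [sum_comm]
    have : ∀ c, ∑ i, (G i a * G⁻¹ c i) • b c = ((1 : Mat3) c a) • b c := by
      intro c
      rw [← h2, Matrix.mul_apply, Finset.sum_smul]
      simp only [mul_comm]
    simp [this, Matrix.one_apply]
  have hco : ∀ c, b.coord c = ∑ j, G⁻¹ c j • b'.coord j := by
    intro c
    refine b'.ext fun i => ?_
    have e1 : b.coord c (b' i) = G⁻¹ c i := by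
      rw [hb]
      simp [Finsupp.single_apply]
    rw [e1]
    simp [Finsupp.single_apply]
  have hdet : b.det = G.det⁻¹ • b'.det := by
    have e : b.det = b.det b' • b'.det := AlternatingMap.eq_smul_basis_det b' b.det
    have e2 : b.toMatrix b' = G⁻¹ := by
      ext i j
      rw [Module.Basis.toMatrix_apply, hb]
      simp [Finsupp.single_apply]
    rw [e, Module.Basis.det_apply, e2, Matrix.det_nonsing_inv, Ring.inverse_eq_inv']
  unfold tensorOf
  rw [sum_prod_four, sum_prod_four]
  have key : ∀ a k c d, S a k c d •
      (((b a ⊗ₜ[ℝ] b k) ⊗ₜ[ℝ] (b.coord c ⊗ₜ[ℝ] b.coord d)) ⊗ₜ[ℝ] b.det) =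
      ∑ x : Fin 3 × Fin 3 × Fin 3 × Fin 3,
        (G.det⁻¹ * (G x.1 a * G x.2.1 k * G⁻¹ c x.2.2.1 * G⁻¹ d x.2.2.2) * S a k c d) •
        (((b' x.1 ⊗ₜ[ℝ] b' x.2.1) ⊗ₜ[ℝ] (b'.coord x.2.2.1 ⊗ₜ[ℝ] b'.coord x.2.2.2)) ⊗ₜ[ℝ]
          b'.det) := by
    intro a k c d
    rw [hba a, hba k, hco c, hco d, hdet, ← sum_prod_four (fun i m j l =>
      (G.det⁻¹ * (G i a * G m k * G⁻¹ c j * G⁻¹ d l) * S a k c d) •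
        (((b' i ⊗ₜ[ℝ] b' m) ⊗ₜ[ℝ] (b'.coord j ⊗ₜ[ℝ] b'.coord l)) ⊗ₜ[ℝ] b'.det))]
    simp only [TensorProduct.sum_tmul, TensorProduct.tmul_sum, TensorProduct.smul_tmul',
      TensorProduct.tmul_smul, smul_smul, Finset.smul_sum]
    rw [sum_prod_four, sum_prod_four]
    refine Fintype.sum_equiv ⟨fun x => (x.2.2.2, x.2.2.1, x.2.1, x.1),
      fun x => (x.2.2.2, x.2.2.1, x.2.1, x.1), fun _ => rfl, fun _ => rfl⟩ _ _ fun x => ?_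
    simp only [Equiv.coe_fn_mk, ← TensorProduct.smul_tmul', TensorProduct.tmul_smul, smul_smul]
    congr 1
    ring
  simp only [key]
  rw [sum_comm]
  refine sum_congr rfl fun x _ => ?_
  rw [hS, Finset.sum_smul.symm, sum_prod_four]

lemma eq_zero_of_tensorOf_eq_zero {b : Basis (Fin 3) ℝ P}
    {S : Fin 3 → Fin 3 → Fin 3 → V3} (h : tensorOf b S = 0) (i k j l : Fin 3) : S i k j l = 0 := by
  let mm : ∀ {A B : Type _} [AddCommGroup A] [Module ℝ A] [AddCommGroup B] [Module ℝ B],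
    (A →ₗ[ℝ] ℝ) → (B →ₗ[ℝ] ℝ) → A ⊗[ℝ] B →ₗ[ℝ] ℝ := fun f g =>
      LinearMap.mul' ℝ ℝ ∘ₗ TensorProduct.map f g
  let ev : P [⋀^Fin 3]→ₗ[ℝ] ℝ →ₗ[ℝ] ℝ :=
    { toFun := fun f => f b, map_add' := fun _ _ => rfl, map_smul' := fun _ _ => rfl }
  let Φ : TensorSpace P →ₗ[ℝ] ℝ := mm (mm (mm (b.coord i) (b.coord k))
    (mm (Module.Dual.eval ℝ P (b j)) (Module.Dual.eval ℝ P (b l)))) ev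
  have h1 := congrArg Φ h
  simpa [b.det_ne_zero, tensorOf, Φ, mm, ev, Finsupp.single_apply] using h1

end TensorOf

section Tensoriality

variable {τ τ' : Fin 3 → OneForm n}
  {S4 S4' : Fin 3 → Fin 3 → Fin 3 → Fin 3 → Euc n → ℝ}
  {S3 S3' : Fin 3 → Fin 3 → Fin 3 → Euc n → ℝ} {S2 S2' : Fin 3 → Fin 3 → Euc n → ℝ}

lemma Lift.IsCanonical.At_apply {L : Lift D n} (hc : L.IsCanonical τ S4 S3 S2)
    (hw : w ∈ L.W) (i j : Fin 3) {x v : Euc n} (hx : ∀ i, L.θ i w x = 0) :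
    L.At τ i j w x v = -∑ k, ∑ l, S4 i k j l w * (L.θ k w v * L.om l w x) := by
  rw [Lift.At, hc.A_eq w hw]
  simp only [wedge, hx, zero_mul, mul_zero, sub_zero, zero_sub, sum_const_zero, add_zero,
    mul_neg, sum_neg_distrib]
  ring

lemma Lift.IsCanonical.S4_eq {L : Lift D n} (hc : L.IsCanonical τ S4 S3 S2)
    (τ' : Fin 3 → OneForm n) (hw : w ∈ L.W) {E : Fin 3 → Euc n} {x : Euc n}
    (hE : ∀ i j, L.θ i w (E j) = delta i j)
    (hx : ∀ i, L.θ i w x = 0) {l : Fin 3} (hx' : ∀ i, L.om i w x = delta i l) (i m j : Fin 3) :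
    S4 i m j l w = -L.At τ' i j w x (E m) + 1 / 2 * delta i j * (∑ c, L.At τ' c c w x (E m))
      - 1 / 2 * delta m j * (∑ c, L.At τ' c c w x (E i)) := by
  have h : ∀ i j m, L.At τ' i j w x (E m) = -S4 i m j l w
      - delta i j * (τ' m w x - τ m w x) + delta j m * (τ' i w x - τ i w x) := by
    intro i j m
    have e : L.At τ' i j w x (E m) = L.At τ i j w x (E m)
        - delta i j * ∑ k, (τ' k w x - τ k w x) * L.θ k w (E m)
        + (τ' i w x - τ i w x) * L.θ j w (E m) := by
      simp only [Lift.At, wedge, hx, sum_univ_three]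
      ring
    rw [e, hc.At_apply hw i j hx]
    simp only [hE, hx']
    have e1 : ∑ k, ∑ d, S4 i k j d w * (delta k m * delta d l) = S4 i m j l w := by simp [delta]
    have e2 : ∑ k, (τ' k w x - τ k w x) * delta k m = τ' m w x - τ m w x := by simp [delta]
    rw [e1, e2]
    ring
  have ht := hc.S4_trace w hw
  simp only [h]
  revert i m j
  (repeat' refine forall_fin3 ?_ ?_ ?_) <;>
  simp only [sum_univ_three, delta_vals] at ht ⊢ <;>
  linarith [ht 0 l, ht 1 l, ht 2 l]

lemma Lift.IsCanonical.S4_change (hD : ∀ x, finrank ℝ (D x) = 3) {L L' : Lift D n}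
    (hc : L.IsCanonical τ S4 S3 S2) (hc' : L'.IsCanonical τ' S4' S3' S2') (hW : L'.W = L.W)
    (hf : ∀ w ∈ L.W, L'.f w = L.f w) (hw : w ∈ L.W) : ∃ G : Mat3, G.det ≠ 0 ∧
      (∀ v, (∀ i, L.θ i w v = 0) → ∀ i, L'.om i w v = ∑ j, G i j * L.om j w v) ∧
      ∀ i m j l, S4' i m j l w = ∑ a, ∑ k, ∑ c, ∑ d,
        G.det⁻¹ * (G i a * G m k * G⁻¹ c j * G⁻¹ d l) * S4 a k c d w := by
  obtain ⟨G, τ₁, -, hdet, hθ, hom, hAt⟩ := Lift.exists_compare hD hW hf hc.smooth_τ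
  have hw' : w ∈ L'.W := hW ▸ hw
  obtain ⟨E, X, -, -, hd⟩ := L'.exists_dual_frame
  obtain ⟨d1, d2, d3, d4⟩ := hd w hw'
  have hu : IsUnit (G w).det := isUnit_iff_ne_zero.2 (hdet w hw)
  have e1 : (G w) * (G w)⁻¹ = 1 := mul_nonsing_inv _ hu
  have e2 : (G w)⁻¹ * (G w) = 1 := nonsing_inv_mul _ hu
  refine ⟨G w, hdet w hw, hom w hw, ?_⟩
  have hθX : ∀ l i, L.θ i w (X l w) = 0 := by
    intro l
    have := (adjugate_transpose_mulVec_eq_zero (x := fun k => L.θ k w (X l w)) e2).1 (by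
      funext i
      have := hθ w hw (X l w) i
      rw [d2] at this
      simpa [mulVec, dotProduct] using this.symm)
    exact fun i => congrFun this i
  have homX : ∀ d l, L.om d w (X l w) = (G w)⁻¹ d l := by
    have : (G w) * (of fun d l => L.om d w (X l w)) = 1 := by
      ext i l
      rw [Matrix.mul_apply]
      have := hom w hw (X l w) (hθX l) i
      rw [d4] at this
      simp only [of_apply, ← this, delta, Matrix.one_apply]
    intro d l
    rw [Matrix.inv_eq_right_inv this]
    rfl
  have hθE : ∀ k m, L.θ k w (E m w) = (G w).det⁻¹ * G w m k := by
    have : ((G w).adjugate).transpose * (of fun k m => L.θ k w (E m w)) = 1 := by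
      ext i l
      rw [Matrix.mul_apply]
      have := hθ w hw (E l w) i
      rw [d1] at this
      simp only [of_apply, transpose_apply, ← this, delta, Matrix.one_apply]
    have h2 : (G w).det • (of fun k m => L.θ k w (E m w)) = (G w).transpose := by
      have h3 := congrArg (fun A => (G w).transpose * A) this
      simp only [← Matrix.mul_assoc, ← transpose_mul, Matrix.adjugate_mul, mul_one,
        Matrix.transpose_smul, Matrix.transpose_one, Matrix.smul_mul, one_mul] at h3
      exact h3
    intro k m
    have := congrFun (congrFun h2 k) m
    simp only [Matrix.smul_apply, of_apply, transpose_apply, smul_eq_mul] at this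
    rw [← this, inv_mul_cancel_left₀ (hdet w hw)]
  have hA : ∀ i j l m, L'.At τ₁ i j w (X l w) (E m w) =
      ∑ a, ∑ c, G w i a * (G w)⁻¹ c j * L.At τ a c w (X l w) (E m w) := by
    intro i j l m
    have h := congrArg (fun A => G w * A) (hAt w hw (X l w) (E m w))
    simp only [← Matrix.mul_assoc, e1, one_mul] at h
    have := congrFun (congrFun h i) j
    rw [Matrix.mul_apply] at this
    simp only [Matrix.mul_apply, of_apply, Finset.sum_mul] at this
    rw [this, sum_comm]
    exact sum_congr rfl fun a _ => sum_congr rfl fun c _ => by ring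
  have htr : ∀ l m, ∑ i, L'.At τ₁ i i w (X l w) (E m w) = 0 := by
    intro l m
    have h3 : ∀ a c, ∑ i, G w i a * (G w)⁻¹ c i = if c = a then 1 else 0 := by
      intro a c
      have := congrFun (congrFun e2 c) a
      rw [Matrix.mul_apply, Matrix.one_apply] at this
      rw [← this]
      exact sum_congr rfl fun i _ => mul_comm _ _
    have h4 : ∑ i, L'.At τ₁ i i w (X l w) (E m w) =
        ∑ a, ∑ c, (∑ i, G w i a * (G w)⁻¹ c i) * L.At τ a c w (X l w) (E m w) := by
      simp only [hA, Finset.sum_mul]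
      rw [sum_comm]
      exact sum_congr rfl fun a _ => sum_comm
    rw [h4]
    simp only [h3, ite_mul, one_mul, zero_mul, Finset.sum_ite_eq', Finset.mem_univ, if_true]
    simp only [hc.At_apply hw _ _ (hθX l)]
    rw [sum_neg_distrib, sum_comm]
    simp only [fun k => sum_comm (γ := Fin 3) (s := Finset.univ) (t := Finset.univ)
      (f := fun a l_1 => S4 a k a l_1 w * (L.θ k w (E m w) * L.om l_1 w (X l w))),
      ← Finset.sum_mul, hc.S4_trace w hw]
    simp
  intro i m j l
  rw [hc'.S4_eq τ₁ hw' (E := fun k => E k w) (x := X l w) d1 (fun i => d2 i l)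
    (fun i => d4 i l) i m j, htr, htr]
  simp only [mul_zero, add_zero, sub_zero, hA, hc.At_apply hw _ _ (hθX l), hθE, homX]
  simp only [mul_neg, sum_neg_distrib, neg_neg, Finset.mul_sum]
  refine sum_congr rfl fun a _ => ?_
  rw [sum_comm]
  refine sum_congr rfl fun k _ => sum_congr rfl fun c _ =>
    sum_congr rfl fun d _ => ?_
  ring

/-- The inclusion of the fibre of `D` at `x` into `ℝ⁶`, the model of the tangent space. -/
def fibreInclusion (D : (x : M) → Submodule ℝ (TangentSpace (𝓡 6) x)) (x : M) : D x →ₗ[ℝ] Euc 6 :=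
  (D x).subtype

lemma fibreInclusion_injective (x : M) : Injective (fibreInclusion D x) := Subtype.val_injective

lemma Lift.fibreInclusion_mem {x : M} (hx : L.f w = x) (d : D x) :
    fibreInclusion D x d ∈ L.Df w := by
  subst hx
  exact d.2

/-- The basis of `D` that is dual to the forms `ω` at a point. -/
def Lift.IsDualBasis (w : Euc n) {x : M} (b : Basis (Fin 3) ℝ (D x)) : Prop :=
  ∀ i j, ∀ v : Euc n, L.df w v = fibreInclusion D x (b i) → L.om j w v = delta i j

lemma Lift.IsCanonical.tensorOf_eq (hD : ∀ x, finrank ℝ (D x) = 3) {L L' : Lift D n}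
    (hc : L.IsCanonical τ S4 S3 S2) (hc' : L'.IsCanonical τ' S4' S3' S2') (hW : L'.W = L.W)
    (hf : ∀ w ∈ L.W, L'.f w = L.f w) (hw : w ∈ L.W) {x : M} (hx : L.f w = x)
    {b b' : Basis (Fin 3) ℝ (D x)} (hb : L.IsDualBasis w b) (hb' : L'.IsDualBasis w b') :
    tensorOf b' (fun i k j l => S4' i k j l w) = tensorOf b (fun i k j l => S4 i k j l w) := by
  obtain ⟨G, hG, hom, hS⟩ := hc.S4_change hD hc' hW hf hw
  refine tensorOf_change hG (fun i => ?_) _ _ hS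
  have hu : IsUnit G.det := isUnit_iff_ne_zero.2 hG
  have hθ0 : ∀ d : D x, ∀ v, L.df w v = fibreInclusion D x d → ∀ i, L.θ i w v = 0 := by
    intro d v hv
    refine L.annihilates w hw v ?_
    change L.df w v ∈ L.Df w
    rw [hv]
    exact L.fibreInclusion_mem hx d
  obtain ⟨v, hv⟩ := L.df_surjective hw (fibreInclusion D x (b' i))
  choose u hu' using fun a => L.df_surjective hw (fibreInclusion D x (b a))
  have hv' : L'.df w v = (fibreInclusion D x (b' i)) := by rw [Lift.df_eq hf hw, hv]
  have h1 : ∀ j, L'.om j w v = delta i j := fun j => hb' i j v hv'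
  have h2 : ∀ d, L.om d w v = G⁻¹ d i := by
    have h3 : G.mulVec (fun d => L.om d w v) = fun j => delta i j := by
      funext j
      rw [← h1 j, hom v (hθ0 _ v hv)]
      rfl
    have h4 := congrArg (fun y => G⁻¹.mulVec y) h3
    simp only [mulVec_mulVec, nonsing_inv_mul _ hu, Matrix.one_mulVec] at h4
    intro d
    rw [congrFun h4 d]
    simp [mulVec, dotProduct, delta]
  have h0 : L.df w (v - ∑ a, G⁻¹ a i • u a) = 0 := by
    refine (L.df_eq_zero_iff hw _).2 ⟨fun k => ?_, fun k => ?_⟩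
    · simp [hθ0 _ v hv, hθ0 _ _ (hu' _)]
    · simp only [map_sub, map_sum, map_smul, h2, hb _ _ _ (hu' _), smul_eq_mul]
      simp [delta]
  rw [map_sub, map_sum, sub_eq_zero] at h0
  simp only [map_smul, hv, hu'] at h0
  apply fibreInclusion_injective
  rw [h0, map_sum]
  simp only [map_smul]

end Tensoriality

section Fundamental

variable {n' : ℕ}
  {τ : Fin 3 → OneForm n} {τ' : Fin 3 → OneForm n'}
  {S4 : Fin 3 → Fin 3 → Fin 3 → Fin 3 → Euc n → ℝ}
  {S4' : Fin 3 → Fin 3 → Fin 3 → Fin 3 → Euc n' → ℝ}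
  {S3 : Fin 3 → Fin 3 → Fin 3 → Euc n → ℝ} {S2 : Fin 3 → Fin 3 → Euc n → ℝ}
  {S3' : Fin 3 → Fin 3 → Fin 3 → Euc n' → ℝ} {S2' : Fin 3 → Fin 3 → Euc n' → ℝ}

lemma Lift.IsDualBasis.pullback {m : ℕ} {L : Lift D n} (s : Euc m → Euc n)
    (V : Set (Euc m)) (hV : IsOpen V) (hs : ContDiffOn ℝ ∞ s V) (h : MapsTo s V L.W)
    (hsub : ∀ y ∈ V, Surjective ((L.df (s y)).comp (fderiv ℝ s y))) {y : Euc m}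
    (hy : y ∈ V) {x : M} {b : Basis (Fin 3) ℝ (D x)} (hb : L.IsDualBasis (s y) b) :
    (L.pullback s V hV hs h hsub).IsDualBasis y b := by
  intro i j v hv
  refine hb i j (fderiv ℝ s y v) ?_
  rw [← hv]
  have e := L.mfderiv_comp (hs.diffAt hV hy) (h hy)
  exact (congrArg (fun l : Euc m →L[ℝ] Euc 6 => l v) e).symm

lemma Lift.IsCanonical.tensorOf_eq_of_f_eq [IsManifold (𝓡 6) ∞ M]
    (hD : ∀ x, finrank ℝ (D x) = 3) {L : Lift D n} {L' : Lift D n'}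
    (hc : L.IsCanonical τ S4 S3 S2) (hc' : L'.IsCanonical τ' S4' S3' S2') {w' : Euc n'}
    (hw : w ∈ L.W) (hw' : w' ∈ L'.W) {x : M} (hx : L.f w = x) (hx' : L'.f w' = x)
    {b b' : Basis (Fin 3) ℝ (D x)} (hb : L.IsDualBasis w b) (hb' : L'.IsDualBasis w' b') :
    tensorOf b' (fun i k j l => S4' i k j l w') = tensorOf b (fun i k j l => S4 i k j l w) := by
  obtain ⟨V, s, hVo, hVm, -, hs, hm, hs0, hf, hsurj⟩ := L.exists_section hw
  obtain ⟨V', s', hVo', hVm', -, hs', hm', hs0', hf', hsurj'⟩ := L'.exists_section hw'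
  rw [hx] at hVm hf hs0
  rw [hx'] at hVm' hf' hs0'
  have hVV : IsOpen (V ∩ V') := hVo.inter hVo'
  set y := chartAt (Euc 6) x x with hy
  have hyV : y ∈ V ∩ V' := ⟨hVm, hVm'⟩
  have a1 := hs.mono (Set.inter_subset_left (t := V'))
  have a2 := hm.mono_left (Set.inter_subset_left (t := V'))
  have a3 := fun y (hy : y ∈ V ∩ V') => hsurj y hy.1
  have b1 := hs'.mono (Set.inter_subset_right (s := V))
  have b2 := hm'.mono_left (Set.inter_subset_right (s := V))
  have b3 := fun y (hy : y ∈ V ∩ V') => hsurj' y hy.2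
  have c1 := hc.pullback s (V ∩ V') hVV a1 a2 a3
  have c2 := hc'.pullback s' (V ∩ V') hVV b1 b2 b3
  have d1 : (L.pullback s (V ∩ V') hVV a1 a2 a3).IsDualBasis y b :=
    Lift.IsDualBasis.pullback s _ hVV a1 a2 a3 hyV (hs0 ▸ hb)
  have d2 : (L'.pullback s' (V ∩ V') hVV b1 b2 b3).IsDualBasis y b' :=
    Lift.IsDualBasis.pullback s' _ hVV b1 b2 b3 hyV (hs0' ▸ hb')
  have h := c1.tensorOf_eq hD c2 rfl (fun z hz => (hf' z hz.2).trans (hf z hz.1).symm)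
    (w := y) hyV (x := x) (by change L.f (s y) = x; rw [hs0, hx]) d1 d2
  simp only [hs0, hs0'] at h
  exact h

lemma exists_isFundamentalTensor [IsManifold (𝓡 6) ∞ M]
    (hD : ∀ x, finrank ℝ (D x) = 3) : ∃ T, IsFundamentalTensor D T := by
  classical
  let P : (x : M) → TensorSpace (D x) → Prop := fun x t =>
    ∃ (n : ℕ) (L : Lift D n) (τ : Fin 3 → OneForm n)
      (S4 : Fin 3 → Fin 3 → Fin 3 → Fin 3 → Euc n → ℝ)
      (S3 : Fin 3 → Fin 3 → Fin 3 → Euc n → ℝ) (S2 : Fin 3 → Fin 3 → Euc n → ℝ) (w : Euc n)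
      (b : Basis (Fin 3) ℝ (D x)),
      L.IsCanonical τ S4 S3 S2 ∧ w ∈ L.W ∧ L.f w = x ∧ L.IsDualBasis w b ∧
        t = tensorOf b (fun i k j l => S4 i k j l w)
  have huniq : ∀ x t t', P x t → P x t' → t = t' := by
    rintro x t t' ⟨n, L, τ, S4, S3, S2, w, b, hc, hw, hx, hb, rfl⟩
      ⟨n', L', τ', S4', S3', S2', w', b', hc', hw', hx', hb', rfl⟩
    exact hc'.tensorOf_eq_of_f_eq hD hc hw' hw hx' hx hb' hb
  refine ⟨fun x => if h : ∃ t, P x t then h.choose else 0, ?_⟩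
  intro n L τ S4 S3 S2 hc w hw b hb
  have hP : P (L.f w) (tensorOf b (fun i k j l => S4 i k j l w)) :=
    ⟨n, L, τ, S4, S3, S2, w, b, hc, hw, rfl, hb, rfl⟩
  have hex : ∃ t, P (L.f w) t := ⟨_, hP⟩
  beta_reduce
  rw [dif_pos hex]
  exact huniq _ _ _ hex.choose_spec hP

lemma isFundamentalTensor_fundamentalTensor [IsManifold (𝓡 6) ∞ M]
    (hD : ∀ x, finrank ℝ (D x) = 3) : IsFundamentalTensor D (fundamentalTensor D) := by
  have h := exists_isFundamentalTensor hD
  unfold fundamentalTensor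
  rw [dif_pos h]
  exact h.choose_spec

lemma Lift.exists_isDualBasis (hD : ∀ x, finrank ℝ (D x) = 3) (L : Lift D n)
    (hw : w ∈ L.W) : ∃ b : Basis (Fin 3) ℝ (D (L.f w)), L.IsDualBasis w b := by
  obtain ⟨E, X, -, -, hd⟩ := L.exists_dual_frame
  obtain ⟨d1, d2, d3, d4⟩ := hd w hw
  let e : Fin 3 → D (L.f w) := fun i =>
    ⟨L.df w (X i w), (L.theta_eq_zero_iff hw (hD _) (X i w)).1 fun k => d2 k i⟩
  have he : ∀ i, fibreInclusion D (L.f w) (e i) = L.df w (X i w) := fun i => rfl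
  have hli : LinearIndependent ℝ e := by
    rw [Fintype.linearIndependent_iff]
    intro g hg i
    have h1 := congrArg (fibreInclusion D (L.f w)) hg
    simp only [map_sum, map_smul, he, map_zero] at h1
    simp only [← map_smul, ← map_sum] at h1
    have h2 := ((L.df_eq_zero_iff hw _).1 h1).2 i
    simpa [d4, delta] using h2
  have : FiniteDimensional ℝ (D (L.f w)) := Module.finite_of_finrank_pos (by rw [hD]; norm_num)
  refine ⟨basisOfLinearIndependentOfCardEqFinrank hli (by rw [hD]; simp), fun i j v hv => ?_⟩
  rw [coe_basisOfLinearIndependentOfCardEqFinrank, he, ← sub_eq_zero, ← map_sub] at hv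
  have h := ((L.df_eq_zero_iff hw _).1 hv).2 j
  rw [map_sub, d4, sub_eq_zero] at h
  rw [h]
  simp only [delta, eq_comm]

lemma Lift.IsCanonical.S4_eq_zero [IsManifold (𝓡 6) ∞ M]
    (hD : ∀ x, finrank ℝ (D x) = 3) (hS : ∀ x, fundamentalTensor D x = 0) {L : Lift D n}
    (hc : L.IsCanonical τ S4 S3 S2) (hw : w ∈ L.W) (i k j l : Fin 3) : S4 i k j l w = 0 := by
  obtain ⟨b, hb⟩ := L.exists_isDualBasis hD hw
  have h := isFundamentalTensor_fundamentalTensor hD n L τ S4 S3 S2 hc w hw b hb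
  rw [hS] at h
  exact eq_zero_of_tensorOf_eq_zero h.symm i k j l

end Fundamental

/-! ### Existence of 2-adapted coframings -/

section Adapted

/-- The torsion `dω^i + α^i_j ∧ ω^j`. -/
def torsion {n : ℕ} (om : Fin 3 → OneForm n) (α : Fin 3 → Fin 3 → OneForm n) (i : Fin 3)
    (w v₁ v₂ : Euc n) : ℝ :=
  extD (om i) w v₁ v₂ + ∑ j, wedge (α i j) (om j) w v₁ v₂

/-- The curvature `dα^i_j + α^i_k ∧ α^k_j`. -/
def curvature {n : ℕ} (α : Fin 3 → Fin 3 → OneForm n) (i j : Fin 3) (w v₁ v₂ : Euc n) : ℝ :=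
  extD (α i j) w v₁ v₂ + ∑ k, wedge (α i k) (α k j) w v₁ v₂

section Bianchi

variable {θ om : Fin 3 → OneForm n} {α : Fin 3 → Fin 3 → OneForm n} {w : Euc n}

lemma torsion_bianchi (h2 : ∀ i, ContDiffAt ℝ 2 (om i) w) (h3 : ∀ i j, ContDiffAt ℝ 2 (α i j) w)
    (v₀ v₁ v₂ : Euc n) (i : Fin 3) : d2 (torsion om α i) w v₀ v₁ v₂ =
      ∑ j, (curvature α i j w v₁ v₂ * om j w v₀ - α i j w v₀ * torsion om α j w v₁ v₂)
      + ∑ j, (curvature α i j w v₂ v₀ * om j w v₁ - α i j w v₁ * torsion om α j w v₂ v₀)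
      + ∑ j, (curvature α i j w v₀ v₁ * om j w v₂ - α i j w v₂ * torsion om α j w v₀ v₁) := by
  have d2' : ∀ i, DifferentiableAt ℝ (om i) w := fun i => (h2 i).diffAt
  have d3' : ∀ i j, DifferentiableAt ℝ (α i j) w := fun i j => (h3 i j).diffAt
  unfold torsion curvature
  rw [d2_add (fun u v => differentiableAt_extD (h2 i) u v)
    (fun u v => DifferentiableAt.fun_sum fun j _ => differentiableAt_wedge (d3' i j) (d2' j) u v),
    d2_extD (h2 i), d2_sum _ (fun j _ u v => differentiableAt_wedge (d3' i j) (d2' j) u v)]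
  simp only [d2_wedge (d3' _ _) (d2' _), wedge, sum_univ_three]
  ring

set_option maxHeartbeats 1600000 in
lemma theta_bianchi (h1 : ∀ i, ContDiffAt ℝ 2 (θ i) w) (h2 : ∀ i, ContDiffAt ℝ 2 (om i) w)
    (h3 : ∀ i j, ContDiffAt ℝ 2 (α i j) w) (hd : ∀ᶠ y in nhds w, ∀ v₁ v₂ i, extD (θ i) y v₁ v₂ =
      - ∑ k, wedge (α k k) (θ i) y v₁ v₂ + ∑ j, wedge (α j i) (θ j) y v₁ v₂
      + ∑ j, ∑ k, eps i j k * wedge (om j) (om k) y v₁ v₂) {v₀ v₁ : Euc n}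
    (hv₀ : ∀ i, θ i w v₀ = 0) (hv₁ : ∀ i, θ i w v₁ = 0) (v₂ : Euc n) (i : Fin 3) :
    ∑ j, ∑ k, 2 * eps i j k * (torsion om α j w v₁ v₂ * om k w v₀)
      + ∑ j, ∑ k, 2 * eps i j k * (torsion om α j w v₂ v₀ * om k w v₁)
      + ∑ j, (curvature α j i w v₀ v₁ * θ j w v₂ - curvature α j j w v₀ v₁ * θ i w v₂
        + ∑ k, 2 * eps i j k * (torsion om α j w v₀ v₁ * om k w v₂)) = 0 := by
  have d1 : ∀ i, DifferentiableAt ℝ (θ i) w := fun i => (h1 i).diffAt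
  have d2' : ∀ i, DifferentiableAt ℝ (om i) w := fun i => (h2 i).diffAt
  have d3' : ∀ i j, DifferentiableAt ℝ (α i j) w := fun i j => (h3 i j).diffAt
  have e := d2_extD (h1 i) v₀ v₁ v₂
  have hsum : d2 (extD (θ i)) w v₀ v₁ v₂ = d2 (fun y v₁ v₂ =>
      ∑ k, (wedge (α k i) (θ k) y v₁ v₂ + ((-1) * wedge (α k k) (θ i) y v₁ v₂
        + ∑ j, eps i k j * wedge (om k) (om j) y v₁ v₂))) w v₀ v₁ v₂ := by
    apply d2_congr
    filter_upwards [hd] with y hy u v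
    rw [hy]
    simp only [sum_add_distrib, neg_mul, one_mul, sum_neg_distrib]
    ring
  have w1 := fun k (u v : Euc n) => differentiableAt_wedge (d3' k i) (d1 k) u v
  have w2 := fun k (u v : Euc n) => differentiableAt_wedge (d3' k k) (d1 i) u v
  have w3 := fun k j (u v : Euc n) => differentiableAt_wedge (d2' k) (d2' j) u v
  have w2' := fun k (u v : Euc n) => (w2 k u v).const_mul (-1)
  have w3' := fun k j (u v : Euc n) => (w3 k j u v).const_mul (eps i k j)
  have w3'' := fun k (u v : Euc n) => DifferentiableAt.fun_sum (u := Finset.univ)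
    fun j _ => w3' k j u v
  rw [hsum, d2_sum _ (fun k _ u v => (w1 k u v).fun_add ((w2' k u v).fun_add (w3'' k u v)))] at e
  simp only [fun k => d2_add (w1 k) (fun u v => (w2' k u v).fun_add (w3'' k u v)),
    fun k => d2_add (w2' k) (w3'' k), fun k => d2_sum Finset.univ (fun j _ => w3' k j),
    fun k => d2_mul (f := fun _ => (-1 : ℝ)) (differentiableAt_const _) (w2 k),
    fun k j => d2_mul (f := fun _ => eps i k j) (differentiableAt_const _) (w3 k j),
    d2_wedge (d3' _ _) (d1 _), d2_wedge (d2' _) (d2' _), fderiv_fun_const, Pi.zero_apply,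
    zero_apply, zero_mul, zero_add, hd.self_of_nhds] at e
  simp only [hv₀, hv₁, wedge, mul_zero, zero_add, sub_zero, zero_sub, add_zero, sum_const_zero] at e
  clear hv₀ hv₁ hsum w1 w2 w3 w2' w3' w3'' d1 d2' d3' hd h1 h2 h3
  unfold torsion curvature
  revert i
  refine forall_fin3 ?_ ?_ ?_ <;> intro e <;>
  simp only [sum_univ_three, eps_vals, wedge, zero_mul, add_zero, zero_add] at e ⊢ <;>
  linear_combination e

end Bianchi

end Adapted

section AdaptedFrame

/-- A coframing `(θ, ω)` of an open set of `ℝ⁶` with dual frame `(E, X)` and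
`dθ_i ≡ ε_{ijk} ω^j ∧ ω^k` modulo `θ`. -/
structure AdaptedFrame where
  W : Set (Euc 6)
  θ : Fin 3 → OneForm 6
  om : Fin 3 → OneForm 6
  E : Fin 3 → Euc 6 → Euc 6
  X : Fin 3 → Euc 6 → Euc 6
  isOpen : IsOpen W
  smooth_θ : ∀ i, ContDiffOn ℝ ∞ (θ i) W
  smooth_om : ∀ i, ContDiffOn ℝ ∞ (om i) W
  smooth_E : ∀ i, ContDiffOn ℝ ∞ (E i) W
  smooth_X : ∀ i, ContDiffOn ℝ ∞ (X i) W
  θE : ∀ w ∈ W, ∀ i j, θ i w (E j w) = delta i j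
  θX : ∀ w ∈ W, ∀ i j, θ i w (X j w) = 0
  omE : ∀ w ∈ W, ∀ i j, om i w (E j w) = 0
  omX : ∀ w ∈ W, ∀ i j, om i w (X j w) = delta i j
  extD_θ : ∀ w ∈ W, ∀ i p q, extD (θ i) w (X p w) (X q w) = 2 * eps i p q

namespace AdaptedFrame

variable (F : AdaptedFrame) {w : Euc 6}

lemma eq_sum (hw : w ∈ F.W) (v : Euc 6) :
    v = ∑ a, F.θ a w v • F.E a w + ∑ a, F.om a w v • F.X a w := by
  let Ψ : Euc 6 →ₗ[ℝ] V3 × V3 :=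
    (LinearMap.pi fun i => (F.θ i w).toLinearMap).prod (LinearMap.pi fun i => (F.om i w).toLinearMap)
  have h1 : Surjective Ψ := by
    rintro ⟨a, b⟩
    refine ⟨∑ j, a j • F.E j w + ∑ j, b j • F.X j w, ?_⟩
    ext i <;> simp [Ψ, F.θE w hw, F.θX w hw, F.omE w hw, F.omX w hw, delta]
  have h2 : Injective Ψ := (LinearMap.injective_iff_surjective_of_finrank_eq_finrank (by simp)).2 h1
  apply h2
  ext i <;> simp [Ψ, F.θE w hw, F.θX w hw, F.omE w hw, F.omX w hw, delta]

lemma two_form_ext (hw : w ∈ F.W) {A B : Euc 6 → Euc 6 → Euc 6 → ℝ} (hA : IsSmoothTwoForm A w)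
    (hB : IsSmoothTwoForm B w) (hXX : ∀ p q, A w (F.X p w) (F.X q w) = B w (F.X p w) (F.X q w))
    (hXE : ∀ p q, A w (F.X p w) (F.E q w) = B w (F.X p w) (F.E q w))
    (hEE : ∀ p q, A w (F.E p w) (F.E q w) = B w (F.E p w) (F.E q w)) (u v : Euc 6) :
    A w u v = B w u v := by
  have hEX : ∀ p q, A w (F.E p w) (F.X q w) = B w (F.E p w) (F.X q w) := by
    intro p q
    rw [hA.swap, hB.swap, hXE]
  obtain ⟨⟨A', hA'⟩, -⟩ := hA.1.self_of_nhds
  obtain ⟨⟨B', hB'⟩, -⟩ := hB.1.self_of_nhds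
  simp only [hA', hB'] at hXX hXE hEE hEX ⊢
  rw [F.eq_sum hw u, F.eq_sum hw v]
  simp only [map_add, map_sum, map_smul, LinearMap.add_apply, LinearMap.sum_apply,
    LinearMap.smul_apply, hXX, hXE, hEE, hEX]

lemma contDiffAt_θ (hw : w ∈ F.W) (i : Fin 3) : ContDiffAt ℝ ∞ (F.θ i) w :=
  (F.smooth_θ i).contDiffAt (F.isOpen.mem_nhds hw)

lemma contDiffAt_om (hw : w ∈ F.W) (i : Fin 3) : ContDiffAt ℝ ∞ (F.om i) w :=
  (F.smooth_om i).contDiffAt (F.isOpen.mem_nhds hw)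

lemma contDiffAt_E (hw : w ∈ F.W) (i : Fin 3) : ContDiffAt ℝ ∞ (F.E i) w :=
  (F.smooth_E i).contDiffAt (F.isOpen.mem_nhds hw)

lemma contDiffAt_X (hw : w ∈ F.W) (i : Fin 3) : ContDiffAt ℝ ∞ (F.X i) w :=
  (F.smooth_X i).contDiffAt (F.isOpen.mem_nhds hw)

/-- The connection forms `α` satisfy the equations for `dθ`. -/
def IsConnection (α : Fin 3 → Fin 3 → OneForm 6) : Prop :=
  (∀ i j, ContDiffOn ℝ ∞ (α i j) F.W) ∧ ∀ w ∈ F.W, ∀ v₁ v₂ i, extD (F.θ i) w v₁ v₂ =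
    - ∑ k, wedge (α k k) (F.θ i) w v₁ v₂ + ∑ j, wedge (α j i) (F.θ j) w v₁ v₂
      + ∑ j, ∑ k, eps i j k * wedge (F.om j) (F.om k) w v₁ v₂

lemma isConnection_of {α : Fin 3 → Fin 3 → OneForm 6} (hα : ∀ i j, ContDiffOn ℝ ∞ (α i j) F.W)
    (h1 : ∀ w ∈ F.W, ∀ i p q, extD (F.θ i) w (F.X p w) (F.E q w) =
      α q i w (F.X p w) - delta i q * ∑ k, α k k w (F.X p w))
    (h2 : ∀ w ∈ F.W, ∀ i p q, extD (F.θ i) w (F.E p w) (F.E q w) =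
      α q i w (F.E p w) - α p i w (F.E q w) - delta i q * ∑ k, α k k w (F.E p w)
        + delta i p * ∑ k, α k k w (F.E q w)) : F.IsConnection α := by
  refine ⟨hα, fun w hw v₁ v₂ i => ?_⟩
  have hα' : ∀ i j, ContDiffAt ℝ ∞ (α i j) w := fun i j =>
    (hα i j).contDiffAt (F.isOpen.mem_nhds hw)
  refine F.two_form_ext hw (isSmoothTwoForm_extD (F.contDiffAt_θ hw i))
    (B := fun w v₁ v₂ => - ∑ k, wedge (α k k) (F.θ i) w v₁ v₂ + ∑ j, wedge (α j i) (F.θ j) w v₁ v₂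
      + ∑ j, ∑ k, eps i j k * wedge (F.om j) (F.om k) w v₁ v₂) ?_
    (fun p q => ?_) (fun p q => ?_) (fun p q => ?_) v₁ v₂
  · exact ((IsSmoothTwoForm.sum fun k _ => isSmoothTwoForm_wedge (hα' k k)
      (F.contDiffAt_θ hw i)).neg.add (IsSmoothTwoForm.sum fun j _ =>
        isSmoothTwoForm_wedge (hα' j i) (F.contDiffAt_θ hw j))).add
      (IsSmoothTwoForm.sum fun j _ => IsSmoothTwoForm.sum fun k _ =>
        (isSmoothTwoForm_wedge (F.contDiffAt_om hw j) (F.contDiffAt_om hw k)).const_mul _)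
  · simp only [F.extD_θ w hw, wedge, F.θX w hw, F.omX w hw, mul_zero, sub_zero,
      sum_const_zero, neg_zero, zero_add]
    revert i p q
    (repeat' refine forall_fin3 ?_ ?_ ?_) <;>
    simp only [sum_univ_three, eps_vals, delta_vals] <;> ring
  · simp only [h1 w hw, wedge, F.θX w hw, F.omX w hw, F.omE w hw, F.θE w hw, mul_zero, zero_mul,
      sub_zero, sum_const_zero, add_zero, ← Finset.sum_mul]
    simp [delta]
    ring
  · simp only [h2 w hw, wedge, F.omE w hw, F.θE w hw, mul_zero,
      sub_zero, sum_const_zero, add_zero, ← Finset.sum_mul, sum_sub_distrib]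
    simp [delta]
    ring

lemma exists_isConnection : ∃ α, F.IsConnection α ∧ ∀ w ∈ F.W, ∀ i j k, α j i w (F.X k w) =
    extD (F.θ i) w (F.X k w) (F.E j w)
      - 1 / 2 * delta i j * ∑ m, extD (F.θ m) w (F.X k w) (F.E m w) := by
  choose a ha ha' using fun i j => IsSmoothTwoForm.exists_insert F.isOpen
    (fun w hw => isSmoothTwoForm_extD (F.contDiffAt_θ hw i)) (F.smooth_E j)
  let c : Fin 3 → Fin 3 → Fin 3 → Euc 6 → ℝ := fun i j k w =>
    1 / 2 * extD (F.θ i) w (F.E k w) (F.E j w)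
  have hc : ∀ i j k, ContDiffOn ℝ ∞ (c i j k) F.W := fun i j k w hw =>
    (contDiffAt_const.mul ((isSmoothTwoForm_extD (F.contDiffAt_θ hw i)).contDiffAt_apply
      (F.contDiffAt_E hw k) (F.contDiffAt_E hw j))).contDiffWithinAt
  let P : Fin 3 → Fin 3 → OneForm 6 := fun i j w => a i j w - ∑ k, c i j k w • F.θ k w
  have hP : ∀ i j, ContDiffOn ℝ ∞ (P i j) F.W := fun i j =>
    (ha i j).sub (ContDiffOn.sum fun k _ => (hc i j k).smul (F.smooth_θ k))
  have hPX : ∀ w ∈ F.W, ∀ i j k, P i j w (F.X k w) = extD (F.θ i) w (F.X k w) (F.E j w) := by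
    intro w hw i j k
    simp [P, ha' _ _ w hw, F.θX w hw]
  have hPE : ∀ w ∈ F.W, ∀ i j k, P i j w (F.E k w) =
      1 / 2 * extD (F.θ i) w (F.E k w) (F.E j w) := by
    intro w hw i j k
    simp only [P, sub_apply, sum_apply, smul_apply, smul_eq_mul, ha' _ _ w hw, F.θE w hw]
    simp [delta, c]
    ring
  let α : Fin 3 → Fin 3 → OneForm 6 := fun j i w => P i j w - (1 / 2 * delta i j) • ∑ m, P m m w
  have hα : ∀ i j w v, α j i w v = P i j w v - (1 / 2 * delta i j) * ∑ m, P m m w v := by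
    intro i j w v
    simp [α]
  refine ⟨α, F.isConnection_of (fun j i => (hP i j).sub
    (ContDiffOn.fun_smul contDiffOn_const (ContDiffOn.sum fun k _ => hP k k))) (fun w hw i p q => ?_)
    (fun w hw i p q => ?_), fun w hw i j k => ?_⟩
  · simp only [hα, hPX w hw]
    generalize extD (F.θ i) w (F.X p w) (F.E q w) = z
    simp only [sum_univ_three, delta_same]
    ring
  · have e : extD (F.θ i) w (F.E q w) (F.E p w) = -extD (F.θ i) w (F.E p w) (F.E q w) :=
      extD_swap (F.contDiffAt_θ hw i).diffAt _ _
    simp only [hα, hPE w hw, e, sum_univ_three, delta_same]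
    ring
  · simp only [hα, hPX w hw]

variable {F}

lemma IsConnection.contDiffAt {α : Fin 3 → Fin 3 → OneForm 6} (h : F.IsConnection α)
    (hw : w ∈ F.W) (i j : Fin 3) : ContDiffAt ℝ ∞ (α i j) w :=
  (h.1 i j).contDiffAt (F.isOpen.mem_nhds hw)

lemma IsConnection.isSmoothTwoForm_torsion {α : Fin 3 → Fin 3 → OneForm 6} (h : F.IsConnection α)
    (hw : w ∈ F.W) (i : Fin 3) : IsSmoothTwoForm (torsion F.om α i) w :=
  (isSmoothTwoForm_extD (F.contDiffAt_om hw i)).add (IsSmoothTwoForm.sum fun j _ =>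
    isSmoothTwoForm_wedge (h.contDiffAt hw i j) (F.contDiffAt_om hw j))

lemma IsConnection.bianchi {α : Fin 3 → Fin 3 → OneForm 6} (h : F.IsConnection α) (hw : w ∈ F.W)
    {v₀ v₁ : Euc 6} (hv₀ : ∀ i, F.θ i w v₀ = 0) (hv₁ : ∀ i, F.θ i w v₁ = 0) (v₂ : Euc 6)
    (i : Fin 3) : ∑ j, ∑ k, 2 * eps i j k * (torsion F.om α j w v₁ v₂ * F.om k w v₀)
      + ∑ j, ∑ k, 2 * eps i j k * (torsion F.om α j w v₂ v₀ * F.om k w v₁)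
      + ∑ j, (curvature α j i w v₀ v₁ * F.θ j w v₂ - curvature α j j w v₀ v₁ * F.θ i w v₂
        + ∑ k, 2 * eps i j k * (torsion F.om α j w v₀ v₁ * F.om k w v₂)) = 0 :=
  theta_bianchi (fun i => (F.contDiffAt_θ hw i).of_le two_le_infty)
  (fun i => (F.contDiffAt_om hw i).of_le two_le_infty)
  (fun i j => (h.contDiffAt hw i j).of_le two_le_infty)
  (Filter.mem_of_superset (F.isOpen.mem_nhds hw) fun y hy => h.2 y hy) hv₀ hv₁ v₂ i

lemma IsConnection.torsion_symm {α : Fin 3 → Fin 3 → OneForm 6} (h : F.IsConnection α)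
    (hw : w ∈ F.W) :
    torsion F.om α 1 w (F.X 1 w) (F.X 2 w) = torsion F.om α 0 w (F.X 2 w) (F.X 0 w) ∧
    torsion F.om α 2 w (F.X 1 w) (F.X 2 w) = torsion F.om α 0 w (F.X 0 w) (F.X 1 w) ∧
    torsion F.om α 2 w (F.X 2 w) (F.X 0 w) = torsion F.om α 1 w (F.X 0 w) (F.X 1 w) := by
  have e := fun i => h.bianchi hw (fun j => F.θX w hw j 0) (fun j => F.θX w hw j 1) (F.X 2 w) i
  have e0 := e 0
  have e1 := e 1
  have e2 := e 2
  simp only [F.omX w hw, F.θX w hw, sum_univ_three, eps_vals, delta_vals] at e0 e1 e2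
  refine ⟨?_, ?_, ?_⟩ <;> linarith

lemma torsion_correction (T : Fin 3 → Fin 3 → V3) (q : Fin 3 → V3)
    (hT : ∀ i p r, T i p r = -T i r p) (s1 : T 1 1 2 = T 0 2 0) (s2 : T 2 1 2 = T 0 0 1)
    (s3 : T 2 2 0 = T 1 0 1) (hq : ∀ i, q i 0 = -(1 / 6) * T i 1 2 ∧ q i 1 = -(1 / 6) * T i 2 0 ∧
      q i 2 = -(1 / 6) * T i 0 1) (i p r : Fin 3) : T i p r + ∑ l, q i l * (2 * eps l p r)
      - ∑ l, q l i * (2 * eps r p l) + 1 / 2 * delta r i * ∑ m, ∑ l, q l m * (2 * eps m p l)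
      + ∑ l, q l i * (2 * eps p r l) - 1 / 2 * delta p i * ∑ m, ∑ l, q l m * (2 * eps m r l)
      = 0 := by
  have h0 : ∀ i p, T i p p = 0 := fun i p => by linarith [hT i p p]
  have h1 : ∀ i, T i 2 1 = -T i 1 2 := fun i => hT _ _ _
  have h2 : ∀ i, T i 0 2 = -T i 2 0 := fun i => hT _ _ _
  have h3 : ∀ i, T i 1 0 = -T i 0 1 := fun i => hT _ _ _
  clear hT
  revert i p r
  (repeat' refine forall_fin3 ?_ ?_ ?_) <;>
  simp only [sum_univ_three, eps_vals, delta_vals, hq, h0, h1, h2, h3, s1, s2, s3] <;> ring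

variable (F) in
lemma exists_torsion_free : ∃ F' : AdaptedFrame, F'.W = F.W ∧ F'.θ = F.θ ∧
    ∃ α, F'.IsConnection α ∧
      ∀ w ∈ F'.W, ∀ i p q, torsion F'.om α i w (F'.X p w) (F'.X q w) = 0 := by
  obtain ⟨α, hα, hαX⟩ := F.exists_isConnection
  let q : Fin 3 → Fin 3 → Euc 6 → ℝ := fun i j w =>
    -(1 / 12) * ∑ a, ∑ b, eps j a b * torsion F.om α i w (F.X a w) (F.X b w)
  have hq : ∀ i j, ContDiffOn ℝ ∞ (q i j) F.W := fun i j w hw =>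
    (contDiffAt_const.mul (ContDiffAt.sum fun a _ => ContDiffAt.sum fun b _ =>
      contDiffAt_const.mul ((hα.isSmoothTwoForm_torsion hw i).contDiffAt_apply
        (F.contDiffAt_X hw a) (F.contDiffAt_X hw b)))).contDiffWithinAt
  have hqv : ∀ w ∈ F.W, ∀ i, q i 0 w = -(1 / 6) * torsion F.om α i w (F.X 1 w) (F.X 2 w) ∧
      q i 1 w = -(1 / 6) * torsion F.om α i w (F.X 2 w) (F.X 0 w) ∧
      q i 2 w = -(1 / 6) * torsion F.om α i w (F.X 0 w) (F.X 1 w) := by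
    intro w hw i
    have e := (hα.isSmoothTwoForm_torsion hw i).swap
    simp only [q, sum_univ_three, eps_vals, e (F.X 2 w) (F.X 1 w), e (F.X 2 w) (F.X 0 w),
      e (F.X 1 w) (F.X 0 w)]
    refine ⟨?_, ?_, ?_⟩ <;> ring
  let om' : Fin 3 → OneForm 6 := fun i w => F.om i w + ∑ j, q i j w • F.θ j w
  have hom' : ∀ i w v, om' i w v = F.om i w v + ∑ j, q i j w * F.θ j w v := by
    intro i w v
    simp [om']
  let E' : Fin 3 → Euc 6 → Euc 6 := fun a w => F.E a w - ∑ j, q j a w • F.X j w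
  let F' : AdaptedFrame :=
    { W := F.W
      θ := F.θ
      om := om'
      E := E'
      X := F.X
      isOpen := F.isOpen
      smooth_θ := F.smooth_θ
      smooth_om := fun i => (F.smooth_om i).add
        (ContDiffOn.sum fun j _ => (hq i j).smul (F.smooth_θ j))
      smooth_E := fun a => (F.smooth_E a).sub
        (ContDiffOn.sum fun j _ => (hq j a).smul (F.smooth_X j))
      smooth_X := F.smooth_X
      θE := fun w hw i j => by simp [E', F.θE w hw, F.θX w hw]
      θX := F.θX
      omE := fun w hw i j => by
        simp [hom', E', F.θE w hw, F.θX w hw, F.omE w hw, F.omX w hw]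
        simp [delta]
      omX := fun w hw i j => by simp [hom', F.θX w hw, F.omX w hw]
      extD_θ := F.extD_θ }
  obtain ⟨α', hα', hαX'⟩ := F'.exists_isConnection
  refine ⟨F', rfl, rfl, α', hα', fun w hw i p r => ?_⟩
  change torsion om' α' i w (F.X p w) (F.X r w) = 0
  have hw₁ : w ∈ F.W := hw
  have e1 : extD (om' i) w (F.X p w) (F.X r w) =
      extD (F.om i) w (F.X p w) (F.X r w) + ∑ l, q i l w * (2 * eps l p r) := by
    have hqd : ∀ i j, DifferentiableAt ℝ (q i j) w := fun i j =>
      ((hq i j).diffAt F.isOpen hw₁)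
    have hθd : ∀ i, DifferentiableAt ℝ (F.θ i) w := fun i =>
      (F.contDiffAt_θ hw₁ i).diffAt
    change extD (F.om i + fun y => ∑ j, q i j y • F.θ j y) w _ _ = _
    rw [extD_add (F.contDiffAt_om hw₁ i).diffAt
      (DifferentiableAt.fun_sum fun j _ => (hqd i j).fun_smul (hθd j)),
      extD_fun_sum _ (fun j _ => (hqd i j).fun_smul (hθd j))]
    simp only [fun j => extD_fun_smul (hqd i j) (hθd j), F.θX w hw₁, F.extD_θ w hw₁, mul_zero,
      sub_zero, zero_add]
  have e2 : ∀ i j k, extD (F.θ i) w (F.X k w) (E' j w) =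
      extD (F.θ i) w (F.X k w) (F.E j w) - ∑ l, q l j w * (2 * eps i k l) := by
    intro i j k
    obtain ⟨⟨B, hB⟩, -⟩ := (isSmoothTwoForm_extD (F.contDiffAt_θ hw₁ i)).1.self_of_nhds
    have h := F.extD_θ w hw₁ i k
    simp only [hB] at h ⊢
    simp [E', h]
  have e3 : ∀ i j k, α' j i w (F.X k w) = α j i w (F.X k w) - ∑ l, q l j w * (2 * eps i k l)
      + 1 / 2 * delta i j * ∑ m, ∑ l, q l m w * (2 * eps m k l) := by
    intro i j k
    have h := hαX' w hw i j k
    change α' j i w (F.X k w) = extD (F.θ i) w (F.X k w) (E' j w)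
      - 1 / 2 * delta i j * ∑ m, extD (F.θ m) w (F.X k w) (E' m w) at h
    rw [h, hαX w hw₁]
    simp only [e2, sum_sub_distrib]
    ring
  have e4 : torsion om' α' i w (F.X p w) (F.X r w) = torsion F.om α i w (F.X p w) (F.X r w)
      + ∑ l, q i l w * (2 * eps l p r) + (α' i r w (F.X p w) - α i r w (F.X p w))
      - (α' i p w (F.X r w) - α i p w (F.X r w)) := by
    unfold torsion
    rw [e1]
    simp only [wedge, hom', F.θX w hw₁, F.omX w hw₁, mul_zero, sum_const_zero, add_zero,
      sum_sub_distrib]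
    simp [delta]
    ring
  rw [e4, e3, e3]
  obtain ⟨s1, s2, s3⟩ := hα.torsion_symm hw₁
  have h := torsion_correction (fun i p r => torsion F.om α i w (F.X p w) (F.X r w))
    (fun i j => q i j w) (fun i p r => (hα.isSmoothTwoForm_torsion hw₁ i).swap _ _) s1 s2 s3
    (hqv w hw₁) i p r
  linarith

end AdaptedFrame

end AdaptedFrame

namespace AdaptedFrame

variable {F : AdaptedFrame} {w : Euc 6}

lemma trace_eq_zero_of_bianchi (R : Fin 3 → Fin 3 → V3) (C : Fin 3 → Fin 3 → Fin 3 → V3)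
    (b1 : ∀ p q r i, ∑ j, ∑ k, 2 * eps i j k * (R j r q * delta k p)
      - ∑ j, ∑ k, 2 * eps i j k * (R j r p * delta k q)
      + ∑ j, (C j i p q * delta j r - C j j p q * delta i r) = 0)
    (b2 : ∀ i, -2 * ∑ j, R i j j = C i 0 1 2 + C i 1 2 0 + C i 2 0 1) (i : Fin 3) :
    ∑ m, (R i m m + R m i m) = 0 := by
  have e := b2 i
  have c0 := b1 1 2 i 0
  have c1 := b1 2 0 i 1
  have c2 := b1 0 1 i 2
  have t0 := b1 1 2 0 0
  have t1 := b1 1 2 1 1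
  have t2 := b1 1 2 2 2
  have t3 := b1 2 0 0 0
  have t4 := b1 2 0 1 1
  have t5 := b1 2 0 2 2
  have t6 := b1 0 1 0 0
  have t7 := b1 0 1 1 1
  have t8 := b1 0 1 2 2
  clear b1 b2
  simp only [sum_univ_three, eps_vals, delta_vals] at t0 t1 t2 t3 t4 t5 t6 t7 t8
  revert i
  refine forall_fin3 ?_ ?_ ?_ <;> intro e c0 c1 c2 <;>
  simp only [sum_univ_three, eps_vals, delta_vals] at e c0 c1 c2 ⊢ <;> linarith

lemma IsConnection.torsion_eq {α : Fin 3 → Fin 3 → OneForm 6} (h : F.IsConnection α)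
    (h0 : ∀ w ∈ F.W, ∀ i p q, torsion F.om α i w (F.X p w) (F.X q w) = 0) (hw : w ∈ F.W)
    (i : Fin 3) (u v : Euc 6) : torsion F.om α i w u v =
      ∑ k, ∑ j, torsion F.om α i w (F.X k w) (F.E j w) * wedge (F.om k) (F.θ j) w u v
      + ∑ a, ∑ b, (1 / 2 * torsion F.om α i w (F.E a w) (F.E b w)) *
        wedge (F.θ a) (F.θ b) w u v := by
  have hs := (h.isSmoothTwoForm_torsion hw i)
  refine F.two_form_ext hw hs (B := fun y u v =>
      ∑ k, ∑ j, torsion F.om α i w (F.X k w) (F.E j w) * wedge (F.om k) (F.θ j) y u v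
      + ∑ a, ∑ b, (1 / 2 * torsion F.om α i w (F.E a w) (F.E b w)) *
        wedge (F.θ a) (F.θ b) y u v) ?_ (fun p q => ?_) (fun p q => ?_) (fun p q => ?_) u v
  · exact (IsSmoothTwoForm.sum fun k _ => IsSmoothTwoForm.sum fun j _ => (isSmoothTwoForm_wedge
      (F.contDiffAt_om hw k) (F.contDiffAt_θ hw j)).const_mul _).add
      (IsSmoothTwoForm.sum fun k _ => IsSmoothTwoForm.sum fun j _ => (isSmoothTwoForm_wedge
      (F.contDiffAt_θ hw k) (F.contDiffAt_θ hw j)).const_mul _)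
  · simp [h0 w hw, wedge, F.θX w hw]
  · simp only [wedge, F.θX w hw, F.omX w hw, F.omE w hw, F.θE w hw, mul_zero, zero_mul, sub_zero,
      sum_const_zero, add_zero]
    simp [delta]
  · simp only [wedge, F.omE w hw, F.θE w hw, mul_zero, zero_mul, sub_zero, sum_const_zero, zero_add]
    have e := hs.swap (F.E q w) (F.E p w)
    simp only [mul_sub, sum_sub_distrib]
    simp [delta]
    linarith

lemma IsConnection.trace_eq_zero {α : Fin 3 → Fin 3 → OneForm 6} (h : F.IsConnection α)
    (h0 : ∀ w ∈ F.W, ∀ i p q, torsion F.om α i w (F.X p w) (F.X q w) = 0) (hw : w ∈ F.W)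
    (i : Fin 3) : ∑ m, (torsion F.om α i w (F.X m w) (F.E m w)
      + torsion F.om α m w (F.X m w) (F.E i w)) = 0 := by
  refine trace_eq_zero_of_bianchi (fun i j k => torsion F.om α i w (F.X k w) (F.E j w))
    (fun i j p q => curvature α i j w (F.X p w) (F.X q w)) (fun p q r i => ?_) (fun i => ?_) i
  · have e := h.bianchi hw (fun j => F.θX w hw j p) (fun j => F.θX w hw j q) (F.E r w) i
    have e' := fun j => (h.isSmoothTwoForm_torsion hw j).swap (F.E r w) (F.X p w)
    simp only [F.omX w hw, F.θE w hw, F.omE w hw, e', mul_zero, sum_const_zero, add_zero,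
      neg_mul, mul_neg, sum_neg_distrib] at e
    linarith
  · have e := torsion_bianchi (fun i => (F.contDiffAt_om hw i).of_le two_le_infty)
      (fun i j => (h.contDiffAt hw i j).of_le two_le_infty) (F.X 0 w) (F.X 1 w) (F.X 2 w) i
    simp only [h0 w hw, F.omX w hw, mul_zero, sub_zero] at e
    have e2 : ∑ j, curvature α i j w (F.X 1 w) (F.X 2 w) * delta j 0
        + ∑ j, curvature α i j w (F.X 2 w) (F.X 0 w) * delta j 1
        + ∑ j, curvature α i j w (F.X 0 w) (F.X 1 w) * delta j 2 =
        curvature α i 0 w (F.X 1 w) (F.X 2 w) + curvature α i 1 w (F.X 2 w) (F.X 0 w)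
        + curvature α i 2 w (F.X 0 w) (F.X 1 w) := by
      simp [delta]
    rw [e2] at e
    rw [← e]
    have hR : ∀ k j, DifferentiableAt ℝ (fun y => torsion F.om α i y (F.X k y) (F.E j y)) w :=
      fun k j => ((h.isSmoothTwoForm_torsion hw i).contDiffAt_apply (F.contDiffAt_X hw k)
        (F.contDiffAt_E hw j)).diffAt
    have hK : ∀ a b, DifferentiableAt ℝ
        (fun y => 1 / 2 * torsion F.om α i y (F.E a y) (F.E b y)) w :=
      fun a b => ((h.isSmoothTwoForm_torsion hw i).contDiffAt_apply (F.contDiffAt_E hw a)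
        (F.contDiffAt_E hw b)).diffAt.const_mul _
    have hθ := fun i => (F.contDiffAt_θ hw i).diffAt
    have hom := fun i => (F.contDiffAt_om hw i).diffAt
    have w1 := fun k j (u v : Euc 6) => differentiableAt_wedge (hom k) (hθ j) u v
    have w2 := fun k j (u v : Euc 6) => differentiableAt_wedge (hθ k) (hθ j) u v
    have w1' := fun k j u v => (hR k j).fun_mul (w1 k j u v)
    have w2' := fun k j u v => (hK k j).fun_mul (w2 k j u v)
    have w1'' := fun k u v => DifferentiableAt.fun_sum (u := Finset.univ) fun j _ => w1' k j u v
    have w2'' := fun k u v => DifferentiableAt.fun_sum (u := Finset.univ) fun j _ => w2' k j u v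
    rw [d2_congr (Filter.mem_of_superset (F.isOpen.mem_nhds hw) fun y hy u v =>
      h.torsion_eq h0 hy i u v), d2_add
        (fun u v => DifferentiableAt.fun_sum (u := Finset.univ) fun k _ => w1'' k u v)
        (fun u v => DifferentiableAt.fun_sum (u := Finset.univ) fun k _ => w2'' k u v),
      d2_sum _ (fun k _ => w1'' k), d2_sum _ (fun k _ => w2'' k)]
    simp only [fun k => d2_sum Finset.univ (fun j _ => w1' k j),
      fun k => d2_sum Finset.univ (fun j _ => w2' k j), fun k j => d2_mul (hR k j) (w1 k j),
      fun k j => d2_mul (hK k j) (w2 k j), d2_wedge (hom _) (hθ _), d2_wedge (hθ _) (hθ _)]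
    simp only [wedge, F.θX w hw, F.omX w hw, F.extD_θ w hw, mul_zero, zero_mul, sub_zero, add_zero, zero_add,
      sum_const_zero, zero_sub]
    simp only [sum_univ_three, eps_vals, delta_vals]
    ring

lemma kappa_identity (K : Fin 3 → Fin 3 → V3) (hK : ∀ i a b, K i a b = -K i b a)
    (c : Fin 3 → V3) (hc : ∀ m i, c m i = 1 / 2 * ∑ a, ∑ b, eps m a b * K i a b
      - 1 / 4 * delta m i * ∑ j, ∑ a, ∑ b, eps j a b * K j a b) (i a b : Fin 3) :
    K i a b = -(∑ m, eps i m b * c m a - ∑ m, eps i m a * c m b) := by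
  have h0 : ∀ i p, K i p p = 0 := fun i p => by linarith [hK i p p]
  have h1 : ∀ i, K i 2 1 = -K i 1 2 := fun i => hK _ _ _
  have h2 : ∀ i, K i 0 2 = -K i 2 0 := fun i => hK _ _ _
  have h3 : ∀ i, K i 1 0 = -K i 0 1 := fun i => hK _ _ _
  clear hK
  simp only [sum_univ_three, hc, h0, h1, h2, h3, eps_vals]
  clear hc
  revert i a b
  (repeat' refine forall_fin3 ?_ ?_ ?_) <;>
  simp only [eps_vals, delta_vals, h0, h1, h2, h3] <;> ring

set_option maxHeartbeats 400000 in
lemma IsConnection.exists_structure {α : Fin 3 → Fin 3 → OneForm 6} (h : F.IsConnection α)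
    (h0 : ∀ w ∈ F.W, ∀ i p q, torsion F.om α i w (F.X p w) (F.X q w) = 0) :
    ∃ (α' : Fin 3 → Fin 3 → OneForm 6) (β : Fin 3 → OneForm 6), F.IsConnection α' ∧
      (∀ i, ContDiffOn ℝ ∞ (β i) F.W) ∧ ∀ w ∈ F.W, ∀ v₁ v₂ i, extD (F.om i) w v₁ v₂ =
      - ∑ k, ∑ j, eps i k j * wedge (β k) (F.θ j) w v₁ v₂
        - ∑ j, wedge (α' i j) (F.om j) w v₁ v₂ := by
  let R : Fin 3 → Fin 3 → Fin 3 → Euc 6 → ℝ := fun i j k w =>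
    torsion F.om α i w (F.X k w) (F.E j w)
  have hR : ∀ i j k, ContDiffOn ℝ ∞ (R i j k) F.W := fun i j k w hw =>
    ((h.isSmoothTwoForm_torsion hw i).contDiffAt_apply (F.contDiffAt_X hw k)
        (F.contDiffAt_E hw j)).contDiffWithinAt
  let K : Fin 3 → Fin 3 → Fin 3 → Euc 6 → ℝ := fun i a b w =>
    torsion F.om α i w (F.E a w) (F.E b w)
  have hK : ∀ i j k, ContDiffOn ℝ ∞ (K i j k) F.W := fun i j k w hw =>
    ((h.isSmoothTwoForm_torsion hw i).contDiffAt_apply (F.contDiffAt_E hw j)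
        (F.contDiffAt_E hw k)).contDiffWithinAt
  let α' : Fin 3 → Fin 3 → OneForm 6 := fun i k w =>
    α i k w + ∑ j, (1 / 2 * (R i j k w + R j i k w)) • F.θ j w
  have hα' : ∀ i k w v, α' i k w v = α i k w v
      + ∑ j, (1 / 2 * (R i j k w + R j i k w)) * F.θ j w v := by
    intro i k w v
    simp [α']
  let b : Fin 3 → Fin 3 → Euc 6 → ℝ := fun m k w => -(1 / 2) * ∑ i, ∑ j, eps i m j * R i j k w
  let c : Fin 3 → Fin 3 → Euc 6 → ℝ := fun m i w => 1 / 2 * ∑ a, ∑ b, eps m a b * K i a b w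
      - 1 / 4 * delta m i * ∑ j, ∑ a, ∑ b, eps j a b * K j a b w
  have hKs : ∀ m i, ContDiffOn ℝ ∞ (fun w => ∑ a, ∑ b, eps m a b * K i a b w) F.W := fun m i =>
    ContDiffOn.sum fun a _ => ContDiffOn.sum fun b _ => contDiffOn_const.mul (hK i a b)
  have hb : ∀ m k, ContDiffOn ℝ ∞ (b m k) F.W := fun m k =>
    contDiffOn_const.mul (ContDiffOn.sum fun i _ => ContDiffOn.sum fun j _ =>
      contDiffOn_const.mul (hR i j k))
  have hc : ∀ m k, ContDiffOn ℝ ∞ (c m k) F.W := fun m k =>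
    (contDiffOn_const.mul (hKs m k)).sub (contDiffOn_const.mul (ContDiffOn.sum fun j _ => hKs j j))
  let β : Fin 3 → OneForm 6 := fun m w => ∑ k, b m k w • F.om k w + ∑ i, c m i w • F.θ i w
  have hβ : ∀ m w v, β m w v = ∑ k, b m k w * F.om k w v + ∑ i, c m i w * F.θ i w v := by
    intro m w v
    simp [β]
  have hα : F.IsConnection α' := by
    refine ⟨fun i k => (h.1 i k).add (ContDiffOn.sum fun j _ =>
      (contDiffOn_const.mul ((hR i j k).add (hR j i k))).smul (F.smooth_θ j)),
      fun w hw v₁ v₂ i => ?_⟩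
    rw [h.2 w hw]
    have ht := h.trace_eq_zero h0 hw
    have ht' : ∀ v, ∑ k, α' k k w v = ∑ k, α k k w v := by
      intro v
      have t : ∀ i, ∑ m, (R i m m w + R m i m w) = 0 := ht
      have t0 := t 0
      have t1 := t 1
      have t2 := t 2
      simp only [sum_univ_three] at t0 t1 t2
      simp only [hα', sum_univ_three]
      linear_combination (1 / 2 * F.θ 0 w v) * t0 + (1 / 2 * F.θ 1 w v) * t1
        + (1 / 2 * F.θ 2 w v) * t2
    have e1 : ∑ k, wedge (α' k k) (F.θ i) w v₁ v₂ = ∑ k, wedge (α k k) (F.θ i) w v₁ v₂ := by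
      simp only [wedge, sum_sub_distrib, ← Finset.sum_mul, ht']
    have e2 : ∑ k, wedge (α' k i) (F.θ k) w v₁ v₂ = ∑ k, wedge (α k i) (F.θ k) w v₁ v₂ := by
      simp only [wedge, hα', sum_univ_three]
      ring
    rw [e1, e2]
  have hβs : ∀ m, ContDiffOn ℝ ∞ (β m) F.W := fun m =>
    (ContDiffOn.sum fun k _ => (hb m k).fun_smul (F.smooth_om k)).add
      (ContDiffOn.sum fun i _ => (hc m i).fun_smul (F.smooth_θ i))
  refine ⟨α', β, hα, hβs, fun w hw v₁ v₂ i => ?_⟩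
  have hβw : ∀ i, ContDiffAt ℝ ∞ (β i) w := fun i =>
    (hβs i).contDiffAt (F.isOpen.mem_nhds hw)
  have key : torsion F.om α' i w v₁ v₂ = -∑ k, ∑ j, eps i k j * wedge (β k) (F.θ j) w v₁ v₂ := by
    have hT : ∀ u v, torsion F.om α' i w u v = torsion F.om α i w u v
        + ∑ k, (α' i k w u - α i k w u) * F.om k w v
        - ∑ k, (α' i k w v - α i k w v) * F.om k w u := by
      intro u v
      simp only [torsion, wedge, sub_mul, sum_sub_distrib]
      ring
    refine F.two_form_ext hw (hα.isSmoothTwoForm_torsion hw i)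
      (B := fun y u v => -∑ k, ∑ j, eps i k j * wedge (β k) (F.θ j) y u v) ?_
      (fun p q => ?_) (fun p q => ?_) (fun p q => ?_) v₁ v₂
    · exact (IsSmoothTwoForm.sum fun k _ => IsSmoothTwoForm.sum fun j _ =>
        (isSmoothTwoForm_wedge (hβw k) (F.contDiffAt_θ hw j)).const_mul _).neg
    · rw [hT, h0 w hw]
      simp [hα', wedge, F.θX w hw]
    · rw [hT]
      simp only [hα', hβ, wedge, F.θX w hw, F.omX w hw, F.omE w hw, F.θE w hw, mul_zero,
        sub_zero, sum_const_zero, add_zero, sub_self, add_sub_cancel_left]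
      change R i q p w - _ = _
      simp only [b]
      clear_value R
      revert i p q
      refine forall_fin3 ?_ ?_ ?_ <;> intro _ <;> (repeat' refine forall_fin3 ?_ ?_ ?_) <;>
      simp only [sum_univ_three, eps_vals, delta_vals] <;> ring
    · rw [hT]
      simp only [hα', hβ, wedge, F.omE w hw, F.θE w hw, mul_zero,
        sub_zero, sum_const_zero, add_zero, zero_add]
      refine (kappa_identity (fun i a b => K i a b w) (fun i a b =>
        (h.isSmoothTwoForm_torsion hw i).swap _ _) (fun m i => c m i w) (fun m i => rfl)
        i p q).trans ?_
      simp [delta, mul_sub]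
  unfold torsion at key
  linarith

end AdaptedFrame

lemma extD_eq_neg_lieBracket {a : OneForm n} {X Y : Euc n → Euc n} {c d : ℝ}
    (ha : DifferentiableAt ℝ a w) (hX : DifferentiableAt ℝ X w) (hY : DifferentiableAt ℝ Y w)
    (haX : ∀ᶠ y in nhds w, a y (X y) = c) (haY : ∀ᶠ y in nhds w, a y (Y y) = d) :
    extD a w (X w) (Y w) = -a w (lieBracket ℝ X Y w) := by
  have key : ∀ {Z : Euc n → Euc n} {c : ℝ}, DifferentiableAt ℝ Z w →
      (∀ᶠ y in nhds w, a y (Z y) = c) → ∀ v, fderiv ℝ a w v (Z w) = -a w (fderiv ℝ Z w v) := by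
    intro Z c hZ h v
    have h1 : fderiv ℝ (fun y => a y (Z y)) w v = 0 := by
      rw [Filter.EventuallyEq.fderiv_eq (f := fun _ => c) h]
      simp
    rw [(ha.hasFDerivAt.clm_apply hZ.hasFDerivAt).fderiv] at h1
    simp at h1
    linarith
  rw [extD_eq _ _ _ _ ha, key hY haY, key hX haX, VectorField.lieBracket_eq, map_sub]
  ring

lemma exists_dual_forms {n : ℕ} {ι : Type*} [Fintype ι] [DecidableEq ι]
    (hι : Fintype.card ι = n) {W : Set (Euc n)} (hW : IsOpen W)
    (Z : ι → Euc n → Euc n) (hZ : ∀ k, ContDiffOn ℝ ∞ (Z k) W)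
    (hli : ∀ w ∈ W, LinearIndependent ℝ fun k => Z k w) :
    ∃ a : ι → OneForm n, (∀ k, ContDiffOn ℝ ∞ (a k) W) ∧
      ∀ w ∈ W, ∀ k l, a k w (Z l w) = if k = l then 1 else 0 := by
  obtain ⟨u, hu, hu'⟩ := exists_dual_vectors hW (fun k w => innerSL ℝ (Z k w))
    (fun k => (innerSL ℝ).contDiff.comp_contDiffOn (hZ k)) (fun w hw x => by
      let b := basisOfLinearIndependentOfCardEqFinrank' (fun k => Z k w) (hli w hw) (by simp [hι])
      refine ⟨∑ k, x k • (InnerProductSpace.toDual ℝ (Euc n)).symm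
        (LinearMap.toContinuousLinearMap (b.coord k)), fun l => ?_⟩
      have hb : ∀ k, b k = Z k w := fun k => by simp [b]
      rw [innerSL_apply_apply, real_inner_comm]
      simp only [sum_inner, inner_smul_left, InnerProductSpace.toDual_symm_apply]
      simp [← hb, Finsupp.single_apply])
  refine ⟨fun k w => innerSL ℝ (u k w), fun k => (innerSL ℝ).contDiff.comp_contDiffOn (hu k),
    fun w hw k l => ?_⟩
  have h := hu' w hw l k
  rw [innerSL_apply_apply] at h ⊢
  rw [real_inner_comm, h]
  simp only [eq_comm]

lemma mlieBracket_eq_lieBracket (X Y : Euc 6 → Euc 6) :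
    mlieBracket (𝓡 6) X Y = lieBracket ℝ X Y := by
  have h := VectorField.mlieBracketWithin_eq_lieBracketWithin (𝕜 := ℝ) (V := X) (W := Y)
    (s := Set.univ)
  exact (VectorField.mlieBracketWithin_univ (I := 𝓡 6) (V := X) (W := Y)).symm.trans
    (h.trans VectorField.lieBracketWithin_univ)

section Charts

variable {e : OpenPartialHomeomorph M (Euc 6)}

lemma mdifferentiable_of_mem_maximalAtlas (he : e ∈ maxAtlas M) : e.MDifferentiable (𝓡 6) (𝓡 6) :=
  ⟨(contMDiffOn_of_mem_maximalAtlas he).mdifferentiableOn (by simp),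
    (contMDiffOn_symm_of_mem_maximalAtlas he).mdifferentiableOn (by simp)⟩

/-- The values of a vector field as elements of the model space. -/
def fieldVal (X : (x : M) → TangentSpace (𝓡 6) x) (x : M) : Euc 6 := X x

/-- The expression of a vector field in a chart. -/
def locField (e : OpenPartialHomeomorph M (Euc 6)) (X : (x : M) → TangentSpace (𝓡 6) x) :
    Euc 6 → Euc 6 :=
  VectorField.mpullback (𝓡 6) (𝓡 6) e.symm X

/-- The differential of the inverse of a chart. -/
def dSymm (e : OpenPartialHomeomorph M (Euc 6)) (y : Euc 6) : Euc 6 →L[ℝ] Euc 6 :=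
  mfderiv (𝓡 6) (𝓡 6) e.symm y

lemma dSymm_isInvertible (he : e ∈ maxAtlas M) {y : Euc 6}
    (hy : y ∈ e.target) : (dSymm e y).IsInvertible :=
  ⟨(mdifferentiable_of_mem_maximalAtlas he).symm.mfderiv hy, rfl⟩

lemma dSymm_locField (he : e ∈ maxAtlas M) {y : Euc 6}
    (hy : y ∈ e.target) (X : (x : M) → TangentSpace (𝓡 6) x) :
    dSymm e y (locField e X y) = fieldVal X (e.symm y) :=
  (dSymm_isInvertible he hy).self_apply_inverse _

lemma dSymm_injective (he : e ∈ maxAtlas M) {y : Euc 6}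
    (hy : y ∈ e.target) : Injective (dSymm e y) :=
  (dSymm_isInvertible he hy).injective

lemma dSymm_surjective (he : e ∈ maxAtlas M) {y : Euc 6}
    (hy : y ∈ e.target) : Surjective (dSymm e y) :=
  (dSymm_isInvertible he hy).surjective

lemma isManifold_minSmoothness {M : Type*} [TopologicalSpace M] [ChartedSpace (Euc 6) M]
    [IsManifold (𝓡 6) ∞ M] : IsManifold (𝓡 6) (minSmoothness ℝ 2) M ∧
      IsManifold (𝓡 6) (minSmoothness ℝ 3) M := by
  simp only [minSmoothness_of_isRCLikeNormedField]
  exact ⟨IsManifold.of_le (n := ∞) two_le_infty,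
    IsManifold.of_le (n := ∞) (WithTop.coe_le_coe.2 le_top)⟩

variable [IsManifold (𝓡 6) ∞ M]

lemma contDiffOn_locField (he : e ∈ maxAtlas M)
    {X : (x : M) → TangentSpace (𝓡 6) x} {U : Set M} (hU : IsOpen U)
    (hX : SmoothVectorFieldOn X U) : ContDiffOn ℝ ∞ (locField e X) (e.target ∩ e.symm ⁻¹' U) := by
  refine contMDiffOn_vectorSpace_iff_contDiffOn.1 ?_
  intro y hy
  have h1 := (hX _ hy.2).contMDiffAt (hU.mem_nhds hy.2)
  have h2 := (contMDiffOn_symm_of_mem_maximalAtlas he y hy.1).contMDiffAt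
    (e.open_target.mem_nhds hy.1)
  have : IsManifold (𝓡 6) 1 M := IsManifold.of_le (n := ∞) (by simp)
  exact (ContMDiffAt.mpullback_vectorField_preimage h1 h2 (dSymm_isInvertible he hy.1)
    (by simp)).contMDiffWithinAt

lemma locField_mlieBracket (he : e ∈ maxAtlas M)
    {X Y : (x : M) → TangentSpace (𝓡 6) x} {U : Set M} (hU : IsOpen U)
    (hX : SmoothVectorFieldOn X U) (hY : SmoothVectorFieldOn Y U) {y : Euc 6}
    (hy : y ∈ e.target) (hy' : e.symm y ∈ U) : locField e (mlieBracket (𝓡 6) X Y) y =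
      lieBracket ℝ (locField e X) (locField e Y) y := by
  have h1 := ((hX _ hy').contMDiffAt (hU.mem_nhds hy')).mdifferentiableAt (by simp)
  have h1' := ((hY _ hy').contMDiffAt (hU.mem_nhds hy')).mdifferentiableAt (by simp)
  have h2 := (contMDiffOn_symm_of_mem_maximalAtlas he y hy).contMDiffAt
    (e.open_target.mem_nhds hy)
  have : IsManifold (𝓡 6) 2 M := IsManifold.of_le (n := ∞) two_le_infty
  obtain ⟨_, _⟩ := isManifold_minSmoothness (M := M)
  have h := VectorField.mpullback_mlieBracket (n := ∞) h1 h1' h2 (by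
    rw [minSmoothness_of_isRCLikeNormedField]; exact two_le_infty)
  exact h.trans (congrFun (mlieBracket_eq_lieBracket _ _) y)

lemma AdaptedFrame.exists_lift (he : e ∈ maxAtlas M) (F : AdaptedFrame) (hW : F.W ⊆ e.target)
    (hD : ∀ w ∈ F.W, ∀ v : Euc 6, mfderiv (𝓡 6) (𝓡 6) e.symm w v ∈ D (e.symm w) →
      ∀ i, F.θ i w v = 0) : ∃ L : Lift D 6, L.W = F.W ∧ L.f = e.symm := by
  obtain ⟨F', hF'W, hF'θ, α₀, hα₀, ht⟩ := F.exists_torsion_free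
  obtain ⟨α, β, hα, hβ, hom⟩ := hα₀.exists_structure ht
  exact ⟨{
    W := F'.W
    f := e.symm
    θ := F'.θ
    om := F'.om
    α := α
    β := β
    isOpen := F'.isOpen
    smooth_f := (contMDiffOn_symm_of_mem_maximalAtlas he).mono (hF'W ▸ hW)
    submersion := fun w hw => dSymm_surjective he (hW (hF'W ▸ hw))
    smooth_θ := F'.smooth_θ
    smooth_om := F'.smooth_om
    smooth_α := hα.1
    smooth_β := hβ
    coframe := fun w hw v => by
      constructor
      · rintro ⟨h1, h2⟩
        have h : ∀ u : Euc 6, (∀ i, F'.θ i w u = 0) → (∀ i, F'.om i w u = 0) → u = 0 := by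
          intro u h1 h2
          rw [F'.eq_sum hw u]
          simp [h1, h2]
        exact (congrArg (dSymm e w) (h v h1 h2)).trans (map_zero _)
      · intro h
        have h : (v : Euc 6) = 0 :=
          dSymm_injective he (hW (hF'W ▸ hw)) (h.trans (map_zero (dSymm e w)).symm)
        exact ⟨fun i => by rw [h]; exact map_zero _, fun i => by rw [h]; exact map_zero _⟩
    annihilates := fun w hw v hv => by
      rw [hF'θ]
      exact hD w (hF'W ▸ hw) v hv
    dθ_eq := hα.2
    dω_eq := hom }, hF'W, rfl⟩

lemma IsNondegenerate.exists_lift (hD : IsNondegenerate D) (p : M) :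
    ∃ L : Lift D 6, chartAt (Euc 6) p p ∈ L.W ∧ L.W ⊆ (chartAt (Euc 6) p).target ∧
      L.f = (chartAt (Euc 6) p).symm := by
  obtain ⟨U, hU, hpU, X, hX, hXD⟩ := hD p
  set e := chartAt (Euc 6) p with hedef
  have he : e ∈ maxAtlas M := IsManifold.chart_mem_maximalAtlas _
  set W := e.target ∩ e.symm ⁻¹' U with hWdef
  have hWo : IsOpen W := e.isOpen_inter_preimage_symm hU
  let Y : Fin 3 → Euc 6 → Euc 6 := fun i => locField e (X i)
  have hY : ∀ i, ContDiffOn ℝ ∞ (Y i) W := fun i => contDiffOn_locField he hU (hX i)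
  let B : Fin 3 → Euc 6 → Euc 6 := fun i => -(1 / 2 : ℝ) • lieBracket ℝ (Y (i + 1))
    (Y (i + 2))
  have hB : ∀ i, ContDiffOn ℝ ∞ (B i) W := by
    intro i w hw
    have h : ContDiffAt ℝ ∞ (lieBracket ℝ (Y (i + 1)) (Y (i + 2))) w :=
      ContDiffAt.lieBracket_vectorField ((hY (i + 1)).contDiffAt (hWo.mem_nhds hw))
      ((hY (i + 2)).contDiffAt (hWo.mem_nhds hw)) (by simp)
    exact (h.const_smul (-(1 / 2 : ℝ))).contDiffWithinAt
  have hli : ∀ w ∈ W, LinearIndependent ℝ fun k : Fin 3 ⊕ Fin 3 => Sum.elim B Y k w := by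
    intro w hw
    rw [Fintype.linearIndependent_iff]
    intro g hg
    have h1 := congrArg (dSymm e w) hg
    have hA : LinearIndependent ℝ ![fieldVal (X 0) (e.symm w), fieldVal (X 1) (e.symm w),
        fieldVal (X 2) (e.symm w), fieldVal (mlieBracket (𝓡 6) (X 1) (X 2)) (e.symm w),
        fieldVal (mlieBracket (𝓡 6) (X 2) (X 0)) (e.symm w),
        fieldVal (mlieBracket (𝓡 6) (X 0) (X 1)) (e.symm w)] := (hXD _ hw.2).2
    have h2 := Fintype.linearIndependent_iff.1 hA ![g (Sum.inr 0), g (Sum.inr 1),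
      g (Sum.inr 2), -(1 / 2) * g (Sum.inl 0), -(1 / 2) * g (Sum.inl 1), -(1 / 2) * g (Sum.inl 2)]
    have hb : ∀ i j, dSymm e w (lieBracket ℝ (Y i) (Y j) w) =
        fieldVal (mlieBracket (𝓡 6) (X i) (X j)) (e.symm w) := by
      intro i j
      rw [← locField_mlieBracket he hU (hX i) (hX j) hw.1 hw.2, dSymm_locField he hw.1]
    have hy : ∀ i, dSymm e w (Y i w) = fieldVal (X i) (e.symm w) := fun i => dSymm_locField he hw.1 _
    have h3 := h2 (by
      refine Eq.trans ?_ (h1.trans (map_zero _))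
      simp only [Fintype.sum_sum_type, Sum.elim_inl, Sum.elim_inr, map_add, map_smul, B,
        Pi.smul_apply, hb, hy, sum_univ_three, Fin.sum_univ_six, smul_smul]
      simp only [Fin.isValue, zero_add, show (1 : Fin 3) + 1 = 2 from rfl,
        show (1 : Fin 3) + 2 = 0 from rfl, show (2 : Fin 3) + 1 = 0 from rfl,
        show (2 : Fin 3) + 2 = 1 from rfl, cons_val, mul_comm]
      abel)
    rintro (i | i)
    · have := h3 (natAdd 3 i)
      fin_cases i <;> simpa using this
    · have := h3 (castAdd 3 i)
      fin_cases i <;> simpa using this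
  obtain ⟨a, ha, hab⟩ := exists_dual_forms (by simp) hWo (Sum.elim B Y)
    (fun k => by rcases k with i | i; exacts [hB i, hY i]) hli
  let F : AdaptedFrame :=
    { W := W
      θ := fun i => a (Sum.inl i)
      om := fun i => a (Sum.inr i)
      E := B
      X := Y
      isOpen := hWo
      smooth_θ := fun i => ha _
      smooth_om := fun i => ha _
      smooth_E := hB
      smooth_X := hY
      θE := fun w hw i j => by simpa [delta] using hab w hw (Sum.inl i) (Sum.inl j)
      θX := fun w hw i j => by simpa [delta] using hab w hw (Sum.inl i) (Sum.inr j)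
      omE := fun w hw i j => by simpa [delta] using hab w hw (Sum.inr i) (Sum.inl j)
      omX := fun w hw i j => by simpa [delta] using hab w hw (Sum.inr i) (Sum.inr j)
      extD_θ := fun w hw i p q => by
        have h := extD_eq_neg_lieBracket (a := a (Sum.inl i)) (X := Y p) (Y := Y q) (w := w)
          (c := 0) (d := 0) ((ha _).diffAt hWo hw)
          ((hY p).diffAt hWo hw)
          ((hY q).diffAt hWo hw)
          (by filter_upwards [hWo.mem_nhds hw] with y hy
              simpa using hab y hy (Sum.inl i) (Sum.inr p))
          (by filter_upwards [hWo.mem_nhds hw] with y hy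
              simpa using hab y hy (Sum.inl i) (Sum.inr q))
        rw [h]
        have hl : ∀ j, a (Sum.inl i) w (lieBracket ℝ (Y (j + 1)) (Y (j + 2)) w) =
            -2 * delta i j := by
          intro j
          have h2 := hab w hw (Sum.inl i) (Sum.inl j)
          simp only [Sum.elim_inl, B, Pi.smul_apply, map_smul, smul_eq_mul, Sum.inl.injEq] at h2
          unfold delta
          linarith
        have hsw : ∀ p q, lieBracket ℝ (Y p) (Y q) w =
            -lieBracket ℝ (Y q) (Y p) w := fun p q => by
          rw [VectorField.lieBracket_swap]
        have l0 := hl 0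
        have l1 := hl 1
        have l2 := hl 2
        have z : ∀ p, lieBracket ℝ (Y p) (Y p) w = 0 := fun p => by simp
        simp only [zero_add, show (1 : Fin 3) + 1 = 2 from rfl, show (1 : Fin 3) + 2 = 0 from rfl,
          show (2 : Fin 3) + 1 = 0 from rfl, show (2 : Fin 3) + 2 = 1 from rfl] at l0 l1 l2
        clear h hl
        revert p q
        (repeat' refine forall_fin3 ?_ ?_ ?_) <;>
        simp only [z, hsw 2 1, hsw 0 2, hsw 1 0, map_neg, map_zero, l0, l1, l2] <;> revert i <;>
        refine forall_fin3 ?_ ?_ ?_ <;>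
        simp only [eps_vals, delta_vals] <;> norm_num }
  obtain ⟨L, hLW, hLf⟩ := F.exists_lift (D := D) he Set.inter_subset_left (fun w hw v hv i => by
    have h1 : dSymm e w v ∈ Submodule.span ℝ (Set.range fun i => fieldVal (X i) (e.symm w)) := by
      have := (hXD _ hw.2).1
      rw [← this] at hv
      exact hv
    obtain ⟨c, hc⟩ := (Submodule.mem_span_range_iff_exists_fun ℝ).1 h1
    have h2 : v = ∑ i, c i • Y i w := by
      apply dSymm_injective he hw.1
      rw [← hc, map_sum]
      simp only [map_smul]
      exact sum_congr rfl fun i _ => by rw [dSymm_locField he hw.1]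
    have h3 : ∀ x, F.θ i w (Y x w) = 0 := fun x => F.θX w hw i x
    rw [h2]
    simp [h3])
  exact ⟨L, hLW ▸ ⟨mem_chart_target _ _, by
    rw [Set.mem_preimage, e.left_inv (mem_chart_source _ _)]; exact hpU⟩,
    hLW ▸ Set.inter_subset_left, hLf⟩

end Charts

section FlatConnection

open Set Metric

universe u v

variable {E : Type u} {𝔸 : Type v} [NormedAddCommGroup E] [NormedSpace ℝ E] [NormedRing 𝔸] [NormedAlgebra ℝ 𝔸]
  [CompleteSpace 𝔸]

lemma exists_bounds {γ : E → E →L[ℝ] 𝔸} (hγ : ContDiffAt ℝ 2 γ 0) {W : Set E} (hW : W ∈ nhds 0) :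
    ∃ C r : ℝ, 1 ≤ C ∧ 0 < r ∧ r ≤ 1 ∧ ball 0 r ⊆ W ∧ (∀ x ∈ ball 0 r, DifferentiableAt ℝ γ x) ∧
      (∀ x ∈ ball 0 r, ‖γ x‖ ≤ C) ∧ (∀ x ∈ ball 0 r, ‖fderiv ℝ γ x‖ ≤ C) ∧
      ∀ x ∈ ball 0 r, ∀ y ∈ ball 0 r, ‖fderiv ℝ γ x - fderiv ℝ γ y‖ ≤ C * ‖x - y‖ := by
  have hd : ContDiffAt ℝ 1 (fderiv ℝ γ) 0 := hγ.fderiv_right (by norm_num)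
  obtain ⟨K, t, ht, hK⟩ := hd.exists_lipschitzOnWith
  have hnorm : ∀ {F : Type (max u v)} [NormedAddCommGroup F] (f : E → F), ContinuousAt f 0 →
      ∀ᶠ x in nhds 0, ‖f x‖ < ‖f 0‖ + 1 := fun f hf =>
    hf.norm.eventually_lt continuousAt_const (lt_add_one _)
  have e1 : ∀ᶠ x in nhds (0 : E), ‖γ x‖ < ‖γ 0‖ + 1 :=
    hγ.continuousAt.norm.eventually_lt continuousAt_const (lt_add_one _)
  have e2 : ∀ᶠ x in nhds (0 : E), ‖fderiv ℝ γ x‖ < ‖fderiv ℝ γ 0‖ + 1 := hnorm _ hd.continuousAt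
  have e3 : ∀ᶠ x in nhds (0 : E), ContDiffAt ℝ 2 γ x := hγ.eventually (by
    norm_cast)
  obtain ⟨r, hr, h⟩ := Metric.eventually_nhds_iff_ball.1 (e1.and (e2.and (e3.and
    ((show ∀ᶠ x in nhds (0 : E), x ∈ t from ht).and (show ∀ᶠ x in nhds (0 : E), x ∈ W from hW)))))
  have hm : ∀ {x}, x ∈ ball (0 : E) (min r 1) → x ∈ ball 0 r := fun hx =>
    ball_subset_ball (min_le_left _ _) hx
  refine ⟨‖γ 0‖ + 1 + (‖fderiv ℝ γ 0‖ + 1) + K, min r 1, ?_, lt_min hr one_pos, min_le_right _ _,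
    fun x hx => (h x (hm hx)).2.2.2.2, fun x hx => (h x (hm hx)).2.2.1.diffAt,
    fun x hx => ?_, fun x hx => ?_, fun x hx y hy => ?_⟩
  · have := norm_nonneg (γ 0); have := norm_nonneg (fderiv ℝ γ 0); have := K.coe_nonneg; linarith
  · have := (h x (hm hx)).1; have := norm_nonneg (fderiv ℝ γ 0); have := K.coe_nonneg; linarith
  · have := (h x (hm hx)).2.1; have := norm_nonneg (γ 0); have := K.coe_nonneg; linarith
  · refine (hK.norm_sub_le (h x (hm hx)).2.2.2.1 (h y (hm hy)).2.2.2.1).trans ?_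
    gcongr
    have := norm_nonneg (γ 0); have := norm_nonneg (fderiv ℝ γ 0); linarith

lemma exists_linear_solution {A : ℝ → 𝔸} {δ : ℝ} (hA : ContinuousOn A (Icc 0 1))
    (hδ : ∀ t ∈ Icc (0 : ℝ) 1, ‖A t‖ ≤ δ) (h : (‖(1 : 𝔸)‖ + 1) * δ ≤ 1) :
    ∃ y : ℝ → 𝔸, y 0 = 1 ∧ ∀ t ∈ Icc (0 : ℝ) 1, HasDerivWithinAt y (y t * A t) (Icc 0 1) t := by
  have hδ0 : 0 ≤ δ := (norm_nonneg _).trans (hδ 0 (by simp))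
  have hpl : IsPicardLindelof (fun t y => y * A t) (tmin := 0) (tmax := 1) ⟨0, by simp⟩ (1 : 𝔸)
      1 0 1 ⟨δ, hδ0⟩ :=
    { lipschitzOnWith := fun t ht => LipschitzOnWith.of_dist_le_mul fun x _ y _ => by
        rw [dist_eq_norm, dist_eq_norm, ← sub_mul]
        refine (norm_mul_le _ _).trans ?_
        rw [mul_comm]
        exact mul_le_mul_of_nonneg_right (hδ t ht) (norm_nonneg _)
      continuousOn := fun x _ => continuousOn_const.mul hA
      norm_le := fun t ht x hx => by
        refine (norm_mul_le _ _).trans (le_trans ?_ h)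
        refine mul_le_mul ?_ (hδ t ht) (norm_nonneg _) (by positivity)
        rw [mem_closedBall, dist_eq_norm] at hx
        calc ‖x‖ = ‖1 + (x - 1)‖ := by congr 1; abel
          _ ≤ ‖(1 : 𝔸)‖ + ‖x - 1‖ := norm_add_le _ _
          _ ≤ _ := by gcongr; simpa using hx
      mul_max_le := by simp }
  exact hpl.exists_eq_forall_mem_Icc_hasDerivWithinAt₀

lemma taylor_bound {γ : E → E →L[ℝ] 𝔸} {C r : ℝ} (hdiff : ∀ x ∈ ball 0 r, DifferentiableAt ℝ γ x)
    (hlip : ∀ x ∈ ball 0 r, ∀ y ∈ ball 0 r, ‖fderiv ℝ γ x - fderiv ℝ γ y‖ ≤ C * ‖x - y‖)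
    {x h : E} (hx : x ∈ ball 0 r) (hh : x + h ∈ ball 0 r) (hC : 0 ≤ C) :
    ‖γ (x + h) - γ x - fderiv ℝ γ x h‖ ≤ C * ‖h‖ * ‖h‖ := by
  have hs : segment ℝ x (x + h) ⊆ ball 0 r := (convex_ball _ _).segment_subset hx hh
  have := (convex_segment x (x + h)).norm_image_sub_le_of_norm_fderiv_le'
    (φ := fderiv ℝ γ x) (C := C * ‖h‖) (fun y hy => hdiff y (hs hy)) (fun y hy => by
      refine (hlip y (hs hy) x hx).trans ?_
      gcongr
      obtain ⟨t, ht, rfl⟩ := (segment_eq_image' ℝ x (x + h)).subset hy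
      simp only [add_sub_cancel_left, norm_smul, Real.norm_eq_abs, abs_of_nonneg ht.1]
      exact mul_le_of_le_one_left (norm_nonneg _) ht.2) (left_mem_segment ..) (right_mem_segment ..)
  simpa using this

lemma exists_parallel_frame {γ : E → E →L[ℝ] 𝔸} {W : Set E} (hW : W ∈ nhds 0)
    (hγ : ContDiffAt ℝ 2 γ 0) (hflat : ∀ x ∈ W, ∀ u v, fderiv ℝ γ x u v - fderiv ℝ γ x v u =
      -(γ x u * γ x v - γ x v * γ x u)) : ∃ (r : ℝ) (g : E → 𝔸), 0 < r ∧ ball 0 r ⊆ W ∧ g 0 = 1 ∧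
      ∀ x ∈ ball 0 r, HasFDerivAt g ((ContinuousLinearMap.mul ℝ 𝔸 (g x)).comp (γ x)) x := by
  obtain ⟨C, r₀, hC, hr₀, hr₁, hrW, hdiff, hγC, hdC, hlip⟩ := exists_bounds hγ hW
  have hC0 : 0 ≤ C := zero_le_one.trans hC
  set r := min r₀ (((‖(1 : 𝔸)‖ + 1) * C)⁻¹) with hr
  have hrpos : 0 < r := lt_min hr₀ (by positivity)
  have hball : ball (0 : E) r ⊆ ball 0 r₀ := ball_subset_ball (min_le_left _ _)
  have hmem : ∀ x ∈ ball (0 : E) r, ∀ t ∈ Icc (0 : ℝ) 1, t • x ∈ ball (0 : E) r₀ := by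
    intro x hx t ht
    have := (hball hx)
    rw [mem_ball_zero_iff] at this ⊢
    rw [norm_smul, Real.norm_eq_abs, abs_of_nonneg ht.1]
    exact (mul_le_of_le_one_left (norm_nonneg _) ht.2).trans_lt this
  have hsm : ∀ x : E, ∀ t : ℝ, HasDerivAt (fun t : ℝ => t • x) x t := fun x t => by
    simpa using (hasDerivAt_id t).smul_const x
  have hγt : ∀ x ∈ ball (0 : E) r, ∀ v, ∀ t ∈ Icc (0 : ℝ) 1,
      HasDerivAt (fun t : ℝ => γ (t • x) v) (fderiv ℝ γ (t • x) x v) t := by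
    intro x hx v t ht
    have h1 := ((hdiff _ (hmem x hx t ht)).hasFDerivAt).comp_hasDerivAt t (hsm x t)
    simpa using (h1.clm_apply (hasDerivAt_const t v))
  have hcont : ∀ x ∈ ball (0 : E) r, ContinuousOn (fun t : ℝ => γ (t • x) x) (Icc 0 1) :=
    fun x hx t ht => (hγt x hx x t ht).continuousAt.continuousWithinAt
  have hex : ∀ x : E, ∃ y : ℝ → 𝔸, x ∈ ball (0 : E) r → y 0 = 1 ∧ ∀ t ∈ Icc (0 : ℝ) 1,
      HasDerivWithinAt y (y t * γ (t • x) x) (Icc 0 1) t := by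
    intro x
    by_cases hx : x ∈ ball (0 : E) r
    · obtain ⟨y, hy⟩ := exists_linear_solution (A := fun t => γ (t • x) x) (δ := C * r) (hcont x hx)
        (fun t ht => ((γ (t • x)).le_opNorm x).trans (mul_le_mul (hγC _ (hmem x hx t ht))
          (mem_ball_zero_iff.1 hx).le (norm_nonneg _) hC0)) (by
          have hpos : 0 < (‖(1 : 𝔸)‖ + 1) * C := by positivity
          have := mul_le_mul_of_nonneg_left (min_le_right r₀ (((‖(1 : 𝔸)‖ + 1) * C)⁻¹)) hpos.le
          rw [mul_inv_cancel₀ hpos.ne'] at this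
          rwa [← mul_assoc])
      exact ⟨y, fun _ => hy⟩
    · exact ⟨0, fun h => absurd h hx⟩
  choose y hy using hex
  refine ⟨r, fun x => y x 1, hrpos, hball.trans hrW, ?_, fun x hx => ?_⟩
  · have h0 := hy 0 (by simpa using hrpos)
    rw [← h0.1]
    exact constant_of_has_deriv_right_zero (fun t ht => (h0.2 t ht).continuousWithinAt)
      (fun t ht => by
        have := (h0.2 t ⟨ht.1, ht.2.le⟩)
        simp only [map_zero, mul_zero] at this
        exact (this.mono_of_mem_nhdsWithin (Icc_mem_nhdsGE_of_mem ht))) 1 (by simp)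
  have hyc : ContinuousOn (y x) (Icc 0 1) := fun t ht => ((hy x hx).2 t ht).continuousWithinAt
  obtain ⟨B, hB⟩ := isCompact_Icc.exists_bound_of_continuousOn hyc
  have hB0 : 0 ≤ B := (norm_nonneg _).trans (hB 0 (by simp))
  have key : ∀ᶠ h in nhds (0 : E), ‖y (x + h) 1 - y x 1 - y x 1 * γ x h‖ ≤
      gronwallBound 0 C (B * (2 * C + 2 * C * C) * (‖h‖ * ‖h‖)) 1 := by
    have e1 : ∀ᶠ h in nhds (0 : E), x + h ∈ ball (0 : E) r := by
      apply (continuous_const.add continuous_id).continuousAt.eventually_mem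
      simpa using isOpen_ball.mem_nhds hx
    filter_upwards [e1] with h hh
    have hz : ∀ t ∈ Icc (0 : ℝ) 1, HasDerivWithinAt
        (fun t => y (x + h) t - y x t * (1 + t • γ (t • x) h))
        (y (x + h) t * γ (t • (x + h)) (x + h) - (y x t * γ (t • x) x * (1 + t • γ (t • x) h) +
          y x t * (t • fderiv ℝ γ (t • x) x h + γ (t • x) h))) (Icc 0 1) t := by
      intro t ht
      have h1 := ((hasDerivAt_id t).smul (hγt x hx h t ht)).const_add 1
      have h2 := ((hy x hx).2 t ht).fun_mul h1.hasDerivWithinAt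
      refine (((hy _ hh).2 t ht).fun_sub h2).congr_deriv ?_
      simp
    have hbound : ∀ t ∈ Ico (0 : ℝ) 1,
        ‖y (x + h) t * γ (t • (x + h)) (x + h) - (y x t * γ (t • x) x * (1 + t • γ (t • x) h) +
          y x t * (t • fderiv ℝ γ (t • x) x h + γ (t • x) h))‖ ≤
        C * ‖y (x + h) t - y x t * (1 + t • γ (t • x) h)‖ +
          B * (2 * C + 2 * C * C) * (‖h‖ * ‖h‖) := by
      intro t ht'
      have ht : t ∈ Icc (0 : ℝ) 1 := ⟨ht'.1, ht'.2.le⟩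
      have m1 := hmem x hx t ht
      have m2 := hmem _ hh t ht
      have hfl := hflat _ (hrW m1) x h
      have hth : ‖t • h‖ ≤ ‖h‖ := by
        rw [norm_smul, Real.norm_eq_abs, abs_of_nonneg ht.1]
        exact mul_le_of_le_one_left (norm_nonneg _) ht.2
      have hxh1 : ‖x + h‖ ≤ 1 := (mem_ball_zero_iff.1 (hball hh)).le.trans hr₁
      set a := γ (t • x) with ha
      set d := fderiv ℝ γ (t • x) with hd
      set b := γ (t • (x + h)) with hb
      have hR : ‖b - a - d (t • h)‖ ≤ C * ‖h‖ * ‖h‖ := by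
        have := taylor_bound hdiff hlip m1 (h := t • h) (by rw [← smul_add]; exact m2) hC0
        rw [← smul_add] at this
        exact this.trans (by gcongr)
      have hba : ‖b - a‖ ≤ C * ‖h‖ := by
        have := (convex_ball (0 : E) r₀).norm_image_sub_le_of_norm_fderiv_le (𝕜 := ℝ) hdiff hdC m1 m2
        rw [smul_add, add_sub_cancel_left] at this
        rw [hb, ha, smul_add]
        exact this.trans (by gcongr)
      have hsplit : y (x + h) t * b (x + h) - (y x t * a x * (1 + t • a h) +
          y x t * (t • d x h + a h)) =
          (y (x + h) t - y x t * (1 + t • a h)) * b (x + h) +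
          y x t * ((b - a - d (t • h)) (x + h) + t • d h h +
            (t • a h) * ((b - a) (x + h) + a h)) := by
        have : d x h = d h x - (a x * a h - a h * a x) := by rw [sub_eq_add_neg, ← hfl]; abel
        rw [this]
        simp only [sub_apply, map_add, map_smul, smul_apply, mul_add, add_mul, sub_mul, mul_sub,
          smul_sub, mul_one, smul_mul_assoc, mul_smul_comm, mul_assoc]
        abel
      rw [hsplit]
      have n1 : ‖b (x + h)‖ ≤ C := (b.le_opNorm _).trans
        (by rw [← mul_one C]; exact mul_le_mul (hγC _ m2) hxh1 (norm_nonneg _) hC0)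
      have n2 : ‖(b - a - d (t • h)) (x + h)‖ ≤ C * ‖h‖ * ‖h‖ :=
        ((b - a - d (t • h)).le_opNorm _).trans
          (by simpa using mul_le_mul hR hxh1 (norm_nonneg _) (by positivity))
      have n3 : ‖t • d h h‖ ≤ C * ‖h‖ * ‖h‖ := by
        rw [norm_smul, Real.norm_eq_abs, abs_of_nonneg ht.1]
        refine (mul_le_of_le_one_left (norm_nonneg _) ht.2).trans ?_
        exact ((d h).le_opNorm _).trans (by
          gcongr
          exact (d.le_opNorm h).trans (by gcongr; exact hdC _ m1))
      have n4 : ‖(t • a h : 𝔸)‖ ≤ C * ‖h‖ := by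
        rw [norm_smul, Real.norm_eq_abs, abs_of_nonneg ht.1]
        refine (mul_le_of_le_one_left (norm_nonneg _) ht.2).trans ?_
        exact (a.le_opNorm h).trans (by gcongr; exact hγC _ m1)
      have n5 : ‖(b - a) (x + h) + a h‖ ≤ C * ‖h‖ + C * ‖h‖ := by
        refine (norm_add_le _ _).trans (add_le_add ?_ ?_)
        · exact ((b - a).le_opNorm _).trans
            (by simpa using mul_le_mul hba hxh1 (norm_nonneg _) (by positivity))
        · exact (a.le_opNorm h).trans (by gcongr; exact hγC _ m1)
      have n6 := (norm_mul_le (t • a h) ((b - a) (x + h) + a h)).trans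
        (mul_le_mul n4 n5 (norm_nonneg _) (by positivity))
      refine (norm_add_le _ _).trans (add_le_add ?_ ?_)
      · rw [mul_comm C]
        exact (norm_mul_le _ _).trans (by gcongr)
      · refine (norm_mul_le _ _).trans ?_
        rw [mul_assoc]
        refine mul_le_mul (hB t ht) ?_ (norm_nonneg _) hB0
        refine (norm_add_le _ _).trans ?_
        have := norm_add_le ((b - a - d (t • h)) (x + h)) (t • d h h)
        calc _ ≤ (C * ‖h‖ * ‖h‖ + C * ‖h‖ * ‖h‖) + C * ‖h‖ * (C * ‖h‖ + C * ‖h‖) :=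
              add_le_add (this.trans (add_le_add n2 n3)) n6
          _ = _ := by ring
    have := norm_le_gronwallBound_of_norm_deriv_right_le (δ := 0)
      (fun t ht => (hz t ht).continuousWithinAt)
      (fun t ht => (hz t ⟨ht.1, ht.2.le⟩).mono_of_mem_nhdsWithin (Icc_mem_nhdsGE_of_mem ht))
      (by simp [(hy _ hh).1, (hy x hx).1]) hbound 1 (by simp)
    simpa [mul_add, sub_sub] using this
  rw [hasFDerivAt_iff_isLittleO_nhds_zero]
  have hO : (fun h : E => y (x + h) 1 - y x 1 -
      ((ContinuousLinearMap.mul ℝ 𝔸 (y x 1)).comp (γ x)) h) =O[nhds 0] fun h => ‖h‖ * ‖h‖ := by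
    refine Asymptotics.IsBigO.of_bound (B * (2 * C + 2 * C * C) / C * (Real.exp C - 1)) ?_
    filter_upwards [key] with h hh
    rw [gronwallBound_of_K_ne_0 (by positivity)] at hh
    refine hh.trans (le_of_eq ?_)
    rw [Real.norm_of_nonneg (by positivity)]
    simp only [mul_one]
    ring
  refine hO.trans_isLittleO ?_
  simpa using (Asymptotics.isLittleO_norm_pow_id (E' := E) one_lt_two).congr_left
    (fun h => by rw [pow_two])

lemma contDiffOn_parallel_frame {γ : E → E →L[ℝ] 𝔸} {g : E → 𝔸} {W : Set E} (hW : IsOpen W)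
    (hγ : ContDiffOn ℝ ∞ γ W)
    (hg : ∀ x ∈ W, HasFDerivAt g ((ContinuousLinearMap.mul ℝ 𝔸 (g x)).comp (γ x)) x) :
    ContDiffOn ℝ ∞ g W := by
  have hd : DifferentiableOn ℝ g W := fun x hx => (hg x hx).differentiableAt.differentiableWithinAt
  refine contDiffOn_infty.2 fun n => ?_
  induction n with
  | zero => exact contDiffOn_zero.2 hd.continuousOn
  | succ n ih =>
    push_cast
    refine (contDiffOn_succ_iff_fderiv_of_isOpen hW).2 ⟨hd, fun h => by
      exact absurd h (by simp), ?_⟩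
    have : ContDiffOn ℝ n (fun x => (ContinuousLinearMap.mul ℝ 𝔸 (g x)).comp (γ x)) W :=
      ((ContinuousLinearMap.mul ℝ 𝔸).contDiff.comp_contDiffOn ih).clm_comp
        (hγ.of_le (by exact_mod_cast le_top))
    exact this.congr fun x hx => (hg x hx).fderiv

end FlatConnection

section ModelAlgebra

open Matrix

/-- The first three coordinates. -/
def xs (p : Euc 6) : V3 := fun i => p (castAdd 3 i)

/-- The last three coordinates. -/
def ys (p : Euc 6) : V3 := fun i => p (natAdd 3 i)

lemma xs_append (a b : V3) : xs (WithLp.toLp 2 (Fin.append a b)) = a := by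
  funext i; exact Fin.append_left a b i

lemma ys_append (a b : V3) : ys (WithLp.toLp 2 (Fin.append a b)) = b := by
  funext i; exact Fin.append_right a b i

/-- The form `dy_i + ε_{ijk} x^j dx^k`. -/
def theta₀ (p v : Euc 6) : V3 := fun i => ys v i + ∑ j, ∑ k, eps i j k * xs p j * xs v k

/-- The Maurer-Cartan form of the flat model in the frame `frame₀`. -/
def gamma₀ (p v : Euc 6) : Mat7 := so43 (theta₀ p v) (xs v) 0 0 0

/-- A moving frame of the flat model. -/
def frame₀ (p : Euc 6) : Mat7 :=
  mk7 1 0 0 (xs p) 1 0 (-vecMulVec (xs p) (xs p) - cross (ys p)) ((-2 : ℝ) • xs p) 1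

/-- The inverse of `frame₀`. -/
def frame₀Inv (p : Euc 6) : Mat7 :=
  mk7 1 0 0 (-xs p) 1 0 (-vecMulVec (xs p) (xs p) + cross (ys p)) ((2 : ℝ) • xs p) 1

lemma cross_transpose (v : V3) : (cross v)ᵀ = -cross v := by
  ext i j
  fin_cases i <;> fin_cases j <;> simp [cross]

lemma frame₀Inv_mul (p : Euc 6) : frame₀Inv p * frame₀ p = 1 := by
  rw [frame₀, frame₀Inv, mk7_mul, ← mk7_one]
  congr 1 <;> simp
  · rw [two_smul]; abel

lemma frame₀_mul (p : Euc 6) : frame₀ p * frame₀Inv p = 1 := mul_eq_one_comm.1 (frame₀Inv_mul p)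

/-- A block in the first three columns. -/
def blkA (g : Mat7) : Mat3 := !![g 0 0, g 0 1, g 0 2; g 1 0, g 1 1, g 1 2; g 2 0, g 2 1, g 2 2]

/-- A block in the first three columns. -/
def blkX (g : Mat7) : V3 := ![g 3 0, g 3 1, g 3 2]

/-- A block in the first three columns. -/
def blkZ (g : Mat7) : Mat3 := !![g 4 0, g 4 1, g 4 2; g 5 0, g 5 1, g 5 2; g 6 0, g 6 1, g 6 2]

/-- The vector corresponding to the skew part of a matrix. -/
def vee (Z : Mat3) : V3 := ![(Z 2 1 - Z 1 2) / 2, (Z 0 2 - Z 2 0) / 2, (Z 1 0 - Z 0 1) / 2]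

lemma vee_cross (v : V3) : vee (cross v) = v := by
  funext i; fin_cases i <;> simp [vee, cross]

lemma cross_vee {Z : Mat3} (h : Zᵀ = -Z) : cross (vee Z) = Z := by
  have e : ∀ i j, Z j i = -Z i j := fun i j => congrFun (congrFun h i) j
  have d : ∀ i, Z i i = 0 := fun i => by have := e i i; linarith
  ext i j
  fin_cases i <;> fin_cases j <;> simp [vee, cross, d] <;>
  linarith [e 0 1, e 0 2, e 1 2]

lemma exists_mk7 (g : Mat7) : ∃ u S c q z R, g = mk7 (blkA g) u S (blkX g) c q (blkZ g) z R :=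
  ⟨![g 0 3, g 1 3, g 2 3], !![g 0 4, g 0 5, g 0 6; g 1 4, g 1 5, g 1 6; g 2 4, g 2 5, g 2 6], g 3 3,
    ![g 3 4, g 3 5, g 3 6], ![g 4 3, g 5 3, g 6 3],
    !![g 4 4, g 4 5, g 4 6; g 5 4, g 5 5, g 5 6; g 6 4, g 6 5, g 6 6], by apply ext_seven <;> rfl⟩

variable {P S T R : Mat3} {u p q z : V3} {c : ℝ}

@[simp] lemma blkA_mk7 : blkA (mk7 P u S p c q T z R) = P := by
  ext i j; fin_cases i <;> fin_cases j <;> rfl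

@[simp] lemma blkX_mk7 : blkX (mk7 P u S p c q T z R) = p := by funext i; fin_cases i <;> rfl

@[simp] lemma blkZ_mk7 : blkZ (mk7 P u S p c q T z R) = T := by
  ext i j; fin_cases i <;> fin_cases j <;> rfl

lemma Q_eq_mk7 : Q = mk7 0 0 1 0 2 0 1 0 0 := by apply ext_seven <;> simp [Q_apply, mk7]

lemma mk7_transpose : (mk7 P u S p c q T z R)ᵀ = mk7 Pᵀ p Tᵀ u c z Sᵀ q Rᵀ := by
  apply ext_seven <;> simp [mk7]

/-- The chart of the flat model given by the first three columns. -/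
def kappa (g : Mat7) : Euc 6 :=
  WithLp.toLp 2 (Fin.append (blkX g ᵥ* (blkA g)⁻¹) (-vee (blkZ g * (blkA g)⁻¹)))

@[simp] lemma xs_kappa (g : Mat7) : xs (kappa g) = blkX g ᵥ* (blkA g)⁻¹ := xs_append _ _

@[simp] lemma ys_kappa (g : Mat7) :
    ys (kappa g) = -vee (blkZ g * (blkA g)⁻¹) :=
  ys_append _ _

lemma euc_ext {v w : Euc 6} (h1 : xs v = xs w) (h2 : ys v = ys w) : v = w := by
  ext i
  exact Fin.addCases (motive := fun i : Fin (3 + 3) => v i = w i) (fun j => congrFun h1 j)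
    (fun j => congrFun h2 j) i

/-- The orthogonal group of `Q`. -/
def IsOrth (g : Mat7) : Prop := gᵀ * Q * g = Q

lemma IsOrth.mul {g h : Mat7} (hg : IsOrth g) (hh : IsOrth h) : IsOrth (g * h) := by
  rw [IsOrth, transpose_mul]
  calc hᵀ * gᵀ * Q * (g * h) = hᵀ * (gᵀ * Q * g) * h := by simp only [Matrix.mul_assoc]
    _ = Q := by rw [hg, hh]

lemma forall_fin_seven {P : Fin 7 → Prop} (h : ∀ i, P i) :
    P 0 ∧ P 1 ∧ P 2 ∧ P 3 ∧ P 4 ∧ P 5 ∧ P 6 := ⟨h 0, h 1, h 2, h 3, h 4, h 5, h 6⟩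

lemma frame₀_isOrth (p : Euc 6) : IsOrth (frame₀ p) := by
  rw [IsOrth, frame₀, mk7_transpose, Q_eq_mk7, mk7_mul, mk7_mul]
  congr 1 <;> simp [cross_transpose, transpose_vecMulVec, smul_vecMulVec]
  all_goals simp only [two_smul]
  all_goals abel

lemma IsOrth.isotropic {g : Mat7} (hg : IsOrth g) :
    (blkA g)ᵀ * blkZ g + (2 : ℝ) • vecMulVec (blkX g) (blkX g) + (blkZ g)ᵀ * blkA g = 0 := by
  obtain ⟨u, S, c, q, z, R, h⟩ := exists_mk7 g
  have h1 := congrArg blkA hg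
  rw [h, mk7_transpose, Q_eq_mk7, mk7_mul, mk7_mul, blkA_mk7, blkA_mk7] at h1
  simp only [Matrix.mul_zero, Matrix.mul_one, zero_add, add_zero, vecMulVec_zero, mulVec_zero,
    smul_vecMulVec] at h1
  rw [← h1]
  abel

lemma IsOrth.blk_eq_zero {g : Mat7} (hg : IsOrth g) (hA : IsUnit (blkA g).det) :
    blkA (frame₀Inv (kappa g) * g) = blkA g ∧ blkX (frame₀Inv (kappa g) * g) = 0 ∧
      blkZ (frame₀Inv (kappa g) * g) = 0 := by
  obtain ⟨u, S, c, q, z, R, h⟩ := exists_mk7 g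
  have hiso := hg.isotropic
  set A := blkA g
  set X := blkX g
  set Z := blkZ g
  have hAA : A⁻¹ * A = 1 := nonsing_inv_mul A hA
  have hAA' : A * A⁻¹ = 1 := mul_nonsing_inv A hA
  have hx : (X ᵥ* A⁻¹) ᵥ* A = X := by rw [vecMul_vecMul, hAA, vecMul_one]
  have hW : (Z * A⁻¹) + (Z * A⁻¹)ᵀ = -(2 : ℝ) • vecMulVec (X ᵥ* A⁻¹) (X ᵥ* A⁻¹) := by
    have h1 : (A⁻¹)ᵀ * (Aᵀ * Z + (2 : ℝ) • vecMulVec X X + Zᵀ * A) * A⁻¹ = 0 := by rw [hiso]; simp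
    have h2 : (A⁻¹)ᵀ * Aᵀ = 1 := by rw [← transpose_mul, hAA', transpose_one]
    have h3 : (A⁻¹)ᵀ * (Aᵀ * Z + (2 : ℝ) • vecMulVec X X + Zᵀ * A) * A⁻¹ =
        ((A⁻¹)ᵀ * Aᵀ) * (Z * A⁻¹) + (2 : ℝ) • vecMulVec (X ᵥ* A⁻¹) (X ᵥ* A⁻¹) +
          ((A⁻¹)ᵀ * Zᵀ) * (A * A⁻¹) := by
      have : vecMulVec (X ᵥ* A⁻¹) (X ᵥ* A⁻¹) = (A⁻¹)ᵀ * vecMulVec X X * A⁻¹ := by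
        rw [mul_vecMulVec, vecMulVec_mul, mulVec_transpose]
      rw [this]
      simp only [Matrix.mul_add, Matrix.add_mul, Matrix.mul_assoc, Matrix.mul_smul, Matrix.smul_mul]
    rw [h3, h2, hAA', Matrix.one_mul, Matrix.mul_one, ← transpose_mul] at h1
    rw [neg_smul, eq_neg_iff_add_eq_zero, ← h1]
    abel
  have hc : cross (vee (Z * A⁻¹)) = Z * A⁻¹ + vecMulVec (X ᵥ* A⁻¹) (X ᵥ* A⁻¹) := by
    have hs : (Z * A⁻¹ + vecMulVec (X ᵥ* A⁻¹) (X ᵥ* A⁻¹))ᵀ =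
        -(Z * A⁻¹ + vecMulVec (X ᵥ* A⁻¹) (X ᵥ* A⁻¹)) := by
      rw [transpose_add, transpose_vecMulVec, eq_neg_iff_add_eq_zero]
      have : (Z * A⁻¹)ᵀ + vecMulVec (X ᵥ* A⁻¹) (X ᵥ* A⁻¹) +
          (Z * A⁻¹ + vecMulVec (X ᵥ* A⁻¹) (X ᵥ* A⁻¹)) = (Z * A⁻¹ + (Z * A⁻¹)ᵀ) +
          (2 : ℝ) • vecMulVec (X ᵥ* A⁻¹) (X ᵥ* A⁻¹) := by rw [two_smul]; abel
      rw [this, hW]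
      simp
    rw [← cross_vee hs]
    congr 1
    funext i
    fin_cases i <;> simp [vee, vecMulVec_apply] <;> ring
  have hneg : cross (-vee (Z * A⁻¹)) = -cross (vee (Z * A⁻¹)) := by
    ext i j; fin_cases i <;> fin_cases j <;> simp [cross]
  have e : frame₀Inv (kappa g) * g = mk7 1 0 0 (-(X ᵥ* A⁻¹)) 1 0
      (-((2 : ℝ) • vecMulVec (X ᵥ* A⁻¹) (X ᵥ* A⁻¹)) - Z * A⁻¹) ((2 : ℝ) • (X ᵥ* A⁻¹)) 1 *
        mk7 A u S X c q Z z R := by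
    rw [← h, frame₀Inv, xs_kappa, ys_kappa, hneg, hc]
    congr 2
    rw [two_smul]
    abel
  rw [e, mk7_mul, blkA_mk7, blkX_mk7, blkZ_mk7]
  refine ⟨by simp, by simp [neg_vecMul, hx], ?_⟩
  have hvm : vecMulVec (X ᵥ* A⁻¹) (X ᵥ* A⁻¹) * A = vecMulVec (X ᵥ* A⁻¹) X := by
    rw [vecMulVec_mul, hx]
  simp only [Matrix.sub_mul, Matrix.neg_mul, Matrix.smul_mul, hvm, Matrix.mul_assoc, hAA,
    Matrix.mul_one, Matrix.one_mul, smul_vecMulVec]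
  abel

lemma blkZ_of_conj {h s s' : Mat7} (hh : IsOrth h) (hX : blkX h = 0)
    (hZ : blkZ h = 0) (hs : s' * h = h * s) : blkZ s = (blkA h)ᵀ * blkZ s' * blkA h := by
  have key : Q * s = hᵀ * (Q * (s' * h)) := by
    rw [hs, ← Matrix.mul_assoc Q, ← Matrix.mul_assoc, ← Matrix.mul_assoc, hh]
  obtain ⟨u, S, c, q, z, R, e⟩ := exists_mk7 h
  obtain ⟨u', S', c', q', z', R', e'⟩ := exists_mk7 s'
  obtain ⟨u₂, S₂, c₂, q₂, z₂, R₂, e₂⟩ := exists_mk7 s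
  rw [hX, hZ] at e
  rw [e, e', e₂] at key
  have := congrArg blkA key
  rw [mk7_transpose, Q_eq_mk7, mk7_mul, mk7_mul, mk7_mul, mk7_mul, blkA_mk7, blkA_mk7] at this
  simpa [Matrix.mul_assoc] using this

lemma eq_so43 {s : Mat7} (hs : s ∈ skewQ) : s = so43 ![s 5 2, s 6 0, s 4 1] (blkX s)
      (fun i j => ![![s 4 4, s 4 5, s 4 6], ![s 5 4, s 5 5, s 5 6], ![s 6 4, s 6 5, s 6 6]] i j)
      ![-s 3 4, -s 3 5, -s 3 6] ![s 2 5, s 0 6, s 1 4] := by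
  rw [mem_skewAdjointMatricesLieSubalgebra, mem_skewAdjointMatricesSubmodule,
    Matrix.IsSkewAdjoint, Matrix.IsAdjointPair] at hs
  have e : ∀ i j, (sᵀ * Q) i j = (Q * -s) i j := fun i j => by rw [hs]
  simp only [Matrix.mul_apply, sum_univ_seven, transpose_apply, Matrix.neg_apply, Q_apply] at e
  have h := fun i => forall_fin_seven (e i)
  simp only [Q_apply, mul_zero, mul_one, zero_add, add_zero] at h
  have h0 := h 0; have h1 := h 1; have h2 := h 2; have h3 := h 3
  have h4 := h 4; have h5 := h 5; have h6 := h 6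
  simp only [Q_apply, zero_mul, one_mul, zero_add, add_zero] at h0 h1 h2 h3 h4 h5 h6
  obtain ⟨h00, h01, h02, h03, h04, h05, h06⟩ := h0
  obtain ⟨-, h11, h12, h13, h14, h15, h16⟩ := h1
  obtain ⟨-, -, h22, h23, h24, h25, h26⟩ := h2
  obtain ⟨-, -, -, h33, h34, h35, h36⟩ := h3
  obtain ⟨-, -, -, -, h44, h45, h46⟩ := h4
  obtain ⟨-, -, -, -, -, h55, h56⟩ := h5
  obtain ⟨-, -, -, -, -, -, h66⟩ := h6
  clear h e hs
  apply ext_seven <;> simp only [so43, of_apply, blkX, cons_val] <;>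
    linarith

/-- The vector field on the flat model induced by a matrix. -/
def modelField (a : Mat7) (p : Euc 6) : Euc 6 :=
  WithLp.toLp 2 (Fin.append (blkX (frame₀Inv p * a * frame₀ p))
    (fun i => -vee (blkZ (frame₀Inv p * a * frame₀ p)) i -
      ∑ j, ∑ k, eps i j k * xs p j * blkX (frame₀Inv p * a * frame₀ p) k))

lemma xs_modelField (a : Mat7) (p : Euc 6) :
    xs (modelField a p) = blkX (frame₀Inv p * a * frame₀ p) := xs_append _ _

lemma theta₀_modelField (a : Mat7) (p : Euc 6) :
    theta₀ p (modelField a p) = -vee (blkZ (frame₀Inv p * a * frame₀ p)) := by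
  have : ys (modelField a p) = fun i => -vee (blkZ (frame₀Inv p * a * frame₀ p)) i -
      ∑ j, ∑ k, eps i j k * xs p j * blkX (frame₀Inv p * a * frame₀ p) k :=
    ys_append _ _
  funext i
  simp only [theta₀, this, xs_modelField, Pi.neg_apply]
  ring

lemma ext_theta₀ {p v w : Euc 6} (h1 : xs v = xs w) (h2 : theta₀ p v = theta₀ p w) : v = w := by
  refine euc_ext h1 (funext fun i => ?_)
  have := congrFun h2 i
  simp only [theta₀, h1] at this
  linarith

@[simp] lemma blkX_so43 (θ om : V3) (α : Fin 3 → V3) (β τ : V3) :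
    blkX (so43 θ om α β τ) = om := by rw [so43_eq_mk7, blkX_mk7]

@[simp] lemma blkZ_so43 (θ om : V3) (α : Fin 3 → V3) (β τ : V3) :
    blkZ (so43 θ om α β τ) = -cross θ := by rw [so43_eq_mk7, blkZ_mk7]

end ModelAlgebra

section ModelCalculus

open Matrix

attribute [local instance] linftyOpNormedRing linftyOpNormedAlgebra

/-- The topology of the norm on matrices. -/
abbrev mat7Topology : TopologicalSpace Mat7 := PseudoMetricSpace.toUniformSpace.toTopologicalSpace

attribute [local instance] mat7Topology

/-- The entries of a matrix as continuous linear maps. -/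
def entryCLM (a b : Fin 7) : Mat7 →L[ℝ] ℝ :=
  LinearMap.toContinuousLinearMap (Matrix.entryLinearMap ℝ ℝ a b)

@[simp] lemma entryCLM_apply (a b : Fin 7) (g : Mat7) : entryCLM a b g = g a b := rfl

lemma sum_entries (g : Mat7) : g = ∑ a, ∑ b, g a b • (Matrix.single a b (1 : ℝ) : Mat7) := by
  conv_lhs => rw [Matrix.matrix_eq_sum_single g]
  simp [Matrix.smul_single]

variable {E : Type*} [NormedAddCommGroup E] [NormedSpace ℝ E]
  {g : E → Mat7} {g' : E →L[ℝ] Mat7} {x : E}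

lemma hasFDerivAt_entry (h : HasFDerivAt g g' x)
    (a b : Fin 7) : HasFDerivAt (fun y => g y a b) ((entryCLM a b).comp g') x :=
  (entryCLM a b).hasFDerivAt.comp x h

lemma contDiffAt_of_entries {n : WithTop ℕ∞}
    (h : ∀ a b, ContDiffAt ℝ n (fun y => g y a b) x) : ContDiffAt ℝ n g x := by
  have : g = fun y => ∑ a, ∑ b, g y a b • (Matrix.single a b (1 : ℝ) : Mat7) :=
    funext fun y => sum_entries (g y)
  rw [this]
  exact ContDiffAt.sum fun a _ => ContDiffAt.sum fun b _ => (h a b).smul contDiffAt_const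

lemma contDiffAt_entry {n : WithTop ℕ∞} (h : ContDiffAt ℝ n g x)
    (a b : Fin 7) : ContDiffAt ℝ n (fun y => g y a b) x :=
  (entryCLM a b).contDiff.contDiffAt.comp x h

lemma eq_zero_of_entry (h : HasFDerivAt g g' x)
    {a b : Fin 7} (h0 : ∀ᶠ y in nhds x, g y a b = 0) (v : E) : g' v a b = 0 := by
  have h1 := (hasFDerivAt_entry h a b).congr_of_eventuallyEq
    (f₁ := fun _ => (0 : ℝ)) (by filter_upwards [h0] with y hy using hy.symm)
  exact DFunLike.congr_fun (h1.unique (hasFDerivAt_const _ _)) v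

/-- The coordinate functions of `Euc 6`. -/
def coordCLM (i : Fin 6) : Euc 6 →L[ℝ] ℝ := EuclideanSpace.proj i

lemma contDiff_frame₀ : ContDiff ℝ ∞ frame₀ := by
  have h : ∀ i : Fin 6, ContDiff ℝ ∞ fun p : Euc 6 => p i := fun i => (coordCLM i).contDiff
  refine contDiff_iff_contDiffAt.2 fun p => contDiffAt_of_entries fun a b => ?_
  refine ContDiff.contDiffAt ?_
  fin_cases a <;> fin_cases b <;>
  simp [frame₀, mk7, vecMulVec_apply, cross, xs, ys] <;>
  fun_prop (disch := assumption)

lemma frame₀Inv_eq (p : Euc 6) : frame₀Inv p = frame₀ (-p) := by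
  have h1 : xs (-p) = -xs p := rfl
  have h2 : ys (-p) = -ys p := rfl
  have h3 : cross (-ys p) = -cross (ys p) := by
    ext i j; fin_cases i <;> fin_cases j <;> simp [cross]
  rw [frame₀Inv, frame₀, h1, h2, h3]
  congr 1 <;> simp

lemma contDiff_frame₀Inv : ContDiff ℝ ∞ frame₀Inv := by
  rw [show frame₀Inv = fun p => frame₀ (-p) from funext frame₀Inv_eq]
  exact contDiff_frame₀.comp contDiff_neg

lemma fderiv_frame₀ (p v : Euc 6) : fderiv ℝ frame₀ p v = frame₀ p * gamma₀ p v := by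
  have hd := (contDiff_frame₀.differentiable (by simp) p).hasFDerivAt
  have hc : ∀ i : Fin 6, HasFDerivAt (fun p : Euc 6 => p i) (coordCLM i) p :=
    fun i => (coordCLM i).hasFDerivAt
  have key : ∀ (a b : Fin 7) {f : Euc 6 → ℝ} {f' : Euc 6 →L[ℝ] ℝ}, (∀ q, frame₀ q a b = f q) →
      HasFDerivAt f f' p → fderiv ℝ frame₀ p v a b = f' v := by
    intro a b f f' h hf
    have h1 := hasFDerivAt_entry hd a b
    have : (fun q => frame₀ q a b) = f := funext h
    rw [this] at h1
    exact DFunLike.congr_fun (h1.unique hf) v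
  have kx : ∀ i : Fin 3, HasFDerivAt (fun p : Euc 6 => xs p i) (coordCLM (castAdd 3 i)) p :=
    fun i => hc _
  have ky : ∀ i : Fin 3, HasFDerivAt (fun p : Euc 6 => ys p i) (coordCLM (natAdd 3 i)) p :=
    fun i => hc _
  have ex : ∀ i v, coordCLM (castAdd 3 i) v = xs v i := fun _ _ => rfl
  have ey : ∀ i v, coordCLM (natAdd 3 i) v = ys v i := fun _ _ => rfl
  have r0 : ∀ (a b : Fin 7) (c : ℝ), (∀ q, frame₀ q a b = c) →
      fderiv ℝ frame₀ p v a b = 0 := fun a b c h => key a b h (hasFDerivAt_const c p)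
  have rx : ∀ (a b : Fin 7) (i : Fin 3), (∀ q, frame₀ q a b = xs q i) →
      fderiv ℝ frame₀ p v a b = xs v i := fun a b i h => key a b h (kx i)
  have rz : ∀ (a b : Fin 7) (i : Fin 3), (∀ q, frame₀ q a b = -2 * xs q i) →
      fderiv ℝ frame₀ p v a b = -2 * xs v i := fun a b i h => by
    rw [key a b h ((kx i).const_mul (-2)), _root_.smul_apply, ex, smul_eq_mul]
  have rw' : ∀ (a b : Fin 7) (i j k : Fin 3) (c : ℝ),
      (∀ q, frame₀ q a b = -(xs q i * xs q j) + c * ys q k) →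
      fderiv ℝ frame₀ p v a b = -(xs p i * xs v j + xs p j * xs v i) + c * ys v k :=
    fun a b i j k c h => by
      rw [key a b h ((((kx i).mul (kx j)).neg).add ((ky k).const_mul c))]
      simp only [_root_.add_apply, _root_.neg_apply, _root_.smul_apply, ex, ey, smul_eq_mul]
  have fz : ∀ (a b : Fin 7) (i j k : Fin 3) (c : ℝ), (∀ v, cross v i j = -(c * v k)) →
      (∀ q, frame₀ q a b = (-vecMulVec (xs q) (xs q) - cross (ys q)) i j) →
      fderiv ℝ frame₀ p v a b =
        (-(vecMulVec (xs p) (xs v) + vecMulVec (xs v) (xs p)) - cross (ys v)) i j :=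
    fun a b i j k c h1 h2 => by
      have h3 : ∀ q, frame₀ q a b = -(xs q i * xs q j) + c * ys q k := fun q => by
        rw [h2, Matrix.sub_apply, h1, Matrix.neg_apply, vecMulVec_apply]
        ring
      rw [rw' a b i j k c h3, Matrix.sub_apply, h1, Matrix.neg_apply, Matrix.add_apply,
        vecMulVec_apply, vecMulVec_apply]
      ring
  have e1 : fderiv ℝ frame₀ p v = mk7 0 0 0 (xs v) 0 0
      (-(vecMulVec (xs p) (xs v) + vecMulVec (xs v) (xs p)) - cross (ys v)) ((-2 : ℝ) • xs v) 0 := by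
    apply ext_seven
    on_goal 29 => exact fz _ _ 0 0 0 0 (by simp [cross]) fun _ => rfl
    on_goal 29 => exact fz _ _ 0 1 2 1 (by simp [cross]) fun _ => rfl
    on_goal 29 => exact fz _ _ 0 2 1 (-1) (by simp [cross]) fun _ => rfl
    on_goal 33 => exact fz _ _ 1 0 2 (-1) (by simp [cross]) fun _ => rfl
    on_goal 33 => exact fz _ _ 1 1 0 0 (by simp [cross]) fun _ => rfl
    on_goal 33 => exact fz _ _ 1 2 0 1 (by simp [cross]) fun _ => rfl
    on_goal 37 => exact fz _ _ 2 0 1 1 (by simp [cross]) fun _ => rfl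
    on_goal 37 => exact fz _ _ 2 1 0 (-1) (by simp [cross]) fun _ => rfl
    on_goal 37 => exact fz _ _ 2 2 0 0 (by simp [cross]) fun _ => rfl
    any_goals exact r0 _ _ _ fun _ => rfl
    exacts [rx _ _ 0 fun _ => rfl, rx _ _ 1 fun _ => rfl, rx _ _ 2 fun _ => rfl,
      rz _ _ 0 fun _ => rfl, rz _ _ 1 fun _ => rfl, rz _ _ 2 fun _ => rfl]
  have e2 : cross (theta₀ p v) = cross (ys v) + vecMulVec (xs v) (xs p) - vecMulVec (xs p) (xs v) := by
    ext i j
    fin_cases i <;> fin_cases j <;>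
      simp [cross, theta₀, vecMulVec_apply, sum_univ_three] <;> ring
  rw [e1, frame₀, gamma₀, so43_eq_mk7, mk7_mul]
  have e3 : cross 0 = 0 := by ext i j; fin_cases i <;> fin_cases j <;> simp [cross]
  congr 1 <;> simp [e2, e3, smul_vecMulVec]
  all_goals simp only [two_smul]
  all_goals abel

lemma contDiffAt_kappa {g : Mat7} (hg : (blkA g).det ≠ 0) : ContDiffAt ℝ ∞ kappa g := by
  have h : ∀ a b, ContDiffAt ℝ ∞ (fun g : Mat7 => g a b) g := fun a b =>
    contDiffAt_entry contDiffAt_id a b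
  have hA : ∀ i j, ContDiffAt ℝ ∞ (fun g : Mat7 => blkA g i j) g := by
    intro i j; fin_cases i <;> fin_cases j <;> exact h _ _
  have hX : ∀ i, ContDiffAt ℝ ∞ (fun g : Mat7 => blkX g i) g := by
    intro i; fin_cases i <;> exact h _ _
  have hZ : ∀ i j, ContDiffAt ℝ ∞ (fun g : Mat7 => blkZ g i j) g := by
    intro i j; fin_cases i <;> fin_cases j <;> exact h _ _
  have hdet : ContDiffAt ℝ ∞ (fun g : Mat7 => (blkA g).det) g := by
    simp only [det_fin_three]
    exact ((((((((hA 0 0).mul (hA 1 1)).mul (hA 2 2)).sub (((hA 0 0).mul (hA 1 2)).mul (hA 2 1))).sub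
      (((hA 0 1).mul (hA 1 0)).mul (hA 2 2))).add (((hA 0 1).mul (hA 1 2)).mul (hA 2 0))).add
      (((hA 0 2).mul (hA 1 0)).mul (hA 2 1))).sub (((hA 0 2).mul (hA 1 1)).mul (hA 2 0)))
  have hinv : ∀ i j, ContDiffAt ℝ ∞ (fun g : Mat7 => (blkA g)⁻¹ i j) g := by
    intro i j
    simp only [Matrix.inv_def, Matrix.smul_apply, smul_eq_mul, Ring.inverse_eq_inv',
      Matrix.adjugate_fin_three]
    refine (hdet.inv hg).mul ?_
    fin_cases i <;> fin_cases j <;>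
    simp only [Fin.zero_eta, Fin.mk_one, Fin.reduceFinMk, of_apply, cons_val] <;>
    fun_prop
  have hx : ∀ j, ContDiffAt ℝ ∞ (fun g : Mat7 => xs (kappa g) j) g := by
    intro j
    simp only [xs_kappa, vecMul, dotProduct]
    exact ContDiffAt.sum fun i _ => (hX i).mul (hinv i j)
  have hW : ∀ i j, ContDiffAt ℝ ∞ (fun g : Mat7 => (blkZ g * (blkA g)⁻¹) i j) g := by
    intro i j
    simp only [Matrix.mul_apply]
    exact ContDiffAt.sum fun k _ => (hZ i k).mul (hinv k j)
  have hy : ∀ j, ContDiffAt ℝ ∞ (fun g : Mat7 => ys (kappa g) j) g := by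
    intro j
    simp only [ys_kappa, Pi.neg_apply]
    refine ContDiffAt.neg ?_
    fin_cases j <;> simp only [vee, Fin.zero_eta, Fin.mk_one, Fin.reduceFinMk, cons_val]
    exacts [((hW 2 1).sub (hW 1 2)).div_const 2, ((hW 0 2).sub (hW 2 0)).div_const 2,
      ((hW 1 0).sub (hW 0 1)).div_const 2]
  rw [contDiffAt_euclidean]
  exact fun i => Fin.addCases (motive := fun i : Fin (3 + 3) =>
    ContDiffAt ℝ ∞ (fun g : Mat7 => kappa g i) g) hx hy i

lemma blkX_mul {s h : Mat7} (hX : blkX h = 0) (hZ : blkZ h = 0) :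
    blkX (s * h) = blkX s ᵥ* blkA h := by
  obtain ⟨u, S, c, q, z, R, e⟩ := exists_mk7 h
  obtain ⟨u', S', c', q', z', R', e'⟩ := exists_mk7 s
  conv_lhs => rw [e, e', mk7_mul, blkX_mk7, hX, hZ]
  simp

lemma blkZ_mul {s h : Mat7} (hX : blkX h = 0) (hZ : blkZ h = 0) :
    blkZ (s * h) = blkZ s * blkA h := by
  obtain ⟨u, S, c, q, z, R, e⟩ := exists_mk7 h
  obtain ⟨u', S', c', q', z', R', e'⟩ := exists_mk7 s
  conv_lhs => rw [e, e', mk7_mul, blkZ_mk7, hX, hZ]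
  simp

lemma blkX_add (s h : Mat7) : blkX (s + h) = blkX s + blkX h := by funext i; fin_cases i <;> rfl

lemma blkZ_add (s h : Mat7) : blkZ (s + h) = blkZ s + blkZ h := by
  ext i j; fin_cases i <;> fin_cases j <;> rfl

lemma IsOrth.inverse {g : Mat7} (hg : IsOrth g) : ∃ k : Mat7, g * k = 1 ∧ k * g = 1 := by
  have hQ : Q * mk7 0 0 1 0 (1 / 2) 0 1 0 0 = 1 := by
    rw [Q_eq_mk7, mk7_mul, ← mk7_one]
    congr 1 <;> simp
  have : (mk7 0 0 1 0 (1 / 2) 0 1 0 0 * gᵀ * Q) * g = 1 := by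
    rw [Matrix.mul_assoc, Matrix.mul_assoc, ← Matrix.mul_assoc gᵀ, hg]
    exact mul_eq_one_comm.1 hQ
  exact ⟨_, mul_eq_one_comm.1 this, this⟩

lemma frame₀Inv_isOrth (p : Euc 6) : IsOrth (frame₀Inv p) := frame₀Inv_eq p ▸ frame₀_isOrth _

lemma entry_zero_of_blk {h : Mat7} (hX : blkX h = 0) (hZ : blkZ h = 0) :
    (h 3 0 = 0 ∧ h 3 1 = 0 ∧ h 3 2 = 0) ∧ (h 4 0 = 0 ∧ h 4 1 = 0 ∧ h 4 2 = 0) ∧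
      (h 5 0 = 0 ∧ h 5 1 = 0 ∧ h 5 2 = 0) ∧ (h 6 0 = 0 ∧ h 6 1 = 0 ∧ h 6 2 = 0) :=
  have x := fun i => congrFun hX i
  have z := fun i j => congrFun (congrFun hZ i) j
  ⟨⟨x 0, x 1, x 2⟩, ⟨z 0 0, z 0 1, z 0 2⟩, ⟨z 1 0, z 1 1, z 1 2⟩, ⟨z 2 0, z 2 1, z 2 2⟩⟩

lemma blk_gamma₀_kappa (hg : HasFDerivAt g g' x)
    (horth : ∀ᶠ y in nhds x, IsOrth (g y)) (hA : (blkA (g x)).det ≠ 0) {v : E} {a : Mat7}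
    (ha : g' v = a * g x) : let φ := fun y => kappa (g y)
    let s := frame₀Inv (φ x) * a * frame₀ (φ x)
    DifferentiableAt ℝ φ x ∧ blkX s = xs (fderiv ℝ φ x v) ∧
      blkZ s = -cross (theta₀ (φ x) (fderiv ℝ φ x v)) := by
  intro φ s
  have hφ : DifferentiableAt ℝ φ x :=
    (contDiffAt_kappa hA).diffAt.comp x hg.differentiableAt
  refine ⟨hφ, ?_⟩
  have hd : ∀ᶠ y in nhds x, (blkA (g y)).det ≠ 0 := by
    have : ContinuousAt (fun y => (blkA (g y)).det) x := by
      have h : ∀ a b, ContinuousAt (fun y => g y a b) x := fun a b =>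
        (hasFDerivAt_entry hg a b).continuousAt
      simp only [det_fin_three, blkA, of_apply, cons_val]
      fun_prop
    exact this.eventually_ne hA
  have hblk : ∀ᶠ y in nhds x, blkX (frame₀Inv (φ y) * g y) = 0 ∧
      blkZ (frame₀Inv (φ y) * g y) = 0 := by
    filter_upwards [horth, hd] with y h1 h2
    exact (h1.blk_eq_zero (isUnit_iff_ne_zero.2 h2)).2
  have hAx := (horth.self_of_nhds.blk_eq_zero (isUnit_iff_ne_zero.2 hA)).1
  set h := fun y => frame₀Inv (φ y) * g y with hh
  have hhx : h x = frame₀Inv (φ x) * g x := rfl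
  have hb : blkX (h x) = 0 ∧ blkZ (h x) = 0 := hblk.self_of_nhds
  have hI : DifferentiableAt ℝ (fun y => frame₀Inv (φ y)) x :=
    (contDiff_frame₀Inv.differentiable (by simp) _).comp x hφ
  have hdh : HasFDerivAt h (fderiv ℝ h x) x := (hI.mul hg.differentiableAt).hasFDerivAt
  have hF : HasFDerivAt (fun y => frame₀ (φ y)) ((fderiv ℝ frame₀ (φ x)).comp (fderiv ℝ φ x)) x :=
    (contDiff_frame₀.differentiable (by simp) _).hasFDerivAt.comp x hφ.hasFDerivAt
  have hgh : g = fun y => frame₀ (φ y) * h y := by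
    funext y
    rw [hh, ← Matrix.mul_assoc, frame₀_mul, Matrix.one_mul]
  have key : s * h x = gamma₀ (φ x) (fderiv ℝ φ x v) * h x + fderiv ℝ h x v := by
    have h1 := hF.mul' hdh
    have h2 : g' v = frame₀ (φ x) * fderiv ℝ h x v +
        frame₀ (φ x) * gamma₀ (φ x) (fderiv ℝ φ x v) * h x := by
      have h3 := h1.congr_of_eventuallyEq (f₁ := g) (Filter.Eventually.of_forall (congrFun hgh))
      rw [hg.unique h3, ← fderiv_frame₀]
      rfl
    have h4 : s * h x = frame₀Inv (φ x) * (a * g x) := by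
      rw [hhx]
      simp only [s, Matrix.mul_assoc]
      rw [← Matrix.mul_assoc (frame₀ (φ x)), frame₀_mul, Matrix.one_mul]
    rw [h4, ← ha, h2, Matrix.mul_add, ← Matrix.mul_assoc, frame₀Inv_mul, Matrix.one_mul,
      Matrix.mul_assoc (frame₀ (φ x)), ← Matrix.mul_assoc (frame₀Inv (φ x)), frame₀Inv_mul,
      Matrix.one_mul, add_comm]
  have hz : blkX (fderiv ℝ h x v) = 0 ∧ blkZ (fderiv ℝ h x v) = 0 := by
    have e : ∀ a b, (∀ᶠ y in nhds x, h y a b = 0) → fderiv ℝ h x v a b = 0 := fun a b h0 =>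
      eq_zero_of_entry hdh h0 v
    have z := hblk.mono fun y hy => entry_zero_of_blk hy.1 hy.2
    constructor
    · funext i
      fin_cases i
      exacts [e 3 0 (z.mono fun y hy => hy.1.1), e 3 1 (z.mono fun y hy => hy.1.2.1),
        e 3 2 (z.mono fun y hy => hy.1.2.2)]
    · ext i j
      fin_cases i <;> fin_cases j
      exacts [e 4 0 (z.mono fun y hy => hy.2.1.1), e 4 1 (z.mono fun y hy => hy.2.1.2.1),
        e 4 2 (z.mono fun y hy => hy.2.1.2.2), e 5 0 (z.mono fun y hy => hy.2.2.1.1),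
        e 5 1 (z.mono fun y hy => hy.2.2.1.2.1), e 5 2 (z.mono fun y hy => hy.2.2.1.2.2),
        e 6 0 (z.mono fun y hy => hy.2.2.2.1), e 6 1 (z.mono fun y hy => hy.2.2.2.2.1),
        e 6 2 (z.mono fun y hy => hy.2.2.2.2.2)]
  have hu : IsUnit (blkA (h x)).det := by rw [hhx, hAx]; exact isUnit_iff_ne_zero.2 hA
  have hX := congrArg blkX key
  have hZ := congrArg blkZ key
  rw [blkX_add, blkX_mul hb.1 hb.2, blkX_mul hb.1 hb.2, hz.1, add_zero] at hX
  rw [blkZ_add, blkZ_mul hb.1 hb.2, blkZ_mul hb.1 hb.2, hz.2, add_zero] at hZ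
  constructor
  · have := congrArg (fun w => w ᵥ* (blkA (h x))⁻¹) hX
    simpa [vecMul_vecMul, mul_nonsing_inv _ hu, gamma₀] using this
  · have := congrArg (fun w => w * (blkA (h x))⁻¹) hZ
    simpa [Matrix.mul_assoc, mul_nonsing_inv _ hu, gamma₀] using this

lemma vee_neg_cross (v : V3) : v = -vee (-cross v) := by
  funext i
  fin_cases i <;> simp [vee, cross] <;> ring

lemma cross_eq_zero_iff {v : V3} : cross v = 0 ↔ v = 0 := by
  constructor
  · intro h
    rw [← vee_cross v, h]
    funext i; fin_cases i <;> simp [vee]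
  · rintro rfl
    ext i j; fin_cases i <;> fin_cases j <;> simp [cross]

lemma fderiv_kappa_eq_modelField
    (hg : HasFDerivAt g g' x) (horth : ∀ᶠ y in nhds x, IsOrth (g y)) (hA : (blkA (g x)).det ≠ 0)
    {v : E} {a : Mat7} (ha : g' v = a * g x) :
    fderiv ℝ (fun y => kappa (g y)) x v = modelField a (kappa (g x)) := by
  obtain ⟨-, h1, h2⟩ := blk_gamma₀_kappa hg horth hA ha
  refine ext_theta₀ (p := kappa (g x)) ?_ ?_
  · rw [xs_modelField, h1]
  · rw [theta₀_modelField, h2, ← vee_neg_cross]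

lemma theta₀_kappa_eq_zero_iff
    (hg : HasFDerivAt g g' x) (horth : ∀ᶠ y in nhds x, IsOrth (g y)) (hA : (blkA (g x)).det ≠ 0)
    {v : E} {s : Mat7} (hs : g' v = g x * s) :
    theta₀ (kappa (g x)) (fderiv ℝ (fun y => kappa (g y)) x v) = 0 ↔ blkZ s = 0 := by
  obtain ⟨k, hk1, hk2⟩ := horth.self_of_nhds.inverse
  have ha : g' v = (g x * s * k) * g x := by rw [Matrix.mul_assoc, hk2, Matrix.mul_one, hs]
  obtain ⟨-, -, h2⟩ := blk_gamma₀_kappa hg horth hA ha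
  obtain ⟨e1, e2, e3⟩ := horth.self_of_nhds.blk_eq_zero (isUnit_iff_ne_zero.2 hA)
  have h3 := blkZ_of_conj (s := s) ((frame₀Inv_isOrth (kappa (g x))).mul horth.self_of_nhds) e2 e3
    (s' := frame₀Inv (kappa (g x)) * (g x * s * k) * frame₀ (kappa (g x))) (by
      calc _ = frame₀Inv (kappa (g x)) * (g x * s * k) * (frame₀ (kappa (g x)) *
              frame₀Inv (kappa (g x))) * g x := by simp only [Matrix.mul_assoc]
        _ = frame₀Inv (kappa (g x)) * (g x * s) * (k * g x) := by
              rw [frame₀_mul]; simp only [Matrix.mul_assoc, Matrix.mul_one]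
        _ = _ := by rw [hk2]; simp only [Matrix.mul_assoc, Matrix.mul_one])
  rw [e1, h2] at h3
  have hu : IsUnit (blkA (g x)).det := isUnit_iff_ne_zero.2 hA
  have hut : IsUnit (blkA (g x))ᵀ.det := by rwa [Matrix.det_transpose]
  rw [← cross_eq_zero_iff, h3]
  constructor
  · intro h
    rw [h]
    simp
  · intro h
    have := congrArg (fun w => (blkA (g x))ᵀ⁻¹ * w * (blkA (g x))⁻¹) h
    simp only [Matrix.mul_assoc, mul_nonsing_inv _ hu, Matrix.mul_zero, Matrix.zero_mul,
      Matrix.mul_one] at this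
    rw [← Matrix.mul_assoc, nonsing_inv_mul _ hut, Matrix.one_mul, neg_eq_zero] at this
    exact this

end ModelCalculus

section FlatChart

open Matrix

attribute [local instance] linftyOpNormedRing linftyOpNormedAlgebra
  mat7Topology

/-- The inverse of `Q`. -/
def Qi : Mat7 := mk7 0 0 1 0 (1 / 2) 0 1 0 0

lemma Q_mul_Qi : Q * Qi = 1 := by
  rw [Q_eq_mk7, Qi, mk7_mul, ← mk7_one]
  congr 1 <;> simp

lemma Qi_mul_Q : Qi * Q = 1 := mul_eq_one_comm.1 Q_mul_Qi

lemma skew_iff {s : Mat7} : s ∈ skewQ ↔ sᵀ * Q = Q * -s := by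
  rw [mem_skewAdjointMatricesLieSubalgebra, mem_skewAdjointMatricesSubmodule,
    Matrix.IsSkewAdjoint, Matrix.IsAdjointPair]

lemma skew_mul_Qi {s : Mat7} (hs : s ∈ skewQ) : s * Qi + Qi * sᵀ = 0 := by
  rw [skew_iff] at hs
  calc s * Qi + Qi * sᵀ = s * Qi + Qi * (sᵀ * Q) * Qi := by
        rw [Matrix.mul_assoc Qi, Matrix.mul_assoc, Q_mul_Qi, Matrix.mul_one]
    _ = 0 := by rw [hs, ← Matrix.mul_assoc, Qi_mul_Q, Matrix.one_mul]; simp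

lemma isOrth_of_mul_Qi {g : Mat7} (h : g * Qi * gᵀ = Qi) : IsOrth g := by
  have h1 : g * (Qi * gᵀ * Q) = 1 := by rw [← Matrix.mul_assoc, ← Matrix.mul_assoc, h, Qi_mul_Q]
  have h2 := mul_eq_one_comm.1 h1
  calc gᵀ * Q * g = Q * (Qi * gᵀ * Q * g) := by
        simp only [← Matrix.mul_assoc, Q_mul_Qi, Matrix.one_mul]
    _ = Q := by rw [h2, Matrix.mul_one]

/-- The transposition as a continuous linear map. -/
def transposeCLM : Mat7 →L[ℝ] Mat7 :=
  LinearMap.toContinuousLinearMap (Matrix.transposeLinearEquiv (Fin 7) (Fin 7) ℝ ℝ).toLinearMap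

lemma isOrth_of_hasFDerivAt {E : Type*} [NormedAddCommGroup E] [NormedSpace ℝ E] {g : E → Mat7}
    {γ : E → E →L[ℝ] Mat7} {U : Set E} (hU : IsOpen U) (hU' : IsPreconnected U)
    (hγ : ∀ x ∈ U, ∀ v, γ x v ∈ skewQ)
    (hg : ∀ x ∈ U, HasFDerivAt g ((ContinuousLinearMap.mul ℝ Mat7 (g x)).comp (γ x)) x)
    {x₀ : E} (hx₀ : x₀ ∈ U) (h0 : g x₀ = 1) {x : E} (hx : x ∈ U) : IsOrth (g x) := by
  have hd : ∀ y ∈ U, HasFDerivAt (fun y => g y * Qi * (g y)ᵀ) (0 : E →L[ℝ] Mat7) y := by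
    intro y hy
    have h1 := ((hg y hy).mul_const' Qi).mul' ((transposeCLM.hasFDerivAt).comp y (hg y hy))
    refine h1.congr_fderiv ?_
    ext1 v
    change (g y * Qi) * (g y * γ y v)ᵀ + (g y * γ y v * Qi) * (g y)ᵀ = 0
    calc _ = g y * (γ y v * Qi + Qi * (γ y v)ᵀ) * (g y)ᵀ := by
          rw [transpose_mul]
          simp only [Matrix.mul_add, Matrix.add_mul, Matrix.mul_assoc]
          rw [add_comm]
      _ = 0 := by rw [skew_mul_Qi (hγ y hy v)]; simp
  apply isOrth_of_mul_Qi
  have := hU.is_const_of_fderiv_eq_zero (𝕜 := ℝ) hU'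
    (fun y hy => (hd y hy).differentiableAt.differentiableWithinAt) (fun y hy => (hd y hy).fderiv)
    hx hx₀
  simpa [h0] using this

lemma exists_localDiffeo {φ : Euc 6 → Euc 6} {O : Set (Euc 6)} (hO : IsOpen O)
    (hφ : ContDiffOn ℝ ∞ φ O) {x : Euc 6} (hx : x ∈ O) (hinj : Injective (fderiv ℝ φ x)) :
    ∃ ψ ∈ contDiffGroupoid ∞ (𝓡 6), x ∈ ψ.source ∧ ψ.source ⊆ O ∧ ⇑ψ = φ := by
  have hc : ∀ y ∈ O, ContDiffAt ℝ ∞ φ y := fun y hy => hφ.contDiffAt (hO.mem_nhds hy)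
  let f' : Euc 6 ≃L[ℝ] Euc 6 :=
    (LinearEquiv.ofInjectiveEndo (fderiv ℝ φ x).toLinearMap hinj).toContinuousLinearEquiv
  have hf' : HasFDerivAt φ (f' : Euc 6 →L[ℝ] Euc 6) x :=
    (hc x hx).diffAt.hasFDerivAt
  let ψ₀ := (hc x hx).toOpenPartialHomeomorph φ hf' (by simp)
  set S := O ∩ fderiv ℝ φ ⁻¹' Set.range ((↑) : (Euc 6 ≃L[ℝ] Euc 6) → Euc 6 →L[ℝ] Euc 6) with hS
  have hSo : IsOpen S := (hφ.continuousOn_fderiv_of_isOpen hO (by simp)).isOpen_inter_preimage hO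
    ContinuousLinearEquiv.isOpen
  have hsrc : (ψ₀.restrOpen S hSo).source = ψ₀.source ∩ S := ψ₀.restrOpen_source S hSo
  refine ⟨ψ₀.restrOpen S hSo, ?_, ?_, ?_, rfl⟩
  · rw [contDiffGroupoid, mem_groupoid_of_pregroupoid]
    simp only [contDiffPregroupoid, modelWithCornersSelf_coe, modelWithCornersSelf_coe_symm,
      Set.range_id, Set.inter_univ, Set.preimage_id_eq, id_eq, Function.id_comp, Function.comp_id]
    constructor
    · intro y hy
      rw [hsrc] at hy
      exact (hc y hy.2.1).contDiffWithinAt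
    · intro y hy
      have h1 : (ψ₀.restrOpen S hSo).symm y ∈ S :=
        (hsrc.subset ((ψ₀.restrOpen S hSo).map_target hy)).2
      obtain ⟨F, hF⟩ := h1.2
      refine ((ψ₀.restrOpen S hSo).contDiffAt_symm hy (f₀' := F) ?_ ?_).contDiffWithinAt
      · rw [hF]
        exact (hc _ h1.1).diffAt.hasFDerivAt
      · exact hc _ h1.1
  · rw [hsrc]
    exact ⟨(hc x hx).mem_toOpenPartialHomeomorph_source hf' (by simp), hx, f', hf'.fderiv.symm⟩
  · rw [hsrc]
    exact fun y hy => hy.2.1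

lemma trans_mem_maximalAtlas {e : OpenPartialHomeomorph M (Euc 6)}
    (he : e ∈ maxAtlas M) {ψ : OpenPartialHomeomorph (Euc 6) (Euc 6)}
    (hψ : ψ ∈ contDiffGroupoid ∞ (𝓡 6)) : e ≫ₕ ψ ∈ maxAtlas M := by
  intro e' he'
  obtain ⟨h1, h2⟩ := he e' he'
  constructor
  · rw [OpenPartialHomeomorph.trans_symm_eq_symm_trans_symm, OpenPartialHomeomorph.trans_assoc]
    exact (contDiffGroupoid ∞ (𝓡 6)).trans ((contDiffGroupoid ∞ (𝓡 6)).symm hψ) h1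
  · rw [← OpenPartialHomeomorph.trans_assoc]
    exact (contDiffGroupoid ∞ (𝓡 6)).trans h2 hψ

variable [IsManifold (𝓡 6) ∞ M]

/-- The Maurer-Cartan form of a lift as a form with values in matrices. -/
def Lift.mcForm {n : ℕ} (L : Lift D n) (τ : Fin 3 → OneForm n) (w : Euc n) : Euc n →L[ℝ] Mat7 :=
  ∑ a, ∑ b, (L.γ τ a b w).smulRight (Matrix.single a b (1 : ℝ) : Mat7)

lemma Lift.mcForm_apply {n : ℕ} (L : Lift D n) (τ : Fin 3 → OneForm n) (w v : Euc n) :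
    L.mcForm τ w v = mat (L.γ τ) w v := by
  rw [sum_entries (mat (L.γ τ) w v)]
  simp [Lift.mcForm, _root_.sum_apply, mat]

lemma Lift.contDiffAt_mcForm {n : ℕ} (L : Lift D n) {τ : Fin 3 → OneForm n} {w : Euc n}
    (hw : w ∈ L.W) (hτ : ∀ i, ContDiffAt ℝ ∞ (τ i) w) : ContDiffAt ℝ ∞ (L.mcForm τ) w :=
  ContDiffAt.sum fun a _ => ContDiffAt.sum fun b _ =>
    (contDiffAt_γ L hw hτ a b).smulRight contDiffAt_const

lemma Lift.fderiv_mcForm {n : ℕ} (L : Lift D n) {τ : Fin 3 → OneForm n} {w : Euc n}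
    (hw : w ∈ L.W) (hτ : ∀ i, ContDiffAt ℝ ∞ (τ i) w) (u v : Euc n) (a b : Fin 7) :
    fderiv ℝ (L.mcForm τ) w u v a b = fderiv ℝ (L.γ τ a b) w u v := by
  have h1 := (L.contDiffAt_mcForm hw hτ).diffAt.hasFDerivAt
  have h2 := (h1.clm_apply (hasFDerivAt_const v w))
  have h3 := hasFDerivAt_entry h2 a b
  have h4 := (((contDiffAt_γ L hw hτ a b).diffAt.hasFDerivAt).clm_apply
    (hasFDerivAt_const v w))
  have h5 : (fun y => L.mcForm τ y v a b) = fun y => L.γ τ a b y v :=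
    funext fun y => by rw [L.mcForm_apply]; rfl
  rw [h5] at h3
  simpa using DFunLike.congr_fun (h3.unique h4) u

lemma Lift.mcForm_flat {n : ℕ} (L : Lift D n) {τ : Fin 3 → OneForm n} {w : Euc n}
    (hw : w ∈ L.W) (hτ : ∀ i, ContDiffAt ℝ ∞ (τ i) w) (hmc : L.MaurerCartan τ) (u v : Euc n) :
    fderiv ℝ (L.mcForm τ) w u v - fderiv ℝ (L.mcForm τ) w v u =
      -(L.mcForm τ w u * L.mcForm τ w v - L.mcForm τ w v * L.mcForm τ w u) := by
  ext a b
  have h := hmc.2 w hw u v a b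
  rw [extD_eq _ _ _ _ (contDiffAt_γ L hw hτ a b).diffAt] at h
  rw [Matrix.sub_apply, L.fderiv_mcForm hw hτ, L.fderiv_mcForm hw hτ, h, Matrix.neg_apply,
    Matrix.sub_apply, Matrix.mul_apply, Matrix.mul_apply, ← sum_sub_distrib]
  simp only [L.mcForm_apply, mat, of_apply, wedge]

lemma Lift.exists_frame {n : ℕ} (L : Lift D n) {τ : Fin 3 → OneForm n}
    (hτ : ∀ i, ContDiffOn ℝ ∞ (τ i) L.W) (hmc : L.MaurerCartan τ) {w₀ : Euc n} (hw₀ : w₀ ∈ L.W) :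
    ∃ (V : Set (Euc n)) (g : Euc n → Mat7), IsOpen V ∧ w₀ ∈ V ∧ V ⊆ L.W ∧ g w₀ = 1 ∧
      ContDiffOn ℝ ∞ g V ∧ (∀ w ∈ V, IsOrth (g w)) ∧
      ∀ w ∈ V, HasFDerivAt g ((ContinuousLinearMap.mul ℝ Mat7 (g w)).comp (L.mcForm τ w)) w := by
  have hτ' : ∀ w ∈ L.W, ∀ i, ContDiffAt ℝ ∞ (τ i) w := fun w hw i =>
    (hτ i).contDiffAt (L.isOpen.mem_nhds hw)
  have hsub : ∀ w : Euc n, HasFDerivAt (fun y => y - w₀) (ContinuousLinearMap.id ℝ (Euc n)) w :=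
    fun w => (hasFDerivAt_id w).sub_const w₀
  have hcont : Continuous fun y : Euc n => w₀ + y := by fun_prop
  obtain ⟨r, g, hr, hrW, hg0, hg⟩ := exists_parallel_frame (γ := fun y => L.mcForm τ (w₀ + y))
    (W := (fun y => w₀ + y) ⁻¹' L.W) (hcont.continuousAt.preimage_mem_nhds
      (by simpa using L.isOpen.mem_nhds hw₀))
    (((L.contDiffAt_mcForm (by simpa using hw₀) (hτ' _ (by simpa using hw₀))).comp (0 : Euc n)
      (contDiffAt_const.add contDiffAt_id)).of_le two_le_infty)
    (fun x hx u v => by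
      have := L.mcForm_flat hx (hτ' _ hx) hmc u v
      rw [fderiv_comp_add_left]
      exact this)
  have hmem : ∀ w ∈ ball w₀ r, w - w₀ ∈ ball (0 : Euc n) r := fun w hw => by
    simpa [dist_eq_norm] using hw
  have hV : ball w₀ r ⊆ L.W := fun w hw => by simpa using hrW (hmem w hw)
  have hG : ∀ w ∈ ball w₀ r, HasFDerivAt (fun w => g (w - w₀))
      ((ContinuousLinearMap.mul ℝ Mat7 (g (w - w₀))).comp (L.mcForm τ w)) w := by
    intro w hw
    have := (hg _ (hmem w hw)).comp w (hsub w)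
    simp only [add_sub_cancel] at this
    exact this
  refine ⟨ball w₀ r, fun w => g (w - w₀), Metric.isOpen_ball, Metric.mem_ball_self hr, hV,
    by simpa using hg0, ?_, ?_, hG⟩
  · exact contDiffOn_parallel_frame Metric.isOpen_ball (fun w hw =>
      (L.contDiffAt_mcForm (hV hw) (hτ' _ (hV hw))).contDiffWithinAt) hG
  · exact fun w hw => isOrth_of_hasFDerivAt Metric.isOpen_ball
      (convex_ball _ _).isPreconnected (fun x hx v => by
        rw [L.mcForm_apply]; exact hmc.1 x (hV hx) v) hG (Metric.mem_ball_self hr)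
      (by simpa using hg0) hw

lemma exists_flat_chart (hD : IsNondegenerate D) (hS : ∀ x, fundamentalTensor D x = 0) (p : M) :
    ∃ e ∈ maxAtlas M, p ∈ e.source ∧ e p = 0 ∧ IsFlatChart D e := by
  obtain ⟨L, hpW, hLW, hLf⟩ := hD.exists_lift p
  set e := chartAt (Euc 6) p with hedef
  have he : e ∈ maxAtlas M := IsManifold.chart_mem_maximalAtlas _
  obtain ⟨τ, S4, S3, S2, hc⟩ := L.exists_isCanonical
  have hmc : L.MaurerCartan τ := hc.maurerCartan fun w hw i k j l =>
    hc.S4_eq_zero hD.finrank_eq_three hS hw i k j l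
  obtain ⟨V, g, hV, hwV, hVW, hg1, hgs, hgo, hgd⟩ := L.exists_frame hc.smooth_τ hmc hpW
  have hdet : ContinuousOn (fun w => (blkA (g w)).det) V := by
    have h : ∀ a b, ContinuousOn (fun y => g y a b) V := fun a b =>
      (entryCLM a b).continuous.comp_continuousOn hgs.continuousOn
    simp only [det_fin_three, blkA, of_apply, cons_val]
    fun_prop
  set O := V ∩ (fun w => (blkA (g w)).det) ⁻¹' {0}ᶜ with hOdef
  have hO : IsOpen O := hdet.isOpen_inter_preimage hV isOpen_compl_singleton
  have hA1 : blkA (1 : Mat7) = 1 := by rw [← mk7_one, blkA_mk7]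
  have hpO : e p ∈ O := ⟨hwV, by simp [hg1, hA1]⟩
  have hφ : ContDiffOn ℝ ∞ (fun w => kappa (g w)) O := fun w hw =>
    ((contDiffAt_kappa hw.2).comp w (hgs.contDiffAt (hV.mem_nhds hw.1))).contDiffWithinAt
  have horth : ∀ w ∈ O, ∀ᶠ y in nhds w, IsOrth (g y) := fun w hw => by
    filter_upwards [hV.mem_nhds hw.1] with y hy using hgo y hy
  have hmc' : ∀ w v, L.mcForm τ w v = so43 (fun i => L.θ i w v) (fun i => L.om i w v)
      (fun i j => L.α i j w v) (fun i => L.β i w v) (fun i => τ i w v) := fun w v => by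
    rw [L.mcForm_apply, mat_γ]
  have hk1 : kappa (1 : Mat7) = 0 := by
    have hx : blkX (1 : Mat7) = 0 := by rw [← mk7_one, blkX_mk7]
    have hz : blkZ (1 : Mat7) = 0 := by rw [← mk7_one, blkZ_mk7]
    refine euc_ext ?_ ?_
    · rw [xs_kappa, hx]; simp; rfl
    · rw [ys_kappa, hz]; funext i; fin_cases i <;> simp [vee, ys]
  have hinj : Injective (fderiv ℝ (fun w => kappa (g w)) (e p)) := by
    rw [injective_iff_map_eq_zero]
    intro v hv
    obtain ⟨-, h1, h2⟩ := blk_gamma₀_kappa (v := v) (a := L.mcForm τ (e p) v) (hgd _ hwV)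
      (horth _ hpO) hpO.2 (by rw [hg1, Matrix.mul_one]; exact Matrix.one_mul (L.mcForm τ (e p) v))
    have hI : frame₀Inv 0 = 1 ∧ frame₀ 0 = 1 := by
      have := frame₀Inv_mul 0
      rw [frame₀Inv_eq, neg_zero] at this ⊢
      have h : frame₀ 0 = 1 := by
        have hx : xs 0 = 0 := rfl
        have hy : ys 0 = 0 := rfl
        rw [frame₀, hx, hy, cross_eq_zero_iff.2 rfl, ← mk7_one]
        simp
      exact ⟨h, h⟩
    simp only [hg1, hk1, hI.1, hI.2, hv, Matrix.one_mul, Matrix.mul_one, hmc', blkX_so43,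
      blkZ_so43] at h1 h2
    have hv0 : theta₀ 0 (0 : Euc 6) = 0 := by funext i; simp [theta₀, xs, ys]
    rw [hv0, neg_inj, cross_eq_zero_iff.2 rfl, cross_eq_zero_iff] at h2
    have h3 := (L.df_eq_zero_iff hpW v).2 ⟨fun i => congrFun h2 i, fun i => congrFun h1 i⟩
    have h4 : L.df (e p) = dSymm e (e p) := by rw [Lift.df, hLf]; rfl
    rw [h4] at h3
    exact dSymm_injective he (hLW hpW) (h3.trans (map_zero _).symm)
  obtain ⟨ψ, hψ, hpψ, hψO, hψφ⟩ := exists_localDiffeo hO hφ hpO hinj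
  refine ⟨e ≫ₕ ψ, trans_mem_maximalAtlas he hψ, ?_, ?_, ?_⟩
  · exact ⟨mem_chart_source _ _, hpψ⟩
  · change ψ (e p) = 0
    rw [hψφ]
    simp [hg1, hk1]
  intro q hq v
  have hqe : q ∈ e.source := hq.1
  have hqO : e q ∈ O := hψO hq.2
  let u : Euc 6 := mfderiv (𝓡 6) (𝓡 6) e q v
  have hmd := mdifferentiable_of_mem_maximalAtlas he
  have hu : dSymm e (e q) u = v := DFunLike.congr_fun (hmd.symm_comp_deriv hqe) v
  have hdφ : HasFDerivAt (fun w => kappa (g w)) (fderiv ℝ (fun w => kappa (g w)) (e q)) (e q) :=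
    (hφ.diffAt hO hqO).hasFDerivAt
  have hcd : ∀ a, coordDiff (e ≫ₕ ψ) a q v = fderiv ℝ (fun w => kappa (g w)) (e q) u a := by
    intro a
    have h1 : HasMFDerivAt (𝓡 6) 𝓘(ℝ, ℝ) (fun w => kappa (g w) a) (e q)
        ((coordCLM a).comp (fderiv ℝ (fun w => kappa (g w)) (e q))) :=
      ((coordCLM a).hasFDerivAt.comp (e q) hdφ).hasMFDerivAt
    have h2 := h1.comp q (hmd.mdifferentiableAt hqe).hasMFDerivAt
    have h3 : (fun x => (e ≫ₕ ψ) x a) = (fun w => kappa (g w) a) ∘ e := by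
      funext x
      change ψ (e x) a = _
      rw [hψφ]
      rfl
    rw [coordDiff, h3, h2.mfderiv]
    rfl
  have hval : (e ≫ₕ ψ) q = kappa (g (e q)) := by
    change ψ (e q) = _
    rw [hψφ]
  have hfq : L.f (e q) = q := by rw [hLf]; exact e.left_inv hqe
  have h1 := L.theta_eq_zero_iff (hVW hqO.1) (hD.finrank_eq_three _) u
  have h2 := theta₀_kappa_eq_zero_iff (v := u) (s := L.mcForm τ (e q) u) (hgd _ hqO.1)
    (horth _ hqO) hqO.2 rfl
  rw [hmc', blkZ_so43, neg_eq_zero, cross_eq_zero_iff] at h2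
  have h3 : v ∈ D q ↔ L.df (e q) u ∈ L.Df (e q) := by
    have h4 : L.df (e q) u = v := by rw [← hu, Lift.df, hLf]; rfl
    rw [h4, Lift.Df, hfq]
    rfl
  rw [h3, ← h1, hval]
  simp only [hcd]
  have h5 := h2.symm
  simp only [funext_iff, theta₀, xs, ys, Pi.zero_apply] at h5
  exact h5

end FlatChart

section Prolongation

variable {V : Type*} [AddCommGroup V] [Module ℝ V]

lemma eq_of_dual {x y : V} (h : ∀ f : Module.Dual ℝ V, f x = f y) : x = y := by
  rw [← sub_eq_zero]
  exact (Module.forall_dual_apply_eq_zero_iff ℝ _).1 fun f => by rw [map_sub, h, sub_self]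

variable {D Y : Fin 3 → V →ₗ[ℝ] V}

lemma prolong_Y (h01 : ∀ f, D 0 (D 1 f) - D 1 (D 0 f) = (-2 : ℝ) • Y 2 f)
    (h12 : ∀ f, D 1 (D 2 f) - D 2 (D 1 f) = (-2 : ℝ) • Y 0 f)
    (h20 : ∀ f, D 2 (D 0 f) - D 0 (D 2 f) = (-2 : ℝ) • Y 1 f) {b a : Fin 3 → V}
    (hb : ∀ m i, D m (b i) = ∑ k, (2 * eps i m k) • a k) (l i : Fin 3) :
    Y l (b i) = delta l i • ∑ q, D q (a q) - D i (a l) := by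
  refine eq_of_dual fun f => ?_
  have e01 := congrArg f (h01 (b i))
  have e12 := congrArg f (h12 (b i))
  have e20 := congrArg f (h20 (b i))
  simp only [hb, map_smul, map_add, map_sub, smul_eq_mul, sum_univ_three] at e01 e12 e20 ⊢
  clear hb h01 h12 h20
  revert l i
  (repeat' refine forall_fin3 ?_ ?_ ?_) <;>
  simp only [eps_vals, delta_vals] <;> intro e01 e12 e20 <;> linarith

set_option maxHeartbeats 2000000 in
lemma prolong (h01 : ∀ f, D 0 (D 1 f) - D 1 (D 0 f) = (-2 : ℝ) • Y 2 f)
    (h12 : ∀ f, D 1 (D 2 f) - D 2 (D 1 f) = (-2 : ℝ) • Y 0 f)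
    (h20 : ∀ f, D 2 (D 0 f) - D 0 (D 2 f) = (-2 : ℝ) • Y 1 f)
    (hY : ∀ i j f, Y i (D j f) = D j (Y i f)) {b a : Fin 3 → V}
    (hb : ∀ m i, D m (b i) = ∑ k, (2 * eps i m k) • a k) :
    ∃ β τ : Fin 3 → V, (∀ m i l, D m (D i (a l)) = (-2 * delta m l) • β i) ∧
      (∀ k i, D k (β i) = ∑ j, (2 * eps i k j) • (1 / 2 : ℝ) • τ j) ∧ ∀ k l, D k (τ l) = 0 := by
  have hYb := prolong_Y h01 h12 h20 hb
  have hu : ∀ (f : Module.Dual ℝ V) l m i, delta l i * ∑ q, f (D m (D q (a q))) -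
      f (D m (D i (a l))) = ∑ k, 2 * eps i m k * f (Y l (a k)) := fun f l m i => by
    have := congrArg f (hY l m (b i))
    rw [hb, hYb] at this
    simpa only [map_sum, map_smul, map_sub, smul_eq_mul] using this.symm
  have hc : ∀ (f : Module.Dual ℝ V) l,
      (f (D 0 (D 1 (a l))) - f (D 1 (D 0 (a l))) = -2 * f (Y 2 (a l))) ∧
      (f (D 1 (D 2 (a l))) - f (D 2 (D 1 (a l))) = -2 * f (Y 0 (a l))) ∧
      (f (D 2 (D 0 (a l))) - f (D 0 (D 2 (a l))) = -2 * f (Y 1 (a l))) := fun f l => by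
    have e01 := congrArg f (h01 (a l))
    have e12 := congrArg f (h12 (a l))
    have e20 := congrArg f (h20 (a l))
    simp only [map_smul, map_sub, smul_eq_mul] at e01 e12 e20
    exact ⟨e01, e12, e20⟩
  have hP : ∀ l k, Y l (a k) = ∑ q, (eps q l k * (-1 / 2)) • D q (∑ r, D r (a r)) := fun l k => by
    refine eq_of_dual fun f => ?_
    have E : ∀ l j, 4 * f (Y l (a j)) + 2 * f (Y j (a l)) =
        - ∑ q, eps q l j * f (D q (∑ r, D r (a r))) := fun l j => by
      have u1 := hu f l (j + 1) (j + 2)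
      have u2 := hu f l (j + 2) (j + 1)
      obtain ⟨c0, c1, c2⟩ := hc f l
      revert u1 u2 c0 c1 c2
      clear hu hc hb hYb hY h01 h12 h20
      revert l j
      (repeat' refine forall_fin3 ?_ ?_ ?_) <;>
      simp only [Fin.reduceAdd, zero_add, sum_univ_three, map_add, eps_vals, delta_vals] <;>
      intros <;> linarith
    have e1 := E l k
    have e2 := E k l
    simp only [map_sum, map_smul, smul_eq_mul] at e1 e2 ⊢
    revert e1 e2
    clear E hu hc hb hYb hY h01 h12 h20
    revert l k
    (repeat' refine forall_fin3 ?_ ?_ ?_) <;>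
    simp only [sum_univ_three, eps_vals] <;> intros <;> linarith
  have hA : ∀ m i l, D m (D i (a l)) = delta m l • D i (∑ r, D r (a r)) := fun m i l => by
    refine eq_of_dual fun f => ?_
    have u := hu f l m i
    simp only [hP, sum_univ_three, map_smul, map_add, smul_eq_mul] at u ⊢
    revert u
    clear hu hc hb hYb hY h01 h12 h20 hP
    revert m i l
    (repeat' refine forall_fin3 ?_ ?_ ?_) <;>
    simp only [eps_vals, delta_vals] <;> intro u <;> linarith
  obtain ⟨β, hβ⟩ : ∃ β : Fin 3 → V, ∀ i, D i (∑ r, D r (a r)) = (-2 : ℝ) • β i :=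
    ⟨fun i => (-1 / 2 : ℝ) • D i (∑ r, D r (a r)), fun i => by rw [smul_smul]; norm_num⟩
  simp only [hβ, smul_smul] at hA hP
  have hE : ∀ i k, D k (β i) + D i (β k) = 0 := fun i k => by
    have e0 := h01 (D i (a 1))
    have e1 := h12 (D i (a 2))
    have e2 := h20 (D i (a 0))
    simp only [hY, hP, hA] at e0 e1 e2
    refine eq_of_dual fun f => ?_
    replace e0 := congrArg f e0
    replace e1 := congrArg f e1
    replace e2 := congrArg f e2
    simp only [sum_univ_three, map_smul, map_add, map_sub, smul_eq_mul, eps_vals, delta_vals,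
      map_zero] at e0 e1 e2 ⊢
    clear hu hc hb hYb hY h01 h12 h20 hP hA hβ
    revert e0 e1 e2
    revert k
    refine forall_fin3 ?_ ?_ ?_ <;> intros <;> linarith
  obtain ⟨τ, hτ⟩ : ∃ τ : Fin 3 → V, ∀ k i, D k (β i) = ∑ j, (2 * eps i k j) • (1 / 2 : ℝ) • τ j :=
    ⟨![D 2 (β 1), D 0 (β 2), D 1 (β 0)], by
      (repeat' refine forall_fin3 ?_ ?_ ?_) <;>
      refine eq_of_dual fun f => ?_ <;>
      [have := congrArg f (hE 0 0); have := congrArg f (hE 0 1); have := congrArg f (hE 0 2);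
       have := congrArg f (hE 0 1); have := congrArg f (hE 1 1); have := congrArg f (hE 1 2);
       have := congrArg f (hE 0 2); have := congrArg f (hE 1 2); have := congrArg f (hE 2 2)] <;>
      simp only [sum_univ_three, map_smul, map_add, smul_eq_mul, eps_vals, map_zero,
        cons_val] at this ⊢ <;> linarith⟩
  refine ⟨β, τ, fun m i l => by rw [hA, mul_comm], hτ, fun k l => ?_⟩
  have hYβ := prolong_Y h01 h12 h20 hτ
  refine eq_of_dual fun f => ?_
  have key : ∀ k l n m, -2 * delta k l * (delta n m * ∑ q, 1 / 2 * f (D q (τ q)) -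
      1 / 2 * f (D m (τ n))) = ∑ q, eps q n l * ∑ j, 2 * eps q m j * (1 / 2 * f (D k (τ j))) :=
    fun k l n m => by
      have e1 : Y n (D k (D m (a l))) = D k (D m (Y n (a l))) := by rw [hY, hY]
      rw [hA, hP, map_smul, hYβ] at e1
      simpa only [map_sum, map_smul, map_sub, hτ, smul_eq_mul, one_div, neg_div, mul_neg, neg_mul,
        inv_mul_cancel₀, mul_one, neg_neg, mul_inv_cancel₀, ne_eq, OfNat.ofNat_ne_zero,
        not_false_eq_true, mul_comm (delta _ _) (2 : ℝ), mul_assoc] using congrArg f e1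
  have k1 := key k l (l + 1) (l + 1)
  have k2 := key (l + 1) (l + 1) l l
  have k3 := key (l + 2) (l + 2) l l
  rw [map_zero]
  clear hu hc hb hYb hY h01 h12 h20 hP hA hβ hE hτ hYβ key
  revert k1 k2 k3
  revert k l
  (repeat' refine forall_fin3 ?_ ?_ ?_) <;>
  simp only [Fin.reduceAdd, zero_add, sum_univ_three, eps_vals, delta_vals] <;> intros <;> linarith

end Prolongation

section ModelFields

open Matrix

attribute [local instance] linftyOpNormedRing linftyOpNormedAlgebra mat7Topology

/-- The matrix `a` expressed in the moving frame at `p`. -/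
def conj (a : Mat7) (p : Euc 6) : Mat7 := frame₀Inv p * a * frame₀ p

lemma skew_commutator {a b : Mat7} (ha : a ∈ skewQ) (hb : b ∈ skewQ) : a * b - b * a ∈ skewQ := by
  rw [skew_iff] at ha hb ⊢
  rw [Matrix.transpose_sub, transpose_mul, transpose_mul, Matrix.sub_mul,
    Matrix.mul_assoc, ha, Matrix.mul_assoc aᵀ, hb, ← Matrix.mul_assoc, ← Matrix.mul_assoc, ha, hb]
  noncomm_ring

lemma skew_conj {a : Mat7} (ha : a ∈ skewQ) (p : Euc 6) : conj a p ∈ skewQ := by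
  rw [skew_iff] at ha ⊢
  have h1 : (frame₀ p)ᵀ * Q = Q * frame₀Inv p := by
    calc _ = (frame₀ p)ᵀ * Q * (frame₀ p * frame₀Inv p) := by rw [frame₀_mul, Matrix.mul_one]
      _ = _ := by rw [← Matrix.mul_assoc, frame₀_isOrth p]
  have h2 : (frame₀Inv p)ᵀ * Q = Q * frame₀ p := by
    calc _ = (frame₀Inv p)ᵀ * Q * (frame₀Inv p * frame₀ p) := by rw [frame₀Inv_mul, Matrix.mul_one]
      _ = _ := by rw [← Matrix.mul_assoc, frame₀Inv_isOrth p]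
  calc _ = (frame₀ p)ᵀ * (aᵀ * ((frame₀Inv p)ᵀ * Q)) := by
        simp only [conj, transpose_mul, Matrix.mul_assoc]
    _ = (frame₀ p)ᵀ * (aᵀ * Q) * frame₀ p := by rw [h2]; simp only [Matrix.mul_assoc]
    _ = _ := by
        rw [ha, ← Matrix.mul_assoc, h1]
        simp only [conj, Matrix.mul_assoc, Matrix.neg_mul, Matrix.mul_neg]

lemma fderiv_frame₀Inv (p v : Euc 6) : fderiv ℝ frame₀Inv p v = -(gamma₀ p v * frame₀Inv p) := by
  have h1 := (contDiff_frame₀.contDiffAt.differentiableAt (x := p) (by simp)).hasFDerivAt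
  have h2 := (contDiff_frame₀Inv.contDiffAt.differentiableAt (x := p) (by simp)).hasFDerivAt
  have h4 := DFunLike.congr_fun ((h2.mul' h1).unique
    ((hasFDerivAt_const (1 : Mat7) p).congr_of_eventuallyEq
      (Filter.Eventually.of_forall frame₀Inv_mul))) v
  change frame₀Inv p * fderiv ℝ frame₀ p v + fderiv ℝ frame₀Inv p v * frame₀ p = 0 at h4
  rw [fderiv_frame₀, ← Matrix.mul_assoc, frame₀Inv_mul, Matrix.one_mul, add_comm] at h4
  calc _ = fderiv ℝ frame₀Inv p v * frame₀ p * frame₀Inv p := by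
        rw [Matrix.mul_assoc, frame₀_mul, Matrix.mul_one]
    _ = _ := by rw [eq_neg_of_add_eq_zero_left h4, Matrix.neg_mul]

lemma hasFDerivAt_conj (a : Mat7) (p : Euc 6) : ∃ T : Euc 6 →L[ℝ] Mat7,
    HasFDerivAt (conj a) T p ∧ ∀ v, T v = conj a p * gamma₀ p v - gamma₀ p v * conj a p := by
  have h1 := (contDiff_frame₀.contDiffAt.differentiableAt (x := p) (by simp)).hasFDerivAt
  have h2 := (contDiff_frame₀Inv.contDiffAt.differentiableAt (x := p) (by simp)).hasFDerivAt
  refine ⟨_, (h2.mul_const' a).mul' h1, fun v => ?_⟩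
  change frame₀Inv p * a * fderiv ℝ frame₀ p v + fderiv ℝ frame₀Inv p v * a * frame₀ p = _
  rw [fderiv_frame₀Inv, fderiv_frame₀, conj]
  simp only [Matrix.mul_assoc, Matrix.neg_mul, sub_eq_add_neg]

/-- The component `θ` of a matrix in `so(4, 3)`. -/
def thetaPart (s : Mat7) : V3 := ![s 5 2, s 6 0, s 4 1]

lemma exists_so43 {s : Mat7} (hs : s ∈ skewQ) :
    ∃ α β τ, s = so43 (thetaPart s) (blkX s) α β τ := ⟨_, _, _, eq_so43 hs⟩

lemma thetaPart_so43 (θ om : V3) (α : Fin 3 → V3) (β τ : V3) :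
    thetaPart (so43 θ om α β τ) = θ := by
  funext i; fin_cases i <;> simp [thetaPart, so43]

lemma theta₀_modelField' {a : Mat7} (ha : a ∈ skewQ) (p : Euc 6) :
    theta₀ p (modelField a p) = thetaPart (conj a p) := by
  obtain ⟨α, β, τ, h⟩ := exists_so43 (skew_conj ha p)
  rw [theta₀_modelField]
  change -vee (blkZ (conj a p)) = _
  conv_lhs => rw [h, blkZ_so43]
  exact (vee_neg_cross _).symm

lemma contDiff_modelField (a : Mat7) : ContDiff ℝ ∞ (modelField a) := by
  have h0 : ContDiff ℝ ∞ (fun p => frame₀Inv p * a * frame₀ p) :=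
    (contDiff_frame₀Inv.mul contDiff_const).mul contDiff_frame₀
  have h : ∀ i j, ContDiff ℝ ∞ (fun p => (frame₀Inv p * a * frame₀ p) i j) := fun i j =>
    (entryCLM i j).contDiff.comp h0
  have hx : ∀ i : Fin 6, ContDiff ℝ ∞ (fun p : Euc 6 => p i) := fun i => (coordCLM i).contDiff
  have hX : ∀ i, ContDiff ℝ ∞ (fun p => blkX (frame₀Inv p * a * frame₀ p) i) :=
    forall_fin3 (h _ _) (h _ _) (h _ _)
  have hZ : ∀ i, ContDiff ℝ ∞ (fun p => vee (blkZ (frame₀Inv p * a * frame₀ p)) i) :=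
    forall_fin3 (((h _ _).sub (h _ _)).div_const 2) (((h _ _).sub (h _ _)).div_const 2)
      (((h _ _).sub (h _ _)).div_const 2)
  rw [contDiff_euclidean]
  intro i
  refine Fin.addCases (m := 3) (n := 3) (motive := fun i => ContDiff ℝ ∞ fun p =>
    modelField a p i) (fun i => ?_) (fun i => ?_) i
  · simpa only [modelField, Fin.append_left] using hX i
  · simp only [modelField, Fin.append_right, xs]
    exact (hZ i).neg.sub (ContDiff.sum fun j _ => ContDiff.sum fun k _ =>
      (contDiff_const.mul (hx _)).mul (hX k))

lemma exists_xs_theta₀ (p : Euc 6) (x θ : V3) : ∃ v, xs v = x ∧ theta₀ p v = θ :=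
  ⟨WithLp.toLp 2 (Fin.append x fun i => θ i - ∑ j, ∑ k, eps i j k * xs p j * x k), xs_append _ _,
    funext fun i => by rw [theta₀, xs_append, ys_append, sub_add_cancel]⟩

lemma modelField_smul_add (c : ℝ) (a b : Mat7) (p : Euc 6) :
    modelField (c • a + b) p = c • modelField a p + modelField b p := by
  have h : frame₀Inv p * (c • a + b) * frame₀ p =
      c • (frame₀Inv p * a * frame₀ p) + frame₀Inv p * b * frame₀ p := by
    rw [Matrix.mul_add, Matrix.add_mul, Matrix.mul_smul, Matrix.smul_mul]
  have hX : blkX (frame₀Inv p * (c • a + b) * frame₀ p) =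
      c • blkX (frame₀Inv p * a * frame₀ p) + blkX (frame₀Inv p * b * frame₀ p) := by
    rw [h]; funext i; fin_cases i <;> rfl
  refine ext_theta₀ (p := p) ?_ (funext fun i => ?_)
  · rw [xs_modelField, hX, ← xs_modelField, ← xs_modelField]; rfl
  · have e : theta₀ p (c • modelField a p + modelField b p) i =
        c * theta₀ p (modelField a p) i + theta₀ p (modelField b p) i := by
      simp only [theta₀, xs, ys, PiLp.add_apply, PiLp.smul_apply, smul_eq_mul, mul_add,
        sum_add_distrib, Finset.mul_sum]
      simp only [mul_left_comm c]
      ring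
    rw [e, theta₀_modelField, theta₀_modelField, theta₀_modelField, h]
    clear e
    revert i
    refine forall_fin3 ?_ ?_ ?_ <;> simp [vee, blkZ] <;> ring

lemma eq_zero_of_modelField {a : Mat7} (ha : a ∈ skewQ) {p : Euc 6}
    (h : ∀ᶠ y in nhds p, modelField a y = 0) : a = 0 := by
  have e0 : ∀ᶠ y in nhds p, thetaPart (conj a y) = 0 ∧ blkX (conj a y) = 0 := by
    filter_upwards [h] with y hy
    rw [← theta₀_modelField' ha, conj, ← xs_modelField, hy]
    exact ⟨by funext i; simp [theta₀, xs, ys], rfl⟩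
  have e1 : ∀ᶠ y in nhds p, ∃ τ, conj a y = so43 0 0 0 0 τ := by
    filter_upwards [e0.eventually_nhds] with y hy
    obtain ⟨T, hT, hTv⟩ := hasFDerivAt_conj a y
    obtain ⟨α, β, τ, hs⟩ := exists_so43 (skew_conj ha y)
    rw [hy.self_of_nhds.1, hy.self_of_nhds.2] at hs
    have hz : ∀ v, T v 3 0 = 0 ∧ T v 3 1 = 0 ∧ T v 3 2 = 0 := fun v => by
      refine ⟨?_, ?_, ?_⟩ <;> refine eq_zero_of_entry hT (hy.mono fun z hz => ?_) v
      exacts [congrFun hz.2 0, congrFun hz.2 1, congrFun hz.2 2]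
    have hα : α = 0 := by
      funext i j
      obtain ⟨v, h1, h2⟩ := exists_xs_theta₀ y (delta j) 0
      have := hz v
      rw [hTv, hs, gamma₀, h1, h2, so43_commutator] at this
      simp only [so43, of_apply, cons_val, sum_univ_three, Pi.zero_apply, mul_zero, zero_mul, sub_zero,
        add_zero, zero_add] at this
      obtain ⟨k0, k1, k2⟩ := this
      clear hTv hs h1 h2
      revert i j
      (repeat' refine forall_fin3 ?_ ?_ ?_) <;>
      simp only [delta_vals, Pi.zero_apply] <;> intros <;> linarith
    have hβ : β = 0 := by
      funext i
      obtain ⟨v, h1, h2⟩ := exists_xs_theta₀ y 0 (delta (i + 1))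
      have := hz v
      rw [hTv, hs, gamma₀, h1, h2, so43_commutator] at this
      simp only [so43, of_apply, cons_val, sum_univ_three, Pi.zero_apply, mul_zero, zero_mul, sub_zero,
        add_zero] at this
      obtain ⟨k0, k1, k2⟩ := this
      clear hTv hs h1 h2
      revert i
      refine forall_fin3 ?_ ?_ ?_ <;>
      simp only [delta_vals, eps_vals, Pi.zero_apply, Fin.reduceAdd, zero_add] <;>
      intros <;> linarith
    exact ⟨τ, by rw [hs, hα, hβ]⟩
  obtain ⟨T, hT, hTv⟩ := hasFDerivAt_conj a p
  obtain ⟨τ, hs⟩ := e1.self_of_nhds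
  have hτ : τ = 0 := by
    obtain ⟨v, h1, h2⟩ := exists_xs_theta₀ p 0 1
    have k : ∀ i j : Fin 7, (∀ τ, so43 0 0 0 0 τ i j = 0) → T v i j = 0 := fun i j hij =>
      eq_zero_of_entry hT (e1.mono fun y ⟨τ, hy⟩ => by rw [hy, hij]) v
    have k0 := k 4 5 fun τ => by simp [so43]
    have k1 := k 5 6 fun τ => by simp [so43]
    have k2 := k 6 4 fun τ => by simp [so43]
    rw [hTv, hs, gamma₀, h1, h2, so43_commutator] at k0 k1 k2
    simp only [so43, of_apply, cons_val, sum_univ_three, Pi.zero_apply, mul_zero, zero_mul, sub_zero,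
      add_zero, zero_add, delta_vals, Pi.one_apply, mul_one] at k0 k1 k2
    funext i
    revert i
    exact forall_fin3 k0 k1 k2
  have h0 : conj a p = 0 := by
    rw [hs, hτ]
    apply ext_seven <;> simp [so43]
  calc a = frame₀ p * conj a p * frame₀Inv p := by
        simp only [conj, Matrix.mul_assoc, frame₀_mul, Matrix.mul_one]
        rw [← Matrix.mul_assoc, frame₀_mul, Matrix.one_mul]
    _ = 0 := by rw [h0]; simp

lemma lieBracket_modelField {a b : Mat7} (ha : a ∈ skewQ) (hb : b ∈ skewQ) (p : Euc 6) :
    lieBracket ℝ (modelField a) (modelField b) p = modelField (b * a - a * b) p := by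
  have hd : ∀ {a : Mat7}, a ∈ skewQ → ∀ v i,
      xs (fderiv ℝ (modelField a) p v) i =
        blkX (conj a p * gamma₀ p v - gamma₀ p v * conj a p) i ∧
      theta₀ p (fderiv ℝ (modelField a) p v) i +
        ∑ j, ∑ k, eps i j k * xs v j * xs (modelField a p) k =
        thetaPart (conj a p * gamma₀ p v - gamma₀ p v * conj a p) i := fun {a} ha v i => by
    obtain ⟨T, hT, hTv⟩ := hasFDerivAt_conj a p
    have hM := ((contDiff_modelField a).contDiffAt.differentiableAt (x := p) (by simp)).hasFDerivAt
    have hc : ∀ i, HasFDerivAt (fun y => modelField a y i) _ p := fun i =>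
      (coordCLM i).hasFDerivAt.comp p hM
    rw [← hTv]
    have hX : ∀ y i, modelField a y (castAdd 3 i) = blkX (conj a y) i := fun y i =>
      congrFun (xs_modelField a y) i
    constructor
    · have h1 := hc (castAdd 3 i)
      simp only [hX] at h1
      revert i
      refine forall_fin3 ?_ ?_ ?_ <;> intro h1 <;>
      exact DFunLike.congr_fun (h1.unique (hasFDerivAt_entry hT _ _)) v
    · have h1 := (hc (natAdd 3 i)).fun_add (HasFDerivAt.fun_sum (u := Finset.univ) fun j _ =>
        HasFDerivAt.fun_sum (u := Finset.univ) fun k _ =>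
          (((coordCLM (castAdd 3 j)).hasFDerivAt (x := p)).const_mul (eps i j k)).fun_mul
            (hc (castAdd 3 k)))
      have h2 : ∀ L : Euc 6 →L[ℝ] ℝ, HasFDerivAt (fun y => thetaPart (conj a y) i) L p →
          L v = thetaPart (T v) i := fun L hL => by
        revert i
        refine forall_fin3 ?_ ?_ ?_ <;> intro _ h <;>
        exact DFunLike.congr_fun (h.unique (hasFDerivAt_entry hT _ _)) v
      rw [← h2 _ (h1.congr_of_eventuallyEq (Filter.Eventually.of_forall fun y =>
        (congrFun (theta₀_modelField' ha y) i).symm))]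
      simp only [_root_.add_apply, _root_.sum_apply, _root_.smul_apply, smul_eq_mul,
        ContinuousLinearMap.comp_apply, sum_add_distrib, theta₀, xs, ys, ← add_assoc]
      congr 1
      exact sum_congr rfl fun j _ => sum_congr rfl fun k _ => by
        change eps i j k * v _ * _ = _ * (eps i j k * v _)
        ring
  obtain ⟨αa, βa, τa, sa⟩ := exists_so43 (skew_conj ha p)
  obtain ⟨αb, βb, τb, sb⟩ := exists_so43 (skew_conj hb p)
  have hba := skew_commutator hb ha
  have hconj : conj (b * a - a * b) p = conj b p * conj a p - conj a p * conj b p := by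
    have : ∀ a b : Mat7, conj (a * b) p = conj a p * conj b p := fun a b => by
      calc _ = frame₀Inv p * a * (frame₀ p * frame₀Inv p) * b * frame₀ p := by
            rw [frame₀_mul]; simp only [conj, Matrix.mul_assoc, Matrix.one_mul]
        _ = _ := by simp only [conj, Matrix.mul_assoc]
    rw [← this, ← this]
    simp only [conj, Matrix.mul_sub, Matrix.sub_mul]
  have hγ : ∀ {a : Mat7}, a ∈ skewQ →
      gamma₀ p (modelField a p) = so43 (thetaPart (conj a p)) (blkX (conj a p)) 0 0 0 := fun ha => by
    rw [gamma₀, theta₀_modelField' ha, xs_modelField]; rfl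
  have hxs : ∀ a : Mat7, xs (modelField a p) = blkX (conj a p) := fun a => xs_modelField a p
  have ha' := hd ha (modelField b p)
  have hb' := hd hb (modelField a p)
  simp only [hγ ha, hγ hb, hxs] at ha' hb'
  rw [VectorField.lieBracket_eq]
  refine ext_theta₀ (p := p) (funext fun i => ?_) (funext fun i => ?_)
  · rw [hxs, hconj]
    change xs _ i - xs _ i = _
    rw [(ha' i).1, (hb' i).1]
    rw [sa, sb]
    simp only [blkX_so43, thetaPart_so43, so43_commutator, sum_univ_three, Pi.zero_apply]
    ring
  · rw [theta₀_modelField' hba, hconj]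
    have h1 := (ha' i).2
    have h2 := (hb' i).2
    have h3 : ∀ u v : Euc 6, theta₀ p (u - v) i = theta₀ p u i - theta₀ p v i := fun u v => by
      simp only [theta₀, xs, ys, PiLp.sub_apply, mul_sub, sum_sub_distrib]
      ring
    rw [h3, eq_sub_of_add_eq h1, eq_sub_of_add_eq h2]
    rw [sa, sb]
    simp only [blkX_so43, thetaPart_so43, so43_commutator, sum_univ_three, Pi.zero_apply]
    clear h1 h2 h3 ha' hb' hd
    revert i
    refine forall_fin3 ?_ ?_ ?_ <;> simp only [eps_vals] <;> ring

end ModelFields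

section LocalSymmetries

open Matrix

attribute [local instance] linftyOpNormedRing linftyOpNormedAlgebra mat7Topology

/-- The functions that are smooth on `O` and vanish outside `O`. -/
def smoothFns (O : Set (Euc 6)) : Submodule ℝ (Euc 6 → ℝ) where
  carrier := {f | ContDiffOn ℝ ∞ f O ∧ ∀ x ∉ O, f x = 0}
  add_mem' hf hg := ⟨hf.1.add hg.1, fun x hx => by rw [Pi.add_apply, hf.2 x hx, hg.2 x hx, add_zero]⟩
  zero_mem' := ⟨contDiffOn_const, fun _ _ => rfl⟩
  smul_mem' c f hf := ⟨contDiffOn_const.smul hf.1, fun x hx => by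
    rw [Pi.smul_apply, hf.2 x hx, smul_zero]⟩

/-- The extension by zero of a function that is smooth on `O`. -/
def extendZero {O : Set (Euc 6)} {f : Euc 6 → ℝ} (hf : ContDiffOn ℝ ∞ f O) : smoothFns O :=
  ⟨O.indicator f, hf.congr fun _ hx => Set.indicator_of_mem hx f,
    fun _ hx => Set.indicator_of_notMem hx f⟩

variable {O : Set (Euc 6)}

lemma smoothFns_contDiffAt (hO : IsOpen O) (f : smoothFns O) {x : Euc 6} (hx : x ∈ O) : ContDiffAt ℝ ∞ f.1 x :=
  f.2.1.contDiffAt (hO.mem_nhds hx)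

lemma extendZero_eventuallyEq (hO : IsOpen O) {f : Euc 6 → ℝ} (hf : ContDiffOn ℝ ∞ f O) {x : Euc 6}
    (hx : x ∈ O) : (extendZero hf).1 =ᶠ[nhds x] f := by
  filter_upwards [hO.mem_nhds hx] with y hy using Set.indicator_of_mem hy f

/-- The derivative along the vector field `c + L`. -/
def der (hO : IsOpen O) (c : Euc 6) (L : Euc 6 →L[ℝ] Euc 6) : smoothFns O →ₗ[ℝ] smoothFns O where
  toFun f := extendZero (f := fun x => fderiv ℝ f.1 x (c + L x)) fun x hx =>
    (((f.2.1.contDiffAt (hO.mem_nhds hx)).fderiv_right (m := ∞) (by simp)).clm_apply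
      (contDiffAt_const.add L.contDiff.contDiffAt)).contDiffWithinAt
  map_add' f g := Subtype.ext (funext fun x => by
    by_cases hx : x ∈ O
    · have hd := fun f => (smoothFns_contDiffAt hO f hx).diffAt
      simp [extendZero, hx, fderiv_add (hd f) (hd g)]
      ring
    · simp [extendZero, hx])
  map_smul' r f := Subtype.ext (funext fun x => by
    by_cases hx : x ∈ O
    · have hd := (smoothFns_contDiffAt hO f hx).diffAt
      simp [extendZero, hx, fderiv_const_smul hd]
      ring
    · simp [extendZero, hx])

variable (hO : IsOpen O)

lemma der_eventuallyEq (c : Euc 6) (L : Euc 6 →L[ℝ] Euc 6) (f : smoothFns O) {x : Euc 6}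
    (hx : x ∈ O) : (der hO c L f).1 =ᶠ[nhds x] fun y => fderiv ℝ f.1 y (c + L y) := by
  filter_upwards [hO.mem_nhds hx] with y hy using
    Set.indicator_of_mem hy (fun y => fderiv ℝ f.1 y (c + L y))

lemma der_apply (c : Euc 6) (L : Euc 6 →L[ℝ] Euc 6) (f : smoothFns O) {x : Euc 6} (hx : x ∈ O) :
    (der hO c L f).1 x = fderiv ℝ f.1 x (c + L x) := (der_eventuallyEq hO c L f hx).self_of_nhds

lemma der_commutator (c c' c'' : Euc 6) (L L' : Euc 6 →L[ℝ] Euc 6) (r : ℝ)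
    (h : ∀ x, L' (c + L x) - L (c' + L' x) = r • c'') (f : smoothFns O) :
    der hO c L (der hO c' L' f) - der hO c' L' (der hO c L f) = r • der hO c'' 0 f := by
  refine Subtype.ext (funext fun x => ?_)
  by_cases hx : x ∈ O
  · have hf := smoothFns_contDiffAt hO f hx
    have hd : ∀ (c c' : Euc 6) (L L' : Euc 6 →L[ℝ] Euc 6), (der hO c L (der hO c' L' f)).1 x =
        fderiv ℝ (fderiv ℝ f.1) x (c + L x) (c' + L' x) + fderiv ℝ f.1 x (L' (c + L x)) := by
      intro c c' L L'
      rw [der_apply hO _ _ _ hx]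
      have h2 := (((hf.fderiv_right (m := ∞) (by simp)).differentiableAt
        (by simp)).hasFDerivAt).clm_apply ((L'.hasFDerivAt (x := x)).const_add c')
      rw [(der_eventuallyEq hO c' L' f hx).fderiv_eq, h2.fderiv]
      simp only [_root_.add_apply, ContinuousLinearMap.comp_apply, ContinuousLinearMap.flip_apply,
        add_comm]
    have hsymm : fderiv ℝ (fderiv ℝ f.1) x (c + L x) (c' + L' x) =
        fderiv ℝ (fderiv ℝ f.1) x (c' + L' x) (c + L x) :=
      (hf.isSymmSndFDerivAt (by simpa using two_le_infty)).eq _ _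
    change (der hO c L (der hO c' L' f)).1 x - (der hO c' L' (der hO c L f)).1 x =
      r * (der hO c'' 0 f).1 x
    rw [hd, hd, der_apply hO _ _ _ hx, hsymm, _root_.zero_apply, add_zero, ← smul_eq_mul r,
      ← map_smul, ← h, map_sub]
    ring
  · exact (Submodule.sub_mem _ (der hO c L (der hO c' L' f)).2
      (der hO c' L' (der hO c L f)).2).2 x hx |>.trans ((r • der hO c'' 0 f).2.2 x hx).symm

/-- The constant part of a vector field in the flat distribution. -/
def hor (m : Fin 3) : Euc 6 := EuclideanSpace.single (castAdd 3 m) 1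

/-- The coordinate vector fields complementary to the flat distribution. -/
def vert (i : Fin 3) : Euc 6 := EuclideanSpace.single (natAdd 3 i) 1

/-- The linear part of a vector field in the flat distribution. -/
def horL (m : Fin 3) : Euc 6 →L[ℝ] Euc 6 :=
  -∑ i, ∑ j, eps i j m • (coordCLM (castAdd 3 j)).smulRight (vert i)

lemma xs_hor (m : Fin 3) : xs (hor m) = delta m := by
  funext i; revert i m; (repeat' refine forall_fin3 ?_ ?_ ?_) <;>
  simp [xs, hor, delta]

lemma ys_hor (m : Fin 3) : ys (hor m) = 0 := by
  funext i; revert i m; (repeat' refine forall_fin3 ?_ ?_ ?_) <;>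
  simp [ys, hor]

lemma xs_vert (m : Fin 3) : xs (vert m) = 0 := by
  funext i; revert i m; (repeat' refine forall_fin3 ?_ ?_ ?_) <;>
  simp [xs, vert]

lemma ys_vert (m : Fin 3) : ys (vert m) = delta m := by
  funext i; revert i m; (repeat' refine forall_fin3 ?_ ?_ ?_) <;>
  simp [ys, vert, delta]

lemma horL_apply (m : Fin 3) (v : Euc 6) :
    horL m v = ∑ i, (-∑ j, eps i j m * xs v j) • vert i := by
  simp only [horL, _root_.neg_apply, _root_.sum_apply, _root_.smul_apply,
    ContinuousLinearMap.smulRight_apply, smul_smul, ← Finset.sum_smul, neg_smul,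
    sum_neg_distrib]
  rfl

lemma xs_sum_vert (c : V3) : xs (∑ i, c i • vert i) = 0 ∧ ys (∑ i, c i • vert i) = c := by
  have h1 := fun i => congrFun (xs_vert i)
  have h2 := fun i => congrFun (ys_vert i)
  simp only [xs, ys] at h1 h2
  constructor <;> funext i
  · simp [xs, h1]
  · simp [ys, h2, delta, -Fin.natAdd_eq_addNat]

lemma xs_horL (m : Fin 3) (v : Euc 6) : xs (horL m v) = 0 := by
  rw [horL_apply]; exact (xs_sum_vert _).1

lemma xs_hor_add (m : Fin 3) (x : Euc 6) : xs (hor m + horL m x) = delta m := by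
  change xs (hor m) + xs (horL m x) = _
  rw [xs_hor, xs_horL, add_zero]

lemma theta₀_hor_add (m : Fin 3) (x : Euc 6) : theta₀ x (hor m + horL m x) = 0 := by
  funext i
  have h : ys (hor m + horL m x) = ys (hor m) + ys (horL m x) := rfl
  rw [theta₀, xs_hor_add, h, ys_hor, horL_apply, (xs_sum_vert _).2]
  simp [delta]

lemma eq_zero_of_hor {f : Euc 6 →L[ℝ] ℝ} {x : Euc 6} (h : ∀ m, f (hor m + horL m x) = 0)
    (h' : ∀ m, f (vert m) = 0) : f = 0 := by
  ext v
  set u := v - ∑ m, xs v m • (hor m + horL m x) with hu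
  have h1 : xs u = 0 := funext fun i => by
    have h2 : ∀ m, coordCLM (castAdd 3 i) (hor m + horL m x) = delta m i := fun m =>
      congrFun (xs_hor_add m x) i
    change coordCLM (castAdd 3 i) u = 0
    rw [hu, map_sub, map_sum]
    simp only [map_smul, h2, smul_eq_mul, delta, mul_ite, mul_one, mul_zero, Finset.sum_ite_eq',
      Finset.mem_univ, if_true]
    exact sub_self _
  have h3 : u = ∑ i, ys u i • vert i :=
    euc_ext (h1.trans (xs_sum_vert _).1.symm) (xs_sum_vert _).2.symm
  have h4 : f u = 0 := by rw [h3, map_sum]; simp only [map_smul, h', smul_zero, sum_const_zero]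
  rw [hu, map_sub, map_sum] at h4
  change f v = 0
  simpa only [map_smul, h, smul_zero, sum_const_zero, sub_zero] using h4

lemma der_hor (m l k : Fin 3) (h : ∀ i, -eps i m l + eps i l m = -2 * delta k i)
    (f : smoothFns O) :
    der hO (hor m) (horL m) (der hO (hor l) (horL l) f) - der hO (hor l) (horL l)
      (der hO (hor m) (horL m) f) = (-2 : ℝ) • der hO (vert k) 0 f :=
  der_commutator hO _ _ _ _ _ _ (fun x => by
    rw [horL_apply l (hor m + horL m x), horL_apply m (hor l + horL l x), xs_hor_add, xs_hor_add, ← sum_sub_distrib]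
    simp only [delta, mul_ite, mul_one, mul_zero, Finset.sum_ite_eq, Finset.mem_univ, if_true,
      ← sub_smul, sub_neg_eq_add, h]
    simp) f

/-- The linear map `so43`. -/
def so43L : (V3 × V3 × (Fin 3 → V3) × V3 × V3) →L[ℝ]
    Mat7 :=
  LinearMap.toContinuousLinearMap
    { toFun := fun t => so43 t.1 t.2.1 t.2.2.1 t.2.2.2.1 t.2.2.2.2
      map_add' := fun _ _ => (so43_add _ _ _ _ _ _ _ _ _ _).symm
      map_smul' := fun r t => by
        apply ext_seven <;> simp [so43] <;> ring }

lemma exists_modelField {p : Euc 6} {r : ℝ} (hr : 0 < r) {W : Euc 6 → Euc 6}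
    (hW : ContDiffOn ℝ ∞ W (ball p r))
    (hs : ∀ y ∈ ball p r, ∀ v, theta₀ y v = 0 → ∀ i, ys (fderiv ℝ W y v) i +
      ∑ j, ∑ k, eps i j k * (xs (W y) j * xs v k + xs y j * xs (fderiv ℝ W y v) k) = 0) :
    ∃ a ∈ skewQ, ∀ y ∈ ball p r, W y = modelField a y := by
  set O := ball p r
  have hO : IsOpen O := Metric.isOpen_ball
  have hcW : ∀ i, ContDiffOn ℝ ∞ (fun y => W y i) O := fun i =>
    (coordCLM i).contDiff.comp_contDiffOn hW
  have hcx : ∀ i, ContDiffOn ℝ ∞ (fun y : Euc 6 => y i) O := fun i =>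
    (coordCLM i).contDiff.contDiffOn
  have hcb : ∀ i, ContDiffOn ℝ ∞ (fun y => theta₀ y (W y) i) O := fun i =>
    (hcW _).add (ContDiffOn.sum fun j _ => ContDiffOn.sum fun k _ =>
      (contDiffOn_const.mul (hcx _)).mul (hcW _))
  have hca : ∀ i, ContDiffOn ℝ ∞ (fun y => xs (W y) i) O := fun i => hcW _
  let H : Fin 3 → smoothFns O →ₗ[ℝ] smoothFns O := fun m => der hO (hor m) (horL m)
  let b : Fin 3 → smoothFns O := fun i => extendZero (hcb i)
  let a : Fin 3 → smoothFns O := fun i => extendZero (hca i)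
  have hb : ∀ m i, H m (b i) = ∑ k, (2 * eps i m k) • a k := fun m i => by
    refine Subtype.ext (funext fun x => ?_)
    by_cases hx : x ∈ O
    · have hWx := (hW.diffAt hO hx).hasFDerivAt
      have hc : ∀ i, HasFDerivAt (fun y => W y i) _ x := fun i =>
        (coordCLM i).hasFDerivAt.comp x hWx
      have h1 := (hc (natAdd 3 i)).fun_add (HasFDerivAt.fun_sum (u := Finset.univ) fun j _ =>
        HasFDerivAt.fun_sum (u := Finset.univ) fun k _ =>
          (((coordCLM (castAdd 3 j)).hasFDerivAt (x := x)).const_mul (eps i j k)).fun_mul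
            (hc (castAdd 3 k)))
      have h2 := hs x hx _ (theta₀_hor_add m x) i
      rw [der_apply hO _ _ _ hx, (extendZero_eventuallyEq hO (hcb i) hx).fderiv_eq,
        show fderiv ℝ (fun y => theta₀ y (W y) i) x = _ from h1.fderiv]
      have h3 : (∑ k, (2 * eps i m k) • a k).1 x = ∑ k, 2 * eps i m k * xs (W x) k := by
        have h4 : ∀ k, (a k).1 x = xs (W x) k := fun k =>
          (extendZero_eventuallyEq hO (hca k) hx).self_of_nhds
        simp only [← h4, sum_univ_three]
        rfl
      have h5 : ∀ j, coordCLM (castAdd 3 j) (hor m + horL m x) = delta m j := fun j =>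
        congrFun (xs_hor_add m x) j
      rw [h3]
      rw [xs_hor_add] at h2
      simp only [_root_.add_apply, _root_.sum_apply, _root_.smul_apply, smul_eq_mul,
        ContinuousLinearMap.comp_apply, h5]
      have h6 : ∀ (j : Fin 6) (v : Euc 6), coordCLM j v = v j := fun _ _ => rfl
      simp only [h6]
      simp only [xs, ys, sum_univ_three] at h2 ⊢
      generalize fderiv ℝ W x (hor m + horL m x) = V at h2 ⊢
      clear h1 h3 h5 h6
      revert i m
      (repeat' refine forall_fin3 ?_ ?_ ?_) <;>
      simp only [eps_vals, delta_vals] <;> intros <;> linarith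
    · exact ((H m (b i)).2.2 x hx).trans ((∑ k, (2 * eps i m k) • a k).2.2 x hx).symm
  have h01 := der_hor hO 0 1 2 (forall_fin3 (by simp [eps_vals]) (by simp [eps_vals]) (by simp only [eps_vals, delta_vals]; norm_num))
  have h12 := der_hor hO 1 2 0 (forall_fin3 (by simp only [eps_vals, delta_vals]; norm_num) (by simp [eps_vals]) (by simp [eps_vals]))
  have h20 := der_hor hO 2 0 1 (forall_fin3 (by simp [eps_vals]) (by simp only [eps_vals, delta_vals]; norm_num) (by simp [eps_vals]))
  obtain ⟨β, τ, hα, hβ, hτ⟩ := prolong (D := H)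
    (Y := fun i => der hO (vert i) 0) h01 h12 h20 (fun i j f => by
      have := der_commutator hO (vert i) (hor j) 0 0 (horL j) 0 (fun x => by
        rw [horL_apply, _root_.zero_apply, _root_.zero_apply, add_zero, xs_vert]; simp) f
      rwa [zero_smul, sub_eq_zero] at this) hb
  let t : Euc 6 → V3 × V3 × (Fin 3 → V3) × V3 × V3 :=
    fun y => (fun i => (b i).1 y, fun i => (a i).1 y, fun i j => (H j (a i)).1 y,
      fun i => (β i).1 y, fun i => (τ i).1 y)
  have ht : ContDiffOn ℝ ∞ (fun y => so43L (t y)) O :=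
    so43L.contDiff.comp_contDiffOn ((contDiffOn_pi.2 fun i => (b i).2.1).prodMk
      ((contDiffOn_pi.2 fun i => (a i).2.1).prodMk
      ((contDiffOn_pi.2 fun i => contDiffOn_pi.2 fun j => (H j (a i)).2.1).prodMk
      ((contDiffOn_pi.2 fun i => (β i).2.1).prodMk (contDiffOn_pi.2 fun i => (τ i).2.1)))))
  have htd : ∀ x ∈ O, ∀ m, fderiv ℝ (fun y => so43L (t y)) x (hor m + horL m x) =
      so43L (t x) * so43 0 (delta m) 0 0 0 - so43 0 (delta m) 0 0 0 * so43L (t x) := by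
    intro x hx m
    have hf : ∀ f : smoothFns O, HasFDerivAt f.1 (fderiv ℝ f.1 x) x := fun f =>
      (smoothFns_contDiffAt hO f hx).diffAt.hasFDerivAt
    have h1 := so43L.hasFDerivAt.comp x ((hasFDerivAt_pi.2 fun i => hf (b i)).prodMk
      ((hasFDerivAt_pi.2 fun i => hf (a i)).prodMk
      ((hasFDerivAt_pi.2 fun i => hasFDerivAt_pi.2 fun j => hf (H j (a i))).prodMk
      ((hasFDerivAt_pi.2 fun i => hf (β i)).prodMk (hasFDerivAt_pi.2 fun i => hf (τ i))))))
    have h2 : ∀ f : smoothFns O, fderiv ℝ f.1 x (hor m + horL m x) = (H m f).1 x := fun f =>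
      (der_apply hO _ _ f hx).symm
    rw [show fderiv ℝ (fun y => so43L (t y)) x = _ from h1.fderiv]
    change so43 (fun i => fderiv ℝ (b i).1 x (hor m + horL m x))
      (fun i => fderiv ℝ (a i).1 x (hor m + horL m x))
      (fun i j => fderiv ℝ (H j (a i)).1 x (hor m + horL m x))
      (fun i => fderiv ℝ (β i).1 x (hor m + horL m x))
      (fun i => fderiv ℝ (τ i).1 x (hor m + horL m x)) = so43 (fun i => (b i).1 x)
      (fun i => (a i).1 x) (fun i j => (H j (a i)).1 x) (fun i => (β i).1 x) (fun i => (τ i).1 x)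
      * _ - _ * so43 (fun i => (b i).1 x) (fun i => (a i).1 x) (fun i j => (H j (a i)).1 x)
      (fun i => (β i).1 x) (fun i => (τ i).1 x)
    have hz : (0 : smoothFns O).1 x = 0 := rfl
    have hsum : ∀ (f : Fin 3 → smoothFns O) (r : V3),
        (∑ k, r k • f k).1 x = ∑ k, r k * (f k).1 x := fun f r => by
      simp only [sum_univ_three]; rfl
    have hsm : ∀ (f : smoothFns O) (r : ℝ), (r • f).1 x = r * f.1 x := fun _ _ => rfl
    simp only [so43_commutator, h2, hb, hα, hβ, hτ, hz, hsum, hsm]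
    clear h2
    simp only [sum_univ_three, Pi.zero_apply]
    congr 1
    · funext i
      revert i m
      (repeat' refine forall_fin3 ?_ ?_ ?_) <;>
      simp only [eps_vals, delta_vals] <;> ring
    · funext i
      revert i m
      (repeat' refine forall_fin3 ?_ ?_ ?_) <;>
      simp only [eps_vals, delta_vals] <;> ring
    · funext i j
      ring
    · funext i
      revert i m
      (repeat' refine forall_fin3 ?_ ?_ ?_) <;>
      simp only [eps_vals, delta_vals] <;> ring
    · funext i
      ring
  let c : Euc 6 → Mat7 := fun y => frame₀ y * so43L (t y) * frame₀Inv y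
  have hc : ContDiffOn ℝ ∞ c O :=
    (contDiff_frame₀.contDiffOn.mul ht).mul contDiff_frame₀Inv.contDiffOn
  have hcd : ∀ x ∈ O, ∀ m, fderiv ℝ c x (hor m + horL m x) = 0 := fun x hx m => by
    have h1 := (contDiff_frame₀.contDiffAt.differentiableAt (x := x) (by simp)).hasFDerivAt
    have h2 := (contDiff_frame₀Inv.contDiffAt.differentiableAt (x := x) (by simp)).hasFDerivAt
    have h3 := (ht.diffAt hO hx).hasFDerivAt
    have hγ : gamma₀ x (hor m + horL m x) = so43 0 (delta m) 0 0 0 := by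
      rw [gamma₀, theta₀_hor_add, xs_hor_add]
    rw [show fderiv ℝ c x = _ from ((h1.mul' h3).mul' h2).fderiv]
    change frame₀ x * so43L (t x) * fderiv ℝ frame₀Inv x _ + (frame₀ x * fderiv ℝ _ x _ +
      fderiv ℝ frame₀ x _ * so43L (t x)) * frame₀Inv x = 0
    rw [fderiv_frame₀Inv, fderiv_frame₀, htd x hx, hγ]
    noncomm_ring
  have hc0 : ∀ x ∈ O, fderiv ℝ c x = 0 := fun x hx => by
    have hce : ∀ i j, ContDiffOn ℝ ∞ (fun y => c y i j) O := fun i j =>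
      (entryCLM i j).contDiff.comp_contDiffOn hc
    have hcd' : ∀ y ∈ O, HasFDerivAt c (fderiv ℝ c y) y := fun y hy =>
      (hc.diffAt hO hy).hasFDerivAt
    have h1 : ∀ i j m, H m (extendZero (hce i j)) = 0 := fun i j m => by
      refine Subtype.ext (funext fun y => ?_)
      by_cases hy : y ∈ O
      · rw [der_apply hO _ _ _ hy, (extendZero_eventuallyEq hO (hce i j) hy).fderiv_eq,
          (hasFDerivAt_entry (hcd' y hy) i j).fderiv]
        change fderiv ℝ c y _ i j = 0
        rw [hcd y hy]
        rfl
      · exact (H m _).2.2 y hy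
    have h2 : ∀ i j k, der hO (vert k) 0 (extendZero (hce i j)) = 0 := fun i j k => by
      have e0 := h12 (extendZero (hce i j))
      have e1 := h20 (extendZero (hce i j))
      have e2 := h01 (extendZero (hce i j))
      simp only [show ∀ m, der hO (hor m) (horL m) (extendZero (hce i j)) = 0 from h1 i j,
        map_zero, sub_zero] at e0 e1 e2
      revert k
      refine forall_fin3 ?_ ?_ ?_
      exacts [(smul_eq_zero.1 e0.symm).resolve_left (by norm_num),
        (smul_eq_zero.1 e1.symm).resolve_left (by norm_num),
        (smul_eq_zero.1 e2.symm).resolve_left (by norm_num)]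
    have h3 : ∀ i j, (entryCLM i j).comp (fderiv ℝ c x) = 0 := fun i j => by
      have h4 : ∀ (C : Euc 6) (L : Euc 6 →L[ℝ] Euc 6), der hO C L (extendZero (hce i j)) = 0 →
          (entryCLM i j).comp (fderiv ℝ c x) (C + L x) = 0 := fun C L h => by
        rw [← (hasFDerivAt_entry (hcd' x hx) i j).fderiv,
          ← (extendZero_eventuallyEq hO (hce i j) hx).fderiv_eq, ← der_apply hO _ _ _ hx, h]
        rfl
      exact eq_zero_of_hor (x := x) (fun m => h4 _ _ (h1 i j m)) fun k => by
        simpa using h4 _ _ (h2 i j k)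
    ext v i j
    exact DFunLike.congr_fun (h3 i j) v
  have hconst : ∀ x ∈ O, c x = c p := fun x hx =>
    hO.is_const_of_fderiv_eq_zero (convex_ball _ _).isPreconnected
      (hc.differentiableOn (by simp)) hc0 hx (Metric.mem_ball_self hr)
  have hcs : c p ∈ skewQ := by
    have := skew_conj (so43_mem _ _ _ _ _ : so43L (t p) ∈ _) (-p)
    rwa [conj, frame₀Inv_eq, neg_neg, ← frame₀Inv_eq] at this
  refine ⟨c p, hcs, fun y hy => ?_⟩
  have hconj : conj (c p) y = so43L (t y) := by
    rw [← hconst y hy]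
    change frame₀Inv y * (frame₀ y * so43L (t y) * frame₀Inv y) * frame₀ y = _
    rw [← Matrix.mul_assoc, ← Matrix.mul_assoc, frame₀Inv_mul, Matrix.one_mul, Matrix.mul_assoc,
      frame₀Inv_mul, Matrix.mul_one]
  refine ext_theta₀ (p := y) ?_ ?_
  · rw [xs_modelField, ← conj, hconj]
    exact (funext fun i => (extendZero_eventuallyEq hO (hca i) hy).self_of_nhds.symm).trans
      (blkX_so43 _ _ _ _ _).symm
  · rw [theta₀_modelField' hcs, hconj]
    exact (funext fun i => (extendZero_eventuallyEq hO (hcb i) hy).self_of_nhds.symm).trans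
      (thetaPart_so43 _ _ _ _ _).symm

end LocalSymmetries

section ModelFlow

open Matrix

attribute [local instance] linftyOpNormedRing linftyOpNormedAlgebra mat7Topology

lemma kappa_frame₀ (x : Euc 6) : kappa (frame₀ x) = x := by
  refine euc_ext ?_ ?_
  · rw [xs_kappa, frame₀, blkX_mk7, blkA_mk7]; simp
  · rw [ys_kappa, frame₀, blkZ_mk7, blkA_mk7]
    funext i
    revert i
    refine forall_fin3 ?_ ?_ ?_ <;> simp [vee, cross, vecMulVec_apply] <;> ring

lemma isOrth_exp {a : Mat7} (ha : a ∈ skewQ) (t : ℝ) : IsOrth (NormedSpace.exp (t • a)) := by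
  refine isOrth_of_hasFDerivAt (E := ℝ) (g := fun t => NormedSpace.exp (t • a))
    (γ := fun _ => (ContinuousLinearMap.id ℝ ℝ).smulRight a) isOpen_univ isPreconnected_univ
    (fun x _ v => Submodule.smul_mem _ v ha) (fun x _ => ?_) (Set.mem_univ 0)
    (by simp) (Set.mem_univ t)
  have h := (hasDerivAt_exp_smul_const (𝕂 := ℝ) a x).hasFDerivAt
  refine HasFDerivAt.congr_fderiv h (ContinuousLinearMap.ext_ring ?_)
  simp

lemma exists_modelFlow {a : Mat7} (ha : a ∈ skewQ)
    {O : Set (Euc 6)} (hO : IsOpen O) {p : Euc 6} (hp : p ∈ O) :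
    ∃ (V : Set (Euc 6)) (r : ℝ) (Φ : ℝ × Euc 6 → Euc 6), IsOpen V ∧ p ∈ V ∧ 0 < r ∧ ∀ x ∈ V,
      Φ (0, x) = x ∧ ∀ t ∈ Ioo (-r) r, ContDiffAt ℝ ∞ Φ (t, x) ∧ Φ (t, x) ∈ O ∧
        fderiv ℝ Φ (t, x) (1, 0) = modelField a (Φ (t, x)) ∧
        (∀ v, theta₀ (Φ (t, x)) (fderiv ℝ Φ (t, x) (0, v)) = 0 ↔ theta₀ x v = 0) ∧
        Surjective fun v => fderiv ℝ Φ (t, x) (0, v) := by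
  let g : ℝ × Euc 6 → Mat7 := fun z => NormedSpace.exp (z.1 • a) * frame₀ z.2
  let Φ : ℝ × Euc 6 → Euc 6 := fun z => kappa (g z)
  have hg : ContDiff ℝ ∞ g := by
    refine ContDiff.mul ?_ (contDiff_frame₀.comp contDiff_snd)
    have h : ContDiff ℝ ∞ (NormedSpace.exp : Mat7 → Mat7) := contDiff_iff_contDiffAt.2 fun x =>
      (NormedSpace.exp_analytic (𝕂 := ℝ) x).contDiffAt
    exact h.comp (contDiff_fst.smul contDiff_const)
  have horth : ∀ z, IsOrth (g z) := fun z => (isOrth_exp ha _).mul (frame₀_isOrth _)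
  have hg0 : ∀ x, g (0, x) = frame₀ x := fun x => by simp [g]
  have hdet : ∀ x, (blkA (frame₀ x)).det ≠ 0 := fun x => by rw [frame₀, blkA_mk7]; simp
  have hd : ∀ z, HasFDerivAt g (fderiv ℝ g z) z := fun z =>
    (hg.contDiffAt.diffAt).hasFDerivAt
  have hd1 : ∀ z, fderiv ℝ g z (1, 0) = a * g z ∧
      ∀ v, fderiv ℝ g z (0, v) = g z * gamma₀ z.2 v := fun z => by
    have h1 := ((hasDerivAt_exp_smul_const' (𝕂 := ℝ) a z.1).hasFDerivAt).comp z
      (hasFDerivAt_fst (𝕜 := ℝ))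
    have h2 := ((contDiff_frame₀.contDiffAt.differentiableAt (x := z.2) (by simp)).hasFDerivAt).comp
      z (hasFDerivAt_snd (𝕜 := ℝ))
    have h3 : fderiv ℝ g z = _ := (h1.mul' h2).fderiv
    rw [h3]
    constructor
    · change NormedSpace.exp (z.1 • a) * fderiv ℝ frame₀ z.2 0 +
        ((1 : ℝ) • (a * NormedSpace.exp (z.1 • a))) * frame₀ z.2 = _
      rw [map_zero, Matrix.mul_zero, zero_add, one_smul, Matrix.mul_assoc]
    · intro v
      change NormedSpace.exp (z.1 • a) * fderiv ℝ frame₀ z.2 v +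
        ((0 : ℝ) • (a * NormedSpace.exp (z.1 • a))) * frame₀ z.2 = _
      rw [fderiv_frame₀, zero_smul, Matrix.zero_mul, add_zero, Matrix.mul_assoc]
  have hΦ0 : ∀ x, Φ (0, x) = x := fun x => by simp only [Φ, hg0, kappa_frame₀]
  have hΦ : ∀ z, (blkA (g z)).det ≠ 0 → ContDiffAt ℝ ∞ Φ z := fun z hz =>
    (contDiffAt_kappa hz).comp z hg.contDiffAt
  have hp0 : (blkA (g (0, p))).det ≠ 0 := by rw [hg0]; exact hdet p
  have hdetc : Continuous fun z => (blkA (g z)).det := by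
    have h : ∀ i j, Continuous fun z => g z i j := fun i j =>
      (entryCLM i j).continuous.comp hg.continuous
    simp only [det_fin_three, blkA, of_apply, cons_val]
    fun_prop
  have hev : ∀ᶠ z in nhds ((0 : ℝ), p), (blkA (g z)).det ≠ 0 ∧ Φ z ∈ O ∧
      Surjective fun v => fderiv ℝ Φ z (0, v) := by
    refine (hdetc.continuousAt.eventually_ne hp0).and (((hΦ _ hp0).continuousAt.eventually_mem
      (hO.mem_nhds ?_)).and ?_)
    · rwa [hΦ0]
    have h1 : ContinuousAt (fun z => (fderiv ℝ Φ z).comp (ContinuousLinearMap.inr ℝ ℝ (Euc 6)))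
        (0, p) := (((hΦ _ hp0).fderiv_right (m := 0) (by simp)).continuousAt).clm_comp
          continuousAt_const
    have h2 : (fderiv ℝ Φ (0, p)).comp (ContinuousLinearMap.inr ℝ ℝ (Euc 6)) =
        (ContinuousLinearEquiv.refl ℝ (Euc 6) : Euc 6 →L[ℝ] Euc 6) := by
      have h3 := (hΦ _ hp0).diffAt.hasFDerivAt.comp p
        (hasFDerivAt_prodMk_right (0 : ℝ) p)
      exact h3.unique ((hasFDerivAt_id p).congr_of_eventuallyEq
        (Filter.Eventually.of_forall hΦ0))
    filter_upwards [h1.eventually_mem (by rw [h2]; exact ContinuousLinearEquiv.nhds _)]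
      with z ⟨F, hF⟩ w
    exact ⟨F.symm w, by
      have := DFunLike.congr_fun hF (F.symm w)
      simpa using this.symm⟩
  rw [nhds_prod_eq] at hev
  obtain ⟨pa, hpa, pb, hpb, h⟩ := Filter.eventually_prod_iff.1 hev
  obtain ⟨r, hr, hr'⟩ := Metric.eventually_nhds_iff_ball.1 hpa
  obtain ⟨V, hV, hVo, hpV⟩ := eventually_nhds_iff.1 hpb
  refine ⟨V, r, Φ, hVo, hpV, hr, fun x hx => ⟨hΦ0 x, fun t ht => ?_⟩⟩
  obtain ⟨k1, k2, k3⟩ := h (hr' t (by simpa [Real.ball_eq_Ioo] using ht)) (hV x hx)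
  refine ⟨hΦ _ k1, k2, ?_, fun v => ?_, k3⟩
  · exact fderiv_kappa_eq_modelField (hd _) (Filter.Eventually.of_forall horth) k1 (hd1 _).1
  · rw [theta₀_kappa_eq_zero_iff (hd _) (Filter.Eventually.of_forall horth) k1 ((hd1 (t, x)).2 v),
      gamma₀, blkZ_so43, neg_eq_zero, cross_eq_zero_iff]

lemma infinitesimal_of_flow {F : ℝ × Euc 6 → Euc 6} {W : Euc 6 → Euc 6} {y v : Euc 6}
    (hF : ContDiffAt ℝ ∞ F (0, y)) (h0 : ∀ᶠ z in nhds y, F (0, z) = z)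
    (h1 : ∀ᶠ z in nhds y, fderiv ℝ F (0, z) (1, 0) = W z)
    (h2 : ∀ᶠ t in nhds (0 : ℝ), theta₀ (F (t, y)) (fderiv ℝ F (t, y) (0, v)) = 0) (i : Fin 3) :
    ys (fderiv ℝ W y v) i +
      ∑ j, ∑ k, eps i j k * (xs (W y) j * xs v k + xs y j * xs (fderiv ℝ W y v) k) = 0 := by
  have hd := hF.diffAt.hasFDerivAt
  have hdd := ((hF.fderiv_right (m := ∞) (by simp)).differentiableAt (by simp)).hasFDerivAt
  have e0 : fderiv ℝ F (0, y) (0, v) = v := by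
    have h3 := hd.comp y (hasFDerivAt_prodMk_right (0 : ℝ) y)
    exact DFunLike.congr_fun (h3.unique ((hasFDerivAt_id y).congr_of_eventuallyEq h0)) v
  have e1 : fderiv ℝ W y v = fderiv ℝ (fderiv ℝ F) (0, y) (1, 0) (0, v) := by
    have h3 := (hdd.comp y (hasFDerivAt_prodMk_right (0 : ℝ) y)).clm_apply
      (hasFDerivAt_const ((1 : ℝ), (0 : Euc 6)) y)
    rw [(h3.congr_of_eventuallyEq (h1.mono fun z hz => hz.symm)).fderiv,
      (hF.isSymmSndFDerivAt (by simpa using two_le_infty)).eq]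
    simp
  have hl : HasFDerivAt (fun t : ℝ => (t, y)) (ContinuousLinearMap.inl ℝ ℝ (Euc 6)) 0 :=
    hasFDerivAt_prodMk_left 0 y
  have c1 : ∀ j, HasDerivAt (fun t : ℝ => F (t, y) j) (W y j) 0 := fun j => by
    have := ((coordCLM j).hasFDerivAt.comp (0 : ℝ) (hd.comp (0 : ℝ) hl)).hasDerivAt
    rw [← h1.self_of_nhds]
    exact this
  have c2 : ∀ j, HasDerivAt (fun t : ℝ => fderiv ℝ F (t, y) (0, v) j) (fderiv ℝ W y v j) 0 :=
    fun j => by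
      have := ((coordCLM j).hasFDerivAt.comp (0 : ℝ) ((hdd.comp (0 : ℝ) hl).clm_apply
        (hasFDerivAt_const ((0 : ℝ), v) (0 : ℝ)))).hasDerivAt
      rw [e1]
      refine (show HasDerivAt (fun t : ℝ => fderiv ℝ F (t, y) (0, v) j) _ 0 from
        this).congr_deriv ?_
      simp
      rfl
  have key := ((c2 (natAdd 3 i)).fun_add (HasDerivAt.fun_sum (u := Finset.univ) fun j _ =>
    HasDerivAt.fun_sum (u := Finset.univ) fun k _ => (((c1 (castAdd 3 j)).const_mul
      (eps i j k)).fun_mul (c2 (castAdd 3 k))))).unique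
    ((hasDerivAt_const (0 : ℝ) (0 : ℝ)).congr_of_eventuallyEq (h2.mono fun t ht => congrFun ht i))
  rw [h0.self_of_nhds, e0] at key
  simpa only [xs, ys, mul_add, mul_assoc] using key

end ModelFlow

section ChartFields

variable {e : OpenPartialHomeomorph M (Euc 6)}

/-- The differential of a chart. -/
def dChart (e : OpenPartialHomeomorph M (Euc 6)) (q : M) : Euc 6 →L[ℝ] Euc 6 :=
  mfderiv (𝓡 6) (𝓡 6) e q

lemma dChart_isInvertible (he : e ∈ maxAtlas M) {q : M}
    (hq : q ∈ e.source) : (dChart e q).IsInvertible :=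
  ⟨(mdifferentiable_of_mem_maximalAtlas he).mfderiv hq, rfl⟩

lemma dSymm_dChart (he : e ∈ maxAtlas M) {q : M} (hq : q ∈ e.source)
    (u : Euc 6) : dSymm e (e q) (dChart e q u) = u :=
  DFunLike.congr_fun ((mdifferentiable_of_mem_maximalAtlas he).symm_comp_deriv hq) u

lemma dChart_dSymm (he : e ∈ maxAtlas M) {y : Euc 6} (hy : y ∈ e.target)
    (v : Euc 6) : dChart e (e.symm y) (dSymm e y v) = v :=
  dSymm_injective he hy (by
    simpa only [e.right_inv hy] using dSymm_dChart he (e.map_target hy) (dSymm e y v))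

lemma IsFlatChart.mem_iff {D : (x : M) → Submodule ℝ (TangentSpace (𝓡 6) x)}
    (hf : IsFlatChart D e) (he : e ∈ maxAtlas M) {q : M}
    (hq : q ∈ e.source) (v : TangentSpace (𝓡 6) q) : v ∈ D q ↔ theta₀ (e q) (dChart e q v) = 0 := by
  have h : ∀ a, coordDiff e a q v = (dChart e q v) a := fun a => by
    have h1 := ((coordCLM a).hasFDerivAt (x := e q)).hasMFDerivAt.comp q
      ((mdifferentiable_of_mem_maximalAtlas he).mdifferentiableAt hq).hasMFDerivAt
    exact DFunLike.congr_fun h1.mfderiv v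
  rw [hf q hq v]
  simp only [h, funext_iff, theta₀, xs, ys, Pi.zero_apply]

/-- The vector field that a matrix in `so(4, 3)` defines in a flat chart. -/
def chartField (e : OpenPartialHomeomorph M (Euc 6)) (a : Mat7) :
    (x : M) → TangentSpace (𝓡 6) x := VectorField.mpullback (𝓡 6) (𝓡 6) e (modelField a)

lemma eq_chartField_iff (he : e ∈ maxAtlas M) {q : M}
    (hq : q ∈ e.source) {a : Mat7} {v : TangentSpace (𝓡 6) q} :
    v = chartField e a q ↔ dChart e q v = modelField a (e q) := by
  have h : dChart e q (chartField e a q) = modelField a (e q) :=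
    (dChart_isInvertible he hq).self_apply_inverse _
  constructor
  · rintro rfl; exact h
  · exact fun h' => (dChart_isInvertible he hq).injective (h'.trans h.symm)

lemma chartField_unique (he : e ∈ maxAtlas M) {q : M}
    (hq : q ∈ e.source) {a b : Mat7} (ha : a ∈ skewQ) (hb : b ∈ skewQ)
    (h : ∀ᶠ x in nhds q, chartField e a x = chartField e b x) : a = b := by
  have h1 : (-1 : ℝ) • b + a = 0 := by
    refine eq_zero_of_modelField (p := e q) (Submodule.add_mem _ (Submodule.smul_mem _ _ hb) ha) ?_
    have h2 := (e.continuousAt_symm (e.map_source hq)).eventually (by rwa [e.left_inv hq])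
    filter_upwards [h2, e.open_target.mem_nhds (e.map_source hq)] with z hz hz'
    have h3 := (eq_chartField_iff he (e.map_target hz')).1 hz
    rw [(eq_chartField_iff he (e.map_target hz')).1 rfl, e.right_inv hz'] at h3
    rw [modelField_smul_add, h3, neg_one_smul, neg_add_cancel]
  rw [neg_one_smul, neg_add_eq_zero] at h1
  exact h1.symm

variable [IsManifold (𝓡 6) ∞ M]

lemma contMDiffAt_chartField (he : e ∈ maxAtlas M) {q : M}
    (hq : q ∈ e.source) (a : Mat7) : ContMDiffAt (𝓡 6) (𝓡 6).tangent ∞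
      (fun x => (⟨x, chartField e a x⟩ : TangentBundle (𝓡 6) M)) q :=
  have : IsManifold (𝓡 6) 1 M := IsManifold.of_le (n := ∞) (by simp)
  ContMDiffAt.mpullback_vectorField_preimage
    (contMDiffAt_vectorSpace_iff_contDiffAt.2 (contDiff_modelField a).contDiffAt)
    ((contMDiffOn_of_mem_maximalAtlas he q hq).contMDiffAt (e.open_source.mem_nhds hq))
    (dChart_isInvertible he hq) (by simp)

lemma mlieBracket_chartField (he : e ∈ maxAtlas M) {q : M}
    (hq : q ∈ e.source) {a b : Mat7} (ha : a ∈ skewQ) (hb : b ∈ skewQ) :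
    mlieBracket (𝓡 6) (chartField e a) (chartField e b) q = chartField e (b * a - a * b) q := by
  have hs : ∀ a, MDifferentiableAt (𝓡 6) (𝓡 6).tangent
      (fun x => (⟨x, modelField a x⟩ : TangentBundle (𝓡 6) (Euc 6))) (e q) := fun a =>
    (contMDiffAt_vectorSpace_iff_contDiffAt.2
      (contDiff_modelField a).contDiffAt).mdifferentiableAt (n := ∞) (by simp)
  have : IsManifold (𝓡 6) 2 M := IsManifold.of_le (n := ∞) two_le_infty
  obtain ⟨_, _⟩ := isManifold_minSmoothness (M := M)
  have h := VectorField.mpullback_mlieBracket (n := ∞) (hs a) (hs b)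
    ((contMDiffOn_of_mem_maximalAtlas he q hq).contMDiffAt (e.open_source.mem_nhds hq)) (by
    rw [minSmoothness_of_isRCLikeNormedField]; exact two_le_infty)
  have h' := (congrArg (dChart e q) h.symm).trans
    (((dChart_isInvertible he hq).self_apply_inverse _).trans
      (congrFun (mlieBracket_eq_lieBracket _ _) _))
  exact (eq_chartField_iff he hq).2 (h'.trans (lieBracket_modelField ha hb _))

lemma exists_flow_of_chartField (he : e ∈ maxAtlas M)
    (hf : IsFlatChart D e) {a : Mat7} (ha : a ∈ skewQ) {p : M}
    (hp : p ∈ e.source) {U : Set M} (hU : U ∈ nhds p) {X : (x : M) → TangentSpace (𝓡 6) x}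
    (hX : ∀ᶠ x in nhds p, X x = chartField e a x) :
    ∃ (V : Set M) (r : ℝ) (φ : ℝ → M → M), p ∈ V ∧ IsLocalFlow X U V r φ ∧
      ∀ t ∈ Ioo (-r) r, ∀ x ∈ V,
        (D x).map (mfderiv (𝓡 6) (𝓡 6) (φ t) x).toLinearMap = D (φ t x) := by
  have hmd := mdifferentiable_of_mem_maximalAtlas he
  obtain ⟨N, hN, hNo, hpN⟩ := eventually_nhds_iff.1 (hX.and hU)
  obtain ⟨V, r, Φ, hV, hpV, hr, hΦ⟩ := exists_modelFlow ha
    (e.isOpen_inter_preimage_symm hNo) (p := e p) ⟨e.map_source hp, by simpa [e.left_inv hp]⟩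
  have hder : ∀ t ∈ Ioo (-r) r, ∀ x ∈ e.source ∩ e ⁻¹' V, HasFDerivAt Φ
      (fderiv ℝ Φ (t, e x)) (t, e x) := fun t ht x hx =>
    (((hΦ _ hx.2).2 t ht).1.diffAt).hasFDerivAt
  have hsy : ∀ {y}, y ∈ e.target → HasMFDerivAt (𝓡 6) (𝓡 6) e.symm y (dSymm e y) := fun hy =>
    (hmd.symm.mdifferentiableAt hy).hasMFDerivAt
  refine ⟨e.source ∩ e ⁻¹' V, r, fun t x => e.symm (Φ (t, e x)), ⟨hp, hpV⟩,
    ⟨e.isOpen_inter_preimage hV, hr, fun t ht x hx => ?_, fun x hx => ?_, ?_, ?_⟩, ?_⟩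
  · exact (hN _ ((hΦ _ hx.2).2 t ht).2.1.2).2
  · rw [(hΦ _ hx.2).1, e.left_inv hx.1]
  · rintro ⟨t, x⟩ ⟨ht, hx⟩
    obtain ⟨h1, h2, -⟩ := (hΦ _ hx.2).2 t ht
    have h3 : ContMDiffAt (𝓘(ℝ, ℝ).prod (𝓡 6)) 𝓘(ℝ, ℝ × Euc 6) ∞
        (fun z : ℝ × M => (z.1, e z.2)) (t, x) :=
      contMDiffAt_fst.prodMk_space (ContMDiffAt.comp (t, x) ((contMDiffOn_of_mem_maximalAtlas he x
        hx.1).contMDiffAt (e.open_source.mem_nhds hx.1)) contMDiffAt_snd)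
    exact (ContMDiffAt.comp (t, x) ((contMDiffOn_symm_of_mem_maximalAtlas he _ h2.1).contMDiffAt
      (e.open_target.mem_nhds h2.1)) (ContMDiffAt.comp (t, x) h1.contMDiffAt h3)).contMDiffWithinAt
  · intro x hx t ht
    obtain ⟨-, h2, h3, -⟩ := (hΦ _ hx.2).2 t ht
    have h4 := (hsy h2.1).comp t (HasFDerivAt.comp (f := fun s => (s, e x)) t (hder t ht x hx)
      (hasFDerivAt_prodMk_left t (e x))).hasMFDerivAt
    have h5 := (hN _ h2.2).1
    have h6 : fieldVal X (e.symm (Φ (t, e x))) = dSymm e (Φ (t, e x)) (fderiv ℝ Φ (t, e x) (1, 0)) := by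
      rw [eq_chartField_iff he (e.map_target h2.1), e.right_inv h2.1, ← h3] at h5
      rw [← h5]
      have h7 := dSymm_dChart he (e.map_target h2.1) (fieldVal X (e.symm (Φ (t, e x))))
      rw [e.right_inv h2.1] at h7
      exact h7.symm
    have h7 : (1 : ℝ →L[ℝ] ℝ).smulRight (fieldVal X (e.symm (Φ (t, e x)))) =
        (dSymm e (Φ (t, e x))).comp
          ((fderiv ℝ Φ (t, e x)).comp (ContinuousLinearMap.inl ℝ ℝ (Euc 6))) :=
      ContinuousLinearMap.ext_ring (by simp [h6])
    have h8 : HasMFDerivAt 𝓘(ℝ, ℝ) (𝓡 6) (fun t => e.symm (Φ (t, e x))) t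
      ((1 : ℝ →L[ℝ] ℝ).smulRight (fieldVal X (e.symm (Φ (t, e x))))) := h7 ▸ h4
    exact h8.hasMFDerivWithinAt
  · intro t ht x hx
    obtain ⟨-, h2, -, h3, h4⟩ := (hΦ _ hx.2).2 t ht
    have h5 := (hsy h2.1).comp x (((hder t ht x hx).comp (e x)
      (hasFDerivAt_prodMk_right t (e x))).hasMFDerivAt.comp x
        (hmd.mdifferentiableAt hx.1).hasMFDerivAt)
    have h6 : ∀ v : Euc 6, mfderiv (𝓡 6) (𝓡 6) (fun x => e.symm (Φ (t, e x))) x v =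
        dSymm e (Φ (t, e x)) (fderiv ℝ Φ (t, e x) (0, dChart e x v)) := fun v =>
      DFunLike.congr_fun h5.mfderiv v
    have h7 : ∀ v : Euc 6, dSymm e (Φ (t, e x)) (fderiv ℝ Φ (t, e x) (0, dChart e x v)) ∈
        D (e.symm (Φ (t, e x))) ↔ v ∈ D x := fun v => by
      refine (hf.mem_iff he (e.map_target h2.1) _).trans
        (Iff.trans ?_ (hf.mem_iff he hx.1 v).symm)
      rw [dChart_dSymm he h2.1, e.right_inv h2.1, h3]
    ext w
    constructor
    · rintro ⟨v, hv, rfl⟩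
      have := (h7 v).2 hv
      rw [← h6 v] at this
      exact this
    · intro hw
      obtain ⟨w', hw'⟩ := dSymm_surjective he h2.1 w
      obtain ⟨v', hv'⟩ := h4 w'
      have h8 : dSymm e (Φ (t, e x)) (fderiv ℝ Φ (t, e x) (0, dChart e x (dSymm e (e x) v'))) = w := by
        have := dChart_dSymm he (e.map_source hx.1) v'
        rw [e.left_inv hx.1] at this
        rw [this]
        exact (congrArg _ hv').trans hw'
      refine ⟨dSymm e (e x) v', (h7 _).1 ?_, (h6 _).trans h8⟩
      rw [h8]
      exact hw

lemma IsInfinitesimalSymmetry.exists_chartField {U : Set M} (hU : IsOpen U)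
    {X : (x : M) → TangentSpace (𝓡 6) x} (hX : IsInfinitesimalSymmetry D U X)
    (he : e ∈ maxAtlas M) (hf : IsFlatChart D e) {p : M} (hpU : p ∈ U) (hp : p ∈ e.source) :
    ∃ a ∈ skewQ, ∀ᶠ x in nhds p, X x = chartField e a x := by
  have hmd := mdifferentiable_of_mem_maximalAtlas he
  have hNo := e.isOpen_inter_preimage_symm hU
  have hW := contDiffOn_locField he hU hX.1
  obtain ⟨r, hr, hrN⟩ := Metric.isOpen_iff.1 hNo (e p) ⟨e.map_source hp, by simpa [e.left_inv hp]⟩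
  obtain ⟨a, ha, h⟩ := exists_modelField hr (hW.mono hrN) (fun y hy v hv => by
    obtain ⟨hy, hyU⟩ := hrN hy
    obtain ⟨V, r, φ, hqV, hφ, hφD⟩ := hX.2 _ hyU
    have hIoo : Ioo (-r) r ∈ nhds (0 : ℝ) := Ioo_mem_nhds (by linarith [hφ.pos]) hφ.pos
    have h0 : (0 : ℝ) ∈ Ioo (-r) r := mem_of_mem_nhds hIoo
    have hφs : ∀ t ∈ Ioo (-r) r, ∀ x ∈ V, ContMDiffAt (𝓘(ℝ, ℝ).prod (𝓡 6)) (𝓡 6) ∞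
        (fun p : ℝ × M => φ p.1 p.2) (t, x) := fun t ht x hx =>
      (hφ.smooth (t, x) ⟨ht, hx⟩).contMDiffAt ((isOpen_Ioo.prod hφ.isOpen).mem_nhds ⟨ht, hx⟩)
    have hes : ∀ {x}, x ∈ e.source → ContMDiffAt (𝓡 6) (𝓡 6) ∞ e x := fun hx =>
      (contMDiffOn_of_mem_maximalAtlas he _ hx).contMDiffAt (e.open_source.mem_nhds hx)
    have hFs : ∀ t ∈ Ioo (-r) r, ∀ z ∈ e.target, e.symm z ∈ V → φ t (e.symm z) ∈ e.source →
        ContDiffAt ℝ ∞ (fun z : ℝ × Euc 6 => e (φ z.1 (e.symm z.2))) (t, z) := by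
      intro t ht z hz hzV hs
      have k1 : ContMDiffAt 𝓘(ℝ, ℝ × Euc 6) (𝓘(ℝ, ℝ).prod (𝓡 6)) ∞
          (fun z : ℝ × Euc 6 => (z.1, e.symm z.2)) (t, z) :=
        contDiffAt_fst.contMDiffAt.prodMk (ContMDiffAt.comp (t, z)
          ((contMDiffOn_symm_of_mem_maximalAtlas he z hz).contMDiffAt (e.open_target.mem_nhds hz))
          contDiffAt_snd.contMDiffAt)
      exact contMDiffAt_iff_contDiffAt.1 (ContMDiffAt.comp (t, z) (hes hs)
        (ContMDiffAt.comp (t, z) (hφs t ht _ hzV) k1))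
    have hev : ∀ᶠ z in nhds y, z ∈ e.target ∧ e.symm z ∈ V :=
      (e.isOpen_inter_preimage_symm hφ.isOpen).mem_nhds ⟨hy, hqV⟩
    have h0s : ∀ {z}, z ∈ e.target → e.symm z ∈ V → φ 0 (e.symm z) ∈ e.source := fun hz hzV => by
      rw [hφ.zero _ hzV]; exact e.map_target hz
    refine infinitesimal_of_flow (hFs 0 h0 y hy hqV (h0s hy hqV)) ?_ ?_ ?_
    · filter_upwards [hev] with z hz
      rw [hφ.zero _ hz.2, e.right_inv hz.1]
    · filter_upwards [hev] with z hz
      have k1 := HasFDerivAt.comp (f := fun s : ℝ => (s, z)) 0 ((hFs 0 h0 z hz.1 hz.2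
        (h0s hz.1 hz.2)).diffAt.hasFDerivAt) (hasFDerivAt_prodMk_left 0 z)
      have k2 := ((hes (h0s hz.1 hz.2)).mdifferentiableAt (by simp)).hasMFDerivAt.comp (0 : ℝ)
        ((hφ.integralCurve _ hz.2 0 h0).hasMFDerivAt hIoo)
      have k3 := DFunLike.congr_fun (k1.unique k2.hasFDerivAt) (1 : ℝ)
      have k4 : fderiv ℝ (fun z : ℝ × Euc 6 => e (φ z.1 (e.symm z.2))) (0, z) (1, 0) =
          dChart e (φ 0 (e.symm z)) ((1 : ℝ) • fieldVal X (φ 0 (e.symm z))) := k3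
      rw [k4, hφ.zero _ hz.2, one_smul, ← dSymm_locField he hz.1, dChart_dSymm he hz.1]
    · have hc : ContinuousAt (fun t => φ t (e.symm y)) 0 :=
        ((hφ.integralCurve _ hqV 0 h0).hasMFDerivAt hIoo).continuousAt
      filter_upwards [hIoo, hc.eventually_mem (e.open_source.mem_nhds (h0s hy hqV))] with t ht hts
      have k1 := HasFDerivAt.comp (f := fun z : Euc 6 => (t, z)) y ((hFs t ht y hy hqV
        hts).diffAt.hasFDerivAt) (hasFDerivAt_prodMk_right t y)
      have k2 : MDifferentiableAt (𝓡 6) (𝓡 6) (φ t) (e.symm y) :=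
        (ContMDiffAt.comp (e.symm y) (hφs t ht _ hqV)
          (contMDiffAt_const.prodMk contMDiffAt_id)).mdifferentiableAt (by simp)
      have k3 := (((hes hts).mdifferentiableAt (by simp)).hasMFDerivAt.comp (e.symm y)
        k2.hasMFDerivAt).comp y (hmd.symm.mdifferentiableAt hy).hasMFDerivAt
      have k4 : fderiv ℝ (fun z : ℝ × Euc 6 => e (φ z.1 (e.symm z.2))) (t, y) (0, v) =
          dChart e (φ t (e.symm y)) (mfderiv (𝓡 6) (𝓡 6) (φ t) (e.symm y) (dSymm e y v)) :=
        DFunLike.congr_fun (k1.unique k3.hasFDerivAt) v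
      rw [k4]
      refine (hf.mem_iff he hts _).1 ?_
      rw [← hφD t ht _ hqV]
      refine ⟨dSymm e y v, (hf.mem_iff he (e.map_target hy) _).2 ?_, rfl⟩
      rw [dChart_dSymm he hy, e.right_inv hy, hv])
  refine ⟨a, ha, ?_⟩
  filter_upwards [e.open_source.mem_nhds hp, (e.continuousAt hp).eventually
    (Metric.ball_mem_nhds (e p) hr)] with x hx hx'
  have h1 := dSymm_locField he (e.map_source hx) X
  rw [h _ hx', e.left_inv hx] at h1
  rw [eq_chartField_iff he hx]
  change dChart e x (fieldVal X x) = _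
  rw [← h1]
  have := dChart_dSymm he (e.map_source hx) (modelField a (e x))
  rwa [e.left_inv hx] at this

end ChartFields

section SplitForm

open Matrix

/-- A change of basis that diagonalizes `Q`. -/
def diagBasis : Mat7 := mk7 1 0 1 0 1 0 1 0 (-1)

/-- The inverse of `diagBasis`. -/
def diagBasisInv : Mat7 :=
  mk7 ((1 / 2 : ℝ) • 1) 0 ((1 / 2 : ℝ) • 1) 0 1 0 ((1 / 2 : ℝ) • 1) 0 ((-1 / 2 : ℝ) • 1)

lemma diagBasis_mul : diagBasis * diagBasisInv = 1 := by
  rw [diagBasis, diagBasisInv, mk7_mul, ← mk7_one]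
  congr 1 <;> simp [← add_smul] <;> norm_num
  all_goals rw [← add_smul]; norm_num

lemma diagBasis_conj : diagBasisᵀ * Q * diagBasis = (Units.mk0 (2 : ℝ) two_ne_zero) •
    Matrix.reindexAlgEquiv ℝ ℝ (finSumFinEquiv (m := 4) (n := 3))
      (LieAlgebra.Orthogonal.indefiniteDiagonal (Fin 4) (Fin 3) ℝ) := by
  have h : Matrix.reindexAlgEquiv ℝ ℝ (finSumFinEquiv (m := 4) (n := 3))
      (LieAlgebra.Orthogonal.indefiniteDiagonal (Fin 4) (Fin 3) ℝ) =
      Matrix.diagonal ![1, 1, 1, 1, -1, -1, -1] := by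
    ext i j
    rw [Matrix.coe_reindexAlgEquiv, Matrix.reindex_apply, Matrix.submatrix_apply,
      LieAlgebra.Orthogonal.indefiniteDiagonal, Matrix.diagonal_apply, Matrix.diagonal_apply]
    simp only [EmbeddingLike.apply_eq_iff_eq]
    congr 1
    fin_cases i <;> rfl
  rw [h, diagBasis, Q_eq_mk7, mk7_transpose, mk7_mul, mk7_mul]
  apply ext_seven <;> simp [mk7, Units.smul_def] <;> norm_num

lemma nonempty_so43_equiv : ∃ E : LieAlgebra.Orthogonal.so' (Fin 4) (Fin 3) ℝ →ₗ[ℝ] Mat7,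
    (∀ a, E a ∈ skewQ) ∧ Injective E ∧ (∀ s ∈ skewQ, ∃ a, E a = s) ∧
    ∀ a b, E ⁅a, b⁆ = E a * E b - E b * E a := by
  have hi : Invertible diagBasis := ⟨diagBasisInv, mul_eq_one_comm.1 diagBasis_mul, diagBasis_mul⟩
  let E₁ := skewAdjointMatricesLieSubalgebraEquivTranspose
    (LieAlgebra.Orthogonal.indefiniteDiagonal (Fin 4) (Fin 3) ℝ)
    (Matrix.reindexAlgEquiv ℝ ℝ (finSumFinEquiv (m := 4) (n := 3))) (fun _ => rfl)
  let E₂ := skewAdjointMatricesLieSubalgebraEquiv Q diagBasis hi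
  have hm : ∀ s, s ∈ skewAdjointMatricesLieSubalgebra (diagBasisᵀ * Q * diagBasis) ↔
      s ∈ skewAdjointMatricesLieSubalgebra
        (Matrix.reindexAlgEquiv ℝ ℝ (finSumFinEquiv (m := 4) (n := 3))
          (LieAlgebra.Orthogonal.indefiniteDiagonal (Fin 4) (Fin 3) ℝ)) := fun s => by
    rw [diagBasis_conj, mem_skewAdjointMatricesLieSubalgebra_unit_smul]
  let _ : LieRing (Matrix (Fin (4 + 3)) (Fin (4 + 3)) ℝ) := LieRing.ofAssociativeRing
  let G : LieAlgebra.Orthogonal.so' (Fin 4) (Fin 3) ℝ ≃ₗ⁅ℝ⁆ skewQ :=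
    (E₁.trans (LieEquiv.ofEq _ _ (Set.ext fun s => (hm s).symm))).trans E₂.symm
  exact ⟨{ toFun := fun a => (G a).1
           map_add' := fun a b => congrArg Subtype.val (G.toLinearEquiv.map_add a b)
           map_smul' := fun r a => congrArg Subtype.val (G.toLinearEquiv.map_smul r a) },
    fun a => (G a).2, fun a b h => G.injective (Subtype.ext h),
    fun s hs => ⟨G.symm ⟨s, hs⟩, congrArg Subtype.val (G.apply_symm_apply ⟨s, hs⟩)⟩,
    fun a b => congrArg Subtype.val (G.map_lie a b)⟩

end SplitForm

section Globalization

variable [IsManifold (𝓡 6) ∞ M]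

/-- The flat charts of a plane field. -/
abbrev FlatChart (D : (x : M) → Submodule ℝ (TangentSpace (𝓡 6) x)) : Type _ :=
  {e : OpenPartialHomeomorph M (Euc 6) // e ∈ maxAtlas M ∧ IsFlatChart D e}

/-- The skew-adjoint matrices for `Q` as a discrete space. -/
@[ext] structure SkewMat where
  /-- the matrix -/
  val : Mat7
  mem : val ∈ skewQ

instance : TopologicalSpace SkewMat := ⊥

instance : DiscreteTopology SkewMat := ⟨rfl⟩

/-- The germ of the vector field `X` at `x` is given by `a` in the flat chart `e`. -/
def HasGerm (e : FlatChart D) (X : (x : M) → TangentSpace (𝓡 6) x) (x : M) (a : Mat7) : Prop :=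
  x ∈ e.1.source ∧ a ∈ skewQ ∧ ∀ᶠ y in nhds x, X y = chartField e.1 a y

variable {e e' : FlatChart D} {X Y : (x : M) → TangentSpace (𝓡 6) x} {x : M} {a b : Mat7}

lemma HasGerm.unique (h : HasGerm e X x a) (h' : HasGerm e X x b) : a = b :=
  chartField_unique e.2.1 h.1 h.2.1 h'.2.1 (by
    filter_upwards [h.2.2, h'.2.2] with y h1 h2 using h1.symm.trans h2)

lemma HasGerm.eventually (h : HasGerm e X x a) : ∀ᶠ y in nhds x, HasGerm e X y a := by
  filter_upwards [e.1.open_source.mem_nhds h.1, h.2.2.eventually_nhds] with y h1 h2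
  exact ⟨h1, h.2.1, h2⟩

lemma HasGerm.congr (h : HasGerm e X x a) (hY : ∀ᶠ y in nhds x, Y y = X y) : HasGerm e Y x a :=
  ⟨h.1, h.2.1, by filter_upwards [h.2.2, hY] with y h1 h2 using h2.trans h1⟩

lemma HasGerm.smul_add (h : HasGerm e X x a) (h' : HasGerm e Y x b) (c : ℝ) :
    HasGerm e (c • X + Y) x (c • a + b) := by
  refine ⟨h.1, Submodule.add_mem _ (Submodule.smul_mem _ _ h.2.1) h'.2.1, ?_⟩
  filter_upwards [h.2.2, h'.2.2, e.1.open_source.mem_nhds h.1] with y h1 h2 h3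
  rw [eq_chartField_iff e.2.1 h3] at h1 h2 ⊢
  rw [modelField_smul_add, ← h1, ← h2]
  exact (map_add (dChart e.1 y) (c • fieldVal X y) (fieldVal Y y)).trans
    (congrArg (· + _) ((dChart e.1 y).map_smul c (fieldVal X y)))

lemma HasGerm.mlieBracket (h : HasGerm e X x a) (h' : HasGerm e Y x b) :
    HasGerm e (mlieBracket (𝓡 6) X Y) x (b * a - a * b) := by
  refine ⟨h.1, skew_commutator h'.2.1 h.2.1, ?_⟩
  filter_upwards [h.eventually, h'.eventually] with y h1 h2
  rw [← mlieBracket_chartField e.2.1 h1.1 h1.2.1 h2.2.1]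
  exact Filter.EventuallyEq.mlieBracket_vectorField_eq h1.2.2 h2.2.2

lemma HasGerm.trans (h : HasGerm e X x a) (hx : x ∈ e'.1.source) : ∃ b, HasGerm e' X x b := by
  have hs : IsInfinitesimalSymmetry D e.1.source (chartField e.1 a) :=
    ⟨fun y hy => (contMDiffAt_chartField e.2.1 hy a).contMDiffWithinAt, fun y hy =>
      exists_flow_of_chartField e.2.1 e.2.2 h.2.1 hy (e.1.open_source.mem_nhds hy)
        (Filter.Eventually.of_forall fun _ => rfl)⟩
  obtain ⟨b, hb, hb'⟩ := hs.exists_chartField e.1.open_source e'.2.1 e'.2.2 h.1 hx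
  exact ⟨b, hx, hb, by filter_upwards [h.2.2, hb'] with y h1 h2 using h1.trans h2⟩

lemma HasGerm.chartField (hx : x ∈ e.1.source) (ha : a ∈ skewQ) :
    HasGerm e (chartField e.1 a) x a := ⟨hx, ha, Filter.Eventually.of_forall fun _ => rfl⟩

lemma isInfinitesimalSymmetry_iff (hflat : ∀ p, ∃ e : FlatChart D, p ∈ e.1.source) {U : Set M}
    (hU : IsOpen U) : IsInfinitesimalSymmetry D U X ↔ ∀ x ∈ U, ∃ (e : FlatChart D) (a : Mat7),
      HasGerm e X x a := by
  constructor
  · intro h x hx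
    obtain ⟨e, he⟩ := hflat x
    obtain ⟨a, ha, h'⟩ := h.exists_chartField hU e.2.1 e.2.2 hx he
    exact ⟨e, a, he, ha, h'⟩
  · intro h
    refine ⟨fun x hx => ?_, fun x hx => ?_⟩ <;> obtain ⟨e, a, he, ha, h'⟩ := h x hx
    · refine ((contMDiffAt_chartField e.2.1 he a).congr_of_eventuallyEq ?_).contMDiffWithinAt
      filter_upwards [h'] with y hy
      rw [hy]
    · exact exists_flow_of_chartField e.2.1 e.2.2 ha he (hU.mem_nhds hx) h'

lemma eq_zero_of_germ {U : Set M} (hU : IsOpen U) (hc : IsPreconnected U)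
    (h : ∀ x ∈ U, ∃ (e : FlatChart D) (a : Mat7), HasGerm e X x a) {x₀ : M} (hx₀ : x₀ ∈ U)
    (h0 : ∀ᶠ y in nhds x₀, X y = 0) : ∀ x ∈ U, X x = 0 := by
  have hz : ∀ (e : FlatChart D) y, y ∈ e.1.source → Bryant.chartField e.1 0 y = 0 := fun e y hy => by
    symm
    rw [eq_chartField_iff e.2.1 hy]
    refine (map_zero (dChart e.1 y)).trans ?_
    simpa using (modelField_smul_add (-1) 0 0 (e.1 y)).symm
  have hopen : IsOpen {x | ∀ᶠ y in nhds x, X y = 0} := isOpen_setOfPred_eventually_nhds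
  have hopen' : IsOpen (U ∩ {x | ¬∀ᶠ y in nhds x, X y = 0}) := by
    rw [isOpen_iff_mem_nhds]
    rintro x ⟨hx, hx'⟩
    obtain ⟨e, a, ha⟩ := h x hx
    filter_upwards [hU.mem_nhds hx, ha.eventually] with y hy hya
    refine ⟨hy, fun hy0 => hx' ?_⟩
    have h1 : HasGerm e X y 0 := ⟨hya.1, Submodule.zero_mem _, by
      filter_upwards [hy0, e.1.open_source.mem_nhds hya.1] with z h1 h2 using h1.trans (hz e z h2).symm⟩
    rw [hya.unique h1] at ha
    filter_upwards [ha.2.2, e.1.open_source.mem_nhds ha.1] with z h1 h2 using h1.trans (hz e z h2)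
  have hsub := hc.subset_left_of_subset_union hopen hopen' (by
    rw [Set.disjoint_left]; exact fun x h1 h2 => h2.2 h1) (fun x hx => by
      by_cases h : ∀ᶠ y in nhds x, X y = 0
      exacts [Or.inl h, Or.inr ⟨hx, h⟩]) ⟨x₀, hx₀, h0⟩
  exact fun x hx => (hsub hx).self_of_nhds

lemma exists_global_field (hflat : ∀ p, ∃ e : FlatChart D, p ∈ e.1.source) {U : Set M}
    (hU : IsOpen U) [SimplyConnectedSpace U] {x₀ : M} (hx₀ : x₀ ∈ U) (he : x₀ ∈ e.1.source)
    (ha : a ∈ skewQ) :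
    ∃ X, HasGerm e X x₀ a ∧ ∀ x ∈ U, ∃ (e : FlatChart D) (a : Mat7), HasGerm e X x a := by
  have hcc : ∀ (i j : FlatChart D) (x : M) (v : SkewMat), ∃ w : SkewMat,
      x ∈ i.1.source → x ∈ j.1.source → HasGerm j (Bryant.chartField i.1 v.val) x w.val :=
    fun i j x v => by
      by_cases h : x ∈ i.1.source ∧ x ∈ j.1.source
      · obtain ⟨b, hb⟩ := (HasGerm.chartField h.1 v.mem).trans (e' := j) h.2
        exact ⟨⟨b, hb.2.1⟩, fun _ _ => hb⟩
      · exact ⟨v, fun h1 h2 => (h ⟨h1, h2⟩).elim⟩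
  choose cc hcc using hcc
  have hself : ∀ i : FlatChart D, ∀ x ∈ i.1.source, ∀ v, cc i i x v = v := fun i x hx v =>
    SkewMat.ext ((hcc i i x v hx hx).unique (HasGerm.chartField hx v.mem))
  choose idx hidx using hflat
  let Z : FiberBundleCore (FlatChart D) M SkewMat :=
    { baseSet := fun i => i.1.source
      isOpen_baseSet := fun i => i.1.open_source
      indexAt := idx
      mem_baseSet_at := hidx
      coordChange := cc
      coordChange_self := hself
      continuousOn_coordChange := fun i j => by
        rintro ⟨x, v⟩ ⟨⟨hi, hj⟩, -⟩
        refine ContinuousAt.continuousWithinAt (tendsto_nhds_of_eventually_eq ?_)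
        rw [nhds_prod_eq, nhds_discrete SkewMat, Filter.prod_pure, Filter.eventually_map]
        filter_upwards [(hcc i j x v hi hj).eventually, i.1.open_source.mem_nhds hi] with y h1 h2
        exact SkewMat.ext ((hcc i j y v h2 h1.1).unique h1)
      coordChange_comp := fun i j k x hx v => by
        obtain ⟨⟨hi, hj⟩, hk⟩ := hx
        have h1 := hcc i j x v hi hj
        have h2 := hcc j k x (cc i j x v) hj hk
        exact SkewMat.ext (((h2.congr h1.2.2)).unique (hcc i k x v hi hk)) }
  have cov : IsCoveringMap (Bundle.TotalSpace.proj : Z.TotalSpace → M) :=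
    FiberBundle.isCoveringMap (F := SkewMat) (E := Z.Fiber)
  have : LocallyPathConnectedSpace M := ChartedSpace.locallyPathConnectedSpace (Euc 6) M
  have : LocallyPathConnectedSpace U := hU.locallyPathConnectedSpace
  obtain ⟨F, ⟨hF0, hF⟩, -⟩ := cov.existsUnique_continuousMap_lifts
    (⟨Subtype.val, continuous_subtype_val⟩ : C(U, M)) ⟨x₀, hx₀⟩ ⟨x₀, cc e (idx x₀) x₀ ⟨a, ha⟩⟩ rfl
  have hF' : ∀ x : U, (F x).1 = x := fun x => congrFun hF x
  let s : U → SkewMat := fun x => (F x).2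
  have hs : ∀ (x : U) (i : FlatChart D), x.1 ∈ i.1.source → ∀ᶠ y : U in nhds x,
      cc (idx y) i y (s y) = cc (idx x) i x (s x) := fun x i hx => by
    have h1 : ∀ y : U, (Z.localTriv i (F y)).2 = cc (idx y) i y (s y) := fun y => by
      change cc (idx (F y).1) i (F y).1 (s y) = _
      rw [hF' y]
    have h2 : ContinuousAt (fun y : U => (Z.localTriv i (F y)).2) x :=
      continuous_snd.continuousAt.comp (((Z.localTriv i).continuousAt (by
        rw [Z.mem_localTriv_source, hF' x]; exact hx)).comp F.continuous.continuousAt)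
    have h3 := h2.eventually_mem ((isOpen_discrete {(Z.localTriv i (F x)).2}).mem_nhds rfl)
    filter_upwards [h3] with y hy
    rw [← h1, ← h1]
    exact hy
  classical
  let X : (x : M) → TangentSpace (𝓡 6) x := fun y =>
    if hy : y ∈ U then Bryant.chartField (idx y).1 (s ⟨y, hy⟩).val y else 0
  have hX : ∀ (x : M) (hx : x ∈ U), HasGerm (idx x) X x (s ⟨x, hx⟩).val := fun x hx => by
    have h1 := hs ⟨x, hx⟩ (idx x) (hidx x)
    rw [hself _ _ (hidx x), nhds_subtype_eq_comap, Filter.eventually_comap] at h1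
    refine ⟨hidx x, (s ⟨x, hx⟩).mem, ?_⟩
    filter_upwards [h1, hU.mem_nhds hx, (idx x).1.open_source.mem_nhds (hidx x)] with y h2 hy hyx
    refine (dif_pos hy).trans ?_
    rw [← h2 ⟨y, hy⟩ rfl]
    exact (hcc (idx y) (idx x) y (s ⟨y, hy⟩) (hidx y) hyx).2.2.self_of_nhds
  refine ⟨X, ?_, fun x hx => ⟨idx x, _, hX x hx⟩⟩
  have h0 : s ⟨x₀, hx₀⟩ = cc e (idx x₀) x₀ ⟨a, ha⟩ := by
    have h : ∀ p : Z.TotalSpace, p = ⟨x₀, cc e (idx x₀) x₀ ⟨a, ha⟩⟩ →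
        (p.2 : SkewMat) = cc e (idx x₀) x₀ ⟨a, ha⟩ := fun p hp => by rw [hp]
    exact h _ hF0
  have h1 := hX x₀ hx₀
  rw [h0] at h1
  refine (HasGerm.chartField he ha).congr ?_
  filter_upwards [h1.2.2, (hcc e (idx x₀) x₀ ⟨a, ha⟩ he (hidx x₀)).2.2] with y h2 h3
    using h2.trans h3.symm

end Globalization

section SymmetryAlgebra

variable [IsManifold (𝓡 6) ∞ M]

/-- The vector field `X` is, near each point of `U`, given by a matrix in a flat chart. -/
def IsLocallyModel (D : (x : M) → Submodule ℝ (TangentSpace (𝓡 6) x)) (U : Set M)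
    (X : (x : M) → TangentSpace (𝓡 6) x) : Prop :=
  ∀ x ∈ U, ∃ (e : FlatChart D) (a : Mat7), HasGerm e X x a

variable {e : FlatChart D} {U : Set M} {X Y : (x : M) → TangentSpace (𝓡 6) x} {x : M} {a b : Mat7}

lemma IsLocallyModel.congr (hU : IsOpen U) (hX : IsLocallyModel D U X)
    (h : ∀ x ∈ U, Y x = X x) : IsLocallyModel D U Y := fun x hx => by
  obtain ⟨e, a, ha⟩ := hX x hx
  exact ⟨e, a, ha.congr (by filter_upwards [hU.mem_nhds hx] with y hy using h y hy)⟩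

lemma IsLocallyModel.smul_add (hX : IsLocallyModel D U X) (hY : IsLocallyModel D U Y) (c : ℝ) :
    IsLocallyModel D U (c • X + Y) := fun x hx => by
  obtain ⟨e, a, ha⟩ := hX x hx
  obtain ⟨e', b, hb⟩ := hY x hx
  obtain ⟨b', hb'⟩ := hb.trans ha.1
  exact ⟨e, _, ha.smul_add hb' c⟩

lemma IsLocallyModel.mlieBracket (hX : IsLocallyModel D U X) (hY : IsLocallyModel D U Y) :
    IsLocallyModel D U (mlieBracket (𝓡 6) X Y) := fun x hx => by
  obtain ⟨e, a, ha⟩ := hX x hx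
  obtain ⟨e', b, hb⟩ := hY x hx
  obtain ⟨b', hb'⟩ := hb.trans ha.1
  exact ⟨e, _, ha.mlieBracket hb'⟩

lemma neg_one_smul_add_eq_zero_iff {V : Type*} [AddCommGroup V] [Module ℝ V] (u v : V) :
    (-1 : ℝ) • u + v = 0 ↔ u = v := by
  rw [neg_one_smul, neg_add_eq_zero]

lemma IsLocallyModel.eq_of_germ (hU : IsOpen U) (hc : IsPreconnected U)
    (hX : IsLocallyModel D U X) (hY : IsLocallyModel D U Y) (hx : x ∈ U)
    (ha : HasGerm e X x a) (hb : HasGerm e Y x a) : ∀ y ∈ U, X y = Y y := fun y hy =>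
  (neg_one_smul_add_eq_zero_iff (V := TangentSpace (𝓡 6) y) _ _).1
    (eq_zero_of_germ hU hc (hX.smul_add hY (-1)) hx (by
      filter_upwards [ha.2.2, hb.2.2] with z h1 h2
      exact (neg_one_smul_add_eq_zero_iff (V := TangentSpace (𝓡 6) z) _ _).2
        (h1.trans h2.symm)) y hy)

lemma symmetryAlgebra (hflat : ∀ p, ∃ e : FlatChart D, p ∈ e.1.source) (hU : IsOpen U)
    [SimplyConnectedSpace U] :
    SymmetryAlgebraIsomorphicTo D U (LieAlgebra.Orthogonal.so' (Fin 4) (Fin 3) ℝ) := by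
  classical
  obtain ⟨E, hE, hinj, hsurj, hlie⟩ := nonempty_so43_equiv
  have hc : IsPreconnected U := isPreconnected_iff_preconnectedSpace.2 inferInstance
  obtain ⟨⟨x₀, hx₀⟩⟩ : Nonempty U := inferInstance
  obtain ⟨e, he⟩ := hflat x₀
  have hex : ∀ z : LieAlgebra.Orthogonal.so' (Fin 4) (Fin 3) ℝ,
      ∃ X, IsLocallyModel D U X ∧ HasGerm e X x₀ (-E z) ∧ ∀ y ∉ U, X y = 0 := fun z => by
    obtain ⟨X, h1, h2⟩ := exists_global_field hflat hU hx₀ he (Submodule.neg_mem _ (hE z))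
    have hX : ∀ y ∈ U, (fun y => if y ∈ U then X y else 0) y = X y := fun y hy => if_pos hy
    exact ⟨fun y => if y ∈ U then X y else 0, IsLocallyModel.congr hU h2 hX,
      h1.congr (by filter_upwards [hU.mem_nhds hx₀] with y hy using hX y hy),
      fun y hy => if_neg hy⟩
  choose Φ hΦ hΦ₀ hΦU using hex
  have hΦ' : ∀ (c : ℝ) z w, Φ (c • z + w) = c • Φ z + Φ w := fun c z w => by
    funext y
    by_cases hy : y ∈ U
    · refine (hΦ _).eq_of_germ hU hc ((hΦ z).smul_add (hΦ w) c) hx₀ (hΦ₀ _) ?_ y hy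
      have h := (hΦ₀ z).smul_add (hΦ₀ w) c
      rwa [show c • -E z + -E w = -E (c • z + w) by rw [map_add, map_smul, smul_neg, neg_add]] at h
    · refine (hΦU _ y hy).trans ?_
      change 0 = c • Φ z y + Φ w y
      rw [hΦU _ y hy, hΦU _ y hy, smul_zero, add_zero]
  refine ⟨{ toFun := Φ
            map_add' := fun z w => ?_
            map_smul' := fun c z => ?_ }, fun z => ?_, fun z hz => ?_, fun X hX => ?_,
    fun z w x hx => ?_⟩
  · rw [show z + w = (1 : ℝ) • z + w by rw [one_smul], hΦ', one_smul]
  · rw [show c • z = (c - 1) • z + z by rw [sub_smul, one_smul, sub_add_cancel], hΦ', sub_smul,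
      one_smul, sub_add_cancel, RingHom.id_apply]
  · exact (isInfinitesimalSymmetry_iff hflat hU).2 (hΦ z)
  · refine hinj (neg_injective ?_)
    have h0 : HasGerm e (Φ z) x₀ (-E 0) := by
      refine (hΦ₀ 0).congr ?_
      filter_upwards [hU.mem_nhds hx₀] with y hy
      refine (hz y hy).trans ?_
      have h1 := congrFun (hΦ' (-1) 0 0) y
      rw [smul_zero, zero_add] at h1
      exact (((neg_one_smul_add_eq_zero_iff (V := TangentSpace (𝓡 6) y) _ _).2 rfl).symm.trans
        h1.symm)
    exact (hΦ₀ z).unique h0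
  · have hX' := (isInfinitesimalSymmetry_iff hflat hU).1 hX
    obtain ⟨e', a', ha'⟩ := hX' x₀ hx₀
    obtain ⟨a, ha⟩ := ha'.trans he
    obtain ⟨z, hz⟩ := hsurj (-a) (Submodule.neg_mem _ ha.2.1)
    refine ⟨z, (hΦ z).eq_of_germ hU hc hX' hx₀ (hΦ₀ z) ?_⟩
    rwa [hz, neg_neg]
  · refine (hΦ _).eq_of_germ hU hc ((hΦ z).mlieBracket (hΦ w)) hx₀ (hΦ₀ _) ?_ x hx
    have h := (hΦ₀ z).mlieBracket (hΦ₀ w)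
    rwa [show -E w * -E z - -E z * -E w = -E ⁅z, w⁆ by rw [hlie]; noncomm_ring] at h

end SymmetryAlgebra

end Bryant

end

theorem mainTheorem3 {M : Type*} [TopologicalSpace M] [T2Space M] [SecondCountableTopology M]
    [ChartedSpace (EuclideanSpace ℝ (Fin 6)) M] [IsManifold (𝓡 6) ∞ M]
    (D : (x : M) → Submodule ℝ (TangentSpace (𝓡 6) x)) (hD : Bryant.IsNondegenerate D)
    (hS : ∀ x, Bryant.fundamentalTensor D x = 0) :
    -- the other curvature functions vanish, and the structure equations become those of `so(4, 3)`
    (∀ (n : ℕ) (L : Bryant.Lift D n),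
      (∃ τ S4 S3 S2, L.IsCanonical τ S4 S3 S2) ∧
      ∀ τ S4 S3 S2, L.IsCanonical τ S4 S3 S2 →
        (∀ w ∈ L.W, ∀ i j k, S3 i j k w = 0) ∧
        (∀ w ∈ L.W, ∀ i j, S2 i j w = 0) ∧
        L.FlatStructureEquations τ ∧
        L.MaurerCartan τ) ∧
    -- the infinitesimal symmetries on a simply connected open set
    (∀ U : Set M, IsOpen U → SimplyConnectedSpace U →
      Bryant.SymmetryAlgebraIsomorphicTo D U
        (LieAlgebra.Orthogonal.so' (Fin 4) (Fin 3) ℝ)) ∧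
    -- flat coordinates centered at an arbitrary point
    (∀ p : M, ∃ e ∈ IsManifold.maximalAtlas (𝓡 6) ∞ M,
      p ∈ e.source ∧ e p = 0 ∧ Bryant.IsFlatChart D e) := by
  have h4 : ∀ {n : ℕ} {L : Bryant.Lift D n} {τ S4 S3 S2}, L.IsCanonical τ S4 S3 S2 →
      ∀ w ∈ L.W, ∀ i k j l, S4 i k j l w = 0 := fun hc w hw i k j l =>
    hc.S4_eq_zero hD.finrank_eq_three hS hw i k j l
  have hflat := fun p => Bryant.exists_flat_chart hD hS p
  refine ⟨fun n L => ⟨L.exists_isCanonical, fun τ S4 S3 S2 hc => ⟨fun w hw i j k =>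
    hc.S3_eq_zero (h4 hc) hw i j k, fun w hw => (hc.S2_T_eq_zero (h4 hc) hw).1,
    hc.flatStructureEquations (h4 hc), hc.maurerCartan (h4 hc)⟩⟩, fun U hU _ =>
    Bryant.symmetryAlgebra (fun p => ?_) hU, hflat⟩
  obtain ⟨e, he, hp, -, hD⟩ := hflat p
  exact ⟨⟨e, he, hD⟩, hp⟩
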